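/- **Setting.** Let $\mathcal H$ be a complex Hilbert space, $\mathcal H_n=\mathcal H^{\otimes n}$ ($\mathcal H_0=\mathbb C$), $K$ a (possibly unbounded) self-adjoint operator on $\mathcal H$, and $\Phi$ a bounded self-adjoint operator on $\mathcal H_2$, invariant under exchange of the two particles. For a set $X$ of particles an operator with argument $X$ acts on these particles (and as the identity on all others). Let $H_n=\sum_{j=1}^nK(j)+\sum_{j_1<j_2}\Phi(j_1,j_2)$ (self-adjoint; the kinetic sum is closed), $\mathcal G_n(t)b=e^{itH_n}be^{-itH_n}$, $\mathcal G^*_n(t)f=e^{-itH_n}fe^{itH_n}$, and let $\mathcal G(t)$, $\mathcal G^*(t)$ act componentwise on sequences. For $\alpha>1$ let $\mathfrak L^1_\alpha$ be the space of sequences $f=(f_n)_{n\ge0}$ of permutation-symmetric trace-class operators $f_n$ on $\mathcal H_n$ with $\|f\|=\sum_n\alpha^n\mathrm{Tr}|f_n|<\infty$; for $0<\gamma<1$ let $\mathfrak L_\gamma$ be the space of sequences of permutation-symmetric bounded self-adjoint operators with $\|b\|=\sup_n\frac{\gamma^n}{n!}\|b_n\|<\infty$. Put $(\mathfrak af)_n=\mathrm{Tr}_{n+1}f_{n+1}$,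 $(\mathfrak a^+b)_n=\sum_{j=1}^n b_{n-1}((1,\dots,n)\setminus j)\otimes\mathbb 1_{(j)}$. For a set $Z$ of particles (regarded as one element $\{Z\}$) and further particles $j_1,\dots,j_n$, let $$\mathfrak A_{1+n}(t,\{Z\},j_1,\dots,j_n)=\sum_{\mathrm P:(\{Z\},j_1,\dots,j_n)=\bigcup_iX_i}(-1)^{|\mathrm P|-1}(|\mathrm P|-1)!\prod_{X_i\in\mathrm P}\mathcal G_{|\theta(X_i)|}(t,\theta(X_i)),$$ the sum being over partitions and $\theta(X)$ being the set of particles in $X$; $\mathfrak A^*_{1+n}$ is defined in the same way from $\mathcal G^*$. Let $\mathcal N^*_nf=-i(H_nf-fH_n)$ and $\mathcal N_nb=-i(bH_n-H_nb)$ on their natural domains, $\mathcal N^*_{\rm int}(i,j)f=-i(\Phi(i,j)f-f\Phi(i,j))$, $\mathcal N_{\rm int}(i,j)b=-i(b\Phi(i,j)-\Phi(i,j)b)$, and $$([\mathfrak a,\mathcal N^*]f)_s=\sum_{j=1}^s\mathrm{Tr}_{s+1}\mathcal N^*_{\rm int}(j,s+1)f_{s+1},\qquad([\mathcal N,\mathfrak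 a^+]b)_s=\sum_{j_1\ne j_2}\mathcal N_{\rm int}(j_1,j_2)\,b_{s-1}((1,\dots,s)\setminus j_1)\otimes\mathbb 1_{(j_1)} .$$ **States.** Let $\alpha>1$, $F(0)\in\mathfrak L^1_\alpha$, $t\in\mathbb R$. The series $$F_s(t)=\sum_{n=0}^\infty\frac1{n!}\mathrm{Tr}_{s+1,\dots,s+n}\,\mathfrak A^*_{1+n}(t,\{1,\dots,s\},s+1,\dots,s+n)F_{s+n}(0)$$ converges in the norm of $\mathfrak L^1_\alpha$ and $F(t)\in\mathfrak L^1_\alpha$. Its terms do not change if $\mathfrak A^*_{1+n}$ is replaced by either reduced cumulant $$\sum_{Y\subset(s+1,\dots,s+n)}(-1)^{n-|Y|}\mathcal G^*_{s+|Y|}(t,(1,\dots,s)\cup Y)\quad\text{or}\quad\sum_{k=0}^n(-1)^k\binom nk\mathcal G^*_{s+n-k}(t,1,\dots,s+n-k).$$ With convergence in the norm of $\mathfrak L^1_\alpha$, $$F(t)=\sum_{n=0}^\infty\frac1{n!}\sum_{k=0}^n(-1)^k\binom nk\mathfrak a^{n-k}\mathcal G^*(t)\mathfrak a^kF(0)=\mathcal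 G^*(t)F(0)+\sum_{n=1}^\infty\frac1{n!}\big[\underbrace{\mathfrak a,\dots,[\mathfrak a}_{n},\mathcal G^*(t)]\dots\big]F(0)=e^{\mathfrak a}\mathcal G^*(t)e^{-\mathfrak a}F(0),$$ where the exponential series applied here converge in the norm of $\mathfrak L^1_\alpha$, and $$F(t)=\sum_{n=0}^\infty\int_0^tdt_1\dots\int_0^{t_{n-1}}dt_n\,\mathcal G^*(t-t_1)[\mathfrak a,\mathcal N^*]\mathcal G^*(t_1-t_2)\dots[\mathfrak a,\mathcal N^*]\mathcal G^*(t_n)F(0).$$ The components of the integrands are norm continuous in $(t_1,\dots,t_n)$, and the $s$-th component is $$\mathrm{Tr}_{s+1,\dots,s+n}\,\mathcal G^*_s(t-t_1)\sum_{j_1=1}^s\mathcal N^*_{\rm int}(j_1,s+1)\mathcal G^*_{s+1}(t_1-t_2)\dots\sum_{j_n=1}^{s+n-1}\mathcal N^*_{\rm int}(j_n,s+n)\mathcal G^*_{s+n}(t_n)F_{s+n}(0).$$ Moreover $[\mathfrak a,\mathcal N^*]$ is the commutator: if $f_n\in D(\mathcal N^*_n)$ for all $n$, then $(\mathfrak af)_n\in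 D(\mathcal N_n^*)$ for all $n$ and $\mathfrak a\mathcal N^*f-\mathcal N^*\mathfrak af=[\mathfrak a,\mathcal N^*]f$. **Observables.** Let $0<\gamma<1$, $B(0)\in\mathfrak L_\gamma$, $t\in\mathbb R$, and let $$B_s(t)=\sum_{n=0}^s\frac1{n!}\sum_{j_1\ne\dots\ne j_n=1}^s\mathfrak A_{1+n}(t,\{Z\},j_1,\dots,j_n)\,B_{s-n}(0,Z)\otimes\mathbb 1_{(j_1)}\otimes\dots\otimes\mathbb 1_{(j_n)},\qquad Z=(1,\dots,s)\setminus(j_1,\dots,j_n).$$ Then $B(t)\in\mathfrak L_\gamma$, and for all $n$ and $s$ the $n$-th term (the sum over $j_1\ne\dots\ne j_n$) does not change if $\mathfrak A_{1+n}(t,\{Z\},j_1,\dots,j_n)$ is replaced by either reduced cumulant $$\sum_{Y\subset(j_1,\dots,j_n)}(-1)^{n-|Y|}\mathcal G_{|Z\cup Y|}(t,Z\cup Y)\quad\text{or}\quad\sum_{k=0}^n(-1)^k\binom nk\mathcal G_{s-k}(t,Z\cup(j_1,\dots,j_{n-k})).$$ With convergence in the norm of $\mathfrak L_\gamma$, $$B(t)=\sum_{n=0}^\infty\frac1{n!}\sum_{k=0}^n(-1)^{n-k}\binom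 nk(\mathfrak a^+)^{n-k}\mathcal G(t)(\mathfrak a^+)^kB(0)=\mathcal G(t)B(0)+\sum_{n=1}^\infty\frac1{n!}\big[\dots[\mathcal G(t),\underbrace{\mathfrak a^+],\dots,\mathfrak a^+}_{n}\big]B(0)=e^{-\mathfrak a^+}\mathcal G(t)e^{\mathfrak a^+}B(0),$$ where the exponential series applied here converge in the norm of $\mathfrak L_\gamma$, and, componentwise in the strong operator topology, $$B(t)=\sum_{n=0}^\infty\int_0^tdt_1\dots\int_0^{t_{n-1}}dt_n\,\mathcal G(t-t_1)[\mathcal N,\mathfrak a^+]\mathcal G(t_1-t_2)\dots[\mathcal N,\mathfrak a^+]\mathcal G(t_n)B(0),$$ the components of the integrands being strongly continuous in $(t_1,\dots,t_n)$. Moreover $[\mathcal N,\mathfrak a^+]$ is the commutator: if $b_n\in D(\mathcal N_n)$ for all $n$, then $(\mathfrak a^+b)_n\in D(\mathcal N_n)$ for all $n$ and $\mathcal N\mathfrak a^+b-\mathfrak a^+\mathcal Nb=[\mathcal N,\mathfrak a^+]b$. -/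

import Mathlib

open scoped ENNReal BigOperators

noncomputable section

namespace QuantumHierarchy

/-! ### Tensor powers of a Hilbert space

A Hilbert space `H` with a Hilbert basis `(e_i)`, `i : ι`, has as its `n`-fold Hilbert tensor power
the space `ℓ²(ιⁿ)`: the basis vector `e_{k 1} ⊗ ⋯ ⊗ e_{k n}` is the unit vector at
`k : Fin n → ι`, and `x₁ ⊗ ⋯ ⊗ xₙ` is the function `k ↦ ∏ j, ⟪e_{k j}, x_j⟫`. -/

/-- `ℓ²(A)`. -/
abbrev L2 (A : Type*) : Type _ := lp (fun _ : A => ℂ) 2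

/-- The `n`-particle Hilbert space `H^{⊗ n}`. -/
abbrev HS (ι : Type*) (n : ℕ) : Type _ := L2 (Fin n → ι)

/-- Bounded operators on the `n`-particle space. -/
abbrev Op (ι : Type*) (n : ℕ) : Type _ := HS ι n →L[ℂ] HS ι n

/-- Sequences `(f₀, f₁, f₂, …)` of bounded operators on the `n`-particle spaces. -/
abbrev OpSeq (ι : Type*) : Type _ := ∀ n : ℕ, Op ι n

theorem summable_sq {A : Type*} (φ : L2 A) : Summable fun a => ‖φ a‖ ^ 2 := by
  have h := (memℓp_gen_iff (by norm_num : 0 < (2 : ℝ≥0∞).toReal)).1 (lp.memℓp φ)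
  simpa using h

theorem norm_sq_eq {A : Type*} (φ : L2 A) : ‖φ‖ ^ 2 = ∑' a, ‖φ a‖ ^ 2 := by
  have h := lp.norm_rpow_eq_tsum (by norm_num : 0 < (2 : ℝ≥0∞).toReal) φ
  simpa using h

theorem memℓp_two {A : Type*} {g : A → ℂ} (h : Summable fun a => ‖g a‖ ^ 2) :
    Memℓp g 2 :=
  (memℓp_gen_iff (by norm_num : 0 < (2 : ℝ≥0∞).toReal)).2 (by simpa using h)

/-- Restriction of square-summable functions along an injective map. -/
def pull {A B : Type*} (g : A ↪ B) : L2 B →L[ℂ] L2 A :=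
  LinearMap.mkContinuous
    { toFun := fun φ => ⟨fun a => φ (g a), memℓp_two ((summable_sq φ).comp_injective g.injective)⟩
      map_add' := fun _ _ => rfl
      map_smul' := fun _ _ => rfl } 1 (by
    intro φ
    rw [one_mul, ← pow_le_pow_iff_left₀ (norm_nonneg _) (norm_nonneg _) two_ne_zero,
      norm_sq_eq, norm_sq_eq]
    exact tsum_comp_le_tsum_of_inj (summable_sq φ) (fun _ => by positivity) g.injective)

/-- The configuration that agrees with `k`, except that the particles in the image of `e` are
in the states `m`. -/
def overwrite {ι α β : Type*} (e : α ↪ β) (k : β → ι) : (α → ι) ↪ (β → ι) where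
  toFun m := Function.extend e m k
  inj' := fun m m' h => by
    funext a
    have := congrFun h (e a)
    simpa [e.injective.extend_apply] using this

/-- A configuration is the same as its values on the image of `e` and its values elsewhere. -/
def splitEquiv {ι α β : Type*} (e : α ↪ β) :
    (({x // x ∉ Set.range e} → ι) × (α → ι)) ≃ (β → ι) where
  toFun p := fun x => by
    classical
    exact if h : x ∈ Set.range e then p.2 h.choose else p.1 ⟨x, h⟩
  invFun k := (fun x => k x, k ∘ e)
  left_inv := by
    rintro ⟨r, m⟩
    ext x
    · simp [x.2]
    · have h : e x ∈ Set.range e := ⟨x, rfl⟩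
      have h2 : h.choose = x := e.injective h.choose_spec
      simp
  right_inv := by
    intro k
    funext x
    by_cases h : x ∈ Set.range e
    · simp only [h, dif_pos, Function.comp]
      rw [h.choose_spec]
    · simp only [h, not_false_eq_true, dif_neg]

theorem overwrite_splitEquiv {ι α β : Type*} (e : α ↪ β) (r : {x // x ∉ Set.range e} → ι)
    (m m' : α → ι) :
    overwrite e (splitEquiv e (r, m)) m' = splitEquiv e (r, m') := by
  classical
  funext x
  by_cases h : ∃ a, e a = x
  · obtain ⟨a, rfl⟩ := h
    have h : e a ∈ Set.range e := ⟨a, rfl⟩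
    have h2 : h.choose = a := e.injective h.choose_spec
    refine (e.injective.extend_apply _ _ _).trans ?_
    simp [splitEquiv]
  · refine (Function.extend_apply' _ _ _ h).trans ?_
    have h' : x ∉ Set.range e := h
    simp only [splitEquiv, Equiv.coe_fn_mk, h', not_false_eq_true, dif_neg]

theorem splitEquiv_comp {ι α β : Type*} (e : α ↪ β) (r : {x // x ∉ Set.range e} → ι)
    (m : α → ι) : splitEquiv e (r, m) ∘ e = m :=
  congrArg Prod.snd ((splitEquiv e).symm_apply_apply (r, m))

theorem lift_aux {ι α β : Type*} (e : α ↪ β) (T : L2 (α → ι) →L[ℂ] L2 (α → ι))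
    (φ : L2 (β → ι)) :
    (Summable fun k : β → ι => ‖T (pull (overwrite e k) φ) (k ∘ e)‖ ^ 2) ∧
      ∑' k : β → ι, ‖T (pull (overwrite e k) φ) (k ∘ e)‖ ^ 2 ≤ (‖T‖ * ‖φ‖) ^ 2 := by
  classical
  have hs : ∀ r : {x // x ∉ Set.range e} → ι, ∃ ψ : L2 (α → ι),
      (∀ m, pull (overwrite e (splitEquiv e (r, m))) φ = ψ) ∧
      (∀ m, ψ m = φ (splitEquiv e (r, m))) := by
    intro r
    have hinj : Function.Injective fun m : α → ι => splitEquiv e (r, m) := fun m m' h => by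
      simpa using (splitEquiv e).injective h
    refine ⟨pull ⟨_, hinj⟩ φ, fun m => ?_, fun m => rfl⟩
    ext m'
    change φ (overwrite e (splitEquiv e (r, m)) m') = φ (splitEquiv e (r, m'))
    rw [overwrite_splitEquiv]
  choose ψ hψ1 hψ2 using hs
  have hφ : Summable fun p : ({x // x ∉ Set.range e} → ι) × (α → ι) =>
      ‖φ (splitEquiv e p)‖ ^ 2 := (splitEquiv e).summable_iff.2 (summable_sq φ)
  have hφ' := (summable_prod_of_nonneg (fun _ => sq_nonneg _)).1 hφ
  have hterm : ∀ r, ∑' m, ‖φ (splitEquiv e (r, m))‖ ^ 2 = ‖ψ r‖ ^ 2 := fun r => by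
    rw [norm_sq_eq]; simp only [hψ2]
  have hle : ∀ r, ∑' m, ‖T (ψ r) m‖ ^ 2 ≤ ‖T‖ ^ 2 * ‖ψ r‖ ^ 2 := fun r => by
    rw [← norm_sq_eq, ← mul_pow]
    exact pow_le_pow_left₀ (norm_nonneg _) (T.le_opNorm _) 2
  have hsum2 : Summable fun r => ‖ψ r‖ ^ 2 := by
    have := hφ'.2
    simpa only [hterm] using this
  have hG : Summable fun p : ({x // x ∉ Set.range e} → ι) × (α → ι) =>
      ‖T (ψ p.1) p.2‖ ^ 2 := by
    refine (summable_prod_of_nonneg (fun _ => sq_nonneg _)).2 ⟨fun r => summable_sq (T (ψ r)), ?_⟩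
    exact Summable.of_nonneg_of_le (fun r => tsum_nonneg fun _ => sq_nonneg _) hle
      (hsum2.mul_left _)
  have heq : ∀ p : ({x // x ∉ Set.range e} → ι) × (α → ι),
      ‖T (pull (overwrite e (splitEquiv e p)) φ) (splitEquiv e p ∘ e)‖ ^ 2 =
        ‖T (ψ p.1) p.2‖ ^ 2 := by
    rintro ⟨r, m⟩
    rw [hψ1, splitEquiv_comp]
  have hG' : Summable fun p : ({x // x ∉ Set.range e} → ι) × (α → ι) =>
      ‖T (pull (overwrite e (splitEquiv e p)) φ) (splitEquiv e p ∘ e)‖ ^ 2 := by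
    simpa only [heq] using hG
  refine ⟨(splitEquiv e).summable_iff.1 hG', ?_⟩
  rw [← (splitEquiv e).tsum_eq]
  simp only [heq]
  rw [hG.tsum_prod' (fun r => summable_sq (T (ψ r)))]
  have h1 : ∑' r, ∑' m, ‖T (ψ r) m‖ ^ 2 ≤ ∑' r, ‖T‖ ^ 2 * ‖ψ r‖ ^ 2 :=
    Summable.tsum_le_tsum hle
      (Summable.of_nonneg_of_le (fun r => tsum_nonneg fun _ => sq_nonneg _) hle
        (hsum2.mul_left _)) (hsum2.mul_left _)
  refine h1.trans (le_of_eq ?_)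
  rw [tsum_mul_left, mul_pow]
  congr 1
  rw [norm_sq_eq φ, ← (splitEquiv e).tsum_eq, hφ.tsum_prod' hφ'.1]
  simp only [hterm]

/-- `lift e T` is the operator `T` acting on the particles `e 1, …, e m` (in this order), tensored
with the identity on all other particles. Fibrewise: freeze the states of the other particles. -/
def lift {ι α β : Type*} (e : α ↪ β) (T : L2 (α → ι) →L[ℂ] L2 (α → ι)) :
    L2 (β → ι) →L[ℂ] L2 (β → ι) :=
  LinearMap.mkContinuous
    { toFun := fun φ => ⟨fun k => T (pull (overwrite e k) φ) (k ∘ e), memℓp_two (lift_aux e T φ).1⟩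
      map_add' := fun φ χ => by
        ext k
        change T (pull (overwrite e k) (φ + χ)) (k ∘ e) = _
        rw [map_add, map_add]
        rfl
      map_smul' := fun c φ => by
        ext k
        change T (pull (overwrite e k) (c • φ)) (k ∘ e) = _
        rw [map_smul, map_smul]
        rfl } ‖T‖ (by
    intro φ
    rw [← pow_le_pow_iff_left₀ (norm_nonneg _) (by positivity) two_ne_zero, norm_sq_eq]
    exact (lift_aux e T φ).2)

/-- The symmetry condition `f(1,…,n) = f(i₁,…,iₙ)` for all permutations. -/
def IsSymm {ι : Type*} {n : ℕ} (f : Op ι n) : Prop :=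
  ∀ σ : Equiv.Perm (Fin n), lift σ.toEmbedding f = f

/-- For `X ⊆ {1,…,N}` and a sequence `b`, the operator `b_{|X|}(X) ⊗ 1` on the `N`-particle space. -/
def onSet {ι : Type*} {N : ℕ} (X : Finset (Fin N)) (b : OpSeq ι) : Op ι N :=
  lift (X.orderEmbOfFin rfl).toEmbedding (b X.card)

/-! ### Trace norm, partial trace and the two scales of spaces -/

/-- The absolute value `|f| = √(f* f)`. -/
def opAbs {E : Type*} [NormedAddCommGroup E] [InnerProductSpace ℂ E] [CompleteSpace E]
    (f : E →L[ℂ] E) : E →L[ℂ] E := CFC.abs f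

open Classical in
/-- `Tr |f| ∈ [0, ∞]`. -/
def traceNorm {A : Type*} (f : L2 A →L[ℂ] L2 A) : ℝ≥0∞ :=
  ∑' a : A, ENNReal.ofReal
    (inner ℂ (lp.single 2 a (1 : ℂ) : L2 A) (opAbs f (lp.single 2 a (1 : ℂ)))).re

/-- The map `m ↦ (m, r)` from `s`-particle to `(s+n)`-particle configurations. -/
def appendEmb {ι : Type*} (s n : ℕ) (r : Fin n → ι) : (Fin s → ι) ↪ (Fin (s + n) → ι) where
  toFun m := Fin.append m r
  inj' := fun m m' h => by
    funext i
    simpa using congrFun h (Fin.castAdd n i)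

/-- The partial trace `Tr_{s+1,…,s+n}`; its matrix elements are
`⟪e_m, (Tr f) e_{m'}⟫ = ∑_r ⟪e_{(m,r)}, f e_{(m',r)}⟫`. For trace-class `f` the series converges
absolutely in operator norm. -/
def traceOut {ι : Type*} (s n : ℕ) (f : Op ι (s + n)) : Op ι s :=
  ∑' r : Fin n → ι,
    pull (appendEmb s n r) ∘L f ∘L ContinuousLinearMap.adjoint (pull (appendEmb s n r))

/-- The norm `∑ αⁿ Tr |fₙ|`. -/
def l1Norm {ι : Type*} (α : ℝ) (f : OpSeq ι) : ℝ≥0∞ :=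
  ∑' n, ENNReal.ofReal (α ^ n) * traceNorm (f n)

/-- The space `𝔏¹_α` of sequences of symmetric trace-class operators. -/
def MemL1 {ι : Type*} (α : ℝ) (f : OpSeq ι) : Prop :=
  (∀ n, IsSymm (f n)) ∧ l1Norm α f < ∞

/-- `∑ₙ uₙ = F` in the norm of `𝔏¹_α`. -/
def HasSumL1 {ι : Type*} (α : ℝ) (u : ℕ → OpSeq ι) (F : OpSeq ι) : Prop :=
  Filter.Tendsto (fun N => l1Norm α (F - ∑ n ∈ Finset.range N, u n)) Filter.atTop (nhds 0)

/-- The norm `sup γⁿ/n! ‖bₙ‖`. -/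
def lgNorm {ι : Type*} (γ : ℝ) (b : OpSeq ι) : ℝ≥0∞ :=
  ⨆ n : ℕ, ENNReal.ofReal (γ ^ n / (n.factorial : ℝ)) * ENNReal.ofReal ‖b n‖

/-- The space `𝔏_γ` of sequences of symmetric bounded self-adjoint operators. -/
def MemLg {ι : Type*} (γ : ℝ) (b : OpSeq ι) : Prop :=
  (∀ n, IsSymm (b n) ∧ IsSelfAdjoint (b n)) ∧ lgNorm γ b < ∞

/-- `∑ₙ uₙ = B` in the norm of `𝔏_γ`. -/
def HasSumLg {ι : Type*} (γ : ℝ) (u : ℕ → OpSeq ι) (B : OpSeq ι) : Prop :=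
  Filter.Tendsto (fun N => lgNorm γ (B - ∑ n ∈ Finset.range N, u n)) Filter.atTop (nhds 0)

/-- The analogue `𝔞` of the annihilation operator, `(𝔞f)ₙ = Tr_{n+1} f_{n+1}`. -/
def ann {ι : Type*} (f : OpSeq ι) : OpSeq ι := fun n => traceOut n 1 (f (n + 1))

/-- The analogue `𝔞⁺` of the creation operator,
`(𝔞⁺b)ₙ = ∑_j b_{n-1}((1,…,n) ∖ j) ⊗ 1_{(j)}`. -/
def cre {ι : Type*} (b : OpSeq ι) : OpSeq ι := fun _ => ∑ j, onSet (Finset.univ.erase j) b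

/-- The terms `Tⁿ f / n!` of the exponential series. -/
def expTerm {ι : Type*} (T : OpSeq ι → OpSeq ι) (f : OpSeq ι) (n : ℕ) : OpSeq ι :=
  ((n.factorial : ℂ)⁻¹) • T^[n] f

/-- `e^T f = ∑ₙ Tⁿ f / n!`, componentwise. -/
def expMap {ι : Type*} (T : OpSeq ι → OpSeq ι) (f : OpSeq ι) : OpSeq ι :=
  fun s => ∑' n, expTerm T f n s

/-- The commutator of two maps on sequences. -/
def comm {ι : Type*} (A B : OpSeq ι → OpSeq ι) : OpSeq ι → OpSeq ι :=
  fun f => A (B f) - B (A f)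

/-! ### Unitary groups and the particle system -/

/-- `U(t) = e^{-itA}`: a strongly continuous unitary group such that `ψ ∈ D(A)`, `Aψ = χ` exactly
when `t ↦ U(t)ψ` has derivative `-iχ` at `0`. -/
def IsUnitaryGroupOf {E : Type*} [NormedAddCommGroup E] [InnerProductSpace ℂ E] [CompleteSpace E]
    (A : E →ₗ.[ℂ] E) (U : ℝ → E →L[ℂ] E) : Prop :=
  U 0 = 1 ∧ (∀ s t, U (s + t) = U s * U t) ∧ (∀ t, U t ∈ unitary (E →L[ℂ] E)) ∧
    (∀ ψ, Continuous fun t => U t ψ) ∧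
    ∀ ψ χ, (ψ, χ) ∈ A.graph ↔ HasDerivAt (fun t => U t ψ) (-Complex.I • χ) 0

open Classical in
/-- The unitary group `t ↦ e^{-itA}` of a self-adjoint operator `A` (it exists and is unique by
Stone's theorem). -/
def unitaryGroup {E : Type*} [NormedAddCommGroup E] [InnerProductSpace ℂ E] [CompleteSpace E]
    (A : E →ₗ.[ℂ] E) : ℝ → E →L[ℂ] E :=
  if h : ∃ U, IsUnitaryGroupOf A U then h.choose else fun _ => 1

/-- Identical spinless particles with one-particle Hilbert space `H`, kinetic energy operator `K`
(self-adjoint, in general unbounded) and bounded pair interaction `Φ`. -/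
structure PairSystem (ι H : Type*) [NormedAddCommGroup H] [InnerProductSpace ℂ H]
    [CompleteSpace H] where
  /-- a Hilbert basis of the one-particle space, used to write down the tensor powers -/
  basis : HilbertBasis ι ℂ H
  /-- the one-particle kinetic energy -/
  K : H →ₗ.[ℂ] H
  K_selfAdjoint : IsSelfAdjoint K
  /-- the pair interaction, an operator on the two-particle space -/
  Φ : Op ι 2
  Φ_selfAdjoint : IsSelfAdjoint Φ
  Φ_symm : IsSymm Φ

open Classical in
/-- Configurations in which only particle `j` may differ from `k`. -/
def updateEmb {ι : Type*} {n : ℕ} (j : Fin n) (k : Fin n → ι) : ι ↪ (Fin n → ι) where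
  toFun i := Function.update k j i
  inj' := Function.update_injective k j

namespace PairSystem

variable {ι H : Type*} [NormedAddCommGroup H] [InnerProductSpace ℂ H] [CompleteSpace H]

/-- The vector in `H` obtained from an `n`-particle vector by freezing all particles but `j` in the
basis states given by `k`. -/
def slice (S : PairSystem ι H) {n : ℕ} (j : Fin n) (k : Fin n → ι) : HS ι n →ₗ[ℂ] H :=
  S.basis.repr.symm.toLinearEquiv.toLinearMap ∘ₗ (pull (updateEmb j k)).toLinearMap

/-- The self-adjoint operator `K(j) = 1 ⊗ ⋯ ⊗ K ⊗ ⋯ ⊗ 1` (`K` in the `j`th place): `φ` is in its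
domain and is mapped to `χ` when every slice of `φ` in the `j`th variable is in the domain of `K`
and is mapped to the corresponding slice of `χ`. -/
def kinetic (S : PairSystem ι H) {n : ℕ} (j : Fin n) : HS ι n →ₗ.[ℂ] HS ι n :=
  (⨅ k : Fin n → ι, S.K.graph.comap ((S.slice j k).prodMap (S.slice j k))).toLinearPMap

/-- The interaction `Φ(i,j)` of two different particles on the `N`-particle space. -/
def pot (S : PairSystem ι H) {N : ℕ} (i j : Fin N) : Op ι N :=
  if h : i ≠ j then
    lift ⟨![i, j], by
      intro a b hab
      fin_cases a <;> fin_cases b <;> simp_all⟩ S.Φ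
  else 0

/-- The Hamiltonian `Hₙ = ∑_j K(j) + ∑_{j₁<j₂} Φ(j₁,j₂)` (the kinetic part is closed, so that the
sum is self-adjoint). -/
def hamiltonian (S : PairSystem ι H) (n : ℕ) : HS ι n →ₗ.[ℂ] HS ι n :=
  ((∑ p : Fin n × Fin n with p.1 < p.2, S.pot p.1 p.2 : Op ι n) : HS ι n →ₗ[ℂ] HS ι n) +ᵥ
    (∑ j : Fin n, S.kinetic j).closure

/-- `e^{-itHₙ}`. -/
def U (S : PairSystem ι H) (n : ℕ) (t : ℝ) : Op ι n := unitaryGroup (S.hamiltonian n) t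

/-- The group `𝒢*(t)` on sequences, `𝒢*ₙ(t)f = e^{-itHₙ} f e^{itHₙ}`. -/
def Gst (S : PairSystem ι H) (t : ℝ) (f : OpSeq ι) : OpSeq ι :=
  fun n => S.U n t * f n * S.U n (-t)

/-- The group `𝒢(t)` on sequences, `𝒢ₙ(t)b = e^{itHₙ} b e^{-itHₙ}`. -/
def G (S : PairSystem ι H) (t : ℝ) (b : OpSeq ι) : OpSeq ι :=
  fun n => S.U n (-t) * b n * S.U n t

/-- `e^{-itH_{|X|}(X)}`, acting on the particles in `X`. -/
def UOn (S : PairSystem ι H) {N : ℕ} (t : ℝ) (X : Finset (Fin N)) : Op ι N :=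
  onSet X fun n => S.U n t

/-- `𝒢*_{|X|}(t, X)` as a map on operators of `N` particles. -/
def GstOn (S : PairSystem ι H) {N : ℕ} (t : ℝ) (X : Finset (Fin N)) : Module.End ℂ (Op ι N) :=
  LinearMap.mulLeftRight ℂ (S.UOn t X, S.UOn (-t) X)

/-- `𝒢_{|X|}(t, X)` as a map on operators of `N` particles. -/
def GOn (S : PairSystem ι H) {N : ℕ} (t : ℝ) (X : Finset (Fin N)) : Module.End ℂ (Op ι N) :=
  LinearMap.mulLeftRight ℂ (S.UOn (-t) X, S.UOn t X)

end PairSystem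

/-! ### Cumulants and reduced cumulants -/

/-- The cumulant over clusters `c 1, …, c m` (disjoint sets of particles)
`∑_P (-1)^{|P|-1} (|P|-1)! ∏_{X ∈ P} 𝒢(θ(X))`, where `P` runs over the partitions of the set of
clusters and `θ(X)` is the set of the particles in the clusters of `X`. The factors act on
disjoint sets of particles and commute, so that their order is immaterial. -/
def cumulant {ι : Type*} {N m : ℕ} (G : Finset (Fin N) → Module.End ℂ (Op ι N))
    (c : Fin m → Finset (Fin N)) : Module.End ℂ (Op ι N) :=
  ∑ P : Finpartition (Finset.univ : Finset (Fin m)),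
    ((-1 : ℂ) ^ (P.parts.card - 1) * ((P.parts.card - 1).factorial : ℂ)) •
      (P.parts.toList.map fun X => G (X.biUnion c)).prod

/-- The cluster `{Z}` followed by the single particles `j₁, …, jₙ`. -/
def clusters {N n : ℕ} (Z : Finset (Fin N)) (j : Fin n → Fin N) : Fin (n + 1) → Finset (Fin N) :=
  Fin.cons Z fun i => {j i}

/-- The reduced cumulant `∑_{Y ⊆ {j₁,…,jₙ}} (-1)^{n-|Y|} 𝒢(Z ∪ Y)`. -/
def redCumulantSets {ι : Type*} {N n : ℕ} (G : Finset (Fin N) → Module.End ℂ (Op ι N))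
    (Z : Finset (Fin N)) (j : Fin n → Fin N) : Module.End ℂ (Op ι N) :=
  ∑ Y : Finset (Fin n), (-1 : ℂ) ^ (n - Y.card) • G (Z ∪ Y.image j)

/-- The reduced cumulant `∑_{k=0}^n (-1)^k C(n,k) 𝒢(Z ∪ {j₁,…,j_{n-k}})`. -/
def redCumulant {ι : Type*} {N n : ℕ} (G : Finset (Fin N) → Module.End ℂ (Op ι N))
    (Z : Finset (Fin N)) (j : Fin n → Fin N) : Module.End ℂ (Op ι N) :=
  ∑ k ∈ Finset.range (n + 1), ((-1 : ℂ) ^ k * (n.choose k : ℂ)) •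
    G (Z ∪ ({i : Fin n | i.val < n - k} : Finset (Fin n)).image j)

/-- The particles `1, …, s` among `N` particles. -/
def firstSet (N s : ℕ) : Finset (Fin N) := {i : Fin N | i.val < s}

/-- The `n`th term `(1/n!) Tr_{s+1,…,s+n} 𝔄_{1+n} F_{s+n}` of an expansion for the states with
generating operators `𝔄_{1+n}({1,…,s}, s+1, …, s+n)`. -/
def stateTerm {ι : Type*} (A : ∀ s n : ℕ, Module.End ℂ (Op ι (s + n))) (F : OpSeq ι) (n : ℕ) :
    OpSeq ι :=
  fun s => ((n.factorial : ℂ)⁻¹) • traceOut s n (A s n (F (s + n)))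

/-- The `n`th term
`(1/n!) ∑_{j₁≠⋯≠jₙ} 𝔄_{1+n} (B_{s-n}((1,…,s) ∖ (j₁,…,jₙ)) ⊗ 1_{(j₁)} ⊗ ⋯ ⊗ 1_{(jₙ)})` of an
expansion for the observables with generating operators
`𝔄_{1+n}({(1,…,s) ∖ (j₁,…,jₙ)}, j₁, …, jₙ)`. -/
def obsTerm {ι : Type*}
    (A : ∀ s n : ℕ, Finset (Fin s) → (Fin n → Fin s) → Module.End ℂ (Op ι s)) (B : OpSeq ι)
    (n : ℕ) : OpSeq ι :=
  fun s => ((n.factorial : ℂ)⁻¹) • ∑ j : Fin n ↪ Fin s,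
    A s n (Finset.univ \ Finset.univ.image j) j (onSet (Finset.univ \ Finset.univ.image j) B)

/-- The iterated integral `∫₀ᵗ dt₁ ∫₀^{t₁} dt₂ ⋯ ∫₀^{t_{n-1}} dtₙ g(t₁,…,tₙ)`. -/
def iterInt {E : Type*} [NormedAddCommGroup E] [NormedSpace ℝ E] :
    (n : ℕ) → ℝ → ((Fin n → ℝ) → E) → E
  | 0, _, g => g Fin.elim0
  | n + 1, t, g => ∫ τ in (0 : ℝ)..t, iterInt n τ fun τs => g (Fin.cons τ τs)

/-- `𝒢(t-t₁) V 𝒢(t₁-t₂) V ⋯ V 𝒢(tₙ) f`. -/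
def duhamel {ι : Type*} (G : ℝ → OpSeq ι → OpSeq ι) (V : OpSeq ι → OpSeq ι) (f : OpSeq ι) :
    (n : ℕ) → ℝ → (Fin n → ℝ) → OpSeq ι
  | 0, t, _ => G t f
  | n + 1, t, τ => G (t - τ 0) (V (duhamel G V f n (τ 0) (Fin.tail τ)))

namespace PairSystem

variable {ι H : Type*} [NormedAddCommGroup H] [InnerProductSpace ℂ H] [CompleteSpace H]

/-- `𝔄*_{1+n}(t, {1,…,s}, s+1, …, s+n)`. -/
def cumSt (S : PairSystem ι H) (t : ℝ) (s n : ℕ) : Module.End ℂ (Op ι (s + n)) :=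
  cumulant (S.GstOn t) (clusters (firstSet (s + n) s) (Fin.natAdd s : Fin n → Fin (s + n)))

/-- `U*_{1+n}(t, {1,…,s}, s+1, …, s+n)` as a sum over subsets. -/
def redCumStSets (S : PairSystem ι H) (t : ℝ) (s n : ℕ) : Module.End ℂ (Op ι (s + n)) :=
  redCumulantSets (S.GstOn t) (firstSet (s + n) s) (Fin.natAdd s : Fin n → Fin (s + n))

/-- `U*_{1+n}(t) = ∑_k (-1)^k C(n,k) 𝒢*_{s+n-k}(t, 1, …, s+n-k)`. -/
def redCumSt (S : PairSystem ι H) (t : ℝ) (s n : ℕ) : Module.End ℂ (Op ι (s + n)) :=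
  ∑ k ∈ Finset.range (n + 1), ((-1 : ℂ) ^ k * (n.choose k : ℂ)) •
    S.GstOn t (firstSet (s + n) (s + n - k))

/-- `𝔄_{1+n}(t, {Z}, j₁, …, jₙ)`. -/
def cumObs (S : PairSystem ι H) (t : ℝ) (s n : ℕ) (Z : Finset (Fin s)) (j : Fin n → Fin s) :
    Module.End ℂ (Op ι s) :=
  cumulant (S.GOn t) (clusters Z j)

/-- The nonperturbative expansion of the reduced density operators,
`F_s(t) = ∑_n (1/n!) Tr_{s+1,…,s+n} 𝔄*_{1+n}(t, {1,…,s}, s+1, …, s+n) F_{s+n}(0)`. -/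
def redDensity (S : PairSystem ι H) (t : ℝ) (F : OpSeq ι) : OpSeq ι :=
  fun s => ∑' n, stateTerm (S.cumSt t) F n s

/-- The nonperturbative expansion of the reduced observables, `B_s(t) = ∑_{n=0}^s (1/n!)
∑_{j₁≠⋯≠jₙ} 𝔄_{1+n}(t, {(1,…,s) ∖ (j₁,…,jₙ)}, j₁, …, jₙ) B_{s-n}(0, (1,…,s) ∖ (j₁,…,jₙ))`. -/
def redObs (S : PairSystem ι H) (t : ℝ) (B : OpSeq ι) : OpSeq ι :=
  fun s => ∑ n ∈ Finset.range (s + 1), obsTerm (S.cumObs t) B n s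

/-- `𝒩*_int(i,j) f = -i(Φ(i,j) f - f Φ(i,j))`. -/
def intSt (S : PairSystem ι H) {N : ℕ} (i j : Fin N) (f : Op ι N) : Op ι N :=
  -Complex.I • (S.pot i j * f - f * S.pot i j)

/-- `𝒩_int(i,j) b = -i(b Φ(i,j) - Φ(i,j) b)`. -/
def intObs (S : PairSystem ι H) {N : ℕ} (i j : Fin N) (b : Op ι N) : Op ι N :=
  -Complex.I • (b * S.pot i j - S.pot i j * b)

/-- The operator `[𝔞, 𝒩*]`, `([𝔞, 𝒩*]f)_s = ∑_{j=1}^s Tr_{s+1} 𝒩*_int(j, s+1) f_{s+1}`. -/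
def commAnn (S : PairSystem ι H) (f : OpSeq ι) : OpSeq ι :=
  fun s => ∑ j : Fin s, traceOut s 1 (S.intSt j.castSucc (Fin.last s) (f (s + 1)))

/-- The operator `[𝒩, 𝔞⁺]`,
`([𝒩, 𝔞⁺]b)_s = ∑_{j₁≠j₂} 𝒩_int(j₁,j₂) b_{s-1}((1,…,s) ∖ j₁) ⊗ 1_{(j₁)}`. -/
def commCre (S : PairSystem ι H) (b : OpSeq ι) : OpSeq ι :=
  fun s => ∑ p : Fin s × Fin s with p.1 ≠ p.2,
    S.intObs p.1 p.2 (onSet (Finset.univ.erase p.1) b)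

/-- `f ∈ D(𝒩*ₙ)` and `𝒩*ₙ f = -i(Hₙ f - f Hₙ) = g`: `f` and `g` are trace class, `f` maps `D(Hₙ)`
into itself, and `-i(Hₙ f - f Hₙ)` is the restriction of `g` to `D(Hₙ)`. -/
def IsVonNeumann (S : PairSystem ι H) (n : ℕ) (f g : Op ι n) : Prop :=
  traceNorm f < ∞ ∧ traceNorm g < ∞ ∧
    ∀ ψ χ, (ψ, χ) ∈ (S.hamiltonian n).graph →
      ∃ η, (f ψ, η) ∈ (S.hamiltonian n).graph ∧ g ψ = -Complex.I • (η - f χ)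

/-- `b ∈ D(𝒩ₙ)` and `𝒩ₙ b = -i(b Hₙ - Hₙ b) = c`: `b` maps `D(Hₙ)` into itself, and
`-i(b Hₙ - Hₙ b)` is the restriction of the bounded operator `c` to `D(Hₙ)`. -/
def IsHeisenberg (S : PairSystem ι H) (n : ℕ) (b c : Op ι n) : Prop :=
  ∀ ψ χ, (ψ, χ) ∈ (S.hamiltonian n).graph →
    ∃ η, (b ψ, η) ∈ (S.hamiltonian n).graph ∧ c ψ = -Complex.I • (b χ - η)

/-- `𝒢*_s(t-t₁) ∑_{j≤s} 𝒩*_int(j,s+1) 𝒢*_{s+1}(t₁-t₂) ⋯ ∑_{j≤s+n-1} 𝒩*_int(j,s+n) 𝒢*_{s+n}(tₙ) f`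
for an operator `f` of `N` particles; `𝒢*_m` acts on the particles `1, …, m`. -/
def iterSt (S : PairSystem ι H) {N : ℕ} (f : Op ι N) : (n s : ℕ) → ℝ → (Fin n → ℝ) → Op ι N
  | 0, s, t, _ => S.GstOn t (firstSet N s) f
  | n + 1, s, t, τ => S.GstOn (t - τ 0) (firstSet N s)
      (∑ p : Fin N × Fin N with p.1.val < s ∧ p.2.val = s,
        S.intSt p.1 p.2 (S.iterSt f n (s + 1) (τ 0) (Fin.tail τ)))

end PairSystem

end QuantumHierarchy

end

/-! States and observables are two cases of one computation. Let `a` be 𝔞 and `g` be 𝒢*(t), or let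
`a` be -𝔞⁺ and `g` be 𝒢(t). In the sequence norm `a` is bounded by some r (α⁻¹ for states, γ for
observables) and `g` does not increase the norm. Hence e^a g e^{-a} can be multiplied out and
rearranged. Its part of order n is `conjCoeff a g n`, that is (1/n!) ∑ (-1)^k C(n,k) a^{n-k} g a^k,
and its norm is at most (2r)ⁿ/n! times that of the argument (`IsSeqNorm.exp_conj`,
`IsSeqNorm.conjCoeff_ne_top`). Left and right multiplication by `a` commute, so the binomial theorem
turns this part into a nested commutator (`iterate_commutator`). What remains is to recognise the
same coefficient in the cumulant series and in the perturbation series.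

Cumulants. In a product over the blocks of a partition only the block containing {Z} has an effect.
For states the other blocks evolve particles that are traced out, and cyclicity of the trace cancels
them; for observables they evolve particles on which the operator is the identity. The weights of
all partitions with a prescribed block X containing {Z} add up to a sign, because ∑_P (-1)^{|P|}
|P|! = (-1)^{|S|} over the partitions of a set S (`sum_finpartition_factorial`). This leaves the sum
over subsets Y. Permutation symmetry makes each term (for observables, after summation over j₁, …,
jₙ) depend on |Y| alone, and a term with |Y| = k is a^k g a^{n-k} for states, and (𝔞⁺)^{n-k} g
(𝔞⁺)^k for observables.

Perturbation series. Put A(τ) = g(-τ) a g(τ). Although the Hamiltonians are unbounded, A is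
continuously differentiable, in trace norm on fixed trace-class operators or in the strong operator
sense. The reason is that H_{s+1} differs from H_s ⊗ 1 + 1 ⊗ K by a bounded operator, and the free
motion of the extra particle cancels, under the partial trace or against the identity factor
(`strongC1_AT`, `strongC1_AC`). The derivative is v(τ) = g(-τ) C g(τ), where C is [𝔞, 𝒩*] or [𝒩,
𝔞⁺]. On symmetric sequences C commutes with `a` (`annT_VT`, `creL_VC`), hence v(τ) with A(τ). So the
order n+1 part of the expansion, in the interaction picture, has derivative v(τ) applied to the
order n part, and it vanishes at τ = 0 (`IsDerivation.interCoeff`, `interCoeff_self`). Integration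
gives the Duhamel recursion.

Commutators. A bounded f has a bounded commutator with the generator on its domain exactly when its
orbit under conjugation by the group is strongly differentiable at 0. The orbit of 𝔞f is A(t)
applied to the orbit of f at the opposite time, so the product rule yields the domain statement and
the commutator at once; the argument for 𝔞⁺b is the same.

Foundations. Stone's theorem comes from symmetric Yosida approximation, the free evolution is a
product of commuting groups, and the interaction is a bounded perturbation. Trace-class operators
form a Banach space in which every element is a norm-convergent sum of rank-one operators, so
identities and estimates reduce to vectors. Identities for partial traces follow by duality with the
operators T ⊗ 1. -/

open scoped ENNReal BigOperators

noncomputable section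

namespace QuantumHierarchy

open Filter Topology MeasureTheory

/-! ### Calculus of operator families in the strong topology -/

section StrongCalculus

variable {F G : Type*} [NormedAddCommGroup F] [NormedSpace ℂ F]
  [NormedAddCommGroup G] [NormedSpace ℂ G]

/-- Product rule for a strongly differentiable family of operators applied to a curve. -/
theorem hasDerivAt_strong_apply {L : ℝ → F →L[ℂ] G} {g : ℝ → F} {t : ℝ} {l' : G} {g' : F} {C : ℝ}
    (hb : ∀ᶠ τ in 𝓝 t, ‖L τ‖ ≤ C) (hL : HasDerivAt (fun τ => L τ (g t)) l' t)
    (hc : ContinuousAt (fun τ => L τ g') t) (hg : HasDerivAt g g' t) :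
    HasDerivAt (fun τ => L τ (g τ)) (l' + L t g') t := by
  have h1 := hasDerivAt_iff_isLittleO.1 hL
  have h2 := hasDerivAt_iff_isLittleO.1 hg
  rw [hasDerivAt_iff_isLittleO]
  have h3 : (fun τ => L τ (g τ - g t - (τ - t) • g')) =o[𝓝 t] fun τ => τ - t := by
    refine Asymptotics.IsBigO.trans_isLittleO (Asymptotics.IsBigO.of_bound C ?_) h2
    filter_upwards [hb] with τ hτ
    exact ((L τ).le_opNorm _).trans (by gcongr)
  have h4 : (fun τ => (τ - t) • (L τ g' - L t g')) =o[𝓝 t] fun τ => τ - t := by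
    have : (fun τ => L τ g' - L t g') =o[𝓝 t] fun _ => (1 : ℝ) := by
      rw [Asymptotics.isLittleO_one_iff]
      simpa using hc.sub_const (L t g')
    simpa using (Asymptotics.isBigO_refl (fun τ : ℝ => τ - t) (𝓝 t)).smul_isLittleO this
  refine ((h1.add h3).add h4).congr_left fun τ => ?_
  have e : ∀ (r : ℝ) (x : F), L τ (r • x) = r • L τ x := fun r x =>
    (L τ).toLinearMap.map_smul_of_tower r x
  simp only [map_sub, e, smul_sub, smul_add]
  abel

/-- Strong convergence of contractions on a dense set implies strong convergence. -/
theorem tendsto_strong_of_dense {α : Type*} {l : Filter α} {T : α → F →L[ℂ] G} {T₀ : F →L[ℂ] G}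
    {C : ℝ} (hT : ∀ a, ‖T a‖ ≤ C) {D : Set F} (hD : Dense D)
    (h : ∀ x ∈ D, Tendsto (fun a => T a x) l (𝓝 (T₀ x))) (x : F) :
    Tendsto (fun a => T a x) l (𝓝 (T₀ x)) := by
  rw [Metric.tendsto_nhds]
  intro ε hε
  set M := max C ‖T₀‖ + 1 with hM
  have hM0 : 0 < M := by have := norm_nonneg T₀; have := le_max_right C ‖T₀‖; positivity
  have hM1 : C ≤ M := by have := le_max_left C ‖T₀‖; linarith
  have hM2 : ‖T₀‖ ≤ M := by have := le_max_right C ‖T₀‖; linarith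
  obtain ⟨y, hy, hxy⟩ := Metric.dense_iff.1 hD x (ε / (3 * M)) (by positivity)
  rw [Metric.mem_ball, dist_eq_norm] at hy
  filter_upwards [(Metric.tendsto_nhds.1 (h y hxy)) (ε / 3) (by positivity)] with a ha
  rw [dist_eq_norm] at ha ⊢
  have h1 : ‖T a (x - y)‖ ≤ M * ‖x - y‖ := ((T a).le_opNorm _).trans (by gcongr; exact (hT a).trans hM1)
  have h2 : ‖T₀ (y - x)‖ ≤ M * ‖y - x‖ := (T₀.le_opNorm _).trans (by gcongr)
  have e : T a x - T₀ x = T a (x - y) + (T a y - T₀ y) + T₀ (y - x) := by simp only [map_sub]; abel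
  have h3 : M * ‖y - x‖ < ε / 3 := by
    calc M * ‖y - x‖ < M * (ε / (3 * M)) := by gcongr
      _ = ε / 3 := by field_simp
  rw [e]
  rw [norm_sub_rev x y] at h1
  calc _ ≤ ‖T a (x - y)‖ + ‖T a y - T₀ y‖ + ‖T₀ (y - x)‖ := norm_add₃_le
    _ < ε := by linarith

/-- A strong derivative known on a dense set is a strong derivative everywhere, if the candidate
derivative is bounded. -/
theorem hasDerivAt_strong_of_dense {X X' : ℝ → F →L[ℂ] G} {C : ℝ}
    (hX' : ∀ t, ‖X' t‖ ≤ C) {D : Set F} (hD : Dense D)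
    (h : ∀ x ∈ D, ∀ t, HasDerivAt (fun τ => X τ x) (X' t x) t) (x : F) (t : ℝ) :
    HasDerivAt (fun τ => X τ x) (X' t x) t := by
  obtain ⟨u, hu, hux⟩ := mem_closure_iff_seq_limit.1 (hD x)
  -- The bound on `X'` makes the derivatives along `u n` converge uniformly in `τ`; for `X` itself
  -- pointwise convergence is enough.
  refine hasDerivAt_of_tendstoUniformly (f := fun n τ => X τ (u n))
    (f' := fun n τ => X' τ (u n)) (g := fun τ => X τ x) (g' := fun τ => X' τ x) (l := atTop) ?_ (Eventually.of_forall fun n τ => h _ (hu n) τ)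
    (fun τ => ((X τ).continuous.tendsto x).comp hux) t
  rw [Metric.tendstoUniformly_iff]
  intro ε hε
  have hC : 0 ≤ C := (norm_nonneg _).trans (hX' 0)
  have := Metric.tendsto_nhds.1 hux (ε / (C + 1)) (by positivity)
  filter_upwards [this] with n hn τ
  rw [dist_eq_norm] at hn ⊢
  rw [← map_sub]
  calc ‖X' τ (x - u n)‖ ≤ (C + 1) * ‖x - u n‖ :=
        ((X' τ).le_opNorm _).trans (by gcongr; linarith [hX' τ])
    _ < (C + 1) * (ε / (C + 1)) := by rw [norm_sub_rev]; gcongr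
    _ = ε := by field_simp

end StrongCalculus

/-! ### Unitary groups, their generators, and bounded perturbations -/

section Groups

variable {E : Type*} [NormedAddCommGroup E] [InnerProductSpace ℂ E] [CompleteSpace E]

/-- A strongly continuous one-parameter group of unitary operators. -/
structure IsUGroup (U : ℝ → E →L[ℂ] E) : Prop where
  zero : U 0 = 1
  add : ∀ s t, U (s + t) = U s * U t
  unit : ∀ t, U t ∈ unitary (E →L[ℂ] E)
  cont : ∀ ψ, Continuous fun t => U t ψ

theorem IsUnitaryGroupOf.isUGroup {A : E →ₗ.[ℂ] E} {U : ℝ → E →L[ℂ] E}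
    (h : IsUnitaryGroupOf A U) : IsUGroup U := ⟨h.1, h.2.1, h.2.2.1, h.2.2.2.1⟩

theorem IsUnitaryGroupOf.mem_iff {A : E →ₗ.[ℂ] E} {U : ℝ → E →L[ℂ] E}
    (h : IsUnitaryGroupOf A U) {ψ χ : E} :
    (ψ, χ) ∈ A.graph ↔ HasDerivAt (fun t => U t ψ) (-Complex.I • χ) 0 := h.2.2.2.2 ψ χ

theorem IsUGroup.of_mem_iff {A : E →ₗ.[ℂ] E} {U : ℝ → E →L[ℂ] E} (h : IsUGroup U)
    (h' : ∀ ψ χ, (ψ, χ) ∈ A.graph ↔ HasDerivAt (fun t => U t ψ) (-Complex.I • χ) 0) :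
    IsUnitaryGroupOf A U := ⟨h.zero, h.add, h.unit, h.cont, h'⟩

namespace IsUGroup

variable {U : ℝ → E →L[ℂ] E} (hU : IsUGroup U)
include hU

theorem mul_neg (t : ℝ) : U t * U (-t) = 1 := by rw [← hU.add, add_neg_cancel, hU.zero]

theorem neg_mul (t : ℝ) : U (-t) * U t = 1 := by rw [← hU.add, neg_add_cancel, hU.zero]

theorem star_eq (t : ℝ) : star (U t) = U (-t) := by
  have h := (Unitary.mem_iff.1 (hU.unit t)).1
  calc star (U t) = star (U t) * (U t * U (-t)) := by rw [hU.mul_neg, mul_one]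
    _ = U (-t) := by rw [← mul_assoc, h, one_mul]

theorem neg_apply (t : ℝ) (x : E) : U (-t) (U t x) = x := by
  rw [← mul_apply_eq_comp, hU.neg_mul]; rfl

theorem inner_left (t : ℝ) (x y : E) : inner ℂ (U t x) y = inner ℂ x (U (-t) y) := by
  rw [← hU.star_eq, ContinuousLinearMap.star_eq_adjoint, ContinuousLinearMap.adjoint_inner_right]

theorem norm_apply (t : ℝ) (x : E) : ‖U t x‖ = ‖x‖ := by
  have h : inner ℂ (U t x) (U t x) = inner ℂ x x := by rw [hU.inner_left, hU.neg_apply]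
  rw [inner_self_eq_norm_sq_to_K, inner_self_eq_norm_sq_to_K] at h
  have : ‖U t x‖ ^ 2 = ‖x‖ ^ 2 := by exact_mod_cast h
  exact (pow_left_inj₀ (norm_nonneg _) (norm_nonneg _) two_ne_zero).1 this

theorem norm_le (t : ℝ) : ‖U t‖ ≤ 1 :=
  ContinuousLinearMap.opNorm_le_bound _ zero_le_one fun x => by rw [hU.norm_apply, one_mul]

theorem hasDerivAt {x y : E} (h : HasDerivAt (fun t => U t x) y 0) (t : ℝ) :
    HasDerivAt (fun τ => U τ x) (U t y) t := by
  have h1 : HasDerivAt (fun τ : ℝ => τ - t) 1 t := (hasDerivAt_id t).sub_const t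
  have h2 : HasDerivAt (fun τ => U (τ - t) x) ((1 : ℝ) • y) t :=
    HasDerivAt.scomp (g₁ := fun r => U r x) (h := fun τ => τ - t) t (by simpa using h) h1
  have h3 := ((U t).restrictScalars ℝ).hasFDerivAt.comp_hasDerivAt t h2
  rw [one_smul] at h3
  refine h3.congr_of_eventuallyEq (Eventually.of_forall fun τ => ?_)
  change U τ x = U t (U (τ - t) x)
  rw [← mul_apply_eq_comp, ← hU.add, add_sub_cancel]

theorem hasDerivAt_neg {x y : E} (h : HasDerivAt (fun t => U t x) y 0) (t : ℝ) :
    HasDerivAt (fun τ => U (-τ) x) (-U (-t) y) t := by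
  have := HasDerivAt.scomp (g₁ := fun r => U r x) t (hU.hasDerivAt h (-t)) (_root_.hasDerivAt_neg t)
  simpa [Function.comp_def] using this

theorem cont_neg (x : E) : Continuous fun t => U (-t) x := (hU.cont x).comp continuous_neg

theorem integral_eq {x y : E} (h : HasDerivAt (fun t => U t x) y 0) (t : ℝ) :
    U t x - x = ∫ s in (0 : ℝ)..t, U s y := by
  rw [intervalIntegral.integral_eq_sub_of_hasDerivAt (fun s _ => hU.hasDerivAt h s)
    ((hU.cont y).intervalIntegrable _ _), hU.zero]
  rfl

/-- With `integral_eq`, this trades a derivative at `0` for an equation that survives limits in `x`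
and `y` and can be checked against test vectors or slice by slice. -/
theorem hasDerivAt_of_integral {x y : E} (h : ∀ t, U t x - x = ∫ s in (0 : ℝ)..t, U s y) :
    HasDerivAt (fun t => U t x) y 0 := by
  have h1 := intervalIntegral.integral_hasDerivAt_right ((hU.cont y).intervalIntegrable 0 0)
    ((hU.cont y).stronglyMeasurableAtFilter _ _) (hU.cont y).continuousAt
  have h2 : (fun t => U t x) = fun t => (∫ s in (0 : ℝ)..t, U s y) + x := by
    funext t; rw [← h]; simp
  rw [h2]
  simpa [hU.zero] using h1.add_const x

end IsUGroup

/-- Graph form of self-adjointness. -/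
theorem isSelfAdjoint_iff_graph {A : E →ₗ.[ℂ] E} : IsSelfAdjoint A ↔
    Dense (A.domain : Set E) ∧ ∀ y y', (y, y') ∈ A.graph ↔
      ∀ x x', (x, x') ∈ A.graph → inner ℂ x' y = inner ℂ x y' := by
  have key : ∀ y y', (y, y') ∈ A.graph.adjoint ↔
      ∀ x x', (x, x') ∈ A.graph → inner ℂ x' y = inner ℂ x y' := fun y y' => by
    rw [Submodule.mem_adjoint_iff]
    simp only [sub_eq_zero]
  constructor
  · intro h
    have hd := h.dense_domain
    refine ⟨hd, fun y y' => ?_⟩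
    rw [← key, ← LinearPMap.adjoint_graph_eq_graph_adjoint hd, LinearPMap.isSelfAdjoint_def.1 h]
  · rintro ⟨hd, h⟩
    refine LinearPMap.isSelfAdjoint_def.2 (LinearPMap.eq_of_eq_graph ?_)
    rw [LinearPMap.adjoint_graph_eq_graph_adjoint hd]
    ext ⟨y, y'⟩
    rw [key, h]

namespace IsUnitaryGroupOf

variable {A : E →ₗ.[ℂ] E} {U : ℝ → E →L[ℂ] E} (h : IsUnitaryGroupOf A U)
include h

theorem deriv_of_mem {x y : E} (hx : (x, y) ∈ A.graph) (t : ℝ) :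
    HasDerivAt (fun τ => U τ x) (U t (-Complex.I • y)) t :=
  h.isUGroup.hasDerivAt (h.mem_iff.1 hx) t

/-- A bounded operator commuting with the group preserves the graph of the generator. -/
theorem graph_of_commute {T : E →L[ℂ] E} (hT : ∀ t, Commute T (U t)) {x y : E}
    (hx : (x, y) ∈ A.graph) : (T x, T y) ∈ A.graph := by
  rw [h.mem_iff] at hx ⊢
  have h3 := ((T).restrictScalars ℝ).hasFDerivAt.comp_hasDerivAt 0 hx
  have e : (fun t => U t (T x)) = fun t => T (U t x) := by
    funext t
    exact (DFunLike.congr_fun (hT t) x).symm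
  rw [e]
  have e2 : (ContinuousLinearMap.restrictScalars ℝ T) (-Complex.I • y) = -Complex.I • T y :=
    T.map_smul _ _
  rw [e2] at h3
  exact h3

theorem graph_apply {x y : E} (hx : (x, y) ∈ A.graph) (t : ℝ) : (U t x, U t y) ∈ A.graph :=
  h.graph_of_commute (fun s => by
    change U t * U s = U s * U t
    rw [← h.isUGroup.add, ← h.isUGroup.add, add_comm]) hx

/-- The averages `r⁻¹ ∫₀ʳ U s ψ ds` lie in the domain, since translating the interval of integration
is differentiable, and they tend to `ψ`. -/
theorem dense_domain : Dense (A.domain : Set E) := by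
  have hU := h.isUGroup
  intro ψ
  set F : ℝ → E := fun t => ∫ s in (0 : ℝ)..t, U s ψ with hF
  have hint : ∀ a b, IntervalIntegrable (fun s => U s ψ) volume a b := fun a b =>
    (hU.cont ψ).intervalIntegrable a b
  have hFd : ∀ t, HasDerivAt F (U t ψ) t := fun t =>
    intervalIntegral.integral_hasDerivAt_right (hint _ _)
      ((hU.cont ψ).stronglyMeasurableAtFilter _ _) (hU.cont ψ).continuousAt
  have hUF : ∀ t r, U t (F r) = F (t + r) - F t := fun t r => by
    have h1 : U t (F r) = ∫ s in (0 : ℝ)..r, U t (U s ψ) :=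
      ((U t).intervalIntegral_comp_comm (hint 0 r)).symm
    have h2 : ∀ s, U t (U s ψ) = U (t + s) ψ := fun s => by rw [hU.add]; rfl
    rw [h1]
    simp only [h2]
    rw [intervalIntegral.integral_comp_add_left (fun s => U s ψ), add_zero,
      intervalIntegral.integral_interval_sub_left (hint _ _) (hint _ _)]
  have hdom : ∀ r, F r ∈ A.domain := fun r => by
    refine LinearPMap.mem_domain_of_mem_graph (y := Complex.I • (U r ψ - ψ)) ?_
    rw [h.mem_iff]
    have : HasDerivAt (fun t => F (t + r) - F t) (U r ψ - U 0 ψ) 0 :=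
      (HasDerivAt.comp_add_const 0 r (by simpa using hFd r)).sub (hFd 0)
    simp only [hUF]
    rw [hU.zero] at this
    simpa [smul_smul] using this
  have hlim : Tendsto (fun r : ℝ => (r⁻¹) • F r) (𝓝[≠] 0) (𝓝 ψ) := by
    have := (hasDerivAt_iff_tendsto_slope.1 (hFd 0))
    rw [hU.zero] at this
    refine this.congr fun r => ?_
    simp [slope, hF]
  refine mem_closure_of_tendsto hlim (Eventually.of_forall fun r => ?_)
  exact A.domain.smul_mem ((r⁻¹ : ℝ) : ℂ) (hdom r)

/-- The generator of a unitary group is self-adjoint. -/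
theorem isSelfAdjoint : IsSelfAdjoint A := by
  have hU := h.isUGroup
  refine isSelfAdjoint_iff_graph.2 ⟨h.dense_domain, fun y y' => ⟨fun hy x x' hx => ?_, fun hy => ?_⟩⟩
  · have h1 : HasDerivAt (fun t => inner ℂ (U t x) (U t y))
        (inner ℂ (U 0 x) (-Complex.I • y') + inner ℂ (-Complex.I • x') (U 0 y)) 0 :=
      (h.mem_iff.1 hx).inner ℂ (h.mem_iff.1 hy)
    have h2 : (fun t => inner ℂ (U t x) (U t y)) = fun _ => inner ℂ x y := by
      funext t; rw [hU.inner_left, hU.neg_apply]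
    rw [h2] at h1
    have h3 := h1.unique (hasDerivAt_const _ _)
    simp only [hU.zero, one_apply_eq_self, inner_smul_left, inner_smul_right, map_neg,
      Complex.conj_I, neg_neg] at h3
    have h4 : Complex.I * (inner ℂ x' y - inner ℂ x y') = 0 := by rw [← h3]; ring
    exact sub_eq_zero.1 ((mul_eq_zero.1 h4).resolve_left Complex.I_ne_zero)
  · rw [h.mem_iff]
    -- It suffices to test the integrated equation against vectors `x` of the dense domain, where
    -- `⟪x, U s y⟫ = ⟪U (-s) x, y⟫` is differentiated on the side of `x`.
    refine hU.hasDerivAt_of_integral fun t => ?_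
    refine h.dense_domain.eq_of_inner_right ℂ fun x hx => ?_
    obtain ⟨x', hx⟩ := LinearPMap.mem_domain_iff.1 hx
    have hc : Continuous fun s => U s (-Complex.I • y') := hU.cont _
    have hd : ∀ s, HasDerivAt (fun s => inner ℂ x (U s y)) (inner ℂ x (U s (-Complex.I • y'))) s := by
      intro s
      have h1 : HasDerivAt (fun s => inner ℂ (U (-s) x) y)
          (inner ℂ (U (-s) x) (0 : E) + inner ℂ (-(U (-s) (-Complex.I • x'))) y) s :=
        (hU.hasDerivAt_neg (h.mem_iff.1 hx) s).inner ℂ (hasDerivAt_const s y)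
      have e1 : (fun s => inner ℂ (U (-s) x) y) = fun s => inner ℂ x (U s y) := by
        funext s; rw [hU.inner_left, neg_neg]
      rw [e1] at h1
      convert h1 using 1
      have h5 := hy _ _ (h.graph_apply hx (-s))
      simp only [map_smul, inner_smul_right, inner_neg_left, inner_smul_left, inner_zero_right,
        zero_add, h5, map_neg, Complex.conj_I, neg_neg]
      rw [hU.inner_left, neg_neg]
      ring
    have h6 := intervalIntegral.integral_eq_sub_of_hasDerivAt (fun s _ => hd s)
      ((continuous_const.inner hc).intervalIntegrable 0 t)
    have h7 : inner ℂ x (∫ s in (0 : ℝ)..t, U s (-Complex.I • y')) =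
        ∫ s in (0 : ℝ)..t, inner ℂ x (U s (-Complex.I • y')) :=
      ((innerSL ℂ x).intervalIntegral_comp_comm (hc.intervalIntegrable 0 t)).symm
    rw [h7, h6, hU.zero, inner_sub_right]
    rfl

/-- A bounded operator preserving the graph of the generator commutes with the group. -/
theorem commute_of_graph {T : E →L[ℂ] E}
    (hT : ∀ x y, (x, y) ∈ A.graph → (T x, T y) ∈ A.graph) (t : ℝ) : Commute T (U t) := by
  have hU := h.isUGroup
  have hd : ∀ x y, (x, y) ∈ A.graph → U (-t) (T (U t x)) = T x := by
    intro x y hx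
    -- The two contributions of the generator cancel because `T` carries its graph into itself.
    have h0 : ∀ s, HasDerivAt (fun s => U (-s) (T (U s x))) 0 s := by
      intro s
      have h1 := h.graph_apply hx s
      have h2 : HasDerivAt (fun s => T (U s x)) (T (U s (-Complex.I • y))) s :=
        (T.restrictScalars ℝ).hasFDerivAt.comp_hasDerivAt s (h.deriv_of_mem hx s)
      have h3 := hasDerivAt_strong_apply (L := fun s => U (-s)) (t := s)
        (Eventually.of_forall fun s => hU.norm_le (-s))
        (hU.hasDerivAt_neg (h.mem_iff.1 (hT _ _ h1)) s) (hU.cont_neg _).continuousAt h2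
      convert h3 using 1
      simp
    have h4 := is_const_of_deriv_eq_zero (fun s => (h0 s).differentiableAt)
      (fun s => (h0 s).deriv) t 0
    simpa [hU.zero] using h4
  have h2 : U (-t) * T * U t = T := by
    refine ContinuousLinearMap.coeFn_injective (Continuous.ext_on h.dense_domain
      (ContinuousLinearMap.continuous _) T.continuous fun x hx => ?_)
    obtain ⟨y, hy⟩ := LinearPMap.mem_domain_iff.1 hx
    exact hd x y hy
  change T * U t = U t * T
  calc T * U t = U t * U (-t) * (T * U t) := by rw [hU.mul_neg, one_mul]
    _ = U t * (U (-t) * T * U t) := by simp only [mul_assoc]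
    _ = U t * T := by rw [h2]

end IsUnitaryGroupOf

theorem mem_graph_vadd {P : E →L[ℂ] E} {A : E →ₗ.[ℂ] E} {x y : E} :
    (x, y) ∈ ((P : E →ₗ[ℂ] E) +ᵥ A).graph ↔ (x, y - P x) ∈ A.graph := by
  simp only [LinearPMap.mem_graph_iff]
  constructor
  · rintro ⟨z, hz, hy⟩
    refine ⟨⟨z, z.2⟩, hz, ?_⟩
    have h2 : P (z : E) + A ⟨z, z.2⟩ = y := hy
    rw [← show (z : E) = x from hz, ← h2]
    exact (add_sub_cancel_left _ _).symm
  · rintro ⟨z, hz, hy⟩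
    refine ⟨⟨z, z.2⟩, hz, ?_⟩
    change P (z : E) + A z = y
    rw [show A z = y - P x from hy, show (z : E) = x from hz]
    exact add_sub_cancel _ _

/-- A bounded self-adjoint perturbation of a self-adjoint operator is self-adjoint. -/
theorem isSelfAdjoint_vadd {P : E →L[ℂ] E} (hP : IsSelfAdjoint P) {A : E →ₗ.[ℂ] E}
    (hA : IsSelfAdjoint A) : IsSelfAdjoint ((P : E →ₗ[ℂ] E) +ᵥ A) := by
  rw [isSelfAdjoint_iff_graph] at hA ⊢
  have hPi : ∀ x y, inner ℂ (P x) y = inner ℂ x (P y) := fun x y =>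
    (ContinuousLinearMap.isSelfAdjoint_iff_isSymmetric.1 hP) x y
  refine ⟨hA.1, fun y y' => ?_⟩
  rw [mem_graph_vadd, hA.2]
  constructor
  · intro h x x' hx
    have := h x _ (mem_graph_vadd.1 hx)
    rw [inner_sub_left, inner_sub_right, hPi] at this
    linear_combination this
  · intro h x x' hx
    have := h x (x' + P x) (mem_graph_vadd.2 (by simpa using hx))
    rw [inner_add_left, hPi] at this
    rw [inner_sub_right]
    linear_combination this

/-- The interaction picture: `V(-t) U(t)` is strongly differentiable on the whole space. -/
theorem hasDerivAt_interaction {A : E →ₗ.[ℂ] E} {P : E →L[ℂ] E} {U V : ℝ → E →L[ℂ] E}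
    (hV : IsUnitaryGroupOf A V) (hU : IsUnitaryGroupOf ((P : E →ₗ[ℂ] E) +ᵥ A) U) (ψ : E) (t : ℝ) :
    HasDerivAt (fun τ => V (-τ) (U τ ψ)) (V (-t) (-Complex.I • P (U t ψ))) t := by
  have hVg := hV.isUGroup
  have hUg := hU.isUGroup
  -- On the domain the unbounded parts of the two generators cancel. The remaining derivative is
  -- bounded by `‖P‖`, hence it extends from the domain to all vectors.
  refine hasDerivAt_strong_of_dense (X := fun τ => V (-τ) * U τ)
    (X' := fun τ => V (-τ) * (-Complex.I • P * U τ)) (C := ‖P‖) ?_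
    hU.dense_domain ?_ ψ t
  · intro τ
    refine ContinuousLinearMap.opNorm_le_bound _ (norm_nonneg _) fun x => ?_
    rw [mul_apply_eq_comp, hVg.norm_apply, mul_apply_eq_comp,
      _root_.smul_apply, norm_smul, norm_neg, Complex.norm_I, one_mul,
      ← hUg.norm_apply τ x]
    exact P.le_opNorm _
  · intro x hx τ
    obtain ⟨y, hx⟩ := LinearPMap.mem_domain_iff.1 hx
    have h1 := mem_graph_vadd.1 (hU.graph_apply hx τ)
    have h3 := hasDerivAt_strong_apply (L := fun s => V (-s)) (t := τ)
        (Eventually.of_forall fun s => hVg.norm_le (-s))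
        (hVg.hasDerivAt_neg (hV.mem_iff.1 h1) τ) (hVg.cont_neg _).continuousAt
        (hU.deriv_of_mem hx τ)
    refine h3.congr_deriv (Eq.symm ?_)
    change V (-τ) (-Complex.I • P (U τ x)) = _
    simp only [map_smul, smul_sub, map_sub, neg_smul, neg_sub, map_neg]
    abel

end Groups

/-! ### Resolvents and Stone's theorem -/

section Stone

variable {E : Type*} [NormedAddCommGroup E] [InnerProductSpace ℂ E] [CompleteSpace E]

/-- `R = (A + ic)⁻¹`, as a relation to the graph of `A`. -/
structure IsResolvent (A : E →ₗ.[ℂ] E) (c : ℝ) (R : E →L[ℂ] E) : Prop where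
  mem : ∀ φ, (R φ, φ - (Complex.I * c) • R φ) ∈ A.graph
  left_inv : ∀ x y, (x, y) ∈ A.graph → R (y + (Complex.I * c) • x) = x
  bound : ∀ φ, |c| * ‖R φ‖ ≤ ‖φ‖

theorem graph_symm {A : E →ₗ.[ℂ] E} (hA : IsSelfAdjoint A) {x x' y y' : E}
    (hx : (x, x') ∈ A.graph) (hy : (y, y') ∈ A.graph) : inner ℂ x' y = inner ℂ x y' :=
  ((isSelfAdjoint_iff_graph.1 hA).2 y y').1 hy x x' hx

/-- Symmetry makes `⟪y, x⟫` real, so the cross term is purely imaginary and has no real part. -/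
theorem norm_sq_resolvent {A : E →ₗ.[ℂ] E} (hA : IsSelfAdjoint A) {x y : E}
    (h : (x, y) ∈ A.graph) (c : ℝ) :
    ‖y + (Complex.I * c) • x‖ ^ 2 = ‖y‖ ^ 2 + c ^ 2 * ‖x‖ ^ 2 := by
  have h1 : inner ℂ y x = inner ℂ x y := graph_symm hA h h
  have h2 : (inner ℂ y x : ℂ).im = 0 := by
    have := congrArg Complex.im (inner_conj_symm (𝕜 := ℂ) y x)
    rw [Complex.conj_im, ← h1] at this
    linarith
  rw [@norm_add_sq ℂ]
  rw [inner_smul_right, norm_smul]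
  have h3 : RCLike.re (Complex.I * (c : ℂ) * inner ℂ y x) = 0 := by
    simp [h2]
  rw [h3]
  simp [mul_pow]

/-- `A + ic` is bounded below on the complete graph of `A`, so its range is closed. A vector `y`
orthogonal to the range satisfies `A y = ic y`, which symmetry allows only for `y = 0`. -/
theorem exists_resolvent {A : E →ₗ.[ℂ] E} (hA : IsSelfAdjoint A) {c : ℝ} (hc : c ≠ 0) :
    ∃ R, IsResolvent A c R := by
  have hgc : IsClosed (A.graph : Set (E × E)) := by
    have : (A.graph : Set (E × E)) = ⋂ p ∈ A.graph, {q : E × E | inner ℂ p.2 q.1 = inner ℂ p.1 q.2} := by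
      ext ⟨y, y'⟩
      simp only [Set.mem_iInter]
      exact ((isSelfAdjoint_iff_graph.1 hA).2 y y').trans
        ⟨fun h p hp => h p.1 p.2 hp, fun h x x' hx => h (x, x') hx⟩
    rw [this]
    exact isClosed_biInter fun p _ => isClosed_eq (by fun_prop) (by fun_prop)
  have : CompleteSpace A.graph := hgc.completeSpace_coe
  set T : A.graph →L[ℂ] E := (ContinuousLinearMap.snd ℂ E E +
    (Complex.I * c : ℂ) • ContinuousLinearMap.fst ℂ E E) ∘L A.graph.subtypeL with hT
  have hTa : ∀ p : A.graph, T p = (p : E × E).2 + (Complex.I * c : ℂ) • (p : E × E).1 := fun p => rfl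
  have hn : ∀ p : A.graph, ‖T p‖ ^ 2 = ‖(p : E × E).2‖ ^ 2 + c ^ 2 * ‖(p : E × E).1‖ ^ 2 := fun p => by
    rw [hTa]; exact norm_sq_resolvent hA (x := (p : E × E).1) (y := (p : E × E).2) p.2 c
  have hn1 : ∀ p : A.graph, ‖(p : E × E).2‖ ≤ ‖T p‖ := fun p => by
    refine (pow_le_pow_iff_left₀ (norm_nonneg _) (norm_nonneg _) two_ne_zero).1 ?_
    rw [hn]; nlinarith [mul_nonneg (sq_nonneg c) (sq_nonneg ‖(p : E × E).1‖)]
  have hn2 : ∀ p : A.graph, |c| * ‖(p : E × E).1‖ ≤ ‖T p‖ := fun p => by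
    refine (pow_le_pow_iff_left₀ (by positivity) (norm_nonneg _) two_ne_zero).1 ?_
    rw [hn, mul_pow, sq_abs]; nlinarith [sq_nonneg ‖(p : E × E).2‖]
  have hanti : AntilipschitzWith (Real.toNNReal (1 + |c|⁻¹)) T := by
    refine ContinuousLinearMap.antilipschitz_of_bound _ fun p => ?_
    rw [Real.coe_toNNReal _ (by positivity)]
    change max ‖(p : E × E).1‖ ‖(p : E × E).2‖ ≤ _
    refine max_le ?_ ?_
    · have h1 : ‖(p : E × E).1‖ ≤ |c|⁻¹ * ‖T p‖ := by
        rw [le_inv_mul_iff₀ (abs_pos.2 hc)]; exact hn2 p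
      linarith [norm_nonneg (T p)]
    · have := hn1 p
      have h3 : 0 ≤ |c|⁻¹ * ‖T p‖ := by positivity
      linarith
  have hcl : IsClosed ((LinearMap.range T.toLinearMap : Submodule ℂ E) : Set E) := by
    have := hanti.isClosed_range T.uniformContinuous
    exact this
  have : CompleteSpace (LinearMap.range T.toLinearMap : Submodule ℂ E) := hcl.completeSpace_coe
  have hsurj : LinearMap.range T.toLinearMap = ⊤ := by
    rw [← Submodule.orthogonal_eq_bot_iff, Submodule.eq_bot_iff]
    intro y hy
    rw [Submodule.mem_orthogonal] at hy
    have hmem : (y, (Complex.I * c : ℂ) • y) ∈ A.graph := by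
      rw [(isSelfAdjoint_iff_graph.1 hA).2]
      intro x x' hx
      have := hy _ ⟨⟨(x, x'), hx⟩, rfl⟩
      change inner ℂ (x' + (Complex.I * c : ℂ) • x) y = 0 at this
      rw [inner_add_left, inner_smul_left] at this
      simp only [map_mul, Complex.conj_I, Complex.conj_ofReal] at this
      rw [inner_smul_right]
      linear_combination this
    have h2 := graph_symm hA hmem hmem
    rw [inner_smul_left, inner_smul_right] at h2
    simp only [map_mul, Complex.conj_I, Complex.conj_ofReal] at h2
    have h3 : (2 * Complex.I * c : ℂ) * inner ℂ y y = 0 := by linear_combination -h2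
    have h4 : (2 * Complex.I * c : ℂ) ≠ 0 := by
      simp [hc]
    exact inner_self_eq_zero.1 ((mul_eq_zero.1 h3).resolve_left h4)
  have hinj : Function.Injective T := hanti.injective
  let e : A.graph ≃ₗ[ℂ] E := LinearEquiv.ofBijective T.toLinearMap ⟨hinj, LinearMap.range_eq_top.1 hsurj⟩
  have he : ∀ φ, T (e.symm φ) = φ := fun φ => e.apply_symm_apply φ
  refine ⟨LinearMap.mkContinuous (LinearMap.fst ℂ E E ∘ₗ A.graph.subtype ∘ₗ e.symm.toLinearMap)
    |c|⁻¹ fun φ => ?_, fun φ => ?_, fun x y h => ?_, fun φ => ?_⟩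
  · rw [le_inv_mul_iff₀ (abs_pos.2 hc)]
    exact (hn2 (e.symm φ)).trans (by rw [he])
  · have h1 := he φ
    rw [hTa] at h1
    have h2 := (e.symm φ).2
    convert h2 using 1
    refine Prod.ext rfl ?_
    exact sub_eq_iff_eq_add.2 h1.symm
  · have : y + (Complex.I * c : ℂ) • x = e ⟨(x, y), h⟩ := rfl
    rw [this]
    change ((e.symm (e _) : A.graph) : E × E).1 = x
    rw [e.symm_apply_apply]
  · exact (hn2 (e.symm φ)).trans (by rw [he])

namespace IsResolvent

variable {A : E →ₗ.[ℂ] E} {c : ℝ} {R : E →L[ℂ] E} (h : IsResolvent A c R)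
include h

theorem apply_mem_domain (φ : E) : R φ ∈ A.domain := LinearPMap.mem_domain_of_mem_graph (h.mem φ)

theorem commute_of_graph {T : E →L[ℂ] E}
    (hT : ∀ x y, (x, y) ∈ A.graph → (T x, T y) ∈ A.graph) : Commute R T := by
  refine ContinuousLinearMap.ext fun φ => ?_
  change R (T φ) = T (R φ)
  have h1 := h.left_inv _ _ (hT _ _ (h.mem φ))
  rw [← h1, ← map_smul T, ← map_add T, sub_add_cancel]

theorem graph {x y : E} (hx : (x, y) ∈ A.graph) : (R x, R y) ∈ A.graph := by
  have h1 := h.left_inv x y hx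
  rw [map_add, map_smul] at h1
  have h2 : R y = x - (Complex.I * c) • R x := eq_sub_of_add_eq h1
  rw [h2]
  exact h.mem x

theorem norm_le : ‖(Complex.I * c) • R‖ ≤ 1 := by
  refine ContinuousLinearMap.opNorm_le_bound _ zero_le_one fun x => ?_
  rw [one_mul, _root_.smul_apply, norm_smul, norm_mul, Complex.norm_I, one_mul, Complex.norm_real]
  exact h.bound x

end IsResolvent

/-- On the domain `ic R x = x - R (A x)`, and `R` has norm at most `1/|c|`; density and the
contraction bound give all vectors. -/
theorem tendsto_resolvent {A : E →ₗ.[ℂ] E} (hA : IsSelfAdjoint A) {c : ℕ → ℝ} {R : ℕ → E →L[ℂ] E}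
    (hc : ∀ n, c n ≠ 0) (hl : Tendsto (fun n => |c n|) atTop atTop)
    (h : ∀ n, IsResolvent A (c n) (R n)) (x : E) :
    Tendsto (fun n => ((Complex.I * c n) • R n) x) atTop (𝓝 x) := by
  refine tendsto_strong_of_dense (T₀ := (1 : E →L[ℂ] E)) (fun n => (h n).norm_le)
    (isSelfAdjoint_iff_graph.1 hA).1 (fun y hy => ?_) x
  obtain ⟨y', hy⟩ := LinearPMap.mem_domain_iff.1 hy
  have h1 : ∀ n, ((Complex.I * c n) • R n) y = y - R n y' := fun n => by
    have := (h n).left_inv y y' hy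
    rw [map_add, map_smul] at this
    rw [_root_.smul_apply, eq_sub_iff_add_eq, add_comm]
    exact this
  simp only [h1]
  have h2 : Tendsto (fun n => R n y') atTop (𝓝 0) := by
    refine squeeze_zero_norm (a := fun n => |c n|⁻¹ * ‖y'‖) (fun n => ?_) ?_
    · rw [le_inv_mul_iff₀ (abs_pos.2 (hc n))]
      exact (h n).bound y'
    · simpa using (tendsto_inv_atTop_zero.comp hl).mul_const ‖y'‖
  simpa using tendsto_const_nhds.sub h2

theorem exp_add_of_commute_clm {a b : E →L[ℂ] E} (h : Commute a b) :
    NormedSpace.exp (a + b) = NormedSpace.exp a * NormedSpace.exp b := by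
  let _ : NormedAlgebra ℚ (E →L[ℂ] E) := NormedAlgebra.restrictScalars ℚ ℂ _
  exact NormedSpace.exp_add_of_commute h

/-- The unitary group of a bounded self-adjoint operator. -/
theorem bounded_group {B : E →L[ℂ] E} (hB : IsSelfAdjoint B) :
    IsUGroup (fun t : ℝ => NormedSpace.exp (t • (-Complex.I • B))) ∧ ∀ t ψ,
      HasDerivAt (fun t : ℝ => NormedSpace.exp (t • (-Complex.I • B)) ψ)
        (NormedSpace.exp (t • (-Complex.I • B)) ((-Complex.I • B) ψ)) t := by
  have hd : ∀ (t : ℝ) (ψ : E), HasDerivAt (fun t : ℝ => NormedSpace.exp (t • (-Complex.I • B)) ψ)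
        (NormedSpace.exp (t • (-Complex.I • B)) ((-Complex.I • B) ψ)) t := fun t ψ => by
    have h1 := hasDerivAt_exp_smul_const (-Complex.I • B) t
    exact ((ContinuousLinearMap.apply ℂ E ψ).restrictScalars ℝ).hasFDerivAt.comp_hasDerivAt t h1
  refine ⟨⟨by simp, fun s t => ?_, fun t => ?_, fun ψ => ?_⟩, hd⟩
  · rw [add_smul, exp_add_of_commute_clm]
    exact ((Commute.refl _).smul_left s).smul_right t
  · have hsk : star (t • (-Complex.I • B)) = -(t • (-Complex.I • B)) := by
      rw [star_smul, star_smul, hB.star_eq]; simp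
    have h1 : star (NormedSpace.exp (t • (-Complex.I • B))) =
        NormedSpace.exp (-(t • (-Complex.I • B))) := by rw [NormedSpace.star_exp, hsk]
    rw [Unitary.mem_iff, h1]
    constructor
    · rw [← exp_add_of_commute_clm (Commute.neg_left (Commute.refl (t • (-Complex.I • B))))]; simp
    · rw [← exp_add_of_commute_clm (Commute.neg_right (Commute.refl (t • (-Complex.I • B))))]; simp
  · exact continuous_iff_continuousAt.2 fun t => (hd t ψ).continuousAt

/-- **Stone's theorem**: a self-adjoint operator generates a unitary group. -/
theorem exists_isUnitaryGroupOf {A : E →ₗ.[ℂ] E} (hA : IsSelfAdjoint A) :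
    ∃ U, IsUnitaryGroupOf A U := by
  have hdense := (isSelfAdjoint_iff_graph.1 hA).1
  set c : ℕ → ℝ := fun n => n + 1 with hcdef
  have hc : ∀ n, c n ≠ 0 := fun n => by positivity
  have hcl : Tendsto (fun n => |c n|) atTop atTop := by
    have : ∀ n, |c n| = (n : ℝ) + 1 := fun n => abs_of_pos (by positivity)
    simp only [this]
    exact tendsto_atTop_add_const_right _ _ tendsto_natCast_atTop_atTop
  choose R hR using fun n => exists_resolvent hA (hc n)
  choose S hS using fun n => exists_resolvent hA (neg_ne_zero.2 (hc n))
  -- The half sum of the resolvents at `ic` and `-ic`, times `c²`, is the symmetric Yosida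
  -- approximation `c² A (A² + c²)⁻¹`: bounded, self-adjoint, and convergent to `A` on the domain.
  set K : ℕ → E →L[ℂ] E := fun n => ((c n ^ 2 / 2 : ℝ) : ℂ) • (R n + S n) with hK
  have hRS : ∀ n x y, inner ℂ (R n x) y = inner ℂ x (S n y) := fun n x y => by
    have h := graph_symm hA ((hR n).mem x) ((hS n).mem y)
    rw [inner_sub_left, inner_sub_right, inner_smul_left, inner_smul_right] at h
    simp only [map_mul, Complex.conj_I, Complex.conj_ofReal, Complex.ofReal_neg] at h
    linear_combination -h
  have hSR : ∀ n x y, inner ℂ (S n x) y = inner ℂ x (R n y) := fun n x y => by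
    rw [← inner_conj_symm, ← hRS, inner_conj_symm]
  have hKsa : ∀ n, IsSelfAdjoint (K n) := fun n => by
    rw [ContinuousLinearMap.isSelfAdjoint_iff_isSymmetric]
    intro x y
    change inner ℂ (((c n ^ 2 / 2 : ℝ) : ℂ) • (R n x + S n x)) y =
      inner ℂ x (((c n ^ 2 / 2 : ℝ) : ℂ) • (R n y + S n y))
    rw [inner_smul_left, inner_smul_right, inner_add_left, inner_add_right, hRS, hSR,
      Complex.conj_ofReal, add_comm]
  have hcomm : ∀ m n, Commute (K m) (K n) := fun m n => by
    have h1 : ∀ T : E →L[ℂ] E, (∀ x y, (x, y) ∈ A.graph → (T x, T y) ∈ A.graph) →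
        Commute (K m) T := fun T hT =>
      (((hR m).commute_of_graph hT).add_left ((hS m).commute_of_graph hT)).smul_left _
    exact (((h1 (R n) fun x y h => (hR n).graph h).add_right
      (h1 (S n) fun x y h => (hS n).graph h))).smul_right _
  have hKlim : ∀ x y, (x, y) ∈ A.graph → Tendsto (fun n => K n x) atTop (𝓝 y) := by
    intro x y hxy
    have e1 : ∀ n, K n x = ((1 / 2 : ℝ) : ℂ) • (((Complex.I * c n) • R n) y +
        ((Complex.I * ((-c n : ℝ) : ℂ)) • S n) y) := fun n => by
      have h1 := (hR n).left_inv x y hxy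
      have h2 := (hS n).left_inv x y hxy
      rw [map_add, map_smul] at h1 h2
      have h3 : R n y = x - (Complex.I * c n) • R n x := eq_sub_of_add_eq h1
      have h4 : S n y = x - (Complex.I * ((-c n : ℝ) : ℂ)) • S n x := eq_sub_of_add_eq h2
      change ((c n ^ 2 / 2 : ℝ) : ℂ) • (R n x + S n x) =
        ((1 / 2 : ℝ) : ℂ) • ((Complex.I * c n) • R n y + (Complex.I * ((-c n : ℝ) : ℂ)) • S n y)
      rw [h3, h4]
      simp only [smul_sub, smul_smul, smul_add]
      have i2 : Complex.I * (c n : ℂ) * (Complex.I * c n) = -(c n : ℂ) ^ 2 := by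
        linear_combination (c n : ℂ) ^ 2 * Complex.I_mul_I
      have i3 : Complex.I * ((-c n : ℝ) : ℂ) * (Complex.I * ((-c n : ℝ) : ℂ)) = -(c n : ℂ) ^ 2 := by
        push_cast; linear_combination (c n : ℂ) ^ 2 * Complex.I_mul_I
      rw [i2, i3]
      push_cast
      module
    have h1 := tendsto_resolvent hA hc hcl hR y
    have h2 := tendsto_resolvent hA (c := fun n => -c n) (fun n => neg_ne_zero.2 (hc n))
      (by simpa using hcl) hS y
    have h3 := (h1.add h2).const_smul ((1 / 2 : ℝ) : ℂ)
    simp only [e1]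
    refine h3.congr_dist ?_ |>.trans (le_of_eq ?_)
    · simp
    · congr 1
      push_cast
      module
  set V : ℕ → ℝ → E →L[ℂ] E := fun n t => NormedSpace.exp (t • (-Complex.I • K n)) with hV
  have hVg : ∀ n, IsUGroup (V n) := fun n => (bounded_group (hKsa n)).1
  have hVd : ∀ n t ψ, HasDerivAt (fun t => V n t ψ) (V n t ((-Complex.I • K n) ψ)) t := fun n =>
    (bounded_group (hKsa n)).2
  -- The approximations commute, so `V n = V m * W`, where `W` is the group of `K n - K m`. Its
  -- generator bounds how far `W t` moves a vector, which makes the groups Cauchy on the domain.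
  have hdiff : ∀ m n t x, ‖V n t x - V m t x‖ ≤ |t| * ‖K n x - K m x‖ := by
    intro m n t x
    obtain ⟨hWg, hWd⟩ := bounded_group ((hKsa n).sub (hKsa m))
    set W : ℝ → E →L[ℂ] E := fun t => NormedSpace.exp (t • (-Complex.I • (K n - K m)))
    have hVW : V n t = V m t * W t := by
      change NormedSpace.exp _ = NormedSpace.exp _ * NormedSpace.exp _
      rw [← exp_add_of_commute_clm]
      · congr 1; module
      · exact ((((hcomm m n).sub_right (hcomm m m)).smul_right _).smul_left _ |>.smul_right _).smul_left _
    have h1 : ‖W t x - x‖ ≤ ‖K n x - K m x‖ * |t| := by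
      have := Convex.norm_image_sub_le_of_norm_hasDerivWithin_le (f := fun t => W t x)
        (C := ‖K n x - K m x‖) (s := Set.univ) (x := 0) (y := t)
        (fun s _ => (hWd s x).hasDerivWithinAt) (fun s _ => by
          rw [hWg.norm_apply s, _root_.smul_apply, norm_smul, norm_neg, Complex.norm_I, one_mul]; rfl)
        convex_univ (Set.mem_univ _) (Set.mem_univ _)
      simpa [hWg.zero] using this
    rw [hVW, mul_apply_eq_comp, ← map_sub, (hVg m).norm_apply, mul_comm]
    exact h1
  have hcauchyD : ∀ t, ∀ x ∈ (A.domain : Set E), CauchySeq fun n => V n t x := by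
    intro t x hx
    obtain ⟨y, hxy⟩ := LinearPMap.mem_domain_iff.1 hx
    have hC := (hKlim x y hxy).cauchySeq
    rw [Metric.cauchySeq_iff] at hC ⊢
    intro ε hε
    obtain ⟨N, hN⟩ := hC (ε / (|t| + 1)) (by positivity)
    refine ⟨N, fun n hn m hm => ?_⟩
    have h1 := hN n hn m hm
    rw [dist_eq_norm] at h1 ⊢
    calc _ ≤ |t| * ‖K n x - K m x‖ := hdiff m n t x
      _ ≤ (|t| + 1) * ‖K n x - K m x‖ := by gcongr; linarith
      _ < (|t| + 1) * (ε / (|t| + 1)) := by gcongr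
      _ = ε := by field_simp
  have hcauchy : ∀ t x, CauchySeq fun n => V n t x := by
    intro t x
    rw [Metric.cauchySeq_iff]
    intro ε hε
    obtain ⟨y, hy, hyD⟩ := Metric.dense_iff.1 hdense x (ε / 3) (by positivity)
    rw [Metric.mem_ball, dist_eq_norm] at hy
    obtain ⟨N, hN⟩ := (Metric.cauchySeq_iff.1 (hcauchyD t y hyD)) (ε / 3) (by positivity)
    refine ⟨N, fun n hn m hm => ?_⟩
    have h1 := hN n hn m hm
    rw [dist_eq_norm] at h1 ⊢
    have e : V n t x - V m t x = V n t (x - y) + (V n t y - V m t y) + V m t (y - x) := by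
      simp only [map_sub]; abel
    rw [e]
    calc _ ≤ ‖V n t (x - y)‖ + ‖V n t y - V m t y‖ + ‖V m t (y - x)‖ := norm_add₃_le
      _ < ε := by rw [(hVg n).norm_apply, (hVg m).norm_apply, norm_sub_rev x y]; linarith
  choose u hu using fun t x => cauchySeq_tendsto_of_complete (hcauchy t x)
  set U : ℝ → E →L[ℂ] E := fun t => continuousLinearMapOfTendsto (fun n => V n t)
    (tendsto_pi_nhds.2 fun x => hu t x) with hUdef
  have hUl : ∀ t x, Tendsto (fun n => V n t x) atTop (𝓝 (U t x)) := hu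
  have hUn : ∀ t x, ‖U t x‖ = ‖x‖ := fun t x =>
    tendsto_nhds_unique (hUl t x).norm (by simp [(hVg _).norm_apply])
  have hU0 : U 0 = 1 := ContinuousLinearMap.ext fun x =>
    tendsto_nhds_unique (hUl 0 x) (by simp [(hVg _).zero])
  have hUadd : ∀ s t, U (s + t) = U s * U t := fun s t => ContinuousLinearMap.ext fun x => by
    refine tendsto_nhds_unique (hUl (s + t) x) ?_
    have h1 : Tendsto (fun n => V n s (U t x) + V n s (V n t x - U t x)) atTop
        (𝓝 (U s (U t x) + 0)) := by
      refine (hUl s (U t x)).add (squeeze_zero_norm (a := fun n => ‖V n t x - U t x‖)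
        (fun n => ((hVg n).norm_apply _ _).le) ?_)
      simpa using ((hUl t x).sub_const (U t x)).norm
    rw [add_zero] at h1
    refine h1.congr fun n => ?_
    rw [← map_add, add_sub_cancel, (hVg n).add]
    rfl
  have hUint : ∀ x y, (x, y) ∈ A.graph → ∀ t, ‖U t x - x‖ ≤ |t| * ‖y‖ := by
    intro x y hxy t
    refine le_of_tendsto_of_tendsto ((hUl t x).sub_const x).norm
      (((hKlim x y hxy).norm).const_mul |t|) (Eventually.of_forall fun n => ?_)
    have := Convex.norm_image_sub_le_of_norm_hasDerivWithin_le (f := fun t => V n t x)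
        (C := ‖K n x‖) (s := Set.univ) (x := 0) (y := t)
        (fun s _ => (hVd n s x).hasDerivWithinAt) (fun s _ => by
          rw [(hVg n).norm_apply s, _root_.smul_apply, norm_smul, norm_neg, Complex.norm_I, one_mul])
        convex_univ (Set.mem_univ _) (Set.mem_univ _)
    simpa [(hVg n).zero, mul_comm] using this
  have hUle : ∀ t, ‖U t‖ ≤ 1 := fun t =>
    ContinuousLinearMap.opNorm_le_bound _ zero_le_one fun x => by rw [hUn, one_mul]
  have hUc : ∀ ψ, Continuous fun t => U t ψ := by
    intro ψ
    have h0 : ∀ ψ, Tendsto (fun t => U t ψ) (𝓝 0) (𝓝 ψ) := by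
      refine tendsto_strong_of_dense (T₀ := (1 : E →L[ℂ] E)) hUle hdense fun x hx => ?_
      obtain ⟨y, hxy⟩ := LinearPMap.mem_domain_iff.1 hx
      rw [tendsto_iff_norm_sub_tendsto_zero]
      refine squeeze_zero (fun _ => norm_nonneg _) (fun t => hUint x y hxy t) ?_
      have : Continuous fun t : ℝ => |t| * ‖y‖ := by fun_prop
      simpa using this.tendsto 0
    refine continuous_iff_continuousAt.2 fun t => ?_
    have h1 : Tendsto (fun τ : ℝ => τ - t) (𝓝 t) (𝓝 0) := by
      have : Continuous fun τ : ℝ => τ - t := by fun_prop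
      simpa using this.tendsto t
    have h2 := ((U t).continuous.tendsto ψ).comp ((h0 ψ).comp h1)
    refine h2.congr fun τ => ?_
    change U t (U (τ - t) ψ) = U τ ψ
    rw [← mul_apply_eq_comp, ← hUadd, add_sub_cancel]
  have hUu : ∀ t, U t ∈ unitary (E →L[ℂ] E) := by
    have hst : ∀ t, star (U t) = U (-t) := fun t => by
      rw [ContinuousLinearMap.star_eq_adjoint, eq_comm, ContinuousLinearMap.eq_adjoint_iff]
      intro x y
      refine tendsto_nhds_unique ((hUl (-t) x).inner tendsto_const_nhds) ?_
      simp only [(hVg _).inner_left, neg_neg]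
      exact tendsto_const_nhds.inner (hUl t y)
    intro t
    rw [Unitary.mem_iff, hst, ← hUadd, ← hUadd]
    simp [hU0]
  have hg : IsUGroup U := ⟨hU0, hUadd, hUu, hUc⟩
  have hmem : ∀ x y, (x, y) ∈ A.graph → HasDerivAt (fun t => U t x) (-Complex.I • y) 0 := by
    intro x y hxy
    refine hg.hasDerivAt_of_integral fun t => ?_
    have h1 : ∀ n, V n t x - x = ∫ s in (0 : ℝ)..t, V n s ((-Complex.I • K n) x) := fun n =>
      (hVg n).integral_eq (by simpa [(hVg n).zero] using hVd n 0 x) t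
    refine tendsto_nhds_unique ((hUl t x).sub_const x) ?_
    simp only [h1]
    have hKy := (hKlim x y hxy)
    obtain ⟨M, hM⟩ := hKy.norm.bddAbove_range
    refine intervalIntegral.tendsto_integral_filter_of_dominated_convergence (fun _ => M)
      (Eventually.of_forall fun n => ((hVg n).cont _).aestronglyMeasurable)
      (Eventually.of_forall fun n => Eventually.of_forall fun s _ => ?_)
      intervalIntegrable_const (Eventually.of_forall fun s _ => ?_)
    · rw [(hVg n).norm_apply, _root_.smul_apply, norm_smul, norm_neg, Complex.norm_I, one_mul]
      exact hM ⟨n, rfl⟩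
    · have h3 : Tendsto (fun n => V n s (-Complex.I • y) + V n s ((-Complex.I • K n) x - -Complex.I • y))
          atTop (𝓝 (U s (-Complex.I • y) + 0)) := by
        refine (hUl s _).add (squeeze_zero_norm (a := fun n => ‖K n x - y‖) (fun n => ?_) ?_)
        · rw [(hVg n).norm_apply, _root_.smul_apply, ← smul_sub, norm_smul, norm_neg,
            Complex.norm_I, one_mul]
        · simpa using (hKy.sub_const y).norm
      rw [add_zero] at h3
      refine h3.congr fun n => ?_
      rw [← map_add, add_sub_cancel]
  refine ⟨U, hg.of_mem_iff fun ψ χ => ⟨hmem ψ χ, fun h => ?_⟩⟩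
  -- A vector at which the group is differentiable pairs with the domain as an element of the
  -- adjoint's graph does, and `A` is its own adjoint.
  rw [(isSelfAdjoint_iff_graph.1 hA).2]
  intro x x' hx
  have h1 : HasDerivAt (fun t => inner ℂ (U t x) (U t ψ))
      (inner ℂ (U 0 x) (-Complex.I • χ) + inner ℂ (-Complex.I • x') (U 0 ψ)) 0 :=
    (hmem x x' hx).inner ℂ h
  have h2 : (fun t => inner ℂ (U t x) (U t ψ)) = fun _ => inner ℂ x ψ := by
    funext t; rw [hg.inner_left, hg.neg_apply]
  rw [h2] at h1
  have h3 := h1.unique (hasDerivAt_const _ _)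
  simp only [hg.zero, one_apply_eq_self, inner_smul_left, inner_smul_right, map_neg,
    Complex.conj_I, neg_neg] at h3
  have h4 : Complex.I * (inner ℂ x' ψ - inner ℂ x χ) = 0 := by rw [← h3]; ring
  exact sub_eq_zero.1 ((mul_eq_zero.1 h4).resolve_left Complex.I_ne_zero)

end Stone

/-! ### The closure of a sum of commuting generators -/

section CommutingSum

variable {E : Type*} [NormedAddCommGroup E] [InnerProductSpace ℂ E] [CompleteSpace E]

theorem mem_graph_add {A B : E →ₗ.[ℂ] E} {x z : E} :
    (x, z) ∈ (A + B).graph ↔ ∃ y y', (x, y) ∈ A.graph ∧ (x, y') ∈ B.graph ∧ z = y + y' := by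
  simp only [LinearPMap.mem_graph_iff]
  constructor
  · rintro ⟨w, rfl, rfl⟩
    exact ⟨_, _, ⟨⟨w, w.2.1⟩, rfl, rfl⟩, ⟨⟨w, w.2.2⟩, rfl, rfl⟩, rfl⟩
  · rintro ⟨y, y', ⟨⟨w, hw⟩, rfl, rfl⟩, ⟨⟨w', hw'⟩, h, rfl⟩, rfl⟩
    change w' = w at h
    subst h
    exact ⟨⟨w', hw, hw'⟩, rfl, rfl⟩

theorem mem_graph_sum {κ : Type*} {s : Finset κ} {A : κ → E →ₗ.[ℂ] E} {x z : E} :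
    (x, z) ∈ (∑ j ∈ s, A j).graph ↔
      ∃ y : κ → E, (∀ j ∈ s, (x, y j) ∈ (A j).graph) ∧ z = ∑ j ∈ s, y j := by
  classical
  induction s using Finset.induction_on generalizing z with
  | empty =>
    simp only [Finset.sum_empty, Finset.notMem_empty, LinearPMap.mem_graph_iff]
    exact ⟨fun ⟨w, _, h⟩ => ⟨fun _ => 0, by simp, h.symm⟩, fun ⟨y, _, h⟩ => ⟨⟨x, trivial⟩, rfl, h.symm⟩⟩
  | insert a s ha ih =>
    rw [Finset.sum_insert ha, mem_graph_add]
    constructor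
    · rintro ⟨y, y', hy, hy', rfl⟩
      obtain ⟨w, hw, rfl⟩ := ih.1 hy'
      refine ⟨Function.update w a y, ?_, ?_⟩
      · intro j hj
        obtain rfl | hj' := Finset.mem_insert.1 hj
        · simpa using hy
        · rw [Function.update_of_ne (by rintro rfl; exact ha hj')]; exact hw j hj'
      · rw [Finset.sum_insert ha, Function.update_self]
        congr 1
        refine Finset.sum_congr rfl fun j hj => ?_
        rw [Function.update_of_ne (by rintro rfl; exact ha hj)]
    · rintro ⟨y, hy, rfl⟩
      rw [Finset.sum_insert ha]
      exact ⟨y a, _, hy a (Finset.mem_insert_self _ _),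
        ih.2 ⟨y, fun j hj => hy j (Finset.mem_insert_of_mem hj), rfl⟩, rfl⟩

variable {κ : Type*} {A : κ → E →ₗ.[ℂ] E} {W : κ → ℝ → E →L[ℂ] E}

theorem IsUGroup.one : IsUGroup (fun _ : ℝ => (1 : E →L[ℂ] E)) :=
  ⟨rfl, fun _ _ => (one_mul _).symm, fun _ => one_mem _, fun _ => continuous_const⟩

theorem continuous_contraction_apply {X : Type*} [TopologicalSpace X] {L : X → E →L[ℂ] E} {g : X → E}
    (hb : ∀ x, ‖L x‖ ≤ 1) (hL : ∀ ψ, Continuous fun x => L x ψ) (hg : Continuous g) :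
    Continuous fun x => L x (g x) := by
  refine continuous_iff_continuousAt.2 fun x => ?_
  have h1 : Tendsto (fun y => L y (g x) + L y (g y - g x)) (𝓝 x) (𝓝 (L x (g x) + 0)) := by
    refine ((hL (g x)).tendsto x).add (squeeze_zero_norm (a := fun y => ‖g y - g x‖) (fun y => ?_) ?_)
    · exact ((L y).le_opNorm _).trans (mul_le_of_le_one_left (norm_nonneg _) (hb y))
    · simpa using ((hg.tendsto x).sub_const (g x)).norm
  rw [add_zero] at h1
  refine h1.congr fun y => ?_
  rw [← map_add, add_sub_cancel]

theorem IsUGroup.mul {U V : ℝ → E →L[ℂ] E} (hU : IsUGroup U) (hV : IsUGroup V)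
    (hc : ∀ s t, Commute (U s) (V t)) : IsUGroup (fun t => U t * V t) := by
  refine ⟨by simp [hU.zero, hV.zero], fun s t => ?_, fun t => mul_mem (hU.unit t) (hV.unit t),
    fun ψ => continuous_contraction_apply (L := U) hU.norm_le hU.cont (hV.cont ψ)⟩
  rw [hU.add, hV.add]
  calc U s * U t * (V s * V t) = U s * (U t * V s) * V t := by simp only [mul_assoc]
    _ = U s * (V s * U t) * V t := by rw [(hc t s).eq]
    _ = U s * V s * (U t * V t) := by simp only [mul_assoc]

/-- The product of a list of operators depending on time. -/
def listProd (W : κ → ℝ → E →L[ℂ] E) (l : List κ) (t : ℝ) : E →L[ℂ] E :=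
  (l.map fun j => W j t).prod

theorem commute_listProd {T : E →L[ℂ] E} {l : List κ} {t : ℝ} (h : ∀ j ∈ l, Commute T (W j t)) :
    Commute T (listProd W l t) := by
  refine Commute.list_prod_right _ _ fun x hx => ?_
  obtain ⟨j, hj, rfl⟩ := List.mem_map.1 hx
  exact h j hj

theorem isUGroup_listProd (hW : ∀ j, IsUGroup (W j)) (hc : ∀ i j s t, Commute (W i s) (W j t))
    (l : List κ) : IsUGroup (listProd W l) := by
  induction l with
  | nil => exact IsUGroup.one
  | cons a l ih =>
    exact (hW a).mul ih fun s t => commute_listProd fun j _ => hc a j s t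

theorem hasDerivAt_listProd (hW : ∀ j, IsUnitaryGroupOf (A j) (W j))
    (hc : ∀ i j s t, Commute (W i s) (W j t)) (l : List κ) {x : E} {y : κ → E}
    (hy : ∀ j ∈ l, (x, y j) ∈ (A j).graph) :
    HasDerivAt (fun t => listProd W l t x) (-Complex.I • (l.map y).sum) 0 := by
  induction l with
  | nil => simpa [listProd] using hasDerivAt_const (0 : ℝ) x
  | cons a l ih =>
    have h1 := ih fun j hj => hy j (List.mem_cons_of_mem _ hj)
    have hg := isUGroup_listProd (fun j => (hW j).isUGroup) hc l
    have hx : listProd W l 0 x = x := by rw [hg.zero]; rfl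
    have h2 := hasDerivAt_strong_apply (L := W a) (t := 0) (g := fun t => listProd W l t x)
      (l' := -Complex.I • y a)
      (Eventually.of_forall fun s => (hW a).isUGroup.norm_le s) (by
        rw [hx]; exact (hW a).mem_iff.1 (hy a List.mem_cons_self))
      ((hW a).isUGroup.cont _).continuousAt h1
    rw [(hW a).isUGroup.zero, one_apply_eq_self, ← smul_add] at h2
    exact h2

/-- The closure of a sum of commuting generators generates the product of the groups. -/
theorem isUnitaryGroupOf_closure_sum {n : ℕ} {A : Fin n → E →ₗ.[ℂ] E} {W : Fin n → ℝ → E →L[ℂ] E}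
    (hW : ∀ j, IsUnitaryGroupOf (A j) (W j)) (hc : ∀ i j s t, Commute (W i s) (W j t)) :
    IsUnitaryGroupOf (∑ j, A j).closure (listProd W (List.finRange n)) := by
  have hg := isUGroup_listProd (fun j => (hW j).isUGroup) hc (List.finRange n)
  set V := listProd W (List.finRange n) with hV
  -- `Γ` is the graph of the generator of the product group. Its integrated form shows that it is
  -- closed, so it contains the closure of the graph of the sum; the point left is the reverse
  -- inclusion.
  set Γ : Set (E × E) := {p | HasDerivAt (fun t => V t p.1) (-Complex.I • p.2) 0} with hΓ
  have hsub : ((∑ j, A j).graph : Set (E × E)) ⊆ Γ := by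
    rintro ⟨x, z⟩ hx
    obtain ⟨y, hy, rfl⟩ := mem_graph_sum.1 hx
    have := hasDerivAt_listProd hW hc (List.finRange n) (y := y) (x := x)
      fun j _ => hy j (Finset.mem_univ j)
    rw [← List.ofFn_eq_map, List.sum_ofFn] at this
    exact this
  have hΓeq : Γ = ⋂ t : ℝ, {p | V t p.1 - p.1 = ∫ s in (0 : ℝ)..t, V s (-Complex.I • p.2)} := by
    ext p
    simp only [hΓ, Set.mem_ofPred_eq, Set.mem_iInter]
    exact ⟨fun h t => hg.integral_eq h t, fun h => hg.hasDerivAt_of_integral h⟩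
  have hΓc : IsClosed Γ := by
    rw [hΓeq]
    refine isClosed_iInter fun t => isClosed_eq (by fun_prop) ?_
    refine intervalIntegral.continuous_parametric_intervalIntegral_of_continuous' ?_ 0 t
    exact continuous_contraction_apply (L := fun p : (E × E) × ℝ => V p.2)
      (g := fun p : (E × E) × ℝ => -Complex.I • p.1.2) (fun p => hg.norm_le _)
      (fun ψ => (hg.cont ψ).comp continuous_snd) (by fun_prop)
  have hclos : closure ((∑ j, A j).graph : Set (E × E)) ⊆ Γ := closure_minimal hsub hΓc
  have hclosable : (∑ j, A j).IsClosable := by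
    refine ⟨(∑ j, A j).graph.topologicalClosure.toLinearPMap, ?_⟩
    refine (Submodule.toLinearPMap_graph_eq _ ?_).symm
    rintro ⟨x, z⟩ hx (rfl : x = 0)
    have h1 : HasDerivAt (fun t => V t (0 : E)) (-Complex.I • z) 0 := hclos hx
    simp only [map_zero] at h1
    have h2 := h1.unique (hasDerivAt_const _ _)
    simpa using h2
  refine hg.of_mem_iff fun x z => ?_
  rw [← hclosable.graph_closure_eq_closure_graph]
  refine ⟨fun h => hclos h, fun h => ?_⟩
  set c : ℕ → ℝ := fun n => n + 1 with hcdef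
  have hc0 : ∀ n, c n ≠ 0 := fun n => by positivity
  have hcl : Tendsto (fun n => |c n|) atTop atTop := by
    have : ∀ n, |c n| = (n : ℝ) + 1 := fun n => abs_of_pos (by positivity)
    simp only [this]
    exact tendsto_atTop_add_const_right _ _ tendsto_natCast_atTop_atTop
  -- The product of all regularised resolvents `ic R_j` maps every vector into every domain,
  -- commutes with all the groups and tends strongly to `1`. Applied to a pair in `Γ` it gives pairs
  -- in the graph of the sum that converge to that pair.
  choose R hR using fun (j : Fin n) (m : ℕ) => exists_resolvent (hW j).isSelfAdjoint (hc0 m)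
  set J : Fin n → ℕ → E →L[ℂ] E := fun j m => (Complex.I * c m) • R j m with hJ
  have hJle : ∀ j m, ‖J j m‖ ≤ 1 := fun j m => (hR j m).norm_le
  have hJl : ∀ j x, Tendsto (fun m => J j m x) atTop (𝓝 x) := fun j x =>
    tendsto_resolvent (hW j).isSelfAdjoint hc0 hcl (hR j) x
  have hJc : ∀ j m (T : E →L[ℂ] E), (∀ t, Commute T (W j t)) → Commute (J j m) T := fun j m T hT =>
    ((hR j m).commute_of_graph fun x y h => (hW j).graph_of_commute hT h).smul_left _
  have hJW : ∀ i j m t, Commute (J j m) (W i t) := fun i j m t => hJc j m _ fun s => hc i j t s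
  have hJJ : ∀ i j m, Commute (J j m) (J i m) := fun i j m =>
    hJc j m _ fun t => hJW j i m t
  set M : List (Fin n) → ℕ → E →L[ℂ] E := fun l m => (l.map fun j => J j m).prod with hM
  have hMlim : ∀ l x, Tendsto (fun m => M l m x) atTop (𝓝 x) := by
    intro l
    induction l with
    | nil => intro x; simp [hM]
    | cons a l ih =>
      intro x
      have h1 : Tendsto (fun m => J a m x + J a m (M l m x - x)) atTop (𝓝 (x + 0)) := by
        refine (hJl a x).add (squeeze_zero_norm (a := fun m => ‖M l m x - x‖) (fun m => ?_) ?_)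
        · exact ((J a m).le_opNorm _).trans (mul_le_of_le_one_left (norm_nonneg _) (hJle a m))
        · simpa using ((ih x).sub_const x).norm
      rw [add_zero] at h1
      refine h1.congr fun m => ?_
      rw [← map_add, add_sub_cancel]
      rfl
  have hMW : ∀ l m i t, Commute (M l m) (W i t) := by
    intro l m i t
    refine Commute.list_prod_left _ _ fun T hT => ?_
    obtain ⟨j, _, rfl⟩ := List.mem_map.1 hT
    exact hJW i j m t
  have hMdom : ∀ (l : List (Fin n)) m j, j ∈ l → ∀ x, M l m x ∈ (A j).domain := by
    intro l m
    induction l with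
    | nil => intro j hj; simp at hj
    | cons a l ih =>
      intro j hj x
      change J a m (M l m x) ∈ _
      by_cases hja : j = a
      · subst hja
        exact (A j).domain.smul_mem _ ((hR j m).apply_mem_domain _)
      · obtain ⟨y, hy⟩ := LinearPMap.mem_domain_iff.1 (ih j ((List.mem_cons.1 hj).resolve_left hja) x)
        exact LinearPMap.mem_domain_of_mem_graph
          ((hW j).graph_of_commute (fun t => hJW j a m t) hy)
  set L := List.finRange n with hL
  have hmem : ∀ m, (M L m x, M L m z) ∈ (∑ j, A j).graph := by
    intro m
    choose y hy using fun j => LinearPMap.mem_domain_iff.1 (hMdom L m j (List.mem_finRange j) x)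
    have h1 : (M L m x, ∑ j, y j) ∈ (∑ j, A j).graph := mem_graph_sum.2 ⟨y, fun j _ => hy j, rfl⟩
    have h2 : HasDerivAt (fun t => V t (M L m x)) (-Complex.I • ∑ j, y j) 0 := hsub h1
    have h3 : HasDerivAt (fun t => M L m (V t x)) (M L m (-Complex.I • z)) 0 :=
      ((M L m).restrictScalars ℝ).hasFDerivAt.comp_hasDerivAt 0 h
    have e : (fun t => M L m (V t x)) = fun t => V t (M L m x) := by
      funext t
      exact DFunLike.congr_fun (commute_listProd (T := M L m) (l := L) (t := t) (W := W) fun j _ => hMW L m j t).eq x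
    rw [e] at h3
    have h4 := h3.unique h2
    rw [map_smul] at h4
    have h5 : M L m z = ∑ j, y j := smul_right_injective E (neg_ne_zero.2 Complex.I_ne_zero) h4
    rw [h5]
    exact h1
  exact mem_closure_of_tendsto ((hMlim L x).prodMk_nhds (hMlim L z)) (Eventually.of_forall hmem)

end CommutingSum

/-! ### Basis vectors and matrix elements -/

section Kets

variable {A B : Type*}

open Classical in
/-- The basis vector `e_a` of `ℓ²(A)`. -/
def ket (a : A) : L2 A := lp.single 2 a (1 : ℂ)

theorem inner_ket_left (a : A) (φ : L2 A) : inner ℂ (ket a) φ = φ a := by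
  classical
  rw [ket, lp.inner_single_left]; simp

theorem inner_ket_right (a : A) (φ : L2 A) : inner ℂ φ (ket a) = starRingEnd ℂ (φ a) := by
  rw [← inner_conj_symm, inner_ket_left]

open Classical in
theorem ket_apply (a b : A) : (ket a : L2 A) b = if b = a then 1 else 0 := by
  rw [ket, lp.single_apply, Pi.single_apply]

theorem hasSum_ket (φ : L2 A) : HasSum (fun a => φ a • ket a) φ := by
  classical
  have h := lp.hasSum_single (E := fun _ : A => ℂ) (p := 2) ENNReal.ofNat_ne_top φ
  convert h using 2 with a
  rw [ket, ← lp.single_smul]; simp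

/-- The matrix elements of an operator determine it. -/
theorem ext_mat {T S : L2 A →L[ℂ] L2 B} (h : ∀ a b, T (ket b) a = S (ket b) a) : T = S := by
  refine ContinuousLinearMap.ext fun φ => ?_
  refine (((hasSum_ket φ).mapL T).unique ?_)
  convert (hasSum_ket φ).mapL S using 2 with b
  rw [map_smul, map_smul]
  congr 1
  ext a
  exact h a b

theorem star_mat (T : L2 A →L[ℂ] L2 A) (a b : A) :
    (star T) (ket b) a = starRingEnd ℂ (T (ket a) b) := by
  rw [← inner_ket_left, ContinuousLinearMap.star_eq_adjoint, ContinuousLinearMap.adjoint_inner_right,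
    inner_ket_right]

theorem hasSum_mul_mat (T S : L2 A →L[ℂ] L2 A) (a b : A) :
    HasSum (fun c => T (ket c) a * S (ket b) c) ((T * S) (ket b) a) := by
  have h := lp.hasSum_inner (𝕜 := ℂ) (G := fun _ : A => ℂ) ((star T) (ket a)) (S (ket b))
  rw [ContinuousLinearMap.star_eq_adjoint, ContinuousLinearMap.adjoint_inner_left, inner_ket_left,
    ← ContinuousLinearMap.star_eq_adjoint] at h
  have e : (fun c => T (ket c) a * S (ket b) c) =
      fun c => inner ℂ ((star T) (ket a) c) (S (ket b) c) := by
    funext c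
    rw [star_mat, RCLike.inner_apply, starRingEnd_self_apply, mul_comm]
  rw [e]
  exact h

@[simp] theorem pull_apply (g : A ↪ B) (φ : L2 B) (a : A) : pull g φ a = φ (g a) := rfl

theorem apply_congr (T : L2 A →L[ℂ] L2 B) {φ χ : L2 A} (h : ∀ a, φ a = χ a) (b : B) :
    T φ b = T χ b := by
  rw [show φ = χ from lp.ext (funext h)]

theorem norm_pull_le (g : A ↪ B) : ‖pull g‖ ≤ 1 :=
  LinearMap.mkContinuous_norm_le _ zero_le_one _

end Kets

/-! ### Algebra of operators acting on some of the particles -/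

section Lift

variable {ι α β γ : Type*}

@[simp] theorem lift_apply (e : α ↪ β) (T : L2 (α → ι) →L[ℂ] L2 (α → ι)) (φ : L2 (β → ι)) (k : β → ι) :
    lift e T φ k = T (pull (overwrite e k) φ) (k ∘ e) := rfl

theorem overwrite_comp (e : α ↪ β) (k : β → ι) (m : α → ι) : overwrite e k m ∘ e = m := by
  funext a
  exact e.injective.extend_apply _ _ _

theorem overwrite_apply_mem (e : α ↪ β) (k : β → ι) (m : α → ι) (a : α) :
    overwrite e k m (e a) = m a := e.injective.extend_apply _ _ _

theorem overwrite_apply_notMem (e : α ↪ β) (k : β → ι) (m : α → ι) {x : β} (hx : x ∉ Set.range e) :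
    overwrite e k m x = k x := Function.extend_apply' _ _ _ hx

theorem overwrite_overwrite (e : α ↪ β) (k : β → ι) (m m' : α → ι) :
    overwrite e (overwrite e k m) m' = overwrite e k m' := by
  funext x
  by_cases hx : x ∈ Set.range e
  · obtain ⟨a, rfl⟩ := hx
    rw [overwrite_apply_mem, overwrite_apply_mem]
  · rw [overwrite_apply_notMem _ _ _ hx, overwrite_apply_notMem _ _ _ hx,
      overwrite_apply_notMem _ _ _ hx]

/-- Once the other particles are frozen, `lift e T` is `T`; multiplicativity of `lift` rests on
this. -/
theorem pull_overwrite_lift (e : α ↪ β) (T : L2 (α → ι) →L[ℂ] L2 (α → ι)) (φ : L2 (β → ι))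
    (k : β → ι) : pull (overwrite e k) (lift e T φ) = T (pull (overwrite e k) φ) := by
  ext m
  rw [pull_apply, lift_apply, overwrite_comp]
  refine apply_congr T (fun m' => ?_) m
  rw [pull_apply, pull_apply, overwrite_overwrite]

theorem lift_one (e : α ↪ β) : lift e (1 : L2 (α → ι) →L[ℂ] L2 (α → ι)) = 1 := by
  ext φ k
  rw [lift_apply]
  change φ (overwrite e k (k ∘ e)) = φ k
  refine congrArg φ (funext fun x => ?_)
  by_cases hx : x ∈ Set.range e
  · obtain ⟨a, rfl⟩ := hx
    rw [overwrite_apply_mem]; rfl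
  · rw [overwrite_apply_notMem _ _ _ hx]

theorem lift_mul (e : α ↪ β) (S T : L2 (α → ι) →L[ℂ] L2 (α → ι)) :
    lift e (S * T) = lift e S * lift e T := by
  ext φ k
  rw [mul_apply_eq_comp, lift_apply, lift_apply, pull_overwrite_lift]
  rfl

theorem lift_add (e : α ↪ β) (S T : L2 (α → ι) →L[ℂ] L2 (α → ι)) :
    lift e (S + T) = lift e S + lift e T := rfl

theorem lift_smul (e : α ↪ β) (c : ℂ) (T : L2 (α → ι) →L[ℂ] L2 (α → ι)) :
    lift e (c • T) = c • lift e T := rfl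

theorem lift_sub (e : α ↪ β) (S T : L2 (α → ι) →L[ℂ] L2 (α → ι)) :
    lift e (S - T) = lift e S - lift e T := rfl

theorem lift_zero (e : α ↪ β) : lift e (0 : L2 (α → ι) →L[ℂ] L2 (α → ι)) = 0 := rfl

/-- `lift e` as a linear map. -/
def liftLM (e : α ↪ β) : (L2 (α → ι) →L[ℂ] L2 (α → ι)) →ₗ[ℂ] (L2 (β → ι) →L[ℂ] L2 (β → ι)) where
  toFun := lift e
  map_add' := lift_add e
  map_smul' := lift_smul e

theorem lift_sum {κ : Type*} (e : α ↪ β) (s : Finset κ) (T : κ → L2 (α → ι) →L[ℂ] L2 (α → ι)) :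
    lift e (∑ i ∈ s, T i) = ∑ i ∈ s, lift e (T i) := map_sum (liftLM e) T s

theorem norm_lift_le (e : α ↪ β) (T : L2 (α → ι) →L[ℂ] L2 (α → ι)) : ‖lift e T‖ ≤ ‖T‖ :=
  LinearMap.mkContinuous_norm_le _ (norm_nonneg _) _

open Classical in
theorem pull_overwrite_ket (e : α ↪ β) (k l : β → ι) :
    pull (overwrite e k) (ket l) = if ∀ x ∉ Set.range e, k x = l x then ket (l ∘ e) else 0 := by
  ext m
  rw [pull_apply, ket_apply]
  split_ifs with h1 h2 h2
  · rw [ket_apply, if_pos]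
    rw [← h1, overwrite_comp]
  · exact absurd (fun x hx => by rw [← h1, overwrite_apply_notMem _ _ _ hx]) h2
  · rw [ket_apply, if_neg]
    rintro rfl
    refine h1 (funext fun x => ?_)
    by_cases hx : x ∈ Set.range e
    · obtain ⟨a, rfl⟩ := hx
      rw [overwrite_apply_mem]; rfl
    · rw [overwrite_apply_notMem _ _ _ hx, h2 x hx]
  · rfl

-- The matrix of `T ⊗ 1` is that of `T` times a Kronecker delta in the other particles. Adjoints and
-- commutation on disjoint sets of particles are then checked entry by entry.
open Classical in
theorem lift_mat (e : α ↪ β) (T : L2 (α → ι) →L[ℂ] L2 (α → ι)) (k l : β → ι) :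
    lift e T (ket l) k = if ∀ x ∉ Set.range e, k x = l x then T (ket (l ∘ e)) (k ∘ e) else 0 := by
  rw [lift_apply, pull_overwrite_ket]
  split_ifs
  · rfl
  · rw [map_zero]; rfl

theorem lift_star (e : α ↪ β) (T : L2 (α → ι) →L[ℂ] L2 (α → ι)) :
    lift e (star T) = star (lift e T) := by
  classical
  refine ext_mat fun k l => ?_
  rw [star_mat, lift_mat, lift_mat, star_mat, apply_ite (starRingEnd ℂ), map_zero]
  simp only [eq_comm]

theorem isSelfAdjoint_lift (e : α ↪ β) {T : L2 (α → ι) →L[ℂ] L2 (α → ι)} (h : IsSelfAdjoint T) :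
    IsSelfAdjoint (lift e T) := by
  rw [IsSelfAdjoint, ← lift_star, h.star_eq]

theorem lift_mem_unitary (e : α ↪ β) {T : L2 (α → ι) →L[ℂ] L2 (α → ι)} (h : T ∈ unitary _) :
    lift e T ∈ unitary _ := by
  rw [Unitary.mem_iff, ← lift_star, ← lift_mul, ← lift_mul, (Unitary.mem_iff.1 h).1,
    (Unitary.mem_iff.1 h).2]
  exact ⟨lift_one e, lift_one e⟩

theorem overwrite_trans (e' : α ↪ β) (e : β ↪ γ) (k : γ → ι) (m : α → ι) :
    overwrite e k (overwrite e' (k ∘ e) m) = overwrite (e'.trans e) k m := by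
  funext x
  by_cases hx : x ∈ Set.range e
  · obtain ⟨b, rfl⟩ := hx
    rw [overwrite_apply_mem]
    by_cases hb : b ∈ Set.range e'
    · obtain ⟨a, rfl⟩ := hb
      rw [overwrite_apply_mem]
      exact (overwrite_apply_mem (e'.trans e) k m a).symm
    · rw [overwrite_apply_notMem _ _ _ hb, overwrite_apply_notMem]; rfl
      rintro ⟨a, ha⟩
      exact hb ⟨a, e.injective ha⟩
  · rw [overwrite_apply_notMem _ _ _ hx, overwrite_apply_notMem]
    rintro ⟨a, ha⟩
    exact hx ⟨e' a, ha⟩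

theorem lift_trans (e' : α ↪ β) (e : β ↪ γ) (T : L2 (α → ι) →L[ℂ] L2 (α → ι)) :
    lift e (lift e' T) = lift (e'.trans e) T := by
  ext φ k
  rw [lift_apply, lift_apply, lift_apply]
  refine apply_congr T (fun m => ?_) _
  simp only [pull_apply, overwrite_trans]

open Classical in
theorem lift_mul_mat {α' : Type*} (e : α ↪ β) (e' : α' ↪ β) (T : L2 (α → ι) →L[ℂ] L2 (α → ι))
    (S : L2 (α' → ι) →L[ℂ] L2 (α' → ι)) (h : Disjoint (Set.range e) (Set.range e')) (k l : β → ι) :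
    (lift e T * lift e' S) (ket l) k =
      if ∀ x, x ∉ Set.range e → x ∉ Set.range e' → k x = l x then
        T (ket (l ∘ e)) (k ∘ e) * S (ket (l ∘ e')) (k ∘ e') else 0 := by
  -- The only intermediate configuration that contributes: `e`'s particles are already in their
  -- state before both operators act, those of `e'` are still in their state after both.
  set p : β → ι := fun x => if x ∈ Set.range e then l x else k x with hp
  have h1 := hasSum_mul_mat (lift e T) (lift e' S) k l
  rw [← h1.tsum_eq, tsum_eq_single p]
  · have e1 : ∀ x ∉ Set.range e, k x = p x := fun x hx => by simp only [hp, if_neg hx]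
    have e2 : p ∘ e = l ∘ e := by
      funext a; simp [hp]
    have e3 : p ∘ e' = k ∘ e' := by
      funext a
      have : e' a ∉ Set.range e := fun h2 => Set.disjoint_left.1 h h2 ⟨a, rfl⟩
      simp only [hp, Function.comp, if_neg this]
    rw [lift_mat, lift_mat, if_pos e1, e2, e3, mul_ite, mul_zero]
    refine if_congr ⟨fun h2 x hx hx' => ?_, fun h2 x hx' => ?_⟩ rfl rfl
    · rw [← h2 x hx']; exact e1 x hx
    · by_cases hx : x ∈ Set.range e
      · simp only [hp, if_pos hx]
      · simp only [hp, if_neg hx]; exact h2 x hx hx'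
  · intro q hq
    rw [lift_mat, lift_mat]
    split_ifs with h2 h3
    · refine absurd (funext fun x => ?_) hq
      by_cases hx : x ∈ Set.range e
      · simp only [hp, if_pos hx]; exact h3 x (fun h4 => Set.disjoint_left.1 h hx h4)
      · simp only [hp, if_neg hx]; exact (h2 x hx).symm
    · rw [mul_zero]
    · rw [zero_mul]
    · rw [zero_mul]

/-- Operators acting on disjoint sets of particles commute. -/
theorem commute_lift {α' : Type*} (e : α ↪ β) (e' : α' ↪ β) (T : L2 (α → ι) →L[ℂ] L2 (α → ι))
    (S : L2 (α' → ι) →L[ℂ] L2 (α' → ι)) (h : Disjoint (Set.range e) (Set.range e')) :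
    Commute (lift e T) (lift e' S) := by
  classical
  refine ext_mat fun k l => ?_
  refine (lift_mul_mat e e' T S h k l).trans (Eq.trans ?_ (lift_mul_mat e' e S T h.symm k l).symm)
  exact if_congr ⟨fun h x h1 h2 => h x h2 h1, fun h x h1 h2 => h x h2 h1⟩ (mul_comm _ _) rfl

/-- The unitary operator permuting the particles. -/
def permOp (σ : Equiv.Perm β) : L2 (β → ι) →L[ℂ] L2 (β → ι) :=
  pull ⟨fun k => k ∘ σ, fun k k' h => by
    funext x
    simpa using congrFun h (σ.symm x)⟩

@[simp] theorem permOp_apply (σ : Equiv.Perm β) (φ : L2 (β → ι)) (k : β → ι) :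
    permOp σ φ k = φ (k ∘ σ) := rfl

theorem permOp_mul_symm (σ : Equiv.Perm β) :
    (permOp σ : L2 (β → ι) →L[ℂ] L2 (β → ι)) * permOp σ.symm = 1 := by
  ext φ k
  change φ ((k ∘ σ) ∘ σ.symm) = φ k
  exact congrArg φ (funext fun x => by simp)

/-- Relabelling the particles is conjugation by a unitary, so permutation symmetry becomes
commutation with `permOp σ`, a form to which the results on generators apply. -/
theorem lift_perm (σ : Equiv.Perm β) (T : L2 (β → ι) →L[ℂ] L2 (β → ι)) :
    lift σ.toEmbedding T = permOp σ * T * permOp σ.symm := by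
  ext φ k
  change T _ (k ∘ σ) = T (permOp σ.symm φ) (k ∘ σ)
  refine apply_congr T (fun m => ?_) _
  rw [pull_apply, permOp_apply]
  refine congrArg φ (funext fun x => ?_)
  have := overwrite_apply_mem σ.toEmbedding k m (σ.symm x)
  simpa using this

theorem lift_perm_eq_iff_commute (σ : Equiv.Perm β) (T : L2 (β → ι) →L[ℂ] L2 (β → ι)) :
    lift σ.toEmbedding T = T ↔ Commute (permOp σ) T := by
  have h1 : (permOp σ.symm : L2 (β → ι) →L[ℂ] L2 (β → ι)) * permOp σ = 1 := by
    simpa using permOp_mul_symm (ι := ι) σ.symm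
  rw [lift_perm]
  constructor
  · intro h
    change permOp σ * T = T * permOp σ
    conv_rhs => rw [← h]
    rw [mul_assoc, h1, mul_one]
  · intro h
    rw [h.eq, mul_assoc, permOp_mul_symm, mul_one]

end Lift

/-! ### Operators placed on a finite set of particles -/

section OnSet

variable {ι : Type*} {N : ℕ}

theorem range_orderEmbOfFin (X : Finset (Fin N)) {m : ℕ} (h : X.card = m) :
    Set.range (X.orderEmbOfFin h).toEmbedding = X := by
  simp

theorem onSet_eq (X : Finset (Fin N)) (b : OpSeq ι) {m : ℕ} (h : X.card = m) :
    onSet X b = lift (X.orderEmbOfFin h).toEmbedding (b m) := by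
  subst h
  rfl

/-- For a symmetric operator the order of the particles is immaterial. -/
theorem onSet_eq_lift {X : Finset (Fin N)} {b : OpSeq ι} {m : ℕ} (hb : IsSymm (b m))
    (e : Fin m ↪ Fin N) (he : Set.range e = X) : onSet X b = lift e (b m) := by
  classical
  have hc : X.card = m := by
    have h1 : X = Finset.univ.map e := by
      ext x
      rw [← Finset.mem_coe, ← he]; simp
    rw [h1, Finset.card_map, Finset.card_univ, Fintype.card_fin]
  rw [onSet_eq X b hc]
  set e0 := (X.orderEmbOfFin hc).toEmbedding with he0
  have hr : Set.range e0 = Set.range e := by rw [he]; exact range_orderEmbOfFin X hc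
  have hex : ∀ i, ∃ j, e0 j = e i := fun i => by
    have : e i ∈ Set.range e0 := hr ▸ ⟨i, rfl⟩
    exact this
  choose f hf using hex
  have hfi : Function.Injective f := fun i j h => e.injective (by rw [← hf, ← hf, h])
  let σ : Equiv.Perm (Fin m) := Equiv.ofBijective f (Finite.injective_iff_bijective.1 hfi)
  have h2 : e = σ.toEmbedding.trans e0 := by
    ext i
    exact congrArg Fin.val (hf i).symm
  rw [h2, ← lift_trans, hb σ]

/-- `onSet` lists its particles in increasing order, which `e` need not preserve; hence the symmetry
of `b X.card`. -/
theorem lift_onSet {M : ℕ} (e : Fin N ↪ Fin M) (X : Finset (Fin N)) {b : OpSeq ι}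
    (hb : IsSymm (b X.card)) : lift e (onSet X b) = onSet (X.map e) b := by
  rw [onSet, lift_trans]
  refine (onSet_eq_lift hb _ ?_).symm
  have h := range_orderEmbOfFin X rfl
  rw [Finset.coe_map, ← h, ← Set.range_comp]
  rfl

theorem commute_onSet (X Y : Finset (Fin N)) (b c : OpSeq ι) (h : Disjoint X Y) :
    Commute (onSet X b) (onSet Y c) := by
  refine commute_lift _ _ _ _ ?_
  rw [range_orderEmbOfFin, range_orderEmbOfFin]
  exact_mod_cast h

theorem onSet_univ (b : OpSeq ι) : onSet (Finset.univ : Finset (Fin N)) b = b N := by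
  rw [onSet_eq _ b (Finset.card_fin N)]
  have : ((Finset.univ : Finset (Fin N)).orderEmbOfFin (Finset.card_fin N)).toEmbedding =
      (1 : Equiv.Perm (Fin N)).toEmbedding := by
    ext i
    have := Finset.orderEmbOfFin_unique (Finset.card_fin N) (f := id) (fun x => Finset.mem_univ x)
      strictMono_id
    exact congrArg Fin.val (congrFun this i).symm
  rw [this, lift_perm]
  ext φ k
  rfl

end OnSet

/-! ### Strongly continuous and strongly differentiable families -/

section StrongCont

variable {X E F G : Type*} [TopologicalSpace X] [NormedAddCommGroup E] [NormedSpace ℂ E]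
  [NormedAddCommGroup F] [NormedSpace ℂ F] [NormedAddCommGroup G] [NormedSpace ℂ G]

/-- Strong continuity of an operator-valued function. -/
def StrongCont (b : X → E →L[ℂ] F) : Prop := ∀ ψ, Continuous fun x => b x ψ

/-- Banach–Steinhaus on a compact neighbourhood. Local boundedness is what makes products of
strongly continuous families strongly continuous. -/
theorem StrongCont.locally_bounded [CompleteSpace E] [LocallyCompactSpace X] {b : X → E →L[ℂ] F}
    (hb : StrongCont b) (x : X) : ∃ C, ∀ᶠ y in 𝓝 x, ‖b y‖ ≤ C := by
  obtain ⟨K, hK, hx⟩ := exists_compact_mem_nhds x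
  have h : ∀ ψ, ∃ C, ∀ y : K, ‖b y ψ‖ ≤ C := fun ψ => by
    obtain ⟨C, hC⟩ := (hK.image (hb ψ)).isBounded.exists_norm_le
    exact ⟨C, fun y => hC _ ⟨y, y.2, rfl⟩⟩
  obtain ⟨C, hC⟩ := banach_steinhaus h
  exact ⟨C, by filter_upwards [hx] with y hy using hC ⟨y, hy⟩⟩

theorem StrongCont.apply [CompleteSpace E] [LocallyCompactSpace X] {b : X → E →L[ℂ] F} {g : X → E}
    (hb : StrongCont b) (hg : Continuous g) : Continuous fun x => b x (g x) := by
  refine continuous_iff_continuousAt.2 fun x => ?_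
  obtain ⟨C, hC⟩ := hb.locally_bounded x
  have h1 : Tendsto (fun y => b y (g x) + b y (g y - g x)) (𝓝 x) (𝓝 (b x (g x) + 0)) := by
    refine ((hb (g x)).tendsto x).add
      (squeeze_zero_norm' (a := fun y => C * ‖g y - g x‖) ?_ ?_)
    · filter_upwards [hC] with y hy
      exact ((b y).le_opNorm _).trans (by gcongr)
    · simpa using (((hg.tendsto x).sub_const (g x)).norm).const_mul C
  rw [add_zero] at h1
  refine h1.congr fun y => ?_
  rw [← map_add, add_sub_cancel]

theorem StrongCont.comp [CompleteSpace F] [LocallyCompactSpace X] {a : X → F →L[ℂ] G}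
    {b : X → E →L[ℂ] F} (ha : StrongCont a) (hb : StrongCont b) : StrongCont fun x => a x ∘L b x :=
  fun ψ => ha.apply (hb ψ)

theorem StrongCont.const (a : E →L[ℂ] F) : StrongCont fun _ : X => a := fun _ => continuous_const

theorem StrongCont.add {a b : X → E →L[ℂ] F} (ha : StrongCont a) (hb : StrongCont b) :
    StrongCont fun x => a x + b x := fun ψ => (ha ψ).add (hb ψ)

theorem StrongCont.smul {b : X → E →L[ℂ] F} (c : ℂ) (hb : StrongCont b) :
    StrongCont fun x => c • b x := fun ψ => (hb ψ).const_smul c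

theorem StrongCont.sub {a b : X → E →L[ℂ] F} (ha : StrongCont a) (hb : StrongCont b) :
    StrongCont fun x => a x - b x := fun ψ => (ha ψ).sub (hb ψ)

theorem StrongCont.sum {κ : Type*} {s : Finset κ} {b : κ → X → E →L[ℂ] F}
    (hb : ∀ i ∈ s, StrongCont (b i)) : StrongCont fun x => ∑ i ∈ s, b i x := fun ψ => by
  simp only [_root_.sum_apply]
  exact continuous_finsetSum _ fun i hi => hb i hi ψ

theorem StrongCont.comp_continuous {Y : Type*} [TopologicalSpace Y] {b : X → E →L[ℂ] F}
    (hb : StrongCont b) {f : Y → X} (hf : Continuous f) : StrongCont fun y => b (f y) :=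
  fun ψ => (hb ψ).comp hf

/-- `b` is strongly continuously differentiable with derivative `b'`. -/
structure StrongC1 (b b' : ℝ → E →L[ℂ] F) : Prop where
  deriv : ∀ ψ t, HasDerivAt (fun τ => b τ ψ) (b' t ψ) t
  cont : StrongCont b'

theorem StrongC1.strongCont {b b' : ℝ → E →L[ℂ] F} (h : StrongC1 b b') : StrongCont b := fun ψ =>
  continuous_iff_continuousAt.2 fun t => (h.deriv ψ t).continuousAt

theorem StrongC1.apply [CompleteSpace E] {b b' : ℝ → E →L[ℂ] F} (h : StrongC1 b b') {g : ℝ → E}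
    {g' : E} {t : ℝ} (hg : HasDerivAt g g' t) :
    HasDerivAt (fun τ => b τ (g τ)) (b' t (g t) + b t g') t := by
  obtain ⟨C, hC⟩ := h.strongCont.locally_bounded t
  exact hasDerivAt_strong_apply hC (h.deriv _ t) (h.strongCont g').continuousAt hg

theorem StrongC1.comp [CompleteSpace E] [CompleteSpace F] {a a' : ℝ → F →L[ℂ] G}
    {b b' : ℝ → E →L[ℂ] F} (ha : StrongC1 a a') (hb : StrongC1 b b') :
    StrongC1 (fun t => a t ∘L b t) (fun t => a' t ∘L b t + a t ∘L b' t) :=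
  ⟨fun ψ t => ha.apply (hb.deriv ψ t),
    (ha.cont.comp hb.strongCont).add (ha.strongCont.comp hb.cont)⟩

theorem StrongC1.const (a : E →L[ℂ] F) : StrongC1 (fun _ => a) (fun _ => 0) :=
  ⟨fun ψ t => hasDerivAt_const t (a ψ), StrongCont.const 0⟩

theorem StrongC1.add {a a' b b' : ℝ → E →L[ℂ] F} (ha : StrongC1 a a') (hb : StrongC1 b b') :
    StrongC1 (fun t => a t + b t) (fun t => a' t + b' t) :=
  ⟨fun ψ t => (ha.deriv ψ t).add (hb.deriv ψ t), ha.cont.add hb.cont⟩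

theorem StrongC1.smul {b b' : ℝ → E →L[ℂ] F} (c : ℂ) (hb : StrongC1 b b') :
    StrongC1 (fun t => c • b t) (fun t => c • b' t) :=
  ⟨fun ψ t => (hb.deriv ψ t).const_smul c, hb.cont.smul c⟩

theorem StrongC1.sum {κ : Type*} {s : Finset κ} {b b' : κ → ℝ → E →L[ℂ] F}
    (hb : ∀ i ∈ s, StrongC1 (b i) (b' i)) :
    StrongC1 (fun t => ∑ i ∈ s, b i t) (fun t => ∑ i ∈ s, b' i t) := by
  refine ⟨fun ψ t => ?_, StrongCont.sum fun i hi => (hb i hi).cont⟩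
  simp only [_root_.sum_apply]
  exact HasDerivAt.fun_sum fun i hi => (hb i hi).deriv ψ t

theorem StrongC1.congr {b b' c c' : ℝ → E →L[ℂ] F} (h : StrongC1 b b') (hc : ∀ t, b t = c t)
    (hc' : ∀ t, b' t = c' t) : StrongC1 c c' := by
  rw [← funext hc, ← funext hc']; exact h

end StrongCont

/-! ### Strong continuity and differentiability under `lift` -/

section LiftStrong

variable {ι α β : Type*}

/-- The fibre over the configuration `r` of the particles outside the image of `e`. -/
def fibre (e : α ↪ β) (r : {x // x ∉ Set.range e} → ι) : (α → ι) ↪ (β → ι) :=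
  ⟨fun m => splitEquiv e (r, m), fun m m' h => by simpa using (splitEquiv e).injective h⟩

theorem pull_fibre_lift (e : α ↪ β) (T : L2 (α → ι) →L[ℂ] L2 (α → ι)) (φ : L2 (β → ι))
    (r : {x // x ∉ Set.range e} → ι) : pull (fibre e r) (lift e T φ) = T (pull (fibre e r) φ) := by
  ext m
  change lift e T φ (splitEquiv e (r, m)) = _
  rw [lift_apply, splitEquiv_comp]
  refine apply_congr T (fun m' => ?_) m
  rw [pull_apply, overwrite_splitEquiv]
  rfl

theorem hasSum_norm_fibre (e : α ↪ β) (φ : L2 (β → ι)) :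
    HasSum (fun r => ‖pull (fibre e r) φ‖ ^ 2) (‖φ‖ ^ 2) := by
  have hφ : Summable fun p : ({x // x ∉ Set.range e} → ι) × (α → ι) =>
      ‖φ (splitEquiv e p)‖ ^ 2 := (splitEquiv e).summable_iff.2 (summable_sq φ)
  have h1 : HasSum (fun p : ({x // x ∉ Set.range e} → ι) × (α → ι) =>
      ‖φ (splitEquiv e p)‖ ^ 2) (‖φ‖ ^ 2) := by
    rw [norm_sq_eq φ]
    exact (splitEquiv e).hasSum_iff.2 (summable_sq φ).hasSum
  refine h1.prod_fiberwise fun r => ?_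
  rw [norm_sq_eq]
  exact (summable_sq (pull (fibre e r) φ)).hasSum

theorem ext_fibre (e : α ↪ β) {φ χ : L2 (β → ι)}
    (h : ∀ r, pull (fibre e r) φ = pull (fibre e r) χ) : φ = χ := by
  have h1 := hasSum_norm_fibre e (φ - χ)
  have h2 : (fun r => ‖pull (fibre e r) (φ - χ)‖ ^ 2) = fun _ => 0 := by
    funext r; rw [map_sub, h r]; simp
  rw [h2] at h1
  have h3 : ‖φ - χ‖ ^ 2 = 0 := h1.unique hasSum_zero
  have h4 : ‖φ - χ‖ = 0 := by simpa using h3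
  exact sub_eq_zero.1 (norm_eq_zero.1 h4)

/-- Each fibre converges by strong continuity; the squared norms over the fibres are dominated by a
multiple of those of `φ`, so the sum over fibres converges too. -/
theorem StrongCont.lift {X : Type*} [TopologicalSpace X] [LocallyCompactSpace X]
    {b : X → L2 (α → ι) →L[ℂ] L2 (α → ι)} (hb : StrongCont b) (e : α ↪ β) :
    StrongCont fun x => lift e (b x) := by
  intro φ
  refine continuous_iff_continuousAt.2 fun x => ?_
  obtain ⟨C, hC⟩ := hb.locally_bounded x
  rw [ContinuousAt, tendsto_iff_norm_sub_tendsto_zero]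
  have h1 : Tendsto (fun y => ∑' r, ‖pull (fibre e r) ((QuantumHierarchy.lift e (b y)) φ -
      (QuantumHierarchy.lift e (b x)) φ)‖ ^ 2) (𝓝 x) (𝓝 (∑' _ : {x // x ∉ Set.range e} → ι, 0)) := by
    refine tendsto_tsum_of_dominated_convergence
      (bound := fun r => (C + ‖b x‖) ^ 2 * ‖pull (fibre e r) φ‖ ^ 2)
      ((hasSum_norm_fibre e φ).summable.mul_left _) (fun r => ?_) ?_
    · simp only [map_sub, pull_fibre_lift]
      have h2 := (((hb (pull (fibre e r) φ)).tendsto x).sub_const (b x (pull (fibre e r) φ))).norm.pow 2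
      simpa using h2
    · filter_upwards [hC] with y hy r
      rw [map_sub, pull_fibre_lift, pull_fibre_lift, ← _root_.sub_apply, ← mul_pow, norm_pow,
        norm_norm]
      gcongr
      exact ((b y - b x).le_opNorm _).trans (by gcongr; exact (norm_sub_le _ _).trans (by gcongr))
  simp only [(hasSum_norm_fibre e _).tsum_eq, tsum_zero] at h1
  have h3 := h1.sqrt
  simpa using h3

theorem lift_apply_intervalIntegral {b : ℝ → L2 (α → ι) →L[ℂ] L2 (α → ι)} (hb : StrongCont b)
    (e : α ↪ β) {T : L2 (α → ι) →L[ℂ] L2 (α → ι)} {t₀ t : ℝ}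
    (h : ∀ ψ, ∫ s in t₀..t, b s ψ = T ψ) (φ : L2 (β → ι)) :
    ∫ s in t₀..t, lift e (b s) φ = lift e T φ := by
  refine ext_fibre e fun r => ?_
  rw [pull_fibre_lift, ← h,
    ← (pull (fibre e r)).intervalIntegral_comp_comm (((hb.lift e) φ).intervalIntegrable _ _)]
  simp only [pull_fibre_lift]

/-- Integrals, unlike difference quotients, pass through `lift` fibre by fibre. The lifted family is
therefore the integral of the lifted derivative, which is strongly continuous. -/
theorem StrongC1.lift {b b' : ℝ → L2 (α → ι) →L[ℂ] L2 (α → ι)} (hb : StrongC1 b b') (e : α ↪ β) :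
    StrongC1 (fun t => lift e (b t)) (fun t => lift e (b' t)) := by
  refine ⟨fun φ t => ?_, hb.cont.lift e⟩
  have hc := hb.cont.lift e φ
  have h1 : ∀ τ, QuantumHierarchy.lift e (b τ) φ =
      (∫ s in (0 : ℝ)..τ, QuantumHierarchy.lift e (b' s) φ) + QuantumHierarchy.lift e (b 0) φ := by
    intro τ
    rw [lift_apply_intervalIntegral hb.cont e (T := b τ - b 0) fun ψ =>
      intervalIntegral.integral_eq_sub_of_hasDerivAt (fun s _ => hb.deriv ψ s)
        ((hb.cont ψ).intervalIntegrable _ _), lift_sub, _root_.sub_apply, sub_add_cancel]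
  rw [funext h1]
  exact (intervalIntegral.integral_hasDerivAt_right (hc.intervalIntegrable _ _)
    (hc.stronglyMeasurableAtFilter _ _) hc.continuousAt).add_const _

end LiftStrong

/-! ### Strong differentiability in the interaction picture -/

section

variable {E F : Type*} [NormedAddCommGroup E] [InnerProductSpace ℂ E] [CompleteSpace E]
  [NormedAddCommGroup F] [NormedSpace ℂ F]

theorem unitaryGroup_spec {A : E →ₗ.[ℂ] E} (hA : IsSelfAdjoint A) :
    IsUnitaryGroupOf A (unitaryGroup A) := by
  have h := exists_isUnitaryGroupOf hA
  rw [unitaryGroup, dif_pos h]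
  exact h.choose_spec

theorem IsUGroup.of_norm {U : ℝ → E →L[ℂ] E} (h0 : U 0 = 1) (ha : ∀ s t, U (s + t) = U s * U t)
    (hn : ∀ t ψ, ‖U t ψ‖ = ‖ψ‖) (hc : ∀ ψ, Continuous fun t => U t ψ) : IsUGroup U := by
  refine ⟨h0, ha, fun t => ?_, hc⟩
  have h1 : star (U t) * U t = 1 :=
    (ContinuousLinearMap.norm_map_iff_adjoint_comp_self (U t)).1 (hn t)
  have h2 : U t * U (-t) = 1 := by rw [← ha, add_neg_cancel, h0]
  have h3 : star (U t) = U (-t) := by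
    calc star (U t) = star (U t) * (U t * U (-t)) := by rw [h2, mul_one]
      _ = U (-t) := by rw [← mul_assoc, h1, one_mul]
  rw [Unitary.mem_iff]
  exact ⟨h1, by rw [h3, h2]⟩

theorem IsUGroup.strongCont {U : ℝ → E →L[ℂ] E} (h : IsUGroup U) : StrongCont U := h.cont

theorem StrongC1.comp_neg {b b' : ℝ → E →L[ℂ] F} (h : StrongC1 b b') :
    StrongC1 (fun t => b (-t)) (fun t => (-1 : ℂ) • b' (-t)) := by
  refine ⟨fun ψ t => ?_, (h.cont.comp_continuous continuous_neg).smul _⟩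
  have := HasDerivAt.scomp (g₁ := fun r => b r ψ) t (h.deriv ψ (-t)) (hasDerivAt_neg t)
  simpa [Function.comp_def] using this

theorem strongC1_interaction {A : E →ₗ.[ℂ] E} {P : E →L[ℂ] E} {U V : ℝ → E →L[ℂ] E}
    (hV : IsUnitaryGroupOf A V) (hU : IsUnitaryGroupOf ((P : E →ₗ[ℂ] E) +ᵥ A) U) :
    StrongC1 (fun t => V (-t) * U t) (fun t => V (-t) * (-Complex.I • P) * U t) := by
  refine ⟨fun ψ t => hasDerivAt_interaction hV hU ψ t, ?_⟩
  exact (((hV.isUGroup.strongCont.comp_continuous continuous_neg).comp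
    (StrongCont.const (-Complex.I • P))).comp hU.isUGroup.strongCont)

/-- The free and perturbed groups exchange roles: `A` is the perturbation of `P + A` by `-P`. -/
theorem strongC1_interaction' {A : E →ₗ.[ℂ] E} {P : E →L[ℂ] E} {U V : ℝ → E →L[ℂ] E}
    (hV : IsUnitaryGroupOf A V) (hU : IsUnitaryGroupOf ((P : E →ₗ[ℂ] E) +ᵥ A) U) :
    StrongC1 (fun t => U (-t) * V t) (fun t => U (-t) * (Complex.I • P) * V t) := by
  have e : A = (((-P : E →L[ℂ] E) : E →ₗ[ℂ] E) +ᵥ ((P : E →ₗ[ℂ] E) +ᵥ A)) := by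
    refine LinearPMap.eq_of_eq_graph ?_
    ext ⟨x, y⟩
    rw [mem_graph_vadd, mem_graph_vadd]
    simp
  rw [e] at hV
  have := strongC1_interaction hU hV
  simpa using this

end

/-! ### Kinetic operators, pair potentials, and the Hamiltonians -/

namespace PairSystem

variable {ι H : Type*} [NormedAddCommGroup H] [InnerProductSpace ℂ H] [CompleteSpace H]
  (S : PairSystem ι H)

/-- The identification of the one-particle space with `H`. -/
def toH : L2 (Unit → ι) →L[ℂ] H :=
  (S.basis.repr.symm.toContinuousLinearEquiv : L2 ι →L[ℂ] H) ∘L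
    pull ⟨fun i _ => i, fun _ _ h => congrFun h ()⟩

/-- The inverse of `toH`. -/
def fromH : H →L[ℂ] L2 (Unit → ι) :=
  pull ⟨fun m => m (), fun _ _ h => funext fun _ => h⟩ ∘L
    (S.basis.repr.toContinuousLinearEquiv : H →L[ℂ] L2 ι)

theorem toH_fromH (x : H) : S.toH (S.fromH x) = x := by
  change S.basis.repr.symm _ = x
  rw [LinearIsometryEquiv.symm_apply_eq]
  rfl

theorem fromH_toH (x : L2 (Unit → ι)) : S.fromH (S.toH x) = x := by
  ext m
  change S.basis.repr (S.basis.repr.symm _) (m ()) = x m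
  rw [LinearIsometryEquiv.apply_symm_apply]
  rfl

theorem norm_toH (x : L2 (Unit → ι)) : ‖S.toH x‖ = ‖x‖ := by
  refine le_antisymm ?_ ?_
  · change ‖S.basis.repr.symm _‖ ≤ _
    rw [LinearIsometryEquiv.norm_map]
    exact ((pull _).le_opNorm x).trans (mul_le_of_le_one_left (norm_nonneg _) (norm_pull_le _))
  · conv_lhs => rw [← S.fromH_toH x]
    refine ((pull _).le_opNorm _).trans ((mul_le_of_le_one_left (norm_nonneg _) (norm_pull_le _)).trans ?_)
    exact (LinearIsometryEquiv.norm_map _ _).le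

/-- The position of one particle. -/
def single {n : ℕ} (j : Fin n) : Unit ↪ Fin n := ⟨fun _ => j, fun _ _ _ => rfl⟩

theorem range_single {n : ℕ} (j : Fin n) : Set.range (single j) = {j} := by
  ext x
  exact ⟨fun ⟨_, h⟩ => h.symm, fun h => ⟨(), h.symm⟩⟩

/-- `e^{-itK(j)}`. -/
def W {n : ℕ} (j : Fin n) (t : ℝ) : Op ι n :=
  lift (single j) (S.fromH ∘L unitaryGroup S.K t ∘L S.toH)

/-- The slice map as a bounded operator. -/
def sliceL {n : ℕ} (j : Fin n) (k : Fin n → ι) : HS ι n →L[ℂ] H :=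
  S.toH ∘L pull (overwrite (single j) k)

theorem slice_apply {n : ℕ} (j : Fin n) (k : Fin n → ι) (φ : HS ι n) :
    S.slice j k φ = S.sliceL j k φ := by
  change S.basis.repr.symm _ = S.basis.repr.symm _
  congr 1
  ext i
  change φ _ = φ _
  refine congrArg φ (funext fun x => ?_)
  by_cases hx : x = j
  · subst hx
    refine Eq.trans ?_ (overwrite_apply_mem (single x) k (fun _ => i) ()).symm
    simp [updateEmb]
  · rw [overwrite_apply_notMem _ _ _ (by rw [range_single]; exact hx)]
    simp [updateEmb, hx]

theorem ext_slice {n : ℕ} (j : Fin n) {φ χ : HS ι n} (h : ∀ k, S.sliceL j k φ = S.sliceL j k χ) :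
    φ = χ := by
  ext k
  have h1 := congrArg S.fromH (h k)
  change S.fromH (S.toH _) = S.fromH (S.toH _) at h1
  rw [fromH_toH, fromH_toH] at h1
  have h2 := congrArg (fun f : L2 (Unit → ι) => f (k ∘ single j)) h1
  change φ (overwrite (single j) k (k ∘ single j)) = χ (overwrite (single j) k (k ∘ single j)) at h2
  have h3 : overwrite (single j) k (k ∘ single j) = k := by
    funext x
    by_cases hx : x ∈ Set.range (single j)
    · obtain ⟨a, rfl⟩ := hx
      rw [overwrite_apply_mem]; rfl
    · rw [overwrite_apply_notMem _ _ _ hx]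
  rwa [h3] at h2

theorem sliceL_W {n : ℕ} (j : Fin n) (k : Fin n → ι) (t : ℝ) (φ : HS ι n) :
    S.sliceL j k (S.W j t φ) = unitaryGroup S.K t (S.sliceL j k φ) := by
  change S.toH (pull _ (lift _ _ φ)) = _
  rw [pull_overwrite_lift]
  exact S.toH_fromH _

/-- The slices determine a vector, so the relation that defines `kinetic` is single valued and
really is the graph of the operator built from it. -/
theorem mem_graph_kinetic {n : ℕ} (j : Fin n) (φ χ : HS ι n) :
    (φ, χ) ∈ (S.kinetic j).graph ↔ ∀ k, (S.sliceL j k φ, S.sliceL j k χ) ∈ S.K.graph := by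
  rw [kinetic, Submodule.toLinearPMap_graph_eq]
  · simp only [Submodule.mem_iInf, Submodule.mem_comap, LinearMap.prodMap_apply, slice_apply]
  · rintro ⟨x, y⟩ h (rfl : x = 0)
    simp only [Submodule.mem_iInf, Submodule.mem_comap, LinearMap.prodMap_apply, slice_apply,
      map_zero] at h
    refine S.ext_slice j fun k => ?_
    rw [map_zero]
    exact LinearPMap.graph_fst_eq_zero_snd S.K (h k) rfl

theorem isUGroup_one : IsUGroup fun t => S.fromH ∘L unitaryGroup S.K t ∘L S.toH := by
  have hg := (unitaryGroup_spec S.K_selfAdjoint).isUGroup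
  refine IsUGroup.of_norm ?_ (fun s t => ?_) (fun t ψ => ?_) (fun ψ => ?_)
  · rw [hg.zero]
    exact ContinuousLinearMap.ext fun x => S.fromH_toH x
  · rw [hg.add]
    ext1 x
    change S.fromH (unitaryGroup S.K s (unitaryGroup S.K t (S.toH x))) =
      S.fromH (unitaryGroup S.K s (S.toH (S.fromH (unitaryGroup S.K t (S.toH x)))))
    rw [toH_fromH]
  · rw [← S.norm_toH, ContinuousLinearMap.comp_apply, toH_fromH, ContinuousLinearMap.comp_apply,
      hg.norm_apply, norm_toH]
  · exact S.fromH.continuous.comp (hg.cont _)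

theorem isUGroup_W {n : ℕ} (j : Fin n) : IsUGroup (S.W j) := by
  have h := S.isUGroup_one
  refine ⟨?_, fun s t => ?_, fun t => lift_mem_unitary _ (h.unit t), h.strongCont.lift _⟩
  · rw [W, h.zero, lift_one]
  · rw [W, h.add, lift_mul]; rfl

/-- Slicing intertwines `W j` with the one-particle group. In one direction the derivative is
sliced; in the other the integrated equations of the slices are assembled, since pointwise
derivatives of slices carry no uniformity. -/
theorem isUnitaryGroupOf_kinetic {n : ℕ} (j : Fin n) : IsUnitaryGroupOf (S.kinetic j) (S.W j) := by
  have hK := unitaryGroup_spec S.K_selfAdjoint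
  have hW := S.isUGroup_W j
  refine hW.of_mem_iff fun φ χ => ?_
  rw [mem_graph_kinetic]
  constructor
  · intro h
    refine hW.hasDerivAt_of_integral fun t => S.ext_slice j fun k => ?_
    have hi := (S.sliceL j k).intervalIntegral_comp_comm
      ((hW.cont (-Complex.I • χ)).intervalIntegrable (μ := volume) 0 t)
    refine Eq.trans ?_ hi
    rw [map_sub]
    simp only [sliceL_W]
    rw [hK.isUGroup.integral_eq (hK.mem_iff.1 (h k))]
    simp only [map_smul]
  · intro h k
    rw [hK.mem_iff]
    have h1 := ((S.sliceL j k).restrictScalars ℝ).hasFDerivAt.comp_hasDerivAt 0 h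
    have e2 : (ContinuousLinearMap.restrictScalars ℝ (S.sliceL j k)) (-Complex.I • χ) =
      -Complex.I • S.sliceL j k χ := (S.sliceL j k).map_smul _ _
    rw [e2] at h1
    refine h1.congr_of_eventuallyEq (Eventually.of_forall fun t => ?_)
    exact (S.sliceL_W j k t φ).symm

theorem commute_W {n : ℕ} (i j : Fin n) (s t : ℝ) : Commute (S.W i s) (S.W j t) := by
  by_cases h : i = j
  · subst h
    change S.W i s * S.W i t = S.W i t * S.W i s
    rw [← (S.isUGroup_W i).add, ← (S.isUGroup_W i).add, add_comm]
  · refine commute_lift _ _ _ _ ?_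
    rw [range_single, range_single]
    simpa using h

/-- The free evolution `e^{-it ∑ K(j)}`. -/
def V (n : ℕ) (t : ℝ) : Op ι n := listProd (fun j => S.W j) (List.finRange n) t

theorem isUnitaryGroupOf_V (n : ℕ) : IsUnitaryGroupOf (∑ j : Fin n, S.kinetic j).closure (S.V n) :=
  isUnitaryGroupOf_closure_sum S.isUnitaryGroupOf_kinetic S.commute_W

theorem lift_W {m n : ℕ} (e : Fin m ↪ Fin n) (j : Fin m) (t : ℝ) : lift e (S.W j t) = S.W (e j) t := by
  rw [W, lift_trans]
  rfl

theorem lift_listProd {m n : ℕ} (e : Fin m ↪ Fin n) (l : List (Fin m)) (t : ℝ) :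
    lift e (listProd (fun j => S.W j) l t) = listProd (fun j => S.W j) (l.map e) t := by
  induction l with
  | nil => exact lift_one e
  | cons a l ih =>
    change lift e (S.W a t * listProd (fun j => S.W j) l t) =
      S.W (e a) t * listProd (fun j => S.W j) (l.map e) t
    rw [lift_mul, ih, lift_W]

theorem listProd_perm {n : ℕ} {l l' : List (Fin n)} (h : l.Perm l') (t : ℝ) :
    listProd (fun j => S.W j) l t = listProd (fun j => S.W j) l' t := by
  refine List.Perm.prod_eq' (h.map _) ?_
  refine List.pairwise_map.2 (List.pairwise_of_forall fun i j => S.commute_W i j t t)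

theorem isSymm_V (n : ℕ) (t : ℝ) : IsSymm (S.V n t) := by
  intro σ
  rw [V, lift_listProd]
  refine S.listProd_perm ?_ t
  rw [List.perm_ext_iff_of_nodup ((List.nodup_finRange n).map σ.toEmbedding.injective)
    (List.nodup_finRange n)]
  intro x
  simpa using σ.surjective x

/-- The interaction potential. -/
def P (n : ℕ) : Op ι n := ∑ p : Fin n × Fin n with p.1 < p.2, S.pot p.1 p.2

/-- The ordered pair of two particles. -/
def pair {N : ℕ} (i j : Fin N) (h : i ≠ j) : Fin 2 ↪ Fin N :=
  ⟨![i, j], by intro a b hab; fin_cases a <;> fin_cases b <;> simp_all⟩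

theorem pot_of_ne {N : ℕ} {i j : Fin N} (h : i ≠ j) : S.pot i j = lift (pair i j h) S.Φ := by
  rw [pot, dif_pos h]; rfl

theorem pot_self {N : ℕ} (i : Fin N) : S.pot i i = 0 := by
  rw [pot, dif_neg (by simp)]

theorem isSelfAdjoint_pot {N : ℕ} (i j : Fin N) : IsSelfAdjoint (S.pot i j) := by
  by_cases h : i = j
  · subst h; rw [pot_self]; exact IsSelfAdjoint.zero _
  · rw [S.pot_of_ne h]; exact isSelfAdjoint_lift _ S.Φ_selfAdjoint

theorem pot_comm {N : ℕ} (i j : Fin N) : S.pot i j = S.pot j i := by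
  by_cases h : i = j
  · subst h; rfl
  · rw [S.pot_of_ne h, S.pot_of_ne (Ne.symm h), ← S.Φ_symm (Equiv.swap 0 1), lift_trans,
      S.Φ_symm (Equiv.swap 0 1)]
    congr 1
    ext a
    fin_cases a <;> rfl

theorem lift_pot {M N : ℕ} (e : Fin M ↪ Fin N) (i j : Fin M) :
    lift e (S.pot i j) = S.pot (e i) (e j) := by
  by_cases h : i = j
  · subst h; rw [pot_self, pot_self, lift_zero]
  · rw [S.pot_of_ne h, S.pot_of_ne (e.injective.ne h), lift_trans]
    congr 1
    ext a
    fin_cases a <;> rfl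

theorem isSelfAdjoint_P (n : ℕ) : IsSelfAdjoint (S.P n) :=
  isSelfAdjoint_sum _ fun p _ => S.isSelfAdjoint_pot p.1 p.2

/-- The sum over all ordered pairs is free of the condition `p.1 < p.2`, so its behaviour under
permutations and under splitting off a particle can be read off; the price is the factor `2`. -/
theorem two_smul_P (n : ℕ) : (2 : ℂ) • S.P n = ∑ i : Fin n, ∑ j : Fin n, S.pot i j := by
  rw [← Finset.sum_product', Finset.univ_product_univ]
  have h1 : ∀ p : Fin n × Fin n, S.pot p.1 p.2 = (if p.1 < p.2 then S.pot p.1 p.2 else 0) +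
      (if p.2 < p.1 then S.pot p.1 p.2 else 0) := fun p => by
    rcases lt_trichotomy p.1 p.2 with h | h | h
    · rw [if_pos h, if_neg h.not_gt, add_zero]
    · rw [if_neg h.not_lt, if_neg h.not_gt, h, pot_self, add_zero]
    · rw [if_pos h, if_neg h.not_gt, zero_add]
  rw [Finset.sum_congr rfl fun p _ => h1 p, Finset.sum_add_distrib, two_smul]
  congr 1
  · rw [P, Finset.sum_filter]
  · rw [P, Finset.sum_filter, ← (Equiv.prodComm (Fin n) (Fin n)).sum_comp]
    refine Finset.sum_congr rfl fun p _ => ?_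
    simp only [Equiv.prodComm_apply, Prod.fst_swap, Prod.snd_swap]
    rw [S.pot_comm p.1 p.2]
    exact if_congr Iff.rfl rfl rfl

theorem isSymm_P (n : ℕ) : IsSymm (S.P n) := by
  intro σ
  have h : (2 : ℂ) • lift σ.toEmbedding (S.P n) = (2 : ℂ) • S.P n := by
    rw [← lift_smul, two_smul_P, lift_sum]
    simp only [lift_sum, lift_pot]
    exact Fintype.sum_equiv σ _ _ fun i => Fintype.sum_equiv σ _ _ fun j => rfl
  exact smul_right_injective _ (two_ne_zero : (2 : ℂ) ≠ 0) h

theorem isSelfAdjoint_hamiltonian (n : ℕ) : IsSelfAdjoint (S.hamiltonian n) :=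
  isSelfAdjoint_vadd (S.isSelfAdjoint_P n) (S.isUnitaryGroupOf_V n).isSelfAdjoint

theorem isUnitaryGroupOf_U (n : ℕ) : IsUnitaryGroupOf (S.hamiltonian n) (S.U n) :=
  unitaryGroup_spec (S.isSelfAdjoint_hamiltonian n)

theorem isUGroup_U (n : ℕ) : IsUGroup (S.U n) := (S.isUnitaryGroupOf_U n).isUGroup

/-- A permutation commutes with the free group and with the potential. It therefore preserves the
graph of the Hamiltonian and commutes with the full group. -/
theorem isSymm_U (n : ℕ) (t : ℝ) : IsSymm (S.U n t) := by
  intro σ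
  rw [lift_perm_eq_iff_commute]
  refine (S.isUnitaryGroupOf_U n).commute_of_graph (fun x y h => ?_) t
  have h1 := mem_graph_vadd.1 h
  refine mem_graph_vadd.2 ?_
  have h2 := (S.isUnitaryGroupOf_V n).graph_of_commute
    (fun t => (lift_perm_eq_iff_commute σ _).1 (S.isSymm_V n t σ)) h1
  have h3 : permOp σ (S.P n x) = S.P n (permOp σ x) :=
    DFunLike.congr_fun ((lift_perm_eq_iff_commute σ _).1 (S.isSymm_P n σ)).eq x
  rw [map_sub] at h2
  change (permOp σ x, permOp σ y - S.P n (permOp σ x)) ∈ _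
  rw [← h3]
  exact h2

/-! ### Comparison of `s + 1` particles with `s` particles and a free one -/

section OneParticleMore

variable {s : ℕ} (e : Fin s ↪ Fin (s + 1)) (j : Fin (s + 1))

theorem sum_eq_add_sum {M : Type*} [AddCommMonoid M] {e : Fin s ↪ Fin (s + 1)} {j : Fin (s + 1)}
    (he : ∀ x, x ∈ Set.range e ↔ x ≠ j) (f : Fin (s + 1) → M) :
    ∑ x, f x = f j + ∑ i, f (e i) := by
  classical
  have h1 : (Finset.univ : Finset (Fin (s + 1))) = insert j (Finset.univ.map e) := by
    ext x
    by_cases hx : x = j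
    · simp [hx]
    · have := (he x).2 hx
      simpa [hx] using this
  rw [h1, Finset.sum_insert, Finset.sum_map]
  intro h
  have h2 : j ∈ Set.range e := by simpa using h
  exact (he j).1 h2 rfl

/-- The interaction of particle `j` with all other particles. -/
def PWith : Op ι (s + 1) := ∑ i, S.pot j (e i)

variable {e j} (he : ∀ x, x ∈ Set.range e ↔ x ≠ j)
include he

theorem P_succ : S.P (s + 1) = lift e (S.P s) + S.PWith e j := by
  have h : (2 : ℂ) • S.P (s + 1) = (2 : ℂ) • (lift e (S.P s) + S.PWith e j) := by
    rw [smul_add, ← lift_smul, two_smul_P, two_smul_P, sum_eq_add_sum he]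
    simp only [sum_eq_add_sum he (fun x => S.pot _ x), pot_self, zero_add, Finset.sum_add_distrib,
      lift_sum, lift_pot, PWith, two_smul]
    rw [Finset.sum_congr rfl fun i _ => S.pot_comm (e i) j]
    abel
  exact smul_right_injective _ (two_ne_zero : (2 : ℂ) ≠ 0) h

theorem V_succ (t : ℝ) : S.V (s + 1) t = lift e (S.V s t) * S.W j t := by
  have h1 : lift e (S.V s t) * S.W j t =
      listProd (fun j => S.W j) ((List.finRange s).map e ++ [j]) t := by
    rw [V, lift_listProd]
    simp [listProd]
  rw [h1, V]
  refine S.listProd_perm ?_ t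
  rw [List.perm_ext_iff_of_nodup (List.nodup_finRange _)]
  · intro x
    by_cases hx : x = j
    · simp [hx]
    · have := (he x).2 hx
      simpa [hx] using this
  · rw [List.nodup_append]
    refine ⟨(List.nodup_finRange s).map e.injective, List.nodup_singleton j, ?_⟩
    intro a ha b hb hab
    obtain rfl : b = j := by simpa using hb
    subst hab
    have : a ∈ Set.range e := by simpa using ha
    exact (he a).1 this rfl

theorem commute_lift_W (T : Op ι s) (t : ℝ) : Commute (lift e T) (S.W j t) := by
  refine commute_lift _ _ _ _ ?_
  rw [range_single, Set.disjoint_singleton_right]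
  exact fun h => (he j).1 h rfl

/-- `e^{it(H_s ⊗ 1 + 1 ⊗ K)} e^{-itH_{s+1}}`. -/
def Y (e : Fin s ↪ Fin (s + 1)) (j : Fin (s + 1)) (t : ℝ) : Op ι (s + 1) :=
  S.W j (-t) * lift e (S.U s (-t)) * S.U (s + 1) t

/-- `e^{itH_{s+1}} e^{-it(H_s ⊗ 1 + 1 ⊗ K)}`. -/
def Z (e : Fin s ↪ Fin (s + 1)) (j : Fin (s + 1)) (t : ℝ) : Op ι (s + 1) :=
  S.U (s + 1) (-t) * (lift e (S.U s t) * S.W j t)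

/-- `Y` is the product of the lifted interaction picture of `s` particles and that of `s + 1`
particles: the inner free groups leave exactly `W j (-t)`. Both factors are strongly differentiable
everywhere, and of the two potentials only the bounded coupling to particle `j` survives. -/
theorem strongC1_Y : StrongC1 (S.Y e j) (fun t =>
    S.W j (-t) * lift e (S.U s (-t)) * (-Complex.I • S.PWith e j) * S.U (s + 1) t) := by
  have h1 := (strongC1_interaction' (S.isUnitaryGroupOf_V s) (S.isUnitaryGroupOf_U s)).lift e
  have h2 := strongC1_interaction (S.isUnitaryGroupOf_V (s + 1)) (S.isUnitaryGroupOf_U (s + 1))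
  have hV : ∀ t, lift e (S.V s t) * S.V (s + 1) (-t) = S.W j (-t) := fun t => by
    rw [S.V_succ he, ← mul_assoc, ← lift_mul, (S.isUnitaryGroupOf_V s).isUGroup.mul_neg, lift_one,
      one_mul]
  refine (h1.comp h2).congr (fun t => ?_) fun t => ?_
  · change lift e (S.U s (-t) * S.V s t) * (S.V (s + 1) (-t) * S.U (s + 1) t) = _
    rw [Y, ← (S.commute_lift_W he _ _).eq, ← hV, lift_mul]
    simp only [mul_assoc]
  · change lift e (S.U s (-t) * (Complex.I • S.P s) * S.V s t) * (S.V (s + 1) (-t) * S.U (s + 1) t) +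
      lift e (S.U s (-t) * S.V s t) * (S.V (s + 1) (-t) * (-Complex.I • S.P (s + 1)) * S.U (s + 1) t) = _
    rw [← (S.commute_lift_W he _ _).eq]
    have e1 : lift e (S.U s (-t) * (Complex.I • S.P s) * S.V s t) *
        (S.V (s + 1) (-t) * S.U (s + 1) t) = lift e (S.U s (-t)) * (S.W j (-t) *
          (Complex.I • lift e (S.P s))) * S.U (s + 1) t := by
      rw [← lift_smul, ← (S.commute_lift_W he _ _).eq, ← hV, lift_mul, lift_mul]
      simp only [mul_assoc]
    have e2 : lift e (S.U s (-t) * S.V s t) * (S.V (s + 1) (-t) * (-Complex.I • S.P (s + 1)) *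
        S.U (s + 1) t) = lift e (S.U s (-t)) * (S.W j (-t) * (-Complex.I • S.P (s + 1))) *
          S.U (s + 1) t := by
      rw [← hV, lift_mul]
      simp only [mul_assoc]
    have e3 : Complex.I • lift e (S.P s) + -Complex.I • (lift e (S.P s) + S.PWith e j) =
        -Complex.I • S.PWith e j := by module
    rw [e1, e2, ← add_mul, ← mul_add, ← mul_add, S.P_succ he, e3]
    simp only [mul_assoc]

theorem strongC1_Z : StrongC1 (S.Z e j) (fun t =>
    S.U (s + 1) (-t) * (Complex.I • S.PWith e j) * (lift e (S.U s t) * S.W j t)) := by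
  have h1 := (strongC1_interaction (S.isUnitaryGroupOf_V s) (S.isUnitaryGroupOf_U s)).lift e
  have h2 := strongC1_interaction' (S.isUnitaryGroupOf_V (s + 1)) (S.isUnitaryGroupOf_U (s + 1))
  have hV : ∀ t, S.V (s + 1) t * lift e (S.V s (-t)) = S.W j t := fun t => by
    rw [S.V_succ he, (S.commute_lift_W he _ _).eq, mul_assoc, ← lift_mul,
      (S.isUnitaryGroupOf_V s).isUGroup.mul_neg, lift_one, mul_one]
  refine (h2.comp h1).congr (fun t => ?_) fun t => ?_
  · change S.U (s + 1) (-t) * S.V (s + 1) t * lift e (S.V s (-t) * S.U s t) = _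
    rw [Z, (S.commute_lift_W he _ _).eq, ← hV, lift_mul]
    simp only [mul_assoc]
  · change S.U (s + 1) (-t) * (Complex.I • S.P (s + 1)) * S.V (s + 1) t * lift e (S.V s (-t) * S.U s t) +
      S.U (s + 1) (-t) * S.V (s + 1) t * lift e (S.V s (-t) * (-Complex.I • S.P s) * S.U s t) = _
    have e1 : S.U (s + 1) (-t) * (Complex.I • S.P (s + 1)) * S.V (s + 1) t *
        lift e (S.V s (-t) * S.U s t) = S.U (s + 1) (-t) * ((Complex.I • S.P (s + 1)) *
          (lift e (S.U s t) * S.W j t)) := by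
      rw [(S.commute_lift_W he _ _).eq, ← hV, lift_mul]
      simp only [mul_assoc]
    have e2 : S.U (s + 1) (-t) * S.V (s + 1) t * lift e (S.V s (-t) * (-Complex.I • S.P s) * S.U s t) =
        S.U (s + 1) (-t) * ((-Complex.I • lift e (S.P s)) * (lift e (S.U s t) * S.W j t)) := by
      rw [(S.commute_lift_W he _ _).eq, ← mul_assoc (-Complex.I • lift e (S.P s)), ← lift_smul,
        (S.commute_lift_W he _ _).eq, ← hV, lift_mul, lift_mul]
      simp only [mul_assoc]
    have e3 : Complex.I • (lift e (S.P s) + S.PWith e j) + -Complex.I • lift e (S.P s) =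
        Complex.I • S.PWith e j := by module
    rw [e1, e2, ← mul_add, ← add_mul, S.P_succ he, e3]
    simp only [mul_assoc]

end OneParticleMore

end PairSystem

/-! ### Factorisation through a contraction, and the polar decomposition -/

section Douglas

variable {E F G : Type*} [NormedAddCommGroup E] [InnerProductSpace ℂ E]
  [NormedAddCommGroup F] [InnerProductSpace ℂ F] [CompleteSpace F]
  [NormedAddCommGroup G] [InnerProductSpace ℂ G] [CompleteSpace G]

/-- The assignment `g x ↦ f x` is well defined and contractive on the range of `g`; it extends to
the closure and is preceded by the orthogonal projection. Applied to `f` and `|f|` in both orders it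
replaces the polar decomposition. -/
theorem exists_contraction (f : E →L[ℂ] F) (g : E →L[ℂ] G) (h : ∀ x, ‖f x‖ ≤ ‖g x‖) :
    ∃ u : G →L[ℂ] F, ‖u‖ ≤ 1 ∧ ∀ x, u (g x) = f x := by
  let S : Submodule ℂ G := (LinearMap.range g.toLinearMap).topologicalClosure
  have hmem : ∀ x, g x ∈ S := fun x => Submodule.le_topologicalClosure _ ⟨x, rfl⟩
  have : CompleteSpace S := (Submodule.isClosed_topologicalClosure _).completeSpace_coe
  let e : E →ₗ[ℂ] S := g.toLinearMap.codRestrict S hmem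
  have hd : DenseRange e := by
    intro y
    rw [Metric.mem_closure_iff]
    intro ε hε
    obtain ⟨z, ⟨x, rfl⟩, hz⟩ := Metric.mem_closure_iff.1 y.2 ε hε
    exact ⟨e x, ⟨x, rfl⟩, hz⟩
  have hn : ∀ x, ‖f.toLinearMap x‖ ≤ 1 * ‖e x‖ := fun x => by rw [one_mul]; exact h x
  refine ⟨(f.toLinearMap.extendOfNorm e) ∘L S.orthogonalProjectionOnto, ?_, fun x => ?_⟩
  · refine (ContinuousLinearMap.opNorm_comp_le _ _).trans ?_
    exact mul_le_one₀ (LinearMap.opNorm_extendOfNorm_le hd zero_le_one hn) (norm_nonneg _)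
      (Submodule.orthogonalProjectionOnto_norm_le S)
  · have h1 : S.orthogonalProjectionOnto (g x) = e x :=
      Submodule.orthogonalProjectionOnto_mem_subspace_eq_self (e x)
    rw [ContinuousLinearMap.comp_apply, h1, LinearMap.extendOfNorm_eq hd ⟨1, hn⟩]
    rfl

theorem norm_opAbs_apply (f : G →L[ℂ] G) (x : G) : ‖opAbs f x‖ = ‖f x‖ := by
  have h : ContinuousLinearMap.adjoint (opAbs f) = opAbs f :=
    (IsSelfAdjoint.of_nonneg (CFC.abs_nonneg f)).star_eq
  have h2 : opAbs f * opAbs f = ContinuousLinearMap.adjoint f * f := CFC.abs_mul_abs f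
  rw [← sq_eq_sq₀ (norm_nonneg _) (norm_nonneg _)]
  have h3 : inner ℂ (opAbs f x) (opAbs f x) = inner ℂ (f x) (f x) := by
    rw [← ContinuousLinearMap.adjoint_inner_right, h, ← ContinuousLinearMap.adjoint_inner_right]
    exact congrArg (fun T : G →L[ℂ] G => inner ℂ x (T x)) h2
  rw [inner_self_eq_norm_sq_to_K, inner_self_eq_norm_sq_to_K] at h3
  exact_mod_cast h3

/-- The square root of `|f|`. -/
def opSqrtAbs (f : G →L[ℂ] G) : G →L[ℂ] G := CFC.sqrt (opAbs f)

theorem opSqrtAbs_adjoint (f : G →L[ℂ] G) :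
    ContinuousLinearMap.adjoint (opSqrtAbs f) = opSqrtAbs f :=
  (IsSelfAdjoint.of_nonneg (CFC.sqrt_nonneg (opAbs f))).star_eq

theorem opSqrtAbs_mul_self (f : G →L[ℂ] G) : opSqrtAbs f * opSqrtAbs f = opAbs f :=
  CFC.sqrt_mul_sqrt_self (opAbs f) (CFC.abs_nonneg f)

theorem norm_opSqrtAbs_sq (f : G →L[ℂ] G) (x : G) :
    ‖opSqrtAbs f x‖ ^ 2 = (inner ℂ x (opAbs f x)).re := by
  rw [← opSqrtAbs_mul_self, mul_apply_eq_comp, ← ContinuousLinearMap.adjoint_inner_left,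
    opSqrtAbs_adjoint, inner_self_eq_norm_sq_to_K]
  norm_cast

end Douglas

theorem tsum_ofReal_mul_le {κ : Type*} {u v : κ → ℝ} {a b : ℝ} (hu : ∀ k, 0 ≤ u k)
    (hv : ∀ k, 0 ≤ v k) (ha : 0 ≤ a) (hb : 0 ≤ b) (h1 : HasSum (fun k => u k ^ 2) (a ^ 2))
    (h2 : HasSum (fun k => v k ^ 2) (b ^ 2)) :
    ∑' k, ENNReal.ofReal (u k * v k) ≤ ENNReal.ofReal (a * b) := by
  have h := Real.summable_and_inner_le_Lp_mul_Lq_tsum_of_nonneg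
    (Real.HolderConjugate.two_two) hu hv (by simpa using h1.summable) (by simpa using h2.summable)
  rw [← ENNReal.ofReal_tsum_of_nonneg (fun k => mul_nonneg (hu k) (hv k)) h.1]
  refine ENNReal.ofReal_le_ofReal (h.2.trans (le_of_eq ?_))
  have e1 : ∑' k, u k ^ (2 : ℝ) = a ^ 2 := by simpa using h1.tsum_eq
  have e2 : ∑' k, v k ^ (2 : ℝ) = b ^ 2 := by simpa using h2.tsum_eq
  rw [e1, e2, ← Real.sqrt_eq_rpow, ← Real.sqrt_eq_rpow, Real.sqrt_sq ha, Real.sqrt_sq hb]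

/-! ### The trace norm as a nuclear norm -/

section TraceNorm

variable {A B : Type*}

/-- The operator `φ ↦ ⟪y, φ⟫ x`. -/
def rankOne (x : L2 B) (y : L2 A) : L2 A →L[ℂ] L2 B := InnerProductSpace.rankOne ℂ x y

theorem rankOne_apply (x : L2 B) (y φ : L2 A) : rankOne x y φ = inner ℂ y φ • x := rfl

theorem hasSum_sq (φ : L2 A) : HasSum (fun a => ‖φ a‖ ^ 2) (‖φ‖ ^ 2) := by
  rw [norm_sq_eq]; exact (summable_sq φ).hasSum

/-- `f` is the sum of the operators `x k ⟪y k, ·⟫`. -/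
def IsNuclearSum {κ : Type*} (f : L2 A →L[ℂ] L2 B) (x : κ → L2 B) (y : κ → L2 A) : Prop :=
  ∀ φ, HasSum (fun k => rankOne (x k) (y k) φ) (f φ)

theorem rankOne_comp {C D : Type*} (S : L2 B →L[ℂ] L2 D) (T : L2 A →L[ℂ] L2 C) (x : L2 B)
    (y : L2 A) :
    S ∘L rankOne x y ∘L ContinuousLinearMap.adjoint T = rankOne (S x) (T y) := by
  refine ContinuousLinearMap.ext fun φ => ?_
  rw [ContinuousLinearMap.comp_apply, ContinuousLinearMap.comp_apply, rankOne_apply, rankOne_apply,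
    map_smul, ContinuousLinearMap.adjoint_inner_right]

theorem IsNuclearSum.comp {C D : Type*} {κ : Type*} {f : L2 A →L[ℂ] L2 B} {x : κ → L2 B}
    {y : κ → L2 A} (h : IsNuclearSum f x y) (S : L2 B →L[ℂ] L2 D) (T : L2 A →L[ℂ] L2 C) :
    IsNuclearSum (S ∘L f ∘L ContinuousLinearMap.adjoint T) (fun k => S (x k))
      (fun k => T (y k)) := fun φ => by
  have := (h (ContinuousLinearMap.adjoint T φ)).mapL S
  simp only [← rankOne_comp]
  exact this

theorem ofReal_norm_le_tsum {κ E : Type*} [NormedAddCommGroup E] {f : κ → E} {a : E}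
    (h : HasSum f a) : ENNReal.ofReal ‖a‖ ≤ ∑' k, ENNReal.ofReal ‖f k‖ := by
  by_cases hs : ∑' k, ENNReal.ofReal ‖f k‖ = ∞
  · rw [hs]; exact le_top
  have h1 : Summable fun k => ‖f k‖ := by
    have := ENNReal.summable_toReal hs
    simpa only [ENNReal.toReal_ofReal (norm_nonneg _)] using this
  rw [← ENNReal.ofReal_tsum_of_nonneg (fun k => norm_nonneg _) h1, ← h.tsum_eq]
  exact ENNReal.ofReal_le_ofReal (norm_tsum_le_tsum_norm h1)

/-- Write `|f| = w f` with a contraction `w`, expand the diagonal elements along the series, and use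
Cauchy–Schwarz over the basis in each term. -/
theorem traceNorm_le_of_isNuclearSum {κ : Type*} {f : L2 A →L[ℂ] L2 A} {x y : κ → L2 A}
    (h : IsNuclearSum f x y) :
    traceNorm f ≤ ∑' k, ENNReal.ofReal (‖x k‖ * ‖y k‖) := by
  obtain ⟨w, hw, hwf⟩ := exists_contraction (opAbs f) f fun x => (norm_opAbs_apply f x).le
  have h1 : ∀ a, ENNReal.ofReal (inner ℂ (ket a) (opAbs f (ket a))).re ≤
      ∑' k, ENNReal.ofReal (‖w (x k) a‖ * ‖y k a‖) := fun a => by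
    have h2 := (h (ket a)).mapL (innerSL ℂ (ket a) ∘L w)
    have h3 : ENNReal.ofReal (inner ℂ (ket a) (opAbs f (ket a))).re ≤
        ENNReal.ofReal ‖(innerSL ℂ (ket a) ∘L w) (f (ket a))‖ := by
      rw [ContinuousLinearMap.comp_apply, hwf]
      exact ENNReal.ofReal_le_ofReal (Complex.re_le_norm _)
    refine (h3.trans (ofReal_norm_le_tsum h2)).trans (le_of_eq (tsum_congr fun k => ?_))
    rw [ContinuousLinearMap.comp_apply, rankOne_apply, map_smul, innerSL_apply_apply, inner_smul_right,
      inner_ket_left, inner_ket_right, norm_mul, mul_comm, RCLike.norm_conj]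
  refine (ENNReal.tsum_le_tsum h1).trans ?_
  rw [ENNReal.tsum_comm]
  refine ENNReal.tsum_le_tsum fun k => ?_
  refine (tsum_ofReal_mul_le (fun _ => norm_nonneg _) (fun _ => norm_nonneg _) (norm_nonneg _)
    (norm_nonneg _) (hasSum_sq _) (hasSum_sq _)).trans ?_
  gcongr
  exact (w.le_opNorm _).trans (mul_le_of_le_one_left (norm_nonneg _) hw)

/-- With `f = u |f|`, inserting the basis between the two factors `|f|^{1/2}` gives a rank-one
series whose cost is at most the trace of `|f|`. Together with the preceding bound, this gives the
nuclear description of the trace norm from which the triangle inequality and the ideal property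
follow. -/
theorem exists_isNuclearSum (f : L2 A →L[ℂ] L2 A) :
    ∃ x y : A → L2 A, IsNuclearSum f x y ∧
      ∑' a, ENNReal.ofReal (‖x a‖ * ‖y a‖) ≤ traceNorm f := by
  obtain ⟨u, hu, huf⟩ := exists_contraction f (opAbs f) fun x => (norm_opAbs_apply f x).ge
  refine ⟨fun a => u (opSqrtAbs f (ket a)), fun a => opSqrtAbs f (ket a), fun φ => ?_, ?_⟩
  · have := (hasSum_ket (opSqrtAbs f φ)).mapL (u ∘L opSqrtAbs f)
    rw [ContinuousLinearMap.comp_apply, ← mul_apply_eq_comp (opSqrtAbs f), opSqrtAbs_mul_self,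
      huf] at this
    convert this using 2 with a
    rw [rankOne_apply, map_smul, ← inner_ket_left, ← ContinuousLinearMap.adjoint_inner_left,
      opSqrtAbs_adjoint]
    rfl
  · refine ENNReal.tsum_le_tsum fun a => ENNReal.ofReal_le_ofReal ?_
    refine le_trans ?_ (norm_opSqrtAbs_sq f (ket a)).le
    rw [sq]
    gcongr
    exact (u.le_opNorm _).trans (mul_le_of_le_one_left (norm_nonneg _) hu)

theorem traceNorm_rankOne_le (x y : L2 A) :
    traceNorm (rankOne x y) ≤ ENNReal.ofReal (‖x‖ * ‖y‖) := by
  refine (traceNorm_le_of_isNuclearSum (κ := Unit) (x := fun _ => x) (y := fun _ => y)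
    fun φ => hasSum_unique _).trans (le_of_eq ?_)
  simp

/-- The rank-one series of all `g k` are concatenated; if the right-hand side is finite the double
series converges absolutely and may be regrouped. -/
theorem traceNorm_le_tsum {κ : Type*} {f : L2 A →L[ℂ] L2 A} {g : κ → L2 A →L[ℂ] L2 A}
    (h : ∀ φ, HasSum (fun k => g k φ) (f φ)) : traceNorm f ≤ ∑' k, traceNorm (g k) := by
  by_cases hs : ∑' k, traceNorm (g k) = ∞
  · rw [hs]; exact le_top
  choose x y hxy hle using fun k => exists_isNuclearSum (g k)
  have hb : ∑' p : κ × A, ENNReal.ofReal (‖x p.1 p.2‖ * ‖y p.1 p.2‖) ≤ ∑' k, traceNorm (g k) := by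
    rw [ENNReal.tsum_prod (f := fun k a => ENNReal.ofReal (‖x k a‖ * ‖y k a‖))]
    exact ENNReal.tsum_le_tsum hle
  refine (traceNorm_le_of_isNuclearSum (κ := κ × A) (x := fun p => x p.1 p.2)
    (y := fun p => y p.1 p.2) fun φ => ?_).trans hb
  have hsm : Summable fun p : κ × A => ‖x p.1 p.2‖ * ‖y p.1 p.2‖ := by
    have := ENNReal.summable_toReal (ne_top_of_le_ne_top hs hb)
    simpa only [ENNReal.toReal_ofReal (mul_nonneg (norm_nonneg _) (norm_nonneg _))] using this
  have hsm2 : Summable fun p : κ × A => rankOne (x p.1 p.2) (y p.1 p.2) φ := by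
    refine Summable.of_norm_bounded (hsm.mul_right ‖φ‖) fun p => ?_
    rw [rankOne_apply, norm_smul]
    refine (mul_le_mul_of_nonneg_right (norm_inner_le_norm _ _) (norm_nonneg _)).trans
      (le_of_eq (by ring))
  have h2 := hsm2.hasSum.prod_fiberwise fun k => hxy k φ
  have h3 := hsm2.hasSum
  rw [h2.unique (h φ)] at h3
  exact h3

theorem traceNorm_comp_le (S T : L2 A →L[ℂ] L2 B) (f : L2 A →L[ℂ] L2 A) :
    traceNorm (S ∘L f ∘L ContinuousLinearMap.adjoint T) ≤
      ENNReal.ofReal (‖S‖ * ‖T‖) * traceNorm f := by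
  obtain ⟨x, y, hxy, hle⟩ := exists_isNuclearSum f
  refine (traceNorm_le_of_isNuclearSum (hxy.comp S T)).trans ?_
  refine le_trans ?_ (mul_le_mul_right hle _)
  rw [← ENNReal.tsum_mul_left]
  refine ENNReal.tsum_le_tsum fun a => ?_
  rw [← ENNReal.ofReal_mul (by positivity)]
  refine ENNReal.ofReal_le_ofReal ?_
  refine (mul_le_mul (S.le_opNorm _) (T.le_opNorm _) (norm_nonneg _) (by positivity)).trans
    (le_of_eq (by ring))

theorem ofReal_norm_le_traceNorm (f : L2 A →L[ℂ] L2 A) : ENNReal.ofReal ‖f‖ ≤ traceNorm f := by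
  obtain ⟨x, y, hxy, hle⟩ := exists_isNuclearSum f
  refine le_trans ?_ hle
  by_cases hs : ∑' a, ENNReal.ofReal (‖x a‖ * ‖y a‖) = ∞
  · rw [hs]; exact le_top
  refine ENNReal.ofReal_le_of_le_toReal (f.opNorm_le_bound ENNReal.toReal_nonneg fun φ => ?_)
  have hsm : Summable fun a => ‖x a‖ * ‖y a‖ := by
    have := ENNReal.summable_toReal hs
    simpa only [ENNReal.toReal_ofReal (mul_nonneg (norm_nonneg _) (norm_nonneg _))] using this
  rw [← ENNReal.ofReal_tsum_of_nonneg (fun a => mul_nonneg (norm_nonneg _) (norm_nonneg _)) hsm,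
    ENNReal.toReal_ofReal (tsum_nonneg fun a => mul_nonneg (norm_nonneg _) (norm_nonneg _)),
    ← (hxy φ).tsum_eq]
  refine tsum_of_norm_bounded (hsm.hasSum.mul_right ‖φ‖) fun a => ?_
  rw [rankOne_apply, norm_smul]
  refine (mul_le_mul_of_nonneg_right (norm_inner_le_norm _ _) (norm_nonneg _)).trans
    (le_of_eq (by ring))

theorem traceNorm_add_le (f g : L2 A →L[ℂ] L2 A) :
    traceNorm (f + g) ≤ traceNorm f + traceNorm g := by
  refine (traceNorm_le_tsum (κ := Bool) (g := fun b => cond b f g) fun φ => ?_).trans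
    (le_of_eq (by rw [tsum_bool, add_comm]; rfl))
  have := hasSum_fintype fun b : Bool => (cond b f g) φ
  rwa [Fintype.sum_bool] at this

theorem traceNorm_smul_le (c : ℂ) (f : L2 A →L[ℂ] L2 A) :
    traceNorm (c • f) ≤ ENNReal.ofReal ‖c‖ * traceNorm f := by
  obtain ⟨x, y, hxy, hle⟩ := exists_isNuclearSum f
  refine (traceNorm_le_of_isNuclearSum (x := fun a => c • x a) (y := y) fun φ => ?_).trans ?_
  · simp only [rankOne_apply, smul_comm _ c]
    exact (hxy φ).const_smul c
  · refine le_trans ?_ (mul_le_mul_right hle _)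
    rw [← ENNReal.tsum_mul_left]
    refine ENNReal.tsum_le_tsum fun a => ?_
    rw [← ENNReal.ofReal_mul (by positivity), norm_smul, mul_assoc]

theorem traceNorm_zero : traceNorm (0 : L2 A →L[ℂ] L2 A) = 0 :=
  le_antisymm ((traceNorm_le_tsum (κ := Empty) (g := fun _ => 0) fun φ => hasSum_empty).trans
    (by simp)) zero_le

end TraceNorm

/-! ### The Banach space of trace-class operators -/

section TC

variable {A : Type*}

/-- The submodule of trace-class operators. -/
def tcSubmodule (A : Type*) : Submodule ℂ (L2 A →L[ℂ] L2 A) where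
  carrier := {f | traceNorm f < ∞}
  add_mem' := fun hf hg => (traceNorm_add_le _ _).trans_lt (ENNReal.add_lt_top.2 ⟨hf, hg⟩)
  zero_mem' := by change traceNorm 0 < ∞; rw [traceNorm_zero]; exact ENNReal.zero_lt_top
  smul_mem' := fun c f hf =>
    (traceNorm_smul_le c f).trans_lt (ENNReal.mul_lt_top ENNReal.ofReal_lt_top hf)

/-- The Banach space of trace-class operators, with the trace norm. -/
def TC (A : Type*) : Type _ := tcSubmodule A

namespace TC

instance : AddCommGroup (TC A) := inferInstanceAs (AddCommGroup (tcSubmodule A))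
instance : Module ℂ (TC A) := inferInstanceAs (Module ℂ (tcSubmodule A))
instance : Norm (TC A) := ⟨fun f => (traceNorm f.1).toReal⟩

theorem norm_def (f : TC A) : ‖f‖ = (traceNorm f.1).toReal := rfl

theorem ofReal_norm (f : TC A) : ENNReal.ofReal ‖f‖ = traceNorm f.1 :=
  ENNReal.ofReal_toReal f.2.ne

theorem norm_le_of {f : TC A} {c : ℝ} (hc : 0 ≤ c) (h : traceNorm f.1 ≤ ENNReal.ofReal c) :
    ‖f‖ ≤ c := ENNReal.toReal_le_of_le_ofReal hc h

theorem opNorm_le (f : TC A) : ‖f.1‖ ≤ ‖f‖ :=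
  (ENNReal.ofReal_le_ofReal_iff ENNReal.toReal_nonneg).1
    ((ofReal_norm_le_traceNorm f.1).trans (ofReal_norm f).ge)

theorem norm_smul_le' (c : ℂ) (f : TC A) : ‖c • f‖ ≤ ‖c‖ * ‖f‖ := by
  refine norm_le_of (mul_nonneg (norm_nonneg _) ENNReal.toReal_nonneg) ?_
  rw [ENNReal.ofReal_mul (norm_nonneg _), ofReal_norm]
  exact traceNorm_smul_le c f.1

theorem core : NormedSpace.Core ℂ (TC A) where
  norm_nonneg _ := ENNReal.toReal_nonneg
  norm_smul c f := by
    refine le_antisymm (norm_smul_le' c f) ?_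
    rcases eq_or_ne c 0 with rfl | hc
    · rw [norm_zero, zero_mul]; exact ENNReal.toReal_nonneg
    · have := norm_smul_le' c⁻¹ (c • f)
      rw [inv_smul_smul₀ hc, norm_inv] at this
      rwa [← le_inv_mul_iff₀ (norm_pos_iff.2 hc)]
  norm_triangle f g := by
    refine norm_le_of (add_nonneg ENNReal.toReal_nonneg ENNReal.toReal_nonneg) ?_
    refine (traceNorm_add_le f.1 g.1).trans (le_of_eq ?_)
    rw [← ofReal_norm f, ← ofReal_norm g]
    exact (ENNReal.ofReal_add ENNReal.toReal_nonneg ENNReal.toReal_nonneg).symm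
  norm_eq_zero_iff f := by
    refine ⟨fun h => ?_, ?_⟩
    · have := opNorm_le f
      rw [h] at this
      exact Subtype.ext (norm_le_zero_iff.1 this)
    · rintro rfl
      rw [norm_def]
      change (traceNorm 0).toReal = 0
      rw [traceNorm_zero, ENNReal.toReal_zero]

instance : NormedAddCommGroup (TC A) := NormedAddCommGroup.ofCore core
instance : NormedSpace ℂ (TC A) := NormedSpace.ofCore core

/-- The inclusion of the trace-class operators into the bounded operators. -/
def toOp : TC A →L[ℂ] (L2 A →L[ℂ] L2 A) :=
  LinearMap.mkContinuous
    { toFun := fun f => f.1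
      map_add' := fun _ _ => rfl
      map_smul' := fun _ _ => rfl } 1 fun f => by rw [one_mul]; exact opNorm_le f

theorem toOp_injective : Function.Injective (toOp : TC A → _) := Subtype.val_injective

/-- An operator with finite trace norm, as an element of the Banach space. -/
def mk (f : L2 A →L[ℂ] L2 A) (h : traceNorm f < ∞) : TC A := ⟨f, h⟩

theorem ofReal_norm_eq (f : TC A) : ENNReal.ofReal ‖f‖ = traceNorm (toOp f) := ofReal_norm f

/-- An absolutely convergent series has a sum in operator norm. Countable subadditivity of the trace
norm bounds the sum, which is therefore trace class, and its tails. -/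
instance : CompleteSpace (TC A) := by
  refine NormedAddCommGroup.completeSpace_of_summable_imp_tendsto fun u hu => ?_
  have h0 : Summable fun n => toOp (u n) :=
    Summable.of_norm_bounded hu fun n => opNorm_le (u n)
  have hle : ∀ N, traceNorm (∑' n, toOp (u n) - ∑ n ∈ Finset.range N, toOp (u n)) ≤
      ENNReal.ofReal (∑' n, ‖u (n + N)‖) := fun N => by
    refine (traceNorm_le_tsum (g := fun n => toOp (u (n + N))) fun φ => ?_).trans ?_
    · have := ((hasSum_nat_add_iff' N).2 h0.hasSum).mapL (ContinuousLinearMap.apply ℂ _ φ)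
      exact this
    · rw [ENNReal.ofReal_tsum_of_nonneg (fun _ => norm_nonneg _) ((summable_nat_add_iff N).2 hu)]
      exact ENNReal.tsum_le_tsum fun n => (ofReal_norm_eq _).ge
  have hmem : traceNorm (∑' n, toOp (u n)) < ∞ := by
    have := hle 0
    rw [Finset.sum_range_zero, sub_zero] at this
    exact this.trans_lt ENNReal.ofReal_lt_top
  refine ⟨mk _ hmem, ?_⟩
  rw [tendsto_iff_norm_sub_tendsto_zero]
  have ht : Tendsto (fun N => ∑' n, ‖u (n + N)‖) atTop (𝓝 0) := tendsto_sum_nat_add fun n => ‖u n‖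
  refine squeeze_zero (fun _ => norm_nonneg _) (fun N => ?_) ht
  rw [norm_sub_rev]
  refine norm_le_of (tsum_nonneg fun _ => norm_nonneg _) ?_
  refine le_trans (le_of_eq (congrArg traceNorm ?_)) (hle N)
  change toOp (_ - _) = _
  rw [map_sub, map_sum]
  rfl

end TC

end TC

/-! ### Sesquilinear maps and real calculus -/

section Sesquilinear

variable {E F G : Type*} [NormedAddCommGroup E] [NormedSpace ℂ E]
  [NormedAddCommGroup F] [NormedSpace ℂ F] [NormedAddCommGroup G] [NormedSpace ℂ G]

/-- `b` is additive in both variables, linear in the first, conjugate linear in the second, and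
contractive. -/
structure IsSesquilinear (b : E → F → G) : Prop where
  add_left : ∀ x x' y, b (x + x') y = b x y + b x' y
  smul_left : ∀ (c : ℂ) x y, b (c • x) y = c • b x y
  add_right : ∀ x y y', b x (y + y') = b x y + b x y'
  smul_right : ∀ (c : ℂ) x y, b x (c • y) = starRingEnd ℂ c • b x y
  bound : ∀ x y, ‖b x y‖ ≤ ‖x‖ * ‖y‖

/-- Over `ℝ` conjugate linearity is linearity, so the calculus of bilinear maps applies to `⟪y, ·⟫
x`. -/
theorem IsSesquilinear.isBoundedBilinearMap {b : E → F → G} (h : IsSesquilinear b) :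
    IsBoundedBilinearMap ℝ fun p : E × F => b p.1 p.2 where
  add_left := h.add_left
  smul_left c x y := h.smul_left c x y
  add_right := h.add_right
  smul_right c x y := by
    refine (h.smul_right (c : ℂ) x y).trans ?_
    rw [Complex.conj_ofReal]
    rfl
  bound := ⟨1, one_pos, fun x y => by rw [one_mul]; exact h.bound x y⟩

theorem IsSesquilinear.continuous {X : Type*} [TopologicalSpace X] {b : E → F → G}
    (h : IsSesquilinear b) {x : X → E} {y : X → F} (hx : Continuous x) (hy : Continuous y) :
    Continuous fun τ => b (x τ) (y τ) :=
  h.isBoundedBilinearMap.continuous.comp (hx.prodMk hy)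

theorem IsSesquilinear.hasDerivAt {b : E → F → G} (hb : IsSesquilinear b)
    {x : ℝ → E} {y : ℝ → F} {x' : E} {y' : F} {t : ℝ} (hx : HasDerivAt x x' t)
    (hy : HasDerivAt y y' t) :
    HasDerivAt (fun τ => b (x τ) (y τ)) (b x' (y t) + b (x t) y') t := by
  have h := (hb.isBoundedBilinearMap.hasFDerivAt (x t, y t)).comp_hasDerivAt t (hx.prodMk hy)
  refine h.congr_deriv ?_
  rw [add_comm]
  rfl

end Sesquilinear

/-! ### Rank-one expansions, conjugation, and the trace -/

namespace TC

variable {A B C : Type*}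

/-- The trace-class operator `⟪y, ·⟫ x`. -/
def ro (x y : L2 A) : TC A :=
  mk (rankOne x y) ((traceNorm_rankOne_le x y).trans_lt ENNReal.ofReal_lt_top)

theorem norm_ro_le (x y : L2 A) : ‖ro x y‖ ≤ ‖x‖ * ‖y‖ :=
  norm_le_of (by positivity) (traceNorm_rankOne_le x y)

theorem isSesquilinear_ro : IsSesquilinear (ro : L2 A → L2 A → TC A) where
  add_left x x' y := toOp_injective (ContinuousLinearMap.ext fun φ =>
    smul_add (inner ℂ y φ) x x')
  smul_left c x y := toOp_injective (ContinuousLinearMap.ext fun φ =>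
    smul_comm (inner ℂ y φ) c x)
  add_right x y y' := by
    refine toOp_injective (ContinuousLinearMap.ext fun φ => ?_)
    refine Eq.trans ?_ (add_smul (inner ℂ y φ) (inner ℂ y' φ) x)
    rw [← inner_add_left]
    rfl
  smul_right c x y := by
    refine toOp_injective (ContinuousLinearMap.ext fun φ => ?_)
    change inner ℂ (c • y) φ • x = starRingEnd ℂ c • inner ℂ y φ • x
    rw [inner_smul_left, mul_smul]
  bound := norm_ro_le

/-- The nuclear series is absolutely summable in the complete trace norm; testing its sum on vectors
identifies it with `f`. Continuous linear maps on `TC A` are thus determined by rank-one operators.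
-/
theorem exists_hasSum_ro (f : TC A) : ∃ x y : A → L2 A,
    (Summable fun a => ‖x a‖ * ‖y a‖) ∧ ∑' a, ENNReal.ofReal (‖x a‖ * ‖y a‖) ≤ ENNReal.ofReal ‖f‖ ∧
      HasSum (fun a => ro (x a) (y a)) f := by
  obtain ⟨x, y, hxy, hle⟩ := exists_isNuclearSum (toOp f)
  rw [← ofReal_norm_eq] at hle
  have hsm : Summable fun a => ‖x a‖ * ‖y a‖ := by
    have := ENNReal.summable_toReal (ne_top_of_le_ne_top ENNReal.ofReal_ne_top hle)
    simpa only [ENNReal.toReal_ofReal (mul_nonneg (norm_nonneg _) (norm_nonneg _))] using this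
  have hs : Summable fun a => ro (x a) (y a) :=
    Summable.of_norm_bounded hsm fun a => norm_ro_le _ _
  refine ⟨x, y, hsm, hle, ?_⟩
  have h : ∑' a, ro (x a) (y a) = f := by
    refine toOp_injective (ContinuousLinearMap.ext fun φ => ?_)
    have h1 := hs.hasSum.mapL ((ContinuousLinearMap.apply ℂ (L2 A) φ) ∘L toOp)
    exact h1.unique (hxy φ)
  exact h ▸ hs.hasSum

theorem clm_ext {G : Type*} [NormedAddCommGroup G] [NormedSpace ℂ G] {S T : TC A →L[ℂ] G}
    (h : ∀ x y, S (ro x y) = T (ro x y)) : S = T := by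
  refine ContinuousLinearMap.ext fun f => ?_
  obtain ⟨x, y, -, -, hf⟩ := exists_hasSum_ro f
  have h1 := hf.mapL S
  simp only [h] at h1
  exact h1.unique (hf.mapL T)

/-- The map `f ↦ S f T†`. -/
def conj (S T : L2 A →L[ℂ] L2 B) : TC A →L[ℂ] TC B :=
  LinearMap.mkContinuous
    { toFun := fun f => mk (S ∘L toOp f ∘L ContinuousLinearMap.adjoint T)
        ((traceNorm_comp_le S T _).trans_lt (ENNReal.mul_lt_top ENNReal.ofReal_lt_top f.2))
      map_add' := fun f g => toOp_injective (ContinuousLinearMap.ext fun φ => map_add S _ _)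
      map_smul' := fun c f => toOp_injective (ContinuousLinearMap.ext fun φ => map_smul S c _) }
    (‖S‖ * ‖T‖) fun f => norm_le_of (by positivity)
      ((traceNorm_comp_le S T _).trans (le_of_eq (by
        rw [ENNReal.ofReal_mul (q := ‖f‖) (by positivity), ofReal_norm_eq])))

theorem toOp_conj (S T : L2 A →L[ℂ] L2 B) (f : TC A) :
    toOp (conj S T f) = S ∘L toOp f ∘L ContinuousLinearMap.adjoint T := rfl

theorem norm_conj_le (S T : L2 A →L[ℂ] L2 B) (f : TC A) : ‖conj S T f‖ ≤ ‖S‖ * ‖T‖ * ‖f‖ :=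
  (conj S T).le_of_opNorm_le (LinearMap.mkContinuous_norm_le _ (by positivity) _) f

theorem conj_ro (S T : L2 A →L[ℂ] L2 B) (x y : L2 A) : conj S T (ro x y) = ro (S x) (T y) :=
  toOp_injective (rankOne_comp S T x y)

/-- The operator `S f T`. -/
def mulLR (S T : L2 A →L[ℂ] L2 A) : TC A →L[ℂ] TC A := conj S (ContinuousLinearMap.adjoint T)

theorem toOp_mulLR (S T : L2 A →L[ℂ] L2 A) (f : TC A) : toOp (mulLR S T f) = S * toOp f * T := by
  rw [mulLR, toOp_conj, ContinuousLinearMap.adjoint_adjoint]; rfl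

theorem mulLR_ro (S T : L2 A →L[ℂ] L2 A) (x y : L2 A) :
    mulLR S T (ro x y) = ro (S x) (ContinuousLinearMap.adjoint T y) := conj_ro _ _ x y

theorem tsum_diag_le (f : TC A) :
    ∑' a, ENNReal.ofReal ‖toOp f (ket a) a‖ ≤ ENNReal.ofReal ‖f‖ := by
  obtain ⟨x, y, -, hle, hf⟩ := exists_hasSum_ro f
  refine le_trans ?_ hle
  have h1 : ∀ a, ENNReal.ofReal ‖toOp f (ket a) a‖ ≤ ∑' k, ENNReal.ofReal (‖x k a‖ * ‖y k a‖) := by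
    intro a
    have h := hf.mapL ((innerSL ℂ (ket a)) ∘L (ContinuousLinearMap.apply ℂ (L2 A) (ket a)) ∘L toOp)
    have h' := ofReal_norm_le_tsum h
    have e : ((innerSL ℂ (ket a)) ∘L (ContinuousLinearMap.apply ℂ (L2 A) (ket a)) ∘L toOp) f =
      toOp f (ket a) a := inner_ket_left a _
    rw [e] at h'
    refine h'.trans (le_of_eq (tsum_congr fun k => ?_))
    change ENNReal.ofReal ‖inner ℂ (ket a) (inner ℂ (y k) (ket a) • x k)‖ = _
    rw [inner_smul_right, inner_ket_left, inner_ket_right, norm_mul, mul_comm, RCLike.norm_conj]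
  refine (ENNReal.tsum_le_tsum h1).trans ?_
  rw [ENNReal.tsum_comm]
  exact ENNReal.tsum_le_tsum fun k => tsum_ofReal_mul_le (fun _ => norm_nonneg _)
    (fun _ => norm_nonneg _) (norm_nonneg _) (norm_nonneg _) (hasSum_sq _) (hasSum_sq _)

theorem summable_diag (f : TC A) : Summable fun a => ‖toOp f (ket a) a‖ := by
  have := ENNReal.summable_toReal (ne_top_of_le_ne_top ENNReal.ofReal_ne_top (tsum_diag_le f))
  simpa only [ENNReal.toReal_ofReal (norm_nonneg _)] using this

/-- The trace. -/
def tr : TC A →L[ℂ] ℂ :=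
  LinearMap.mkContinuous
    { toFun := fun f => ∑' a, toOp f (ket a) a
      map_add' := fun f g => (summable_diag f).of_norm.tsum_add (summable_diag g).of_norm
      map_smul' := fun c f => tsum_mul_left } 1 fun f => by
    rw [one_mul, ← ENNReal.ofReal_le_ofReal_iff (norm_nonneg _)]
    exact (ofReal_norm_le_tsum (summable_diag f).of_norm.hasSum).trans (tsum_diag_le f)

theorem tr_ro (x y : L2 A) : tr (ro x y) = inner ℂ y x := by
  change ∑' a, rankOne x y (ket a) a = _
  rw [lp.inner_eq_tsum]
  refine tsum_congr fun a => ?_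
  change inner ℂ y (ket a) * x a = inner ℂ (y a) (x a)
  rw [inner_ket_right, mul_comm]
  rfl

theorem tr_mulLR_comm (T : L2 A →L[ℂ] L2 A) (f : TC A) : tr (mulLR T 1 f) = tr (mulLR 1 T f) := by
  have h : tr ∘L mulLR T 1 = tr ∘L mulLR 1 T := clm_ext fun x y => by
    rw [ContinuousLinearMap.comp_apply, ContinuousLinearMap.comp_apply, mulLR_ro, mulLR_ro, tr_ro,
      tr_ro, ContinuousLinearMap.adjoint_inner_left]
    exact (ContinuousLinearMap.adjoint_inner_left T x y).symm
  exact congrArg (fun L : TC A →L[ℂ] ℂ => L f) h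

theorem tr_rankOne_mul (u v : L2 A) (f : TC A) :
    tr (mulLR (rankOne u v) 1 f) = inner ℂ v (toOp f u) := by
  have h : tr ∘L mulLR (rankOne u v) 1 =
      (innerSL ℂ v) ∘L (ContinuousLinearMap.apply ℂ (L2 A) u) ∘L toOp := clm_ext fun x y => by
    rw [ContinuousLinearMap.comp_apply, mulLR_ro, tr_ro]
    change inner ℂ (ContinuousLinearMap.adjoint 1 y) (inner ℂ v x • u) =
      inner ℂ v (inner ℂ y u • x)
    rw [ContinuousLinearMap.adjoint_inner_left, inner_smul_right, one_apply_eq_self,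
      inner_smul_right, mul_comm]
  exact congrArg (fun L : TC A →L[ℂ] ℂ => L f) h

/-- Testing with rank-one `T` recovers every matrix element. This duality reduces identities for the
partial trace to identities for `lift`. -/
theorem ext_tr {f g : TC A} (h : ∀ T, tr (mulLR T 1 f) = tr (mulLR T 1 g)) : f = g := by
  refine toOp_injective (ContinuousLinearMap.ext fun u => ext_inner_left ℂ fun v => ?_)
  rw [← tr_rankOne_mul, ← tr_rankOne_mul, h]

theorem mulLR_mulLR (S T S' T' : L2 A →L[ℂ] L2 A) (f : TC A) :
    mulLR S T (mulLR S' T' f) = mulLR (S * S') (T' * T) f :=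
  toOp_injective (by simp only [toOp_mulLR, mul_assoc])

theorem tr_mulLR (S T : L2 A →L[ℂ] L2 A) (f : TC A) :
    tr (mulLR S T f) = tr (mulLR (T * S) 1 f) := by
  have h : mulLR S T f = mulLR 1 T (mulLR S 1 f) := by rw [mulLR_mulLR, one_mul, one_mul]
  rw [h, ← tr_mulLR_comm, mulLR_mulLR, one_mul]

/-- On a rank-one operator only two vectors move, continuously in norm, and the rank-one series is
dominated uniformly in `t`. Strong continuity of the groups thus becomes continuity in trace norm.
-/
theorem strongCont_conj {X : Type*} [TopologicalSpace X] {S T : X → L2 A →L[ℂ] L2 B}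
    (hS : StrongCont S) (hT : StrongCont T) {c d : ℝ} (hc : ∀ t, ‖S t‖ ≤ c) (hd : ∀ t, ‖T t‖ ≤ d) :
    StrongCont fun t => conj (S t) (T t) := by
  intro f
  obtain ⟨x, y, hs, -, hf⟩ := exists_hasSum_ro f
  have h : ∀ t, conj (S t) (T t) f = ∑' a, ro (S t (x a)) (T t (y a)) := fun t => by
    have := hf.mapL (conj (S t) (T t))
    simp only [conj_ro] at this
    exact this.tsum_eq.symm
  simp only [h]
  refine continuous_tsum (fun a => ?_) (hs.mul_left (c * d)) fun a t => ?_
  · exact isSesquilinear_ro.continuous (hS (x a)) (hT (y a))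
  · refine (norm_ro_le _ _).trans ?_
    have h0 : 0 ≤ c := (norm_nonneg _).trans (hc t)
    refine (mul_le_mul ((S t).le_of_opNorm_le (hc t) _) ((T t).le_of_opNorm_le (hd t) _)
      (norm_nonneg _) (by positivity)).trans (le_of_eq (by ring))

/-- The same reduction to vectors, now with termwise differentiation of the rank-one series; the
uniform bounds on `S'` and `T'` dominate the derivatives. -/
theorem strongC1_conj {S S' T T' : ℝ → L2 A →L[ℂ] L2 B} (hS : StrongC1 S S') (hT : StrongC1 T T')
    {c d c' d' : ℝ} (hc : ∀ t, ‖S t‖ ≤ c) (hd : ∀ t, ‖T t‖ ≤ d) (hc' : ∀ t, ‖S' t‖ ≤ c')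
    (hd' : ∀ t, ‖T' t‖ ≤ d') :
    StrongC1 (fun t => conj (S t) (T t)) (fun t => conj (S' t) (T t) + conj (S t) (T' t)) := by
  refine ⟨fun f t => ?_, (strongCont_conj hS.cont hT.strongCont hc' hd).add
    (strongCont_conj hS.strongCont hT.cont hc hd')⟩
  obtain ⟨x, y, hs, -, hf⟩ := exists_hasSum_ro f
  have h : ∀ t, HasSum (fun a => ro (S t (x a)) (T t (y a))) (conj (S t) (T t) f) := fun t => by
    have := hf.mapL (conj (S t) (T t))
    simpa only [conj_ro] using this
  have h' : HasSum (fun a => ro (S' t (x a)) (T t (y a)) + ro (S t (x a)) (T' t (y a)))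
      (conj (S' t) (T t) f + conj (S t) (T' t) f) := by
    have h1 := hf.mapL (conj (S' t) (T t))
    have h2 := hf.mapL (conj (S t) (T' t))
    simp only [conj_ro] at h1 h2
    exact h1.add h2
  have h0 : 0 ≤ c := (norm_nonneg _).trans (hc t)
  have h0' : 0 ≤ c' := (norm_nonneg _).trans (hc' t)
  have hsum := hasDerivAt_tsum (𝕜 := ℝ) (y₀ := t) (hs.mul_left (c' * d + c * d'))
    (g := fun a t => ro (S t (x a)) (T t (y a)))
    (g' := fun a t => ro (S' t (x a)) (T t (y a)) + ro (S t (x a)) (T' t (y a)))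
    (fun a s => isSesquilinear_ro.hasDerivAt (hS.deriv (x a) s) (hT.deriv (y a) s))
    (fun a s => by
      refine (norm_add_le _ _).trans ?_
      rw [add_mul]
      refine add_le_add ((norm_ro_le _ _).trans ?_) ((norm_ro_le _ _).trans ?_)
      · refine (mul_le_mul ((S' s).le_of_opNorm_le (hc' s) _) ((T s).le_of_opNorm_le (hd s) _)
          (norm_nonneg _) (by positivity)).trans (le_of_eq (by ring))
      · refine (mul_le_mul ((S s).le_of_opNorm_le (hc s) _) ((T' s).le_of_opNorm_le (hd' s) _)
          (norm_nonneg _) (by positivity)).trans (le_of_eq (by ring))) (h t).summable t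
  refine (hsum.congr_deriv h'.tsum_eq).congr_of_eventuallyEq (Eventually.of_forall fun s => ?_)
  exact (h s).tsum_eq.symm

end TC

/-! ### The partial trace and its duality with `lift` -/

namespace TC

variable {ι α β γ : Type*}

theorem hasSum_inner_fibre (e : α ↪ β) (φ χ : L2 (β → ι)) :
    HasSum (fun r => inner ℂ (pull (fibre e r) φ) (pull (fibre e r) χ)) (inner ℂ φ χ) :=
  HasSum.prod_fiberwise (β := {x // x ∉ Set.range e} → ι) (γ := α → ι)
    ((splitEquiv e).hasSum_iff.2 (lp.hasSum_inner φ χ)) fun r =>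
      lp.hasSum_inner (pull (fibre e r) φ) (pull (fibre e r) χ)

theorem tsum_ptr_le (e : α ↪ β) (f : TC (β → ι)) :
    ∑' r, ENNReal.ofReal ‖conj (pull (fibre e r)) (pull (fibre e r)) f‖ ≤ ENNReal.ofReal ‖f‖ := by
  obtain ⟨x, y, -, hle, hf⟩ := exists_hasSum_ro f
  have h1 : ∀ r, ENNReal.ofReal ‖conj (pull (fibre e r)) (pull (fibre e r)) f‖ ≤
      ∑' a, ENNReal.ofReal (‖pull (fibre e r) (x a)‖ * ‖pull (fibre e r) (y a)‖) := fun r => by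
    have h2 := hf.mapL (conj (pull (fibre e r)) (pull (fibre e r)))
    refine (ofReal_norm_le_tsum h2).trans (ENNReal.tsum_le_tsum fun a => ?_)
    rw [conj_ro]
    exact ENNReal.ofReal_le_ofReal (norm_ro_le _ _)
  refine (ENNReal.tsum_le_tsum h1).trans (le_trans ?_ hle)
  rw [ENNReal.tsum_comm]
  exact ENNReal.tsum_le_tsum fun a => tsum_ofReal_mul_le (fun _ => norm_nonneg _)
    (fun _ => norm_nonneg _) (norm_nonneg _) (norm_nonneg _) (hasSum_norm_fibre e _)
    (hasSum_norm_fibre e _)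

theorem summable_ptr (e : α ↪ β) (f : TC (β → ι)) :
    Summable fun r => conj (pull (fibre e r)) (pull (fibre e r)) f := by
  have := ENNReal.summable_toReal (ne_top_of_le_ne_top ENNReal.ofReal_ne_top (tsum_ptr_le e f))
  simp only [ENNReal.toReal_ofReal (norm_nonneg _)] at this
  exact this.of_norm

/-- The partial trace over all particles outside the image of `e`. -/
def ptr (e : α ↪ β) : TC (β → ι) →L[ℂ] TC (α → ι) :=
  LinearMap.mkContinuous
    { toFun := fun f => ∑' r, conj (pull (fibre e r)) (pull (fibre e r)) f
      map_add' := fun f g => by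
        simp only [map_add]
        exact (summable_ptr e f).tsum_add (summable_ptr e g)
      map_smul' := fun c f => by
        simp only [map_smul]
        exact (summable_ptr e f).tsum_const_smul c } 1 fun f => by
    rw [one_mul, ← ENNReal.ofReal_le_ofReal_iff (norm_nonneg _)]
    exact (ofReal_norm_le_tsum (summable_ptr e f).hasSum).trans (tsum_ptr_le e f)

theorem hasSum_ptr (e : α ↪ β) (f : TC (β → ι)) :
    HasSum (fun r => conj (pull (fibre e r)) (pull (fibre e r)) f) (ptr e f) :=
  (summable_ptr e f).hasSum

theorem norm_ptr_le (e : α ↪ β) (f : TC (β → ι)) : ‖ptr e f‖ ≤ ‖f‖ := by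
  have := (ptr e).le_of_opNorm_le (LinearMap.mkContinuous_norm_le _ zero_le_one _) f
  rwa [one_mul] at this

theorem tr_mulLR_ro (T : L2 α →L[ℂ] L2 α) (x y : L2 α) :
    tr (mulLR T 1 (ro x y)) = inner ℂ y (T x) := by
  rw [mulLR_ro, tr_ro, ContinuousLinearMap.adjoint_inner_left, one_apply_eq_self]

/-- The partial trace is dual to `T ↦ T ⊗ 1`. On rank-one operators this is the decomposition of an
inner product into fibres, in each of which `lift e T` acts as `T`. -/
theorem tr_ptr (e : α ↪ β) (T : L2 (α → ι) →L[ℂ] L2 (α → ι)) (f : TC (β → ι)) :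
    tr (mulLR T 1 (ptr e f)) = tr (mulLR (lift e T) 1 f) := by
  have h : (tr ∘L mulLR T 1) ∘L ptr e = tr ∘L mulLR (lift e T) 1 := clm_ext fun x y => by
    have h1 := (hasSum_ptr e (ro x y)).mapL (tr ∘L mulLR T 1)
    have h2 : ∀ r, (tr ∘L mulLR T 1) (conj (pull (fibre e r)) (pull (fibre e r)) (ro x y)) =
        inner ℂ (pull (fibre e r) y) (pull (fibre e r) (lift e T x)) := fun r => by
      rw [conj_ro, ContinuousLinearMap.comp_apply, tr_mulLR_ro, pull_fibre_lift]
    rw [funext h2] at h1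
    refine (h1.unique (hasSum_inner_fibre e y _)).trans ?_
    rw [ContinuousLinearMap.comp_apply, tr_mulLR_ro]
  exact congrArg (fun L : TC (β → ι) →L[ℂ] ℂ => L f) h

theorem ptr_trans (e' : α ↪ β) (e : β ↪ γ) (f : TC (γ → ι)) :
    ptr e' (ptr e f) = ptr (e'.trans e) f :=
  ext_tr fun T => by rw [tr_ptr, tr_ptr, tr_ptr, lift_trans]

theorem ptr_refl (f : TC (α → ι)) : ptr (Function.Embedding.refl α) f = f :=
  ext_tr fun T => by
    have h : lift (Function.Embedding.refl α) T = T := by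
      ext φ k
      change T (pull (overwrite (Function.Embedding.refl α) k) φ) k = T φ k
      refine apply_congr T (fun m => ?_) k
      rw [pull_apply]
      exact congrArg φ (funext fun a => overwrite_apply_mem (Function.Embedding.refl α) k m a)
    rw [tr_ptr, h]

theorem ptr_mulLR_lift (e : α ↪ β) (S T : L2 (α → ι) →L[ℂ] L2 (α → ι)) (f : TC (β → ι)) :
    ptr e (mulLR (lift e S) (lift e T) f) = mulLR S T (ptr e f) :=
  ext_tr fun R => by
    rw [tr_ptr, mulLR_mulLR, mulLR_mulLR, tr_mulLR, tr_mulLR (R * S), tr_ptr]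
    simp only [lift_mul, mul_one]

/-- Cyclicity of the full trace, tested against `lift e T`, lets an operator of the traced-out
particles pass from one side to the other. -/
theorem ptr_mul_comm (e : α ↪ β) {Q : L2 (β → ι) →L[ℂ] L2 (β → ι)}
    (hQ : ∀ T, Commute Q (lift e T)) (f : TC (β → ι)) :
    ptr e (mulLR Q 1 f) = ptr e (mulLR 1 Q f) :=
  ext_tr fun T => by
    rw [tr_ptr, tr_ptr, mulLR_mulLR, mulLR_mulLR, tr_mulLR _ (Q * _), ← (hQ T).eq]
    simp only [mul_one]

theorem ptr_mulLR_cancel (e : α ↪ β) {Q Q' : L2 (β → ι) →L[ℂ] L2 (β → ι)}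
    (hQ : ∀ T, Commute Q (lift e T)) (h1 : Q' * Q = 1) (S T : L2 (β → ι) →L[ℂ] L2 (β → ι))
    (f : TC (β → ι)) : ptr e (mulLR (Q * S) (T * Q') f) = ptr e (mulLR S T f) := by
  have h : mulLR (Q * S) (T * Q') f = mulLR Q 1 (mulLR S (T * Q') f) := by
    rw [mulLR_mulLR, mul_one]
  rw [h, ptr_mul_comm e hQ, mulLR_mulLR, one_mul, mul_assoc, h1, mul_one]

/-- The permutation symmetry of a trace-class operator. -/
def Symm (f : TC (α → ι)) : Prop := ∀ σ : Equiv.Perm α, lift σ.toEmbedding (toOp f) = toOp f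

theorem toOp_mulLR_perm (σ : Equiv.Perm α) (f : TC (α → ι)) :
    toOp (mulLR (permOp σ) (permOp σ.symm) f) = lift σ.toEmbedding (toOp f) := by
  rw [toOp_mulLR, lift_perm]

theorem ptr_perm (e : α ↪ β) (σ : Equiv.Perm β) (f : TC (β → ι)) :
    ptr e (mulLR (permOp σ) (permOp σ.symm) f) = ptr (e.trans σ.symm.toEmbedding) f :=
  ext_tr fun T => by
    rw [tr_ptr, tr_ptr, mulLR_mulLR, tr_mulLR, ← lift_trans, lift_perm, Equiv.symm_symm, mul_one,
      mul_assoc]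

theorem Symm.ptr_eq {f : TC (β → ι)} (hf : Symm f) (e : α ↪ β) (σ : Equiv.Perm β) :
    ptr (e.trans σ.toEmbedding) f = ptr e f := by
  have h := ptr_perm e σ.symm f
  rw [show mulLR (permOp σ.symm) (permOp σ.symm.symm) f = f from
    toOp_injective ((toOp_mulLR_perm σ.symm f).trans (hf σ.symm))] at h
  exact h.symm

/-- Permutations act transitively on embeddings, so for a symmetric operator it is immaterial which
particles are traced out. -/
theorem Symm.ptr_eq_ptr {n N : ℕ} {f : TC (Fin N → ι)} (hf : Symm f) (e e' : Fin n ↪ Fin N) :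
    ptr e f = ptr e' f := by
  have := Equiv.Perm.isMultiplyPretransitive (Fin N) n
  obtain ⟨σ, hσ⟩ := MulAction.exists_smul_eq (Equiv.Perm (Fin N)) e e'
  rw [← hσ]
  exact (hf.ptr_eq e σ).symm

theorem lift_perm_toOp_ptr (e : α ↪ β) (σ : Equiv.Perm α) (f : TC (β → ι)) :
    lift σ.toEmbedding (toOp (ptr e f)) = toOp (ptr (σ.symm.toEmbedding.trans e) f) := by
  rw [← toOp_mulLR_perm, ← ptr_trans]
  refine congrArg toOp ?_
  have h := ptr_perm (Function.Embedding.refl α) σ (ptr e f)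
  rw [ptr_refl] at h
  exact h

theorem Symm.ptr {n N : ℕ} {f : TC (Fin N → ι)} (hf : Symm f) (e : Fin n ↪ Fin N) :
    Symm (ptr e f) := fun σ => by
  rw [lift_perm_toOp_ptr, hf.ptr_eq_ptr _ e]

/-- States of the last `n` particles correspond to configurations outside the first `s`. This
identifies the partial trace defined by `Fin.append` with the one defined by fibres. -/
theorem fibre_castAdd (s n : ℕ) : ∃ E : (Fin n → ι) ≃ ({x // x ∉ Set.range (Fin.castAddEmb n :
    Fin s ↪ Fin (s + n))} → ι), ∀ r, appendEmb s n r = fibre (Fin.castAddEmb n) (E r) := by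
  let E0 : Fin n ≃ {x // x ∉ Set.range (Fin.castAddEmb n : Fin s ↪ Fin (s + n))} :=
    Equiv.ofBijective (fun i => ⟨Fin.natAdd s i, by
      rintro ⟨j, hj⟩
      have := congrArg Fin.val hj
      simp at this
      omega⟩) ⟨fun i j h => by simpa using congrArg (fun x => x.1) h, fun ⟨x, hx⟩ => by
        induction x using Fin.addCases with
        | left i => exact absurd ⟨i, rfl⟩ hx
        | right i => exact ⟨i, rfl⟩⟩
  refine ⟨E0.arrowCongr (Equiv.refl ι), fun r => ?_⟩
  ext m x
  have h := overwrite_splitEquiv (Fin.castAddEmb n) (E0.arrowCongr (Equiv.refl ι) r) m m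
  change Fin.append m r x = splitEquiv _ (_, m) x
  induction x using Fin.addCases with
  | left i =>
    rw [Fin.append_left]
    exact (congrFun (splitEquiv_comp (Fin.castAddEmb n) (E0.arrowCongr (Equiv.refl ι) r) m) i).symm
  | right i =>
    rw [Fin.append_right]
    have h2 := (E0 i).2
    have h3 := congrFun (congrArg Prod.fst ((splitEquiv (Fin.castAddEmb n)).symm_apply_apply
      (E0.arrowCongr (Equiv.refl ι) r, m))) (E0 i)
    refine Eq.trans ?_ h3.symm
    change r i = r (E0.symm (E0 i))
    rw [Equiv.symm_apply_apply]

theorem traceOut_toOp (s n : ℕ) (f : TC (Fin (s + n) → ι)) :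
    traceOut s n (toOp f) = toOp (ptr (Fin.castAddEmb n) f) := by
  obtain ⟨E, hE⟩ := fibre_castAdd (ι := ι) s n
  have h := (hasSum_ptr (Fin.castAddEmb n) f).mapL toOp
  rw [← h.tsum_eq, ← E.tsum_eq]
  refine tsum_congr fun r => ?_
  rw [hE, toOp_conj]

end TC

/-! ### Sums over set partitions -/

section Partitions

variable {τ : Type*} [DecidableEq τ]

theorem sup_erase_parts {S X : Finset τ} (P : Finpartition S) (hX : X ∈ P.parts) :
    (P.parts.erase X).sup id = S \ X := by
  ext a
  rw [Finset.mem_sup, Finset.mem_sdiff]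
  constructor
  · rintro ⟨Y, hY, ha⟩
    rw [Finset.mem_erase] at hY
    exact ⟨P.le hY.2 ha, fun h => hY.1 (P.eq_of_mem_parts hY.2 hX ha h)⟩
  · rintro ⟨ha, haX⟩
    refine ⟨P.part a, Finset.mem_erase.2 ⟨?_, P.part_mem.2 ha⟩, P.mem_part ha⟩
    rintro rfl
    exact haX (P.mem_part ha)

/-- Removing the block `X` is a bijection onto the partitions of `S \ X`, and it lowers the number
of blocks by one. -/
theorem sum_finpartition_of_mem {W : Type*} [AddCommMonoid W] {S X : Finset τ} (hX : X.Nonempty)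
    (hXS : X ⊆ S) (a : ℕ → W) :
    ∑ P : Finpartition S with X ∈ P.parts, a P.parts.card =
      ∑ P : Finpartition (S \ X), a (P.parts.card + 1) := by
  have hX' : ∀ P : Finpartition (S \ X), X ∉ P.parts := fun P h => by
    obtain ⟨x, hx⟩ := hX
    exact (Finset.mem_sdiff.1 (P.le h hx)).2 hx
  have hb : X ≠ ⊥ := hX.ne_empty
  have hd : Disjoint (S \ X) X := Finset.sdiff_disjoint
  have hs : (S \ X) ⊔ X = S := Finset.sdiff_union_of_subset hXS
  refine Finset.sum_bij' (fun P hP => P.ofSubset (Finset.erase_subset X P.parts)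
      (sup_erase_parts P (Finset.mem_filter.1 hP).2))
    (fun P _ => P.extend hb hd hs) (fun _ _ => Finset.mem_univ _) (fun P _ => ?_) (fun P hP => ?_)
    (fun P _ => ?_) fun P hP => ?_
  · exact Finset.mem_filter.2 ⟨Finset.mem_univ _, Finset.mem_insert_self _ _⟩
  · exact Finpartition.ext (Finset.insert_erase (Finset.mem_filter.1 hP).2)
  · exact Finpartition.ext (Finset.erase_insert (hX' P))
  · congr 1
    exact (Finset.card_erase_add_one (Finset.mem_filter.1 hP).2).symm

/-- Since `|P|! = |P| · (|P| - 1)!`, one block may be marked and removed. The sum `c` then satisfies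
`c(S) = -∑ c(S \ X)` over nonempty `X ⊆ S`, and so does `(-1)^{|S|}`, because the alternating sum
over all subsets of a nonempty set vanishes. -/
theorem sum_finpartition_factorial (S : Finset τ) :
    ∑ P : Finpartition S, (-1 : ℂ) ^ P.parts.card * (P.parts.card.factorial : ℂ) =
      (-1) ^ S.card := by
  induction S using Finset.strongInduction with
  | H S ih =>
  rcases S.eq_empty_or_nonempty with rfl | hS
  · have : Unique (Finpartition (∅ : Finset τ)) := inferInstanceAs (Unique (Finpartition ⊥))
    rw [Fintype.sum_unique]
    have h : (default : Finpartition (∅ : Finset τ)).parts = ∅ :=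
      (Finpartition.parts_eq_empty_iff).2 rfl
    simp [h]
  have h1 : ∀ P : Finpartition S, (-1 : ℂ) ^ P.parts.card * (P.parts.card.factorial : ℂ) =
      ∑ X ∈ S.powerset with X ∈ P.parts,
        (-1 : ℂ) ^ P.parts.card * ((P.parts.card - 1).factorial : ℂ) := fun P => by
    have h2 : S.powerset.filter (fun X => X ∈ P.parts) = P.parts := by
      ext X
      rw [Finset.mem_filter, Finset.mem_powerset]
      exact ⟨fun h => h.2, fun h => ⟨P.le h, h⟩⟩
    have h3 : 0 < P.parts.card := Finset.card_pos.2 (P.parts_nonempty hS.ne_empty)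
    rw [h2, Finset.sum_const, nsmul_eq_mul, ← Nat.mul_factorial_pred h3.ne']
    push_cast
    ring
  simp only [h1, Finset.sum_filter]
  rw [Finset.sum_comm]
  -- The empty set is no block, so its term is zero; the correction for `X = ∅` makes the right-hand
  -- side zero as well and lets the sum run over the whole power set.
  have h4 : ∀ X ∈ S.powerset, (∑ P : Finpartition S, if X ∈ P.parts then
      (-1 : ℂ) ^ P.parts.card * ((P.parts.card - 1).factorial : ℂ) else 0) =
      (if X = ∅ then (-1) ^ S.card else 0) - (-1 : ℂ) ^ (S \ X).card := fun X hX => by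
    rw [← Finset.sum_filter]
    rcases X.eq_empty_or_nonempty with rfl | hne
    · rw [if_pos rfl, Finset.sdiff_empty, sub_self]
      exact Finset.sum_eq_zero fun P hP =>
        absurd (Finset.mem_filter.1 hP).2 P.empty_notMem_parts
    · rw [if_neg hne.ne_empty, sum_finpartition_of_mem hne (Finset.mem_powerset.1 hX)
        (fun m => (-1 : ℂ) ^ m * ((m - 1).factorial : ℂ)),
        ← ih (S \ X) (Finset.sdiff_ssubset (Finset.mem_powerset.1 hX) hne), zero_sub,
        ← Finset.sum_neg_distrib]
      refine Finset.sum_congr rfl fun P _ => ?_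
      rw [Nat.add_sub_cancel]
      ring
  rw [Finset.sum_congr rfl h4, Finset.sum_sub_distrib]
  have h5 : ∑ X ∈ S.powerset, (-1 : ℂ) ^ (S \ X).card = 0 := by
    have h6 : ∑ X ∈ S.powerset, (-1 : ℂ) ^ (S \ X).card = ∑ X ∈ S.powerset, (-1 : ℂ) ^ X.card :=
      Finset.sum_nbij' (fun X => S \ X) (fun X => S \ X)
        (fun X _ => Finset.mem_powerset.2 Finset.sdiff_subset)
        (fun X _ => Finset.mem_powerset.2 Finset.sdiff_subset)
        (fun X hX => Finset.sdiff_sdiff_eq_self (Finset.mem_powerset.1 hX))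
        (fun X hX => Finset.sdiff_sdiff_eq_self (Finset.mem_powerset.1 hX)) fun X _ => rfl
    rw [h6]
    exact_mod_cast congrArg (Int.cast : ℤ → ℂ) (Finset.sum_powerset_neg_one_pow_card_of_nonempty hS)
  rw [h5, sub_zero, Finset.sum_ite_eq' S.powerset ∅, if_pos (Finset.empty_mem_powerset S)]

/-- Partitions are grouped by the block containing `a`. The other blocks form a partition of the
complement into `|P| - 1` blocks, so the cumulant weight is exactly the one summed in
`sum_finpartition_factorial`. -/
theorem sum_finpartition_part {W : Type*} [AddCommGroup W] [Module ℂ W] {S : Finset τ} {a : τ}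
    (ha : a ∈ S) (φ : Finset τ → W) :
    ∑ P : Finpartition S, ((-1 : ℂ) ^ (P.parts.card - 1) * ((P.parts.card - 1).factorial : ℂ)) •
        φ (P.part a) =
      ∑ X ∈ S.powerset with a ∈ X, (-1 : ℂ) ^ (S \ X).card • φ X := by
  have h1 : ∀ P : Finpartition S,
      ((-1 : ℂ) ^ (P.parts.card - 1) * ((P.parts.card - 1).factorial : ℂ)) • φ (P.part a) =
      ∑ X ∈ S.powerset with a ∈ X, if X ∈ P.parts then
        ((-1 : ℂ) ^ (P.parts.card - 1) * ((P.parts.card - 1).factorial : ℂ)) • φ X else 0 :=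
    fun P => by
    rw [← Finset.sum_filter, Finset.filter_filter]
    have h2 : S.powerset.filter (fun X => a ∈ X ∧ X ∈ P.parts) = {P.part a} := by
      ext X
      rw [Finset.mem_filter, Finset.mem_singleton]
      constructor
      · rintro ⟨-, h3, h4⟩
        exact (P.part_eq_of_mem h4 h3).symm
      · rintro rfl
        exact ⟨Finset.mem_powerset.2 (P.part_subset a), P.mem_part ha, P.part_mem.2 ha⟩
    rw [h2, Finset.sum_singleton]
  rw [Finset.sum_congr rfl fun P _ => h1 P, Finset.sum_comm]
  refine Finset.sum_congr rfl fun X hX => ?_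
  obtain ⟨hX, haX⟩ := Finset.mem_filter.1 hX
  rw [← Finset.sum_filter, sum_finpartition_of_mem ⟨a, haX⟩ (Finset.mem_powerset.1 hX)
    (fun m => ((-1 : ℂ) ^ (m - 1) * ((m - 1).factorial : ℂ)) • φ X),
    ← sum_finpartition_factorial, Finset.sum_smul]
  rfl

end Partitions

/-! ### Reduction of cumulants to sums over subsets -/

section Cumulants

variable {ι : Type*} {N n : ℕ}

/-- The union of the clusters with numbers in `X`. -/
theorem biUnion_clusters (Z : Finset (Fin N)) (j : Fin n → Fin N) (Y : Finset (Fin n)) :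
    (insert 0 (Y.map (Fin.succEmb n))).biUnion (clusters Z j) = Z ∪ Y.image j := by
  rw [Finset.biUnion_insert, Finset.map_eq_image, Finset.image_biUnion]
  change Z ∪ Y.biUnion (fun i => {j i}) = _
  rw [Finset.biUnion_singleton]

/-- `L` stands for any linear way of looking at the cumulant that sees only the block of the
distinguished cluster. For states it is evaluation modulo operators of vanishing partial trace, for
observables evaluation at an operator supported on `Z`. -/
theorem map_cumulant {W : Type*} [AddCommGroup W] [Module ℂ W]
    (G : Finset (Fin N) → Module.End ℂ (Op ι N)) (Z : Finset (Fin N)) (j : Fin n → Fin N)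
    (L : Module.End ℂ (Op ι N) →ₗ[ℂ] W)
    (h : ∀ P : Finpartition (Finset.univ : Finset (Fin (n + 1))),
      L (P.parts.toList.map fun X => G (X.biUnion (clusters Z j))).prod =
        L (G ((P.part 0).biUnion (clusters Z j)))) :
    L (cumulant G (clusters Z j)) = L (redCumulantSets G Z j) := by
  rw [cumulant, map_sum]
  simp only [map_smul, h]
  rw [sum_finpartition_part (Finset.mem_univ 0) (fun X => L (G (X.biUnion (clusters Z j)))),
    redCumulantSets, map_sum]
  symm
  refine Finset.sum_bij' (fun Y _ => insert 0 (Y.map (Fin.succEmb n)))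
    (fun X _ => Finset.univ.filter fun i => Fin.succ i ∈ X) (fun Y _ => ?_)
    (fun _ _ => Finset.mem_univ _) (fun Y _ => ?_) (fun X hX => ?_) fun Y _ => ?_
  · exact Finset.mem_filter.2 ⟨Finset.mem_powerset.2 (Finset.subset_univ _),
      Finset.mem_insert_self _ _⟩
  · ext i
    simp [Fin.succ_ne_zero]
  · ext i
    have h0 := (Finset.mem_filter.1 hX).2
    refine Fin.cases ?_ (fun i => ?_) i
    · simp [h0]
    · simp [Fin.succ_ne_zero]
  · have hc : (insert 0 (Y.map (Fin.succEmb n)) : Finset (Fin (n + 1))).card = Y.card + 1 := by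
      rw [Finset.card_insert_of_notMem (by simp [Fin.succ_ne_zero]), Finset.card_map]
    rw [map_smul, biUnion_clusters, Finset.card_sdiff_of_subset (Finset.subset_univ _), hc,
      Finset.card_univ, Fintype.card_fin, Nat.add_sub_add_right]

theorem disjoint_biUnion_clusters {Z : Finset (Fin N)} {j : Fin n → Fin N}
    (hj : Function.Injective j) (hZ : ∀ i, j i ∉ Z) {X Y : Finset (Fin (n + 1))}
    (h : Disjoint X Y) : Disjoint (X.biUnion (clusters Z j)) (Y.biUnion (clusters Z j)) := by
  rw [Finset.disjoint_biUnion_left]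
  intro a ha
  rw [Finset.disjoint_biUnion_right]
  intro b hb
  have hab : a ≠ b := fun hab => Finset.disjoint_left.1 h ha (hab ▸ hb)
  revert hab
  refine Fin.cases ?_ (fun a => ?_) a <;> refine Fin.cases ?_ (fun b => ?_) b <;> intro hab
  · exact absurd rfl hab
  · exact Finset.disjoint_singleton_right.2 (hZ b)
  · exact Finset.disjoint_singleton_left.2 (hZ a)
  · exact Finset.disjoint_singleton.2 fun h => hab (congrArg Fin.succ (hj h))

/-- In the product over a partition the factor of one part can be put first or last. -/
theorem prod_toList_eq {τ M : Type*} [DecidableEq τ] [Monoid M] {S X : Finset τ}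
    (P : Finpartition S) (hX : X ∈ P.parts) (g : Finset τ → M)
    (hg : ∀ A ∈ P.parts, ∀ B ∈ P.parts, A ≠ B → Commute (g A) (g B)) :
    (P.parts.toList.map g).prod = g X * ((P.parts.erase X).toList.map g).prod ∧
      (P.parts.toList.map g).prod = ((P.parts.erase X).toList.map g).prod * g X := by
  have hp : List.Perm P.parts.toList (X :: (P.parts.erase X).toList) := by
    have := Finset.toList_insert (Finset.notMem_erase X P.parts)
    rwa [Finset.insert_erase hX] at this
  have h1 : (P.parts.toList.map g).prod = g X * ((P.parts.erase X).toList.map g).prod := by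
    rw [List.Perm.prod_eq' (hp.map g), List.map_cons, List.prod_cons]
    rw [List.pairwise_map]
    refine (P.parts.nodup_toList.imp_of_mem ?_)
    intro A B hA hB hne
    exact hg A (Finset.mem_toList.1 hA) B (Finset.mem_toList.1 hB) hne
  refine ⟨h1, h1.trans ?_⟩
  refine (Commute.list_prod_right _ _ fun y hy => ?_).eq
  obtain ⟨B, hB, rfl⟩ := List.mem_map.1 hy
  rw [Finset.mem_toList, Finset.mem_erase] at hB
  exact hg X hX B hB.2 hB.1.symm

end Cumulants

/-! ### Weighted sequence norms and the expansion of `e^a g e^{-a}` -/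

section Sequences

variable {X : ℕ → Type*} [∀ n, NormedAddCommGroup (X n)] [∀ n, NormedSpace ℂ (X n)]

/-- A norm (with values in `[0, ∞]`) on sequences which dominates the norms of the components and is
countably subadditive. -/
structure IsSeqNorm (N : (∀ n, X n) → ℝ≥0∞) : Prop where
  bound : ∀ s, ∃ c : ℝ≥0∞, c ≠ ∞ ∧ ∀ F, ENNReal.ofReal ‖F s‖ ≤ c * N F
  le_tsum : ∀ {u : ℕ → ∀ n, X n} {F : ∀ n, X n}, (∀ s, HasSum (fun n => u n s) (F s)) →
    N F ≤ ∑' n, N (u n)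
  smul_le : ∀ (c : ℂ) F, N (c • F) ≤ ENNReal.ofReal ‖c‖ * N F

/-- A linear map on sequences which is compatible with componentwise convergent series. -/
def IsSeqCont (A : Module.End ℂ (∀ n, X n)) : Prop :=
  ∀ ⦃u : ℕ → ∀ n, X n⦄ ⦃F : ∀ n, X n⦄, (∀ s, HasSum (fun n => u n s) (F s)) →
    ∀ s, HasSum (fun n => A (u n) s) (A F s)

/-- The componentwise sum of a series. -/
def seqSum (u : ℕ → ∀ n, X n) : ∀ n, X n := fun s => ∑' n, u n s

variable {N : (∀ n, X n) → ℝ≥0∞}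

theorem IsSeqNorm.zero (hN : IsSeqNorm N) : N 0 = 0 := by
  have := hN.smul_le 0 0
  rw [smul_zero, norm_zero, ENNReal.ofReal_zero, zero_mul] at this
  exact le_antisymm this zero_le

theorem IsSeqNorm.sum_le (hN : IsSeqNorm N) (u : ℕ → ∀ n, X n) (M : ℕ) :
    N (∑ n ∈ Finset.range M, u n) ≤ ∑ n ∈ Finset.range M, N (u n) := by
  have h : ∀ s, HasSum (fun n => (if n ∈ Finset.range M then u n else 0) s)
      ((∑ n ∈ Finset.range M, u n) s) := fun s => by
    have h1 := hasSum_sum_of_ne_finset_zero (L := SummationFilter.unconditional ℕ) (s := Finset.range M)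
      (f := fun n => (if n ∈ Finset.range M then u n else 0) s)
      (fun n hn => by rw [if_neg hn]; rfl)
    have h2 : ∑ n ∈ Finset.range M, (if n ∈ Finset.range M then u n else 0) s =
        ∑ n ∈ Finset.range M, u n s := Finset.sum_congr rfl fun n hn => by rw [if_pos hn]
    rw [Finset.sum_apply, ← h2]
    exact h1
  refine (hN.le_tsum h).trans (le_of_eq ?_)
  rw [tsum_eq_sum (s := Finset.range M) fun n hn => by rw [if_neg hn, hN.zero]]
  exact Finset.sum_congr rfl fun n hn => by rw [if_pos hn]

theorem IsSeqCont.mul {A B : Module.End ℂ (∀ n, X n)} (hA : IsSeqCont A) (hB : IsSeqCont B) :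
    IsSeqCont (A * B) := fun _ _ h => hA (hB h)

theorem IsSeqCont.pow {A : Module.End ℂ (∀ n, X n)} (hA : IsSeqCont A) (m : ℕ) :
    IsSeqCont (A ^ m) := by
  induction m with
  | zero => exact fun _ _ h => h
  | succ m ih => rw [pow_succ]; exact ih.mul hA

theorem IsSeqCont.neg {A : Module.End ℂ (∀ n, X n)} (hA : IsSeqCont A) : IsSeqCont (-A) :=
  fun _ _ h s => (hA h s).neg

theorem pow_le_of_le {A : Module.End ℂ (∀ n, X n)} {r : ℝ≥0∞} (hA : ∀ F, N (A F) ≤ r * N F) (m : ℕ)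
    (F : ∀ n, X n) : N ((A ^ m) F) ≤ r ^ m * N F := by
  induction m with
  | zero => rw [pow_zero, pow_zero, one_mul]; rfl
  | succ m ih =>
    rw [pow_succ', Module.End.mul_apply, pow_succ', mul_assoc]
    exact (hA _).trans (by gcongr)

variable [∀ n, CompleteSpace (X n)]

theorem IsSeqNorm.summable_norm (hN : IsSeqNorm N) {κ : Type*} {u : κ → ∀ n, X n}
    (hu : ∑' n, N (u n) ≠ ∞) (s : ℕ) : Summable fun n => ‖u n s‖ := by
  obtain ⟨c, hc, h⟩ := hN.bound s
  have h1 : ∑' n, ENNReal.ofReal ‖u n s‖ ≠ ∞ := by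
    refine ne_top_of_le_ne_top (ENNReal.mul_ne_top hc hu) ?_
    rw [← ENNReal.tsum_mul_left]
    exact ENNReal.tsum_le_tsum fun n => h (u n)
  simpa only [ENNReal.toReal_ofReal (norm_nonneg _)] using ENNReal.summable_toReal h1

theorem IsSeqNorm.hasSum (hN : IsSeqNorm N) {u : ℕ → ∀ n, X n} (hu : ∑' n, N (u n) ≠ ∞) (s : ℕ) :
    HasSum (fun n => u n s) (seqSum u s) := (hN.summable_norm hu s).of_norm.hasSum

/-- The remainder is the componentwise sum of the tail, so countable subadditivity bounds its norm
by the tail of a convergent series; the sequence space is not needed as a Banach space. -/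
theorem IsSeqNorm.tendsto (hN : IsSeqNorm N) {u : ℕ → ∀ n, X n} (hu : ∑' n, N (u n) ≠ ∞) :
    Tendsto (fun M => N (seqSum u - ∑ n ∈ Finset.range M, u n)) atTop (𝓝 0) := by
  refine tendsto_of_tendsto_of_tendsto_of_le_of_le tendsto_const_nhds
    (ENNReal.tendsto_sum_nat_add (fun n => N (u n)) hu) (fun _ => zero_le) fun M => ?_
  refine hN.le_tsum (u := fun n => u (n + M)) fun s => ?_
  rw [Pi.sub_apply, Finset.sum_apply]
  exact (hasSum_nat_add_iff' M).2 (hN.hasSum hu s)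

/-- The `n`th coefficient of `e^a g e^{-a}`. -/
def conjCoeff {M : Type*} [AddCommGroup M] [Module ℂ M] (a g : Module.End ℂ M) (n : ℕ) :
    Module.End ℂ M :=
  ((n.factorial : ℂ)⁻¹) • ∑ k ∈ Finset.range (n + 1),
    ((-1 : ℂ) ^ k * (n.choose k : ℂ)) • (a ^ (n - k) * g * a ^ k)

theorem conjCoeff_eq_antidiagonal {M : Type*} [AddCommGroup M] [Module ℂ M] (a g : Module.End ℂ M)
    (n : ℕ) (F : M) : conjCoeff a g n F = ∑ p ∈ Finset.HasAntidiagonal.antidiagonal n,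
      ((p.1.factorial : ℂ)⁻¹) • (a ^ p.1) (g (((p.2.factorial : ℂ)⁻¹) • ((-a) ^ p.2) F)) := by
  rw [← Finset.Nat.sum_antidiagonal_swap, Finset.Nat.sum_antidiagonal_eq_sum_range_succ_mk, conjCoeff,
    Finset.smul_sum, LinearMap.sum_apply]
  refine Finset.sum_congr rfl fun k hk => ?_
  have hk' : k ≤ n := Nat.lt_succ_iff.1 (Finset.mem_range.1 hk)
  have h1 : (-a) ^ k = (-1 : ℂ) ^ k • a ^ k := by
    rw [← smul_pow, neg_one_smul]
  have h2 : ((n.factorial : ℂ)⁻¹) * ((-1 : ℂ) ^ k * (n.choose k : ℂ)) =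
      ((n - k).factorial : ℂ)⁻¹ * ((k.factorial : ℂ)⁻¹ * (-1) ^ k) := by
    rw [Nat.cast_choose ℂ hk']
    have := Nat.cast_ne_zero (R := ℂ).2 n.factorial_ne_zero
    field_simp
  simp only [Prod.swap_prod_mk, h1, LinearMap.smul_apply, map_smul, smul_smul, Module.End.mul_apply]
  rw [h2]

theorem tsum_pow_div_factorial_ne_top (r : ℝ) (hr : 0 ≤ r) (b : ℝ≥0∞) (hb : b ≠ ∞) :
    ∑' n : ℕ, ENNReal.ofReal ((n.factorial : ℝ)⁻¹) * (ENNReal.ofReal r ^ n * b) ≠ ∞ := by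
  have h : ∀ n : ℕ, ENNReal.ofReal ((n.factorial : ℝ)⁻¹) * (ENNReal.ofReal r ^ n * b) =
      ENNReal.ofReal (r ^ n / n.factorial) * b := fun n => by
    rw [← mul_assoc, ← ENNReal.ofReal_pow hr, ← ENNReal.ofReal_mul (by positivity), div_eq_inv_mul]
  simp only [h]
  rw [ENNReal.tsum_mul_right, ← ENNReal.ofReal_tsum_of_nonneg (fun n => by positivity)
    (Real.summable_pow_div_factorial r)]
  exact ENNReal.mul_ne_top ENNReal.ofReal_ne_top hb

theorem norm_inv_factorial (n : ℕ) : ‖((n.factorial : ℂ)⁻¹)‖ = (n.factorial : ℝ)⁻¹ := by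
  rw [norm_inv, RCLike.norm_natCast]

variable {a g : Module.End ℂ (∀ n, X n)} {r : ℝ}

theorem IsSeqNorm.exp_ne_top (hN : IsSeqNorm N) (hr : 0 ≤ r)
    (ha : ∀ F, N (a F) ≤ ENNReal.ofReal r * N F) {F : ∀ n, X n} (hF : N F ≠ ∞) :
    ∑' n : ℕ, N (((n.factorial : ℂ)⁻¹) • (a ^ n) F) ≠ ∞ := by
  refine ne_top_of_le_ne_top (tsum_pow_div_factorial_ne_top r hr (N F) hF)
    (ENNReal.tsum_le_tsum fun n => (hN.smul_le _ _).trans ?_)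
  rw [norm_inv_factorial]
  gcongr
  exact pow_le_of_le ha n F

theorem IsSeqNorm.neg_le (hN : IsSeqNorm N) (ha : ∀ F, N (a F) ≤ ENNReal.ofReal r * N F)
    (F : ∀ n, X n) : N ((-a) F) ≤ ENNReal.ofReal r * N F := by
  have h := hN.smul_le (-1) (a F)
  rw [norm_neg, norm_one, ENNReal.ofReal_one, one_mul, neg_one_smul] at h
  exact h.trans (ha F)

/-- Every summand costs `r ^ n` times a binomial coefficient, and these add up to `2 ^ n`; hence the
majorant `(2r) ^ n / n!`. -/
theorem IsSeqNorm.conjCoeff_ne_top (hN : IsSeqNorm N) (hr : 0 ≤ r)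
    (ha : ∀ F, N (a F) ≤ ENNReal.ofReal r * N F) (hg : ∀ F, N (g F) ≤ N F) {F : ∀ n, X n}
    (hF : N F ≠ ∞) : ∑' n, N (conjCoeff a g n F) ≠ ∞ := by
  refine ne_top_of_le_ne_top (tsum_pow_div_factorial_ne_top (2 * r) (by positivity) (N F) hF)
    (ENNReal.tsum_le_tsum fun n => ?_)
  rw [conjCoeff, LinearMap.smul_apply, LinearMap.sum_apply]
  refine (hN.smul_le _ _).trans ?_
  rw [norm_inv_factorial]
  gcongr
  refine (hN.sum_le _ _).trans ?_
  have h : ∀ k ∈ Finset.range (n + 1),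
      N ((((-1 : ℂ) ^ k * (n.choose k : ℂ)) • (a ^ (n - k) * g * a ^ k)) F) ≤
        ENNReal.ofReal (n.choose k) * (ENNReal.ofReal r ^ n * N F) := fun k hk => by
    rw [LinearMap.smul_apply]
    refine (hN.smul_le _ _).trans ?_
    rw [norm_mul, norm_pow, norm_neg, norm_one, one_pow, one_mul, RCLike.norm_natCast]
    gcongr
    rw [Module.End.mul_apply, Module.End.mul_apply]
    refine (pow_le_of_le ha _ _).trans ?_
    rw [← Nat.sub_add_cancel (Nat.lt_succ_iff.1 (Finset.mem_range.1 hk)), pow_add, mul_assoc,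
      Nat.add_sub_cancel]
    gcongr
    exact (hg _).trans (pow_le_of_le ha k F)
  refine (Finset.sum_le_sum h).trans (le_of_eq ?_)
  rw [← Finset.sum_mul, ← ENNReal.ofReal_sum_of_nonneg (fun _ _ => by positivity), ← mul_assoc]
  congr 1
  rw [← Nat.cast_sum, Nat.sum_range_choose, ENNReal.ofReal_mul zero_le_two, mul_pow,
    ← ENNReal.ofReal_pow zero_le_two]
  norm_num

/-- The double series in the two exponents is absolutely summable. Summing rows gives the
exponentials, where `IsSeqCont` moves `a ^ m` and `g` inside the inner series; summing antidiagonals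
gives the coefficients `conjCoeff`. -/
theorem IsSeqNorm.exp_conj (hN : IsSeqNorm N) (hr : 0 ≤ r)
    (ha : ∀ F, N (a F) ≤ ENNReal.ofReal r * N F) (hg : ∀ F, N (g F) ≤ N F) (hac : IsSeqCont a)
    (hgc : IsSeqCont g) {F : ∀ n, X n} (hF : N F ≠ ∞) :
    seqSum (fun n => conjCoeff a g n F) = seqSum fun m => ((m.factorial : ℂ)⁻¹) •
      (a ^ m) (g (seqSum fun k => ((k.factorial : ℂ)⁻¹) • ((-a) ^ k) F)) := by
  have hna := hN.neg_le ha
  let w : ℕ × ℕ → ∀ n, X n := fun p =>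
    ((p.1.factorial : ℂ)⁻¹) • (a ^ p.1) (g (((p.2.factorial : ℂ)⁻¹) • ((-a) ^ p.2) F))
  have hw : ∑' p, N (w p) ≠ ∞ := by
    rw [ENNReal.tsum_prod (f := fun m k => N (w (m, k)))]
    refine ne_top_of_le_ne_top (tsum_pow_div_factorial_ne_top r hr _
      (tsum_pow_div_factorial_ne_top r hr (N F) hF)) (ENNReal.tsum_le_tsum fun m => ?_)
    rw [← ENNReal.tsum_mul_left, ← ENNReal.tsum_mul_left]
    refine ENNReal.tsum_le_tsum fun k => (hN.smul_le _ _).trans ?_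
    rw [norm_inv_factorial]
    gcongr
    refine (pow_le_of_le ha m _).trans ?_
    gcongr
    refine (hg _).trans ((hN.smul_le _ _).trans ?_)
    rw [norm_inv_factorial]
    gcongr
    exact pow_le_of_le hna k F
  funext s
  have h1 := (hN.summable_norm hw s).of_norm.hasSum
  have h2 := h1.prod_fiberwise (g := fun m => (((m.factorial : ℂ)⁻¹) •
      (a ^ m) (g (seqSum fun k => ((k.factorial : ℂ)⁻¹) • ((-a) ^ k) F))) s) fun m =>
    (((hac.pow m).mul hgc) (hN.hasSum (hN.exp_ne_top hr hna hF)) s).const_smul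
      ((m.factorial : ℂ)⁻¹)
  have h3 := (Finset.HasAntidiagonal.sigmaAntidiagonalEquivProd (A := ℕ)).hasSum_iff.2 h1
  have h4 := h3.sigma (g := fun n => conjCoeff a g n F s) fun n => by
    rw [conjCoeff_eq_antidiagonal, Finset.sum_apply]
    exact Finset.hasSum (Finset.HasAntidiagonal.antidiagonal n) fun p => w p s
  exact h4.tsum_eq.trans h2.tsum_eq.symm

end Sequences

/-! ### Nested commutators, and derivatives in the interaction picture -/

section Derivatives

variable {M : Type*} [AddCommGroup M] [Module ℂ M]

/-- `b ↦ a b - b a` is left minus right multiplication by `a`; these commute, so the binomial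
theorem expands its powers. -/
theorem iterate_commutator (a g : Module.End ℂ M) (n : ℕ) :
    (fun b => a * b - b * a)^[n] g = (n.factorial : ℂ) • conjCoeff a g n := by
  let R : Module.End ℂ (Module.End ℂ M) := LinearMap.mulRight ℂ a
  let L : Module.End ℂ (Module.End ℂ M) := LinearMap.mulLeft ℂ a
  have h1 : ∀ b : Module.End ℂ M, (-R + L) b = a * b - b * a := fun b => by
    rw [LinearMap.add_apply, LinearMap.neg_apply, LinearMap.mulRight_apply,
      LinearMap.mulLeft_apply, neg_add_eq_sub]
  have h2 : (fun b => a * b - b * a)^[n] g =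
      ((-R + L) ^ n) g := by
    rw [Module.End.pow_apply]
    exact congrArg (fun f => f^[n] g) (funext fun b => (h1 b).symm)
  have hc : Commute (-R) L := by
    have hc : Commute L R := LinearMap.commute_mulLeft_right a a
    exact hc.symm.neg_left
  rw [h2, hc.add_pow, conjCoeff, smul_smul, mul_inv_cancel₀
    (Nat.cast_ne_zero.2 n.factorial_ne_zero), one_smul, LinearMap.sum_apply]
  refine Finset.sum_congr rfl fun k _ => ?_
  have h3 : (-R) ^ k = (-1 : ℂ) ^ k • LinearMap.mulRight ℂ (a ^ k) := by
    rw [← LinearMap.pow_mulRight, ← smul_pow, neg_one_smul]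
  rw [h3, LinearMap.pow_mulLeft, Module.End.mul_apply, Module.End.mul_apply, LinearMap.smul_apply,
    LinearMap.mulRight_apply, LinearMap.mulLeft_apply, Module.End.natCast_apply,
    ← Nat.cast_smul_eq_nsmul ℂ, mul_smul_comm, smul_mul_assoc, smul_smul]

variable {X : ℕ → Type*} [∀ n, AddCommGroup (X n)] [∀ n, Module ℂ (X n)]

/-- `G(-τ) C_n(τ)`, written with `A(τ) = G(-τ) a G(τ)`. -/
def interCoeff (a A : Module.End ℂ M) (n : ℕ) : Module.End ℂ M :=
  ((n.factorial : ℂ)⁻¹) • ∑ k ∈ Finset.range (n + 1),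
    ((-1 : ℂ) ^ k * (n.choose k : ℂ)) • (A ^ (n - k) * a ^ k)

theorem mul_interCoeff {a g g' : Module.End ℂ M} (h : g * g' = 1) (n : ℕ) :
    g * interCoeff a (g' * a * g) n = conjCoeff a g n := by
  have h1 : ∀ m : ℕ, g * (g' * a * g) ^ m = a ^ m * g := fun m => by
    induction m with
    | zero => rw [pow_zero, pow_zero, mul_one, one_mul]
    | succ m ih =>
      rw [pow_succ, ← mul_assoc, ih, pow_succ]
      simp only [mul_assoc]
      rw [← mul_assoc g g', h, one_mul]
  rw [interCoeff, conjCoeff, mul_smul_comm, Finset.mul_sum]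
  refine congrArg _ (Finset.sum_congr rfl fun k _ => ?_)
  rw [mul_smul_comm, ← mul_assoc, h1]

/-- At time `0` the operators `A` and `a` coincide and only an alternating binomial sum remains.
This is the zero initial value of the Duhamel recursion. -/
theorem interCoeff_self (a : Module.End ℂ M) (n : ℕ) : interCoeff a a (n + 1) = 0 := by
  have h : ∀ k ∈ Finset.range (n + 1 + 1), ((-1 : ℂ) ^ k * ((n + 1).choose k : ℂ)) •
      (a ^ (n + 1 - k) * a ^ k) = ((-1 : ℂ) ^ k * ((n + 1).choose k : ℂ)) • a ^ (n + 1) :=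
    fun k hk => by
      rw [← pow_add, Nat.sub_add_cancel (Nat.lt_succ_iff.1 (Finset.mem_range.1 hk))]
  rw [interCoeff, Finset.sum_congr rfl h, ← Finset.sum_smul]
  have h2 : ∑ k ∈ Finset.range (n + 1 + 1), (-1 : ℂ) ^ k * ((n + 1).choose k : ℂ) = 0 := by
    have := Int.alternating_sum_range_choose_of_ne (Nat.succ_ne_zero n)
    exact_mod_cast congrArg (Int.cast : ℤ → ℂ) this
  rw [h2, zero_smul, smul_zero]

/-- A notion of differentiability for curves in the components which is compatible with the linear
structure. -/
structure IsDerivation (D : ∀ s, (ℝ → X s) → (ℝ → X s) → Prop) : Prop where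
  const : ∀ s (x : X s), D s (fun _ => x) fun _ => 0
  add : ∀ s f f' h h', D s f f' → D s h h' → D s (f + h) (f' + h')
  smul : ∀ s (c : ℂ) f f', D s f f' → D s (c • f) (c • f')

theorem IsDerivation.sum {D : ∀ s, (ℝ → X s) → (ℝ → X s) → Prop} (hD : IsDerivation D) {s : ℕ}
    {κ : Type*} (t : Finset κ) {f f' : κ → ℝ → X s} (h : ∀ k ∈ t, D s (f k) (f' k)) :
    D s (∑ k ∈ t, f k) (∑ k ∈ t, f' k) := by
  classical
  induction t using Finset.induction_on with
  | empty => exact hD.const s 0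
  | insert k t hk ih =>
    rw [Finset.sum_insert hk, Finset.sum_insert hk]
    exact hD.add s _ _ _ _ (h k (Finset.mem_insert_self k t))
      (ih fun k hk => h k (Finset.mem_insert_of_mem hk))

/-- Since `A τ` commutes with its derivative `v τ` on `Y`, the power `A ^ (m + 1)` has derivative
`(m + 1) v A ^ m`. The identity `(n + 1 - k) C(n + 1, k) = (n + 1) C(n, k)` then turns the
derivative of the coefficient of order `n + 1` into `v` applied to that of order `n`. -/
theorem IsDerivation.interCoeff {D : ∀ s, (ℝ → X s) → (ℝ → X s) → Prop} (hD : IsDerivation D)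
    {a : Module.End ℂ (∀ n, X n)} {A v : ℝ → Module.End ℂ (∀ n, X n)}
    {Y : Set (∀ n, X n)} (ha : ∀ F ∈ Y, a F ∈ Y) (hAY : ∀ τ, ∀ F ∈ Y, A τ F ∈ Y)
    (hc : ∀ τ, ∀ F ∈ Y, A τ (v τ F) = v τ (A τ F))
    (hA : ∀ f f' : ℝ → ∀ n, X n, (∀ s, D s (fun τ => f τ s) fun τ => f' τ s) →
      ∀ s, D s (fun τ => A τ (f τ) s) fun τ => v τ (f τ) s + A τ (f' τ) s)
    {F : ∀ n, X n} (hF : F ∈ Y) (n s : ℕ) :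
    D s (fun τ => QuantumHierarchy.interCoeff a (A τ) (n + 1) F s)
      fun τ => v τ (QuantumHierarchy.interCoeff a (A τ) n F) s := by
  have hAm : ∀ m τ, ∀ F ∈ Y, (A τ ^ m) F ∈ Y := fun m τ F hF => by
    induction m with
    | zero => exact hF
    | succ m ih => rw [pow_succ', Module.End.mul_apply]; exact hAY τ _ ih
  have ham : ∀ m, (a ^ m) F ∈ Y := fun m => by
    induction m with
    | zero => exact hF
    | succ m ih => rw [pow_succ', Module.End.mul_apply]; exact ha _ ih
  have hpow : ∀ (m : ℕ), ∀ F ∈ Y, ∀ s, D s (fun τ => (A τ ^ (m + 1)) F s)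
      fun τ => ((m + 1 : ℕ) : ℂ) • v τ ((A τ ^ m) F) s := fun m F hF => by
    induction m with
    | zero =>
      intro s
      have := hA (fun _ => F) (fun _ => 0) (fun s => hD.const s (F s)) s
      simp only [map_zero, Pi.zero_apply, add_zero] at this
      simpa using this
    | succ m ih =>
      intro s
      have := hA (fun τ => (A τ ^ (m + 1)) F) (fun τ => ((m + 1 : ℕ) : ℂ) • v τ ((A τ ^ m) F)) ih s
      have e1 : (fun τ => (A τ ^ (m + 1 + 1)) F s) = fun τ => A τ ((A τ ^ (m + 1)) F) s := by
        funext τ; rw [pow_succ' _ (m + 1), Module.End.mul_apply]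
      have e2 : (fun τ => ((m + 1 + 1 : ℕ) : ℂ) • v τ ((A τ ^ (m + 1)) F) s) =
          fun τ => v τ ((A τ ^ (m + 1)) F) s + A τ (((m + 1 : ℕ) : ℂ) • v τ ((A τ ^ m) F)) s := by
        funext τ
        rw [map_smul, hc τ _ (hAm m τ F hF), ← Module.End.mul_apply (A τ), ← pow_succ',
          Pi.smul_apply, Nat.cast_succ (m + 1), add_smul, one_smul, add_comm]
      rw [e1, e2]
      exact this
  have hsum := hD.sum (s := s) (Finset.range (n + 1 + 1))
    (f := fun k τ => ((-1 : ℂ) ^ k * ((n + 1).choose k : ℂ)) •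
      (A τ ^ (n + 1 - k)) ((a ^ k) F) s)
    -- The summand `k = n + 1` contains no power of `A` and is constant; treating it apart avoids
    -- the truncated exponent `n - k`.
    (f' := fun k τ => if k = n + 1 then 0 else ((-1 : ℂ) ^ k * ((n + 1).choose k : ℂ)) •
      ((n + 1 - k : ℕ) : ℂ) • v τ ((A τ ^ (n - k)) ((a ^ k) F)) s) fun k hk => by
    rcases eq_or_ne k (n + 1) with rfl | hne
    · simp only [if_true, Nat.sub_self, pow_zero]
      exact hD.const s _
    · have hk' : k ≤ n := by have := Finset.mem_range.1 hk; omega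
      simp only [if_neg hne]
      have := hD.smul s ((-1 : ℂ) ^ k * ((n + 1).choose k : ℂ)) _ _ (hpow (n - k) _ (ham k) s)
      rw [Nat.succ_sub hk']
      exact this
  have h := hD.smul s (((n + 1).factorial : ℂ)⁻¹) _ _ hsum
  have e1 : (fun τ => QuantumHierarchy.interCoeff a (A τ) (n + 1) F s) =
      (((n + 1).factorial : ℂ)⁻¹) • ∑ k ∈ Finset.range (n + 1 + 1),
        (fun τ => ((-1 : ℂ) ^ k * ((n + 1).choose k : ℂ)) •
          (A τ ^ (n + 1 - k)) ((a ^ k) F) s) := by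
    funext τ
    rw [QuantumHierarchy.interCoeff, LinearMap.smul_apply, LinearMap.sum_apply, Pi.smul_apply,
      Pi.smul_apply, Finset.sum_apply, Finset.sum_apply]
    rfl
  have e2 : (fun τ => v τ (QuantumHierarchy.interCoeff a (A τ) n F) s) =
      (((n + 1).factorial : ℂ)⁻¹) • ∑ k ∈ Finset.range (n + 1 + 1),
        (fun τ => if k = n + 1 then 0 else ((-1 : ℂ) ^ k * ((n + 1).choose k : ℂ)) •
          ((n + 1 - k : ℕ) : ℂ) • v τ ((A τ ^ (n - k)) ((a ^ k) F)) s) := by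
    funext τ
    rw [QuantumHierarchy.interCoeff, LinearMap.smul_apply, LinearMap.sum_apply, map_smul, map_sum,
      Pi.smul_apply, Pi.smul_apply, Finset.sum_apply, Finset.sum_apply,
      Finset.sum_range_succ _ (n + 1), if_pos rfl, add_zero, Finset.smul_sum, Finset.smul_sum]
    refine Finset.sum_congr rfl fun k hk => ?_
    have hk' : k < n + 1 := Finset.mem_range.1 hk
    rw [if_neg hk'.ne, LinearMap.smul_apply, map_smul, Pi.smul_apply, smul_smul, smul_smul,
      smul_smul, Module.End.mul_apply]
    congr 1
    have h3 := congrArg (Nat.cast : ℕ → ℂ) (Nat.choose_mul_succ_eq n k)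
    push_cast at h3
    have h4 : (n.factorial : ℂ) ≠ 0 := Nat.cast_ne_zero.2 n.factorial_ne_zero
    have h5 : ((n : ℂ) + 1) ≠ 0 := by exact_mod_cast n.succ_ne_zero
    rw [Nat.factorial_succ]
    push_cast
    field_simp
    exact h3
  rw [e1, e2]
  exact h

end Derivatives

/-! ### Iterated integrals -/

section IterInt

variable {E F : Type*} [NormedAddCommGroup E] [NormedSpace ℝ E] [NormedAddCommGroup F]
  [NormedSpace ℝ F]

/-- The parameter space `X` varies in the induction, so that the outermost integration variable can
be absorbed into it. -/
theorem continuous_iterInt (n : ℕ) : ∀ {X : Type*} [TopologicalSpace X]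
    {g : X → (Fin n → ℝ) → E} {t : X → ℝ}, Continuous (fun p : X × (Fin n → ℝ) => g p.1 p.2) →
    Continuous t → Continuous fun x => iterInt n (t x) (g x) := by
  induction n with
  | zero =>
    intro X _ g t hg _
    exact hg.comp (continuous_id.prodMk continuous_const)
  | succ n ih =>
    intro X _ g t hg ht
    refine intervalIntegral.continuous_parametric_intervalIntegral_of_continuous
      (f := fun x τ => iterInt n τ fun τs => g x (Fin.cons τ τs)) ?_ ht
    refine ih (X := X × ℝ) (g := fun p τs => g p.1 (Fin.cons p.2 τs)) (t := fun p => p.2) ?_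
      continuous_snd
    have hc : Continuous fun p : (X × ℝ) × (Fin n → ℝ) => (Fin.cons p.1.2 p.2 : Fin (n + 1) → ℝ) :=
      Continuous.finCons (continuous_snd.comp continuous_fst) continuous_snd
    exact hg.comp ((continuous_fst.comp continuous_fst).prodMk hc)

theorem continuous_iterInt_cons {n : ℕ} {g : (Fin (n + 1) → ℝ) → E} (hg : Continuous g) :
    Continuous fun τ => iterInt n τ fun τs => g (Fin.cons τ τs) :=
  continuous_iterInt n (X := ℝ) (g := fun τ τs => g (Fin.cons τ τs))
    (hg.comp (Continuous.finCons continuous_fst continuous_snd)) continuous_id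

theorem iterInt_clm [NormedSpace ℂ E] [NormedSpace ℂ F] [CompleteSpace E] [CompleteSpace F]
    (L : E →L[ℂ] F) : ∀ (n : ℕ) (t : ℝ) {g : (Fin n → ℝ) → E}, Continuous g →
      iterInt n t (fun τ => L (g τ)) = L (iterInt n t g) := by
  intro n
  induction n with
  | zero => intro t g _; rfl
  | succ n ih =>
    intro t g hg
    change ∫ τ in (0 : ℝ)..t, iterInt n τ (fun τs => L (g (Fin.cons τ τs))) = L (∫ τ in (0 : ℝ)..t, _)
    rw [← ContinuousLinearMap.intervalIntegral_comp_comm L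
      ((continuous_iterInt_cons hg).intervalIntegrable 0 t)]
    refine intervalIntegral.integral_congr fun τ _ => ?_
    exact ih τ (hg.comp (Continuous.finCons continuous_const continuous_id))

end IterInt

/-! ### Sequences of trace-class operators and the operator 𝔞 -/

/-- Sequences of trace-class operators. -/
abbrev TSeq (ι : Type*) : Type _ := ∀ n : ℕ, TC (Fin n → ι)

section

variable {ι : Type*}

/-- A sequence of trace-class operators as a sequence of bounded operators. -/
def ops (F : TSeq ι) : OpSeq ι := fun n => TC.toOp (F n)

theorem exists_ops {f : OpSeq ι} (h : ∀ n, traceNorm (f n) < ∞) : ∃ F, ops F = f :=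
  ⟨fun n => TC.mk (f n) (h n), rfl⟩

/-- The embedding of the first `s` of `s + 1` particles. -/
abbrev initEmb (s : ℕ) : Fin s ↪ Fin (s + 1) := Fin.castAddEmb 1

theorem mem_range_initEmb {s : ℕ} (x : Fin (s + 1)) :
    x ∈ Set.range (initEmb s) ↔ x ≠ Fin.last s := by
  constructor
  · rintro ⟨i, rfl⟩
    exact (Fin.castSucc_lt_last i).ne
  · intro h
    exact ⟨x.castPred h, Fin.castSucc_castPred x h⟩

theorem l1Norm_ops (α : ℝ) (F : TSeq ι) :
    l1Norm α (ops F) = ∑' n, ENNReal.ofReal (α ^ n) * ENNReal.ofReal ‖F n‖ :=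
  tsum_congr fun n => by rw [TC.ofReal_norm_eq]; rfl

theorem isSeqNorm_l1 {α : ℝ} (hα : 0 < α) : IsSeqNorm fun F : TSeq ι => l1Norm α (ops F) where
  bound s := by
    refine ⟨ENNReal.ofReal (α ^ s)⁻¹, ENNReal.ofReal_ne_top, fun F => ?_⟩
    rw [l1Norm_ops]
    calc ENNReal.ofReal ‖F s‖ = ENNReal.ofReal (α ^ s)⁻¹ *
          (ENNReal.ofReal (α ^ s) * ENNReal.ofReal ‖F s‖) := by
          rw [← mul_assoc, ← ENNReal.ofReal_mul (by positivity),
            inv_mul_cancel₀ (pow_pos hα s).ne', ENNReal.ofReal_one, one_mul]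
      _ ≤ _ := by
          gcongr
          exact ENNReal.le_tsum (f := fun n => ENNReal.ofReal (α ^ n) * ENNReal.ofReal ‖F n‖) s
  le_tsum {u F} h := by
    simp only [l1Norm_ops]
    rw [ENNReal.tsum_comm]
    refine ENNReal.tsum_le_tsum fun s => ?_
    rw [ENNReal.tsum_mul_left]
    gcongr
    exact ofReal_norm_le_tsum (h s)
  smul_le c F := by
    simp only [l1Norm_ops]
    rw [← ENNReal.tsum_mul_left]
    refine (ENNReal.tsum_le_tsum fun s => le_of_eq ?_)
    rw [Pi.smul_apply, norm_smul, ENNReal.ofReal_mul (norm_nonneg _)]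
    ring

/-- The operator `𝔞` on sequences of trace-class operators. -/
def annT : Module.End ℂ (TSeq ι) where
  toFun F n := TC.ptr (initEmb n) (F (n + 1))
  map_add' F F' := funext fun n => map_add (TC.ptr (initEmb n)) (F (n + 1)) (F' (n + 1))
  map_smul' c F := funext fun n => map_smul (TC.ptr (initEmb n)) c (F (n + 1))

theorem annT_apply (F : TSeq ι) (n : ℕ) : annT F n = TC.ptr (initEmb n) (F (n + 1)) := rfl

theorem ann_ops (F : TSeq ι) : ann (ops F) = ops (annT F) :=
  funext fun n => TC.traceOut_toOp n 1 (F (n + 1))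

theorem isSeqCont_annT : IsSeqCont (annT : Module.End ℂ (TSeq ι)) := fun _ _ h s =>
  (h (s + 1)).mapL (TC.ptr (initEmb s))

/-- The partial trace is contractive; moving component `n + 1` to place `n` replaces the weight `α ^
(n + 1)` by `α ^ n`, which gives the factor `α⁻¹`. -/
theorem l1Norm_annT_le {α : ℝ} (hα : 0 < α) (F : TSeq ι) :
    l1Norm α (ops (annT F)) ≤ ENNReal.ofReal α⁻¹ * l1Norm α (ops F) := by
  rw [l1Norm_ops, l1Norm_ops, tsum_eq_zero_add' (f := fun n => ENNReal.ofReal (α ^ n) *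
    ENNReal.ofReal ‖F n‖) ENNReal.summable]
  refine le_trans ?_ (mul_le_mul_right le_add_self _)
  rw [← ENNReal.tsum_mul_left]
  refine ENNReal.tsum_le_tsum fun n => ?_
  rw [← mul_assoc, ← ENNReal.ofReal_mul (p := α⁻¹) (by positivity), pow_succ',
    inv_mul_cancel_left₀ hα.ne']
  gcongr
  exact TC.norm_ptr_le _ _

/-- Permutation symmetry of all components. -/
def TSymm (ι : Type*) : Set (TSeq ι) := {F | ∀ n, TC.Symm (F n)}

theorem annT_mem {F : TSeq ι} (hF : F ∈ TSymm ι) : annT F ∈ TSymm ι := fun n =>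
  (hF (n + 1)).ptr (initEmb n)

theorem annT_pow_mem {F : TSeq ι} (hF : F ∈ TSymm ι) (m : ℕ) : (annT ^ m) F ∈ TSymm ι := by
  induction m with
  | zero => exact hF
  | succ m ih => rw [pow_succ', Module.End.mul_apply]; exact annT_mem ih

/-- Successive partial traces compose to a single one, and by symmetry every embedding gives the
same one. Keeping `N` apart from `s + m` spares the induction a cast between `s + (m + 1)` and `s +
1 + m`. -/
theorem annT_pow_apply {F : TSeq ι} (hF : F ∈ TSymm ι) (m : ℕ) : ∀ {s N : ℕ}, N = s + m →
    ∀ e : Fin s ↪ Fin N, (annT ^ m) F s = TC.ptr e (F N) := by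
  induction m with
  | zero =>
    intro s N h e
    obtain rfl : N = s := h
    rw [(hF N).ptr_eq_ptr e (Function.Embedding.refl _), TC.ptr_refl]
    rfl
  | succ m ih =>
    intro s N h e
    subst h
    rw [pow_succ', Module.End.mul_apply, annT_apply,
      ih (by omega : s + (m + 1) = s + 1 + m)
        (Fin.castLEEmb (by omega)), TC.ptr_trans]
    exact (hF _).ptr_eq_ptr _ _

/-- The map `f ↦ -i (Q f - f Q)`. -/
def kap {A : Type*} (Q : L2 A →L[ℂ] L2 A) : TC A →L[ℂ] TC A :=
  -Complex.I • (TC.mulLR Q 1 - TC.mulLR 1 Q)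

theorem toOp_kap {A : Type*} (Q : L2 A →L[ℂ] L2 A) (f : TC A) :
    TC.toOp (kap Q f) = -Complex.I • (Q * TC.toOp f - TC.toOp f * Q) := by
  have h : kap Q f = -Complex.I • (TC.mulLR Q 1 f - TC.mulLR 1 Q f) := rfl
  rw [h, map_smul, map_sub, TC.toOp_mulLR, TC.toOp_mulLR, one_mul, mul_one]

theorem kap_add {A : Type*} (Q Q' : L2 A →L[ℂ] L2 A) (f : TC A) :
    kap (Q + Q') f = kap Q f + kap Q' f :=
  TC.toOp_injective (by rw [map_add, toOp_kap, toOp_kap, toOp_kap, add_mul, mul_add]; module)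

theorem kap_sum {A κ : Type*} (t : Finset κ) (Q : κ → L2 A →L[ℂ] L2 A) (f : TC A) :
    kap (∑ k ∈ t, Q k) f = ∑ k ∈ t, kap (Q k) f :=
  TC.toOp_injective (by
    simp only [map_sum, toOp_kap, Finset.sum_mul, Finset.mul_sum, ← Finset.sum_sub_distrib,
      Finset.smul_sum])

theorem ptr_kap_lift {α β : Type*} (e : α ↪ β) (Q : L2 (α → ι) →L[ℂ] L2 (α → ι))
    (f : TC (β → ι)) : TC.ptr e (kap (lift e Q) f) = kap Q (TC.ptr e f) := by
  have h : ∀ (R : L2 (β → ι) →L[ℂ] L2 (β → ι)) (f : TC (β → ι)),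
    kap R f = -Complex.I • (TC.mulLR R 1 f - TC.mulLR 1 R f) := fun _ _ => rfl
  have h' : kap Q (TC.ptr e f) = -Complex.I • (TC.mulLR Q 1 (TC.ptr e f) -
    TC.mulLR 1 Q (TC.ptr e f)) := rfl
  rw [h, h', map_smul, map_sub, ← TC.ptr_mulLR_lift, ← TC.ptr_mulLR_lift, lift_one]

theorem ptr_kap_comm {α β : Type*} (e : α ↪ β) {Q : L2 (β → ι) →L[ℂ] L2 (β → ι)}
    (hQ : ∀ T, Commute Q (lift e T)) (f : TC (β → ι)) : TC.ptr e (kap Q f) = 0 := by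
  have h : kap Q f = -Complex.I • (TC.mulLR Q 1 f - TC.mulLR 1 Q f) := rfl
  rw [h, map_smul, map_sub, TC.ptr_mul_comm e hQ, sub_self, smul_zero]

theorem kap_perm {β : Type*} (σ : Equiv.Perm β) (Q : L2 (β → ι) →L[ℂ] L2 (β → ι)) {f : TC (β → ι)}
    (hf : TC.Symm f) : kap (lift σ.toEmbedding Q) f =
      TC.mulLR (permOp σ) (permOp σ.symm) (kap Q f) := by
  refine TC.toOp_injective ?_
  rw [TC.toOp_mulLR_perm, toOp_kap, toOp_kap, lift_smul, lift_sub, lift_mul, lift_mul, hf σ]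

/-- `σ` moves only particles that are traced out, and `f` is symmetric, so relabelling `Q` by `σ` is
invisible after the trace. -/
theorem TC.Symm.ptr_kap_perm {α β : Type*} (e : α ↪ β) (σ : Equiv.Perm β) (hσ : ∀ a, σ (e a) = e a)
    (Q : L2 (β → ι) →L[ℂ] L2 (β → ι)) {f : TC (β → ι)} (hf : TC.Symm f) :
    TC.ptr e (kap (lift σ.toEmbedding Q) f) = TC.ptr e (kap Q f) := by
  rw [kap_perm σ Q hf, TC.ptr_perm]
  congr 2
  ext a
  exact (Equiv.symm_apply_eq σ).2 (hσ a).symm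

end

/-! ### Evolution of states and differentiability of 𝒢*(-τ) 𝔞 𝒢*(τ) -/

namespace PairSystem

variable {ι H : Type*} [NormedAddCommGroup H] [InnerProductSpace ℂ H] [CompleteSpace H]
  (S : PairSystem ι H)

/-- `𝒢*(t)` on sequences of trace-class operators. -/
def GT (t : ℝ) : Module.End ℂ (TSeq ι) where
  toFun F n := TC.mulLR (S.U n t) (S.U n (-t)) (F n)
  map_add' F F' := funext fun n => map_add (TC.mulLR (S.U n t) (S.U n (-t))) (F n) (F' n)
  map_smul' c F := funext fun n => map_smul (TC.mulLR (S.U n t) (S.U n (-t))) c (F n)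

theorem GT_apply (t : ℝ) (F : TSeq ι) (n : ℕ) :
    S.GT t F n = TC.mulLR (S.U n t) (S.U n (-t)) (F n) := rfl

theorem Gst_ops (t : ℝ) (F : TSeq ι) : S.Gst t (ops F) = ops (S.GT t F) :=
  funext fun n => (TC.toOp_mulLR _ _ (F n)).symm

theorem isSeqCont_GT (t : ℝ) : IsSeqCont (S.GT t) := fun _ _ h s =>
  (h s).mapL (TC.mulLR (S.U s t) (S.U s (-t)))

theorem adjoint_U (n : ℕ) (t : ℝ) : ContinuousLinearMap.adjoint (S.U n t) = S.U n (-t) :=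
  (S.isUGroup_U n).star_eq t

theorem GT_eq_conj (t : ℝ) (F : TSeq ι) (n : ℕ) : S.GT t F n = TC.conj (S.U n t) (S.U n t) (F n) := by
  rw [GT_apply, TC.mulLR, adjoint_U, neg_neg]

theorem norm_GT_le (t : ℝ) (F : TSeq ι) (n : ℕ) : ‖S.GT t F n‖ ≤ ‖F n‖ := by
  rw [GT_eq_conj]
  refine (TC.norm_conj_le _ _ _).trans (mul_le_of_le_one_left (norm_nonneg _) ?_)
  exact mul_le_one₀ ((S.isUGroup_U n).norm_le t) (norm_nonneg _) ((S.isUGroup_U n).norm_le t)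

theorem l1Norm_GT_le (α : ℝ) (t : ℝ) (F : TSeq ι) : l1Norm α (ops (S.GT t F)) ≤ l1Norm α (ops F) := by
  rw [l1Norm_ops, l1Norm_ops]
  refine ENNReal.tsum_le_tsum fun n => ?_
  gcongr
  exact S.norm_GT_le t F n

theorem GT_mul (s t : ℝ) : S.GT s * S.GT t = S.GT (s + t) := by
  refine LinearMap.ext fun F => funext fun n => ?_
  rw [Module.End.mul_apply, GT_apply, GT_apply, GT_apply, TC.mulLR_mulLR, ← (S.isUGroup_U n).add,
    ← (S.isUGroup_U n).add, neg_add_rev]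

theorem GT_zero : S.GT 0 = 1 := by
  refine LinearMap.ext fun F => funext fun n => TC.toOp_injective ?_
  rw [GT_apply, TC.toOp_mulLR, neg_zero, (S.isUGroup_U n).zero, one_mul, mul_one]
  rfl

theorem GT_mul_neg (t : ℝ) : S.GT t * S.GT (-t) = 1 := by rw [GT_mul, add_neg_cancel, GT_zero]

theorem GT_mem (t : ℝ) {F : TSeq ι} (hF : F ∈ TSymm ι) : S.GT t F ∈ TSymm ι := fun n σ => by
  rw [GT_apply, TC.toOp_mulLR, lift_mul, lift_mul, S.isSymm_U n t σ, S.isSymm_U n (-t) σ, hF n σ]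

theorem continuous_GT {X : Type*} [TopologicalSpace X] [LocallyCompactSpace X] {t : X → ℝ}
    (ht : Continuous t) {F : X → TSeq ι} {n : ℕ} (hF : Continuous fun x => F x n) :
    Continuous fun x => S.GT (t x) (F x) n := by
  simp only [GT_eq_conj]
  have h : StrongCont fun x => S.U n (t x) := fun ψ => ((S.isUGroup_U n).cont ψ).comp ht
  exact (TC.strongCont_conj h h (fun x => (S.isUGroup_U n).norm_le _)
    (fun x => (S.isUGroup_U n).norm_le _)).apply hF

/-- The interaction of the last particle with the others. -/
def Q (s : ℕ) : Op ι (s + 1) := S.PWith (initEmb s) (Fin.last s)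

/-- The component of `[𝔞, 𝒩*]` which acts on operators of `s + 1` particles. -/
def vL (s : ℕ) : TC (Fin (s + 1) → ι) →L[ℂ] TC (Fin s → ι) := TC.ptr (initEmb s) ∘L kap (S.Q s)

/-- The operator `[𝔞, 𝒩*]` on sequences of trace-class operators. -/
def VT : Module.End ℂ (TSeq ι) where
  toFun F n := S.vL n (F (n + 1))
  map_add' F F' := funext fun n => map_add (S.vL n) (F (n + 1)) (F' (n + 1))
  map_smul' c F := funext fun n => map_smul (S.vL n) c (F (n + 1))

theorem VT_apply (F : TSeq ι) (n : ℕ) : S.VT F n = TC.ptr (initEmb n) (kap (S.Q n) (F (n + 1))) := rfl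

theorem intSt_toOp {N : ℕ} (i j : Fin N) (f : TC (Fin N → ι)) :
    S.intSt i j (TC.toOp f) = TC.toOp (kap (S.pot i j) f) := (toOp_kap _ _).symm

theorem commAnn_ops (F : TSeq ι) : S.commAnn (ops F) = ops (S.VT F) := by
  funext s
  change ∑ j : Fin s, traceOut s 1 (S.intSt j.castSucc (Fin.last s) (TC.toOp (F (s + 1)))) = _
  simp only [intSt_toOp, TC.traceOut_toOp]
  rw [← map_sum, ← map_sum, ← kap_sum, ops, VT_apply, Q, PWith]
  simp only [S.pot_comm (Fin.last s)]
  rfl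

/-- Both sides trace out the last two of `s + 2` particles. In the coupling of the last particle to
the others, the term that joins the two traced particles drops out by cyclicity. The other terms may
be carried by the next-to-last particle instead, by exchanging the two, and that is the right-hand
side. -/
theorem annT_VT {F : TSeq ι} (hF : F ∈ TSymm ι) : annT (S.VT F) = S.VT (annT F) := by
  funext s
  rw [annT_apply, VT_apply, VT_apply, annT_apply, ← ptr_kap_lift, TC.ptr_trans, TC.ptr_trans]
  set e := (initEmb s).trans (initEmb (s + 1)) with he
  set f := F (s + 1 + 1)
  let σ : Equiv.Perm (Fin (s + 1 + 1)) := Equiv.swap (Fin.last (s + 1)) (Fin.last s).castSucc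
  have hσ : ∀ a, σ (e a) = e a := fun a => by
    refine Equiv.swap_apply_of_ne_of_ne (Fin.castSucc_lt_last _).ne ?_
    exact fun h => (Fin.castSucc_lt_last a).ne (Fin.castSucc_injective _ h)
  have h1 : S.Q (s + 1) = lift σ.toEmbedding (lift (initEmb (s + 1)) (S.Q s)) +
      S.pot (Fin.last (s + 1)) (Fin.last s).castSucc := by
    rw [Q, PWith, Fin.sum_univ_castSucc, Q, PWith, lift_sum, lift_sum]
    congr 1
    refine Finset.sum_congr rfl fun i _ => ?_
    rw [lift_pot, lift_pot]
    congr 1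
    · exact (Equiv.swap_apply_right _ _).symm
    · exact (hσ i).symm
  have h2 : ∀ T, Commute (S.pot (Fin.last (s + 1)) (Fin.last s).castSucc) (lift e T) := fun T => by
    rw [S.pot_of_ne (Fin.castSucc_lt_last _).ne']
    refine commute_lift _ _ _ _ ?_
    rw [Set.disjoint_left]
    rintro x ⟨i, rfl⟩ ⟨a, ha⟩
    revert ha
    refine Fin.cases ?_ (fun i => ?_) i
    · exact fun ha => (Fin.castSucc_lt_last _).ne ha
    · obtain rfl : i = 0 := Subsingleton.elim _ _
      exact fun ha => (Fin.castSucc_lt_last a).ne (Fin.castSucc_injective _ ha)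
  rw [h1, kap_add, map_add, ptr_kap_comm e h2, add_zero, (hF _).ptr_kap_perm e σ hσ]

theorem norm_Q_smul (s : ℕ) (c : ℂ) (A B : Op ι (s + 1)) (hA : ‖A‖ ≤ 1) (hB : ‖B‖ ≤ 1) :
    ‖A * (c • S.Q s) * B‖ ≤ ‖c • S.Q s‖ :=
  (norm_mul_le _ _).trans ((mul_le_mul (norm_mul_le _ _) hB (norm_nonneg _) (by positivity)).trans
    (by rw [mul_one]; exact mul_le_of_le_one_left (norm_nonneg _) hA))

/-- `𝒢*(-τ) 𝔞 𝒢*(τ)`. -/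
def AT (τ : ℝ) : Module.End ℂ (TSeq ι) := S.GT (-τ) * annT * S.GT τ

/-- `𝒢*(-τ) [𝔞, 𝒩*] 𝒢*(τ)`. -/
def vT (τ : ℝ) : Module.End ℂ (TSeq ι) := S.GT (-τ) * S.VT * S.GT τ

theorem adjoint_lift_U {s n : ℕ} (e : Fin s ↪ Fin n) (t : ℝ) :
    ContinuousLinearMap.adjoint (lift e (S.U s t)) = lift e (S.U s (-t)) := by
  rw [← ContinuousLinearMap.star_eq_adjoint, ← lift_star, ContinuousLinearMap.star_eq_adjoint,
    adjoint_U]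

theorem ptr_W_cancel (s : ℕ) (t : ℝ) (A B : Op ι (s + 1)) (f : TC (Fin (s + 1) → ι)) :
    TC.ptr (initEmb s) (TC.mulLR (S.W (Fin.last s) (-t) * A) (B * S.W (Fin.last s) t) f) =
      TC.ptr (initEmb s) (TC.mulLR A B f) :=
  TC.ptr_mulLR_cancel (initEmb s)
    (fun T => (S.commute_lift_W mem_range_initEmb T (-t)).symm)
    ((S.isUGroup_W (Fin.last s)).mul_neg t) A B f

theorem adjoint_Y (s : ℕ) (τ : ℝ) :
    ContinuousLinearMap.adjoint (S.Y (initEmb s) (Fin.last s) τ) =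
      S.U (s + 1) (-τ) * lift (initEmb s) (S.U s τ) * S.W (Fin.last s) τ := by
  have h1 : star (S.W (Fin.last s) (-τ)) = S.W (Fin.last s) τ := by
    rw [(S.isUGroup_W _).star_eq, neg_neg]
  have h2 : star (lift (initEmb s) (S.U s (-τ))) = lift (initEmb s) (S.U s τ) := by
    rw [ContinuousLinearMap.star_eq_adjoint, adjoint_lift_U, neg_neg]
  rw [← ContinuousLinearMap.star_eq_adjoint, Y, star_mul, star_mul, h1, h2,
    (S.isUGroup_U _).star_eq, mul_assoc]

/-- The free evolution of the traced-out particle can be inserted at no cost, since it cancels under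
the trace. The conjugating operator becomes `Y`, which is strongly differentiable everywhere
although the full evolutions are not. -/
theorem AT_apply (τ : ℝ) (F : TSeq ι) (s : ℕ) : S.AT τ F s = TC.ptr (initEmb s)
    (TC.conj (S.Y (initEmb s) (Fin.last s) τ) (S.Y (initEmb s) (Fin.last s) τ) (F (s + 1))) := by
  have h1 : TC.conj (S.Y (initEmb s) (Fin.last s) τ) (S.Y (initEmb s) (Fin.last s) τ) (F (s + 1)) =
      TC.mulLR (S.W (Fin.last s) (-τ) * (lift (initEmb s) (S.U s (-τ)) * S.U (s + 1) τ))
        ((S.U (s + 1) (-τ) * lift (initEmb s) (S.U s τ)) * S.W (Fin.last s) τ) (F (s + 1)) := by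
    refine TC.toOp_injective ?_
    rw [TC.toOp_conj, TC.toOp_mulLR, adjoint_Y, Y]
    simp only [mul_assoc]
    rfl
  rw [h1, ptr_W_cancel, ← TC.mulLR_mulLR, TC.ptr_mulLR_lift, AT, Module.End.mul_apply,
    Module.End.mul_apply, GT_apply, annT_apply, GT_apply, neg_neg]

theorem isSelfAdjoint_Q (s : ℕ) : IsSelfAdjoint (S.Q s) :=
  isSelfAdjoint_sum _ fun _ _ => S.isSelfAdjoint_pot _ _

/-- Differentiating the two factors `Y` of the conjugation produces the two terms of the commutator
with `Q s`; removing the inserted free evolution leaves [𝔞, 𝒩*] in the interaction picture. -/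
theorem strongC1_AT (s : ℕ) : ∃ A v : ℝ → TC (Fin (s + 1) → ι) →L[ℂ] TC (Fin s → ι),
    StrongC1 A v ∧ (∀ τ F, S.AT τ F s = A τ (F (s + 1))) ∧ ∀ τ F, S.vT τ F s = v τ (F (s + 1)) := by
  set Y := S.Y (initEmb s) (Fin.last s) with hY
  let Y' : ℝ → Op ι (s + 1) := fun t => S.W (Fin.last s) (-t) * lift (initEmb s) (S.U s (-t)) *
    (-Complex.I • S.Q s) * S.U (s + 1) t
  have h1 : StrongC1 Y Y' := S.strongC1_Y mem_range_initEmb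
  have hL : ∀ t, ‖S.W (Fin.last s) (-t) * lift (initEmb s) (S.U s (-t))‖ ≤ 1 := fun t =>
    (norm_mul_le _ _).trans (mul_le_one₀ ((S.isUGroup_W _).norm_le _) (norm_nonneg _)
      ((norm_lift_le _ _).trans ((S.isUGroup_U _).norm_le _)))
  have hYn : ∀ t, ‖Y t‖ ≤ 1 := fun t => (norm_mul_le _ _).trans
    (mul_le_one₀ (hL t) (norm_nonneg _) ((S.isUGroup_U _).norm_le _))
  have hYn' : ∀ t, ‖Y' t‖ ≤ ‖-Complex.I • S.Q s‖ := fun t =>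
    S.norm_Q_smul s _ _ _ (hL t) ((S.isUGroup_U _).norm_le _)
  have h2 := (StrongC1.const (TC.ptr (initEmb s))).comp (TC.strongC1_conj h1 h1 hYn hYn hYn' hYn')
  refine ⟨_, _, h2, fun τ F => S.AT_apply τ F s, fun τ F => ?_⟩
  have hadj : ContinuousLinearMap.adjoint (Y' τ) = S.U (s + 1) (-τ) * (Complex.I • S.Q s) *
      (lift (initEmb s) (S.U s τ) * S.W (Fin.last s) τ) := by
    have e1 : star (S.W (Fin.last s) (-τ)) = S.W (Fin.last s) τ := by
      rw [(S.isUGroup_W _).star_eq, neg_neg]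
    have e2 : star (lift (initEmb s) (S.U s (-τ))) = lift (initEmb s) (S.U s τ) := by
      rw [ContinuousLinearMap.star_eq_adjoint, adjoint_lift_U, neg_neg]
    have e3 : star (-Complex.I • S.Q s) = Complex.I • S.Q s := by
      rw [star_smul, (S.isSelfAdjoint_Q s).star_eq]
      congr 1
      simp
    rw [← ContinuousLinearMap.star_eq_adjoint, star_mul, star_mul, star_mul, e1, e2, e3,
      (S.isUGroup_U _).star_eq, mul_assoc]
  have h3 : TC.conj (Y' τ) (Y τ) (F (s + 1)) + TC.conj (Y τ) (Y' τ) (F (s + 1)) =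
      TC.mulLR (S.W (Fin.last s) (-τ) * lift (initEmb s) (S.U s (-τ)))
        (lift (initEmb s) (S.U s τ) * S.W (Fin.last s) τ)
        (kap (S.Q s) (TC.mulLR (S.U (s + 1) τ) (S.U (s + 1) (-τ)) (F (s + 1)))) := by
    refine TC.toOp_injective ?_
    rw [map_add, TC.toOp_conj, TC.toOp_conj, TC.toOp_mulLR, toOp_kap, TC.toOp_mulLR, hadj, hY,
      adjoint_Y, PairSystem.Y]
    change Y' τ * (TC.toOp (F (s + 1)) * _) + _ * (TC.toOp (F (s + 1)) * _) = _
    simp only [Y', mul_smul_comm, smul_mul_assoc, smul_sub, mul_sub, sub_mul, mul_assoc]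
    module
  -- The product rule contributes a zero term for the constant factor `TC.ptr`.
  refine Eq.trans ?_ (zero_add (TC.ptr (initEmb s)
    (TC.conj (Y' τ) (Y τ) (F (s + 1)) + TC.conj (Y τ) (Y' τ) (F (s + 1))))).symm
  rw [h3, ptr_W_cancel, TC.ptr_mulLR_lift, vT, Module.End.mul_apply, Module.End.mul_apply, GT_apply,
    VT_apply, GT_apply, neg_neg]

end PairSystem

/-! ### Continuous differentiability as a derivation -/

section

variable {X : ℕ → Type*} [∀ n, NormedAddCommGroup (X n)] [∀ n, NormedSpace ℂ (X n)]

theorem isDerivation_C1 : IsDerivation (X := X) fun _ f f' =>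
    (∀ t, HasDerivAt f (f' t) t) ∧ Continuous f' where
  const _ x := ⟨fun t => hasDerivAt_const t x, continuous_const⟩
  add _ _ _ _ _ hf hh := ⟨fun t => (hf.1 t).add (hh.1 t), hf.2.add hh.2⟩
  smul _ c _ _ hf := ⟨fun t => (hf.1 t).const_smul c, hf.2.const_smul c⟩

end

/-! ### The perturbation series and the cumulant series for states -/

namespace PairSystem

variable {ι H : Type*} [NormedAddCommGroup H] [InnerProductSpace ℂ H] [CompleteSpace H]
  (S : PairSystem ι H)

theorem AT_mem (τ : ℝ) {F : TSeq ι} (hF : F ∈ TSymm ι) : S.AT τ F ∈ TSymm ι :=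
  S.GT_mem _ (annT_mem (S.GT_mem _ hF))

theorem AT_vT_comm (τ : ℝ) {F : TSeq ι} (hF : F ∈ TSymm ι) :
    S.AT τ (S.vT τ F) = S.vT τ (S.AT τ F) := by
  have h : ∀ F, S.GT τ (S.GT (-τ) F) = F := fun F =>
    DFunLike.congr_fun (S.GT_mul_neg τ) F
  simp only [AT, vT, Module.End.mul_apply, h]
  rw [S.annT_VT (S.GT_mem τ hF)]

theorem interCoeff_C1 {F : TSeq ι} (hF : F ∈ TSymm ι) (n s : ℕ) :
    (∀ τ, HasDerivAt (fun τ => interCoeff annT (S.AT τ) (n + 1) F s)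
      (S.vT τ (interCoeff annT (S.AT τ) n F) s) τ) ∧
    Continuous fun τ => S.vT τ (interCoeff annT (S.AT τ) n F) s := by
  refine isDerivation_C1.interCoeff (A := S.AT) (v := S.vT) (Y := TSymm ι)
    (fun F hF => annT_mem hF) (fun τ F hF => S.AT_mem τ hF) (fun τ F hF => S.AT_vT_comm τ hF)
    (fun f f' hf s => ?_) hF n s
  obtain ⟨A, v, hA, h1, h2⟩ := S.strongC1_AT s
  simp only [h1, h2]
  have hc : Continuous fun τ => f τ (s + 1) :=
    continuous_iff_continuousAt.2 fun t => ((hf (s + 1)).1 t).continuousAt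
  exact ⟨fun t => hA.apply ((hf (s + 1)).1 t),
    (hA.cont.apply hc).add (hA.strongCont.apply (hf (s + 1)).2)⟩

theorem AT_zero : S.AT 0 = annT := by rw [AT, neg_zero, GT_zero, one_mul, mul_one]

/-- The fundamental theorem of calculus for the coefficient in the interaction picture, whose
initial value is zero. Applying `GT t` under the integral gives `GT (t - τ) * VT * GT τ`, and the
last factor turns the coefficient back into `conjCoeff` of order `n`. -/
theorem conjCoeff_succ_eq_integral {F : TSeq ι} (hF : F ∈ TSymm ι) (n s : ℕ) (t : ℝ) :
    conjCoeff annT (S.GT t) (n + 1) F s =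
      ∫ τ in (0 : ℝ)..t, S.GT (t - τ) (S.VT (conjCoeff annT (S.GT τ) n F)) s := by
  obtain ⟨hd, hc⟩ := S.interCoeff_C1 hF n s
  have h1 := intervalIntegral.integral_eq_sub_of_hasDerivAt (fun τ _ => hd τ)
    (hc.intervalIntegrable 0 t)
  rw [AT_zero, interCoeff_self, LinearMap.zero_apply, Pi.zero_apply, sub_zero] at h1
  rw [← mul_interCoeff (S.GT_mul_neg t), Module.End.mul_apply]
  have h2 : S.GT t (interCoeff annT (S.GT (-t) * annT * S.GT t) (n + 1) F) s =
      TC.mulLR (S.U s t) (S.U s (-t)) (interCoeff annT (S.AT t) (n + 1) F s) := rfl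
  rw [h2, ← h1, ← ContinuousLinearMap.intervalIntegral_comp_comm _ (hc.intervalIntegrable 0 t)]
  refine intervalIntegral.integral_congr fun τ _ => ?_
  change S.GT t (S.vT τ (interCoeff annT (S.AT τ) n F)) s = _
  rw [← mul_interCoeff (S.GT_mul_neg τ) n, vT, Module.End.mul_apply, Module.End.mul_apply,
    ← Module.End.mul_apply (S.GT t), GT_mul, ← sub_eq_add_neg]
  rfl

/-- The integrands of the perturbation series, on sequences of trace-class operators. -/
def dT (F : TSeq ι) : (n : ℕ) → ℝ → (Fin n → ℝ) → TSeq ι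
  | 0, t, _ => S.GT t F
  | n + 1, t, τ => S.GT (t - τ 0) (S.VT (dT F n (τ 0) (Fin.tail τ)))

theorem duhamel_ops (F : TSeq ι) (n : ℕ) : ∀ (t : ℝ) (τ : Fin n → ℝ),
    duhamel S.Gst S.commAnn (ops F) n t τ = ops (S.dT F n t τ) := by
  induction n with
  | zero => exact fun t _ => S.Gst_ops t F
  | succ n ih =>
    intro t τ
    rw [duhamel, ih, commAnn_ops, Gst_ops, dT]

theorem continuous_dT {X : Type*} [TopologicalSpace X] [LocallyCompactSpace X] (F : TSeq ι) (n : ℕ) :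
    ∀ {t : X → ℝ} {τ : X → Fin n → ℝ}, Continuous t → Continuous τ → ∀ s,
      Continuous fun x => S.dT F n (t x) (τ x) s := by
  induction n with
  | zero => exact fun ht _ s => S.continuous_GT ht continuous_const
  | succ n ih =>
    intro t τ ht hτ s
    have h0 : Continuous fun x => τ x 0 := (continuous_apply 0).comp hτ
    have h1 : Continuous fun x => Fin.tail (τ x) :=
      continuous_pi fun i => (continuous_apply i.succ).comp hτ
    exact S.continuous_GT (ht.sub h0) ((S.vL s).continuous.comp (ih h0 h1 (s + 1)))

theorem iterInt_dT {F : TSeq ι} (hF : F ∈ TSymm ι) (n : ℕ) : ∀ (t : ℝ) (s : ℕ),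
    iterInt n t (fun τ => S.dT F n t τ s) = conjCoeff annT (S.GT t) n F s := by
  induction n with
  | zero =>
    intro t s
    have h : conjCoeff annT (S.GT t) 0 = S.GT t := by simp [conjCoeff]
    rw [h]
    rfl
  | succ n ih =>
    intro t s
    rw [S.conjCoeff_succ_eq_integral hF]
    refine intervalIntegral.integral_congr fun τ _ => ?_
    have h1 : ∀ τs : Fin n → ℝ, S.dT F (n + 1) t (Fin.cons τ τs) s =
        (TC.mulLR (S.U s (t - τ)) (S.U s (-(t - τ))) ∘L S.vL s) (S.dT F n τ τs (s + 1)) :=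
      fun τs => rfl
    simp only [h1]
    refine (iterInt_clm _ n τ (g := fun τs => S.dT F n τ τs (s + 1))
      (S.continuous_dT F n continuous_const continuous_id (s + 1))).trans ?_
    rw [ih]
    rfl

theorem UOn_eq_lift {m N : ℕ} (e : Fin m ↪ Fin N) {X : Finset (Fin N)} (he : Set.range e = X)
    (t : ℝ) : S.UOn t X = lift e (S.U m t) := onSet_eq_lift (S.isSymm_U m t) e he

theorem range_castLEEmb {s N : ℕ} (h : s ≤ N) :
    Set.range (Fin.castLEEmb h : Fin s ↪ Fin N) = (firstSet N s : Finset (Fin N)) := by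
  ext i
  simp only [firstSet, Finset.coe_filter, Finset.mem_univ, true_and, Set.mem_ofPred_eq]
  exact ⟨fun ⟨j, hj⟩ => hj ▸ j.2, fun hi => ⟨⟨i, hi⟩, rfl⟩⟩

/-- `𝒢*(t, X)` on trace-class operators. -/
def GTOn {N : ℕ} (t : ℝ) (X : Finset (Fin N)) : TC (Fin N → ι) →L[ℂ] TC (Fin N → ι) :=
  TC.mulLR (S.UOn t X) (S.UOn (-t) X)

theorem GstOn_apply {N : ℕ} (t : ℝ) (X : Finset (Fin N)) (f : Op ι N) :
    S.GstOn t X f = S.UOn t X * f * S.UOn (-t) X := rfl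

theorem GstOn_toOp {N : ℕ} (t : ℝ) (X : Finset (Fin N)) (f : TC (Fin N → ι)) :
    S.GstOn t X (TC.toOp f) = TC.toOp (S.GTOn t X f) := (TC.toOp_mulLR _ _ f).symm

theorem ptr_GTOn_lift {m N : ℕ} (e : Fin m ↪ Fin N) {X : Finset (Fin N)} (he : Set.range e = X)
    (t : ℝ) (f : TC (Fin N → ι)) :
    TC.ptr e (S.GTOn t X f) = TC.mulLR (S.U m t) (S.U m (-t)) (TC.ptr e f) := by
  rw [GTOn, S.UOn_eq_lift e he, S.UOn_eq_lift e he, TC.ptr_mulLR_lift]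

/-- The components of the integrands before the partial trace is taken. -/
def itT {N : ℕ} (f : TC (Fin N → ι)) : (n s : ℕ) → ℝ → (Fin n → ℝ) → TC (Fin N → ι)
  | 0, s, t, _ => S.GTOn t (firstSet N s) f
  | n + 1, s, t, τ => S.GTOn (t - τ 0) (firstSet N s)
      (∑ p : Fin N × Fin N with p.1.val < s ∧ p.2.val = s,
        kap (S.pot p.1 p.2) (itT f n (s + 1) (τ 0) (Fin.tail τ)))

theorem iterSt_toOp {N : ℕ} (f : TC (Fin N → ι)) (n : ℕ) : ∀ (s : ℕ) (t : ℝ) (τ : Fin n → ℝ),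
    S.iterSt (TC.toOp f) n s t τ = TC.toOp (S.itT f n s t τ) := by
  induction n with
  | zero => exact fun s t _ => S.GstOn_toOp t _ f
  | succ n ih =>
    intro s t τ
    simp only [iterSt, itT, ih, intSt_toOp]
    rw [← map_sum, GstOn_toOp]

theorem sum_pairs {M : Type*} [AddCommMonoid M] {s N : ℕ} (h : s + 1 ≤ N)
    (φ : Fin N → Fin N → M) :
    ∑ p : Fin N × Fin N with p.1.val < s ∧ p.2.val = s, φ p.1 p.2 =
      ∑ i : Fin s, φ (Fin.castLE h i.castSucc) (Fin.castLE h (Fin.last s)) := by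
  symm
  refine Finset.sum_bij (fun i _ => (Fin.castLE h i.castSucc, Fin.castLE h (Fin.last s)))
    (fun i _ => ?_) (fun i _ j _ hij => ?_) (fun p hp => ?_) fun _ _ => rfl
  · simp
  · have := congrArg (fun p : Fin N × Fin N => p.1.val) hij
    exact Fin.ext this
  · obtain ⟨h1, h2⟩ := (Finset.mem_filter.1 hp).2
    exact ⟨⟨p.1, h1⟩, Finset.mem_univ _, Prod.ext (Fin.ext rfl) (Fin.ext h2.symm)⟩

/-- The particles are traced out one at a time, the outermost evolution needing only the first `s`.
Under the trace to `s + 1` particles the couplings of particle `s + 1` to the first `s` add up to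
the lift of `Q s`. -/
theorem ptr_itT (F : TSeq ι) (n : ℕ) : ∀ {s N : ℕ} (_ : N = s + n) (h : s ≤ N) (t : ℝ)
    (τ : Fin n → ℝ), TC.ptr (Fin.castLEEmb h) (S.itT (F N) n s t τ) = S.dT F n t τ s := by
  induction n with
  | zero =>
    intro s N hN h t τ
    obtain rfl : N = s := hN
    rw [itT, S.ptr_GTOn_lift _ (range_castLEEmb h)]
    have : (Fin.castLEEmb h : Fin N ↪ Fin N) = Function.Embedding.refl _ := rfl
    rw [this, TC.ptr_refl]
    rfl
  | succ n ih =>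
    intro s N hN h t τ
    have h1 : s + 1 ≤ N := by omega
    rw [itT, S.ptr_GTOn_lift _ (range_castLEEmb h),
      sum_pairs h1 (fun i j => kap (S.pot i j) (S.itT (F N) n (s + 1) (τ 0) (Fin.tail τ))),
      ← kap_sum]
    have h2 : ∑ i : Fin s, S.pot (Fin.castLE h1 i.castSucc) (Fin.castLE h1 (Fin.last s)) =
        lift (Fin.castLEEmb h1) (S.Q s) := by
      rw [Q, PWith, lift_sum]
      refine Finset.sum_congr rfl fun i _ => ?_
      rw [lift_pot, pot_comm]
      rfl
    have h3 : (Fin.castLEEmb h : Fin s ↪ Fin N) = (initEmb s).trans (Fin.castLEEmb h1) := rfl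
    rw [h2, h3, ← TC.ptr_trans, ptr_kap_lift, ih (by omega) h1]
    rfl

/-! ### Cumulants -/

theorem UOn_mul_neg {N : ℕ} (t : ℝ) (X : Finset (Fin N)) : S.UOn t X * S.UOn (-t) X = 1 := by
  rw [UOn, UOn, onSet, onSet, ← lift_mul, (S.isUGroup_U _).mul_neg, lift_one]

theorem UOn_neg_mul {N : ℕ} (t : ℝ) (X : Finset (Fin N)) : S.UOn (-t) X * S.UOn t X = 1 := by
  have := S.UOn_mul_neg (-t) X
  rwa [neg_neg] at this

/-- A unitary of the traced-out particles meets its inverse by cyclicity. This is why only the block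
containing `{1, …, s}` survives in a cumulant. -/
theorem ptr_GTOn_of_disjoint {α : Type*} {N : ℕ} (e : α ↪ Fin N) {X : Finset (Fin N)}
    (h : ∀ a, e a ∉ X) (t : ℝ) (f : TC (Fin N → ι)) : TC.ptr e (S.GTOn t X f) = TC.ptr e f := by
  have := TC.ptr_mulLR_cancel e (Q := S.UOn t X) (Q' := S.UOn (-t) X) (fun T => ?_)
    (S.UOn_neg_mul t X) 1 1 f
  · rw [mul_one, one_mul] at this
    refine this.trans ?_
    congr 1
    exact TC.toOp_injective (by rw [TC.toOp_mulLR, one_mul, mul_one])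
  · refine commute_lift _ _ _ _ ?_
    rw [range_orderEmbOfFin X rfl, Set.disjoint_left]
    rintro x hx ⟨a, rfl⟩
    exact h a hx

theorem commute_UOn {N : ℕ} (t t' : ℝ) {X Y : Finset (Fin N)} (h : Disjoint X Y) :
    Commute (S.UOn t X) (S.UOn t' Y) := commute_onSet X Y _ _ h

theorem commute_GstOn {N : ℕ} (t : ℝ) {X Y : Finset (Fin N)} (h : Disjoint X Y) :
    Commute (S.GstOn t X) (S.GstOn t Y) := by
  refine LinearMap.ext fun f => ?_
  rw [Module.End.mul_apply, Module.End.mul_apply, GstOn_apply, GstOn_apply, GstOn_apply, GstOn_apply,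
    ← mul_assoc, ← mul_assoc, ← mul_assoc, ← mul_assoc, (S.commute_UOn t t h).eq, mul_assoc _ _
    (S.UOn (-t) X), mul_assoc _ _ (S.UOn (-t) Y), (S.commute_UOn (-t) (-t) h).eq]

theorem ptr_prod_GstOn {α : Type*} {N : ℕ} (e : α ↪ Fin N) (t : ℝ) (f : TC (Fin N → ι))
    {τ : Type*} (c : τ → Finset (Fin N)) (L : List τ) (hL : ∀ X ∈ L, ∀ a, e a ∉ c X) :
    ∃ g, (L.map fun X => S.GstOn t (c X)).prod (TC.toOp f) = TC.toOp g ∧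
      TC.ptr e g = TC.ptr e f := by
  induction L with
  | nil => exact ⟨f, rfl, rfl⟩
  | cons X L ih =>
    obtain ⟨g, h1, h2⟩ := ih fun X hX => hL X (List.mem_cons_of_mem _ hX)
    refine ⟨S.GTOn t (c X) g, ?_, ?_⟩
    · rw [List.map_cons, List.prod_cons, Module.End.mul_apply, h1, GstOn_toOp]
    · rw [S.ptr_GTOn_of_disjoint e (hL X List.mem_cons_self), h2]

theorem natAdd_notMem_firstSet (s n : ℕ) (i : Fin n) : Fin.natAdd s i ∉ firstSet (s + n) s := by
  simp [firstSet]

theorem castAdd_mem_firstSet (s n : ℕ) (i : Fin s) : Fin.castAdd n i ∈ firstSet (s + n) s := by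
  simp [firstSet]

/-- The value of a generating operator under the partial trace, up to operators whose partial trace
vanishes. -/
theorem ptr_cumSt (t : ℝ) (s n : ℕ) (f : TC (Fin (s + n) → ι)) :
    ∃ k, S.cumSt t s n (TC.toOp f) = S.redCumStSets t s n (TC.toOp f) + TC.toOp k ∧
      TC.ptr (Fin.castAddEmb n : Fin s ↪ Fin (s + n)) k = 0 := by
  set e : Fin s ↪ Fin (s + n) := Fin.castAddEmb n with he
  -- `traceOut` is a `tsum` with a default value, not a linear map on all bounded operators. The
  -- reduction is therefore made modulo the trace-class operators whose partial trace vanishes.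
  let K : Submodule ℂ (Op ι (s + n)) :=
    (LinearMap.ker (TC.ptr e).toLinearMap).map
      (TC.toOp (A := Fin (s + n) → ι)).toLinearMap
  let L : Module.End ℂ (Op ι (s + n)) →ₗ[ℂ] Op ι (s + n) ⧸ K :=
    K.mkQ ∘ₗ LinearMap.applyₗ (TC.toOp f)
  have hsub : ∀ A B : Module.End ℂ (Op ι (s + n)), L A = L B ↔
      A (TC.toOp f) - B (TC.toOp f) ∈ K := fun A B => Submodule.Quotient.eq K
  have key := map_cumulant (S.GstOn t) (firstSet (s + n) s) (Fin.natAdd s : Fin n → Fin (s + n)) L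
    fun P => by
      rw [hsub]
      have hP0 := P.part_mem.2 (Finset.mem_univ (0 : Fin (n + 1)))
      have hdis : ∀ A ∈ P.parts, ∀ B ∈ P.parts, A ≠ B → Disjoint
          (A.biUnion (clusters (firstSet (s + n) s) (Fin.natAdd s : Fin n → Fin (s + n))))
          (B.biUnion (clusters (firstSet (s + n) s) (Fin.natAdd s : Fin n → Fin (s + n)))) :=
        fun A hA B hB hAB => disjoint_biUnion_clusters (Fin.natAdd_injective n s)
          (natAdd_notMem_firstSet s n) (P.disjoint hA hB hAB)
      rw [(prod_toList_eq P hP0 _ fun A hA B hB hAB => S.commute_GstOn t (hdis A hA B hB hAB)).2,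
        Module.End.mul_apply, GstOn_toOp]
      obtain ⟨g, h1, h2⟩ := S.ptr_prod_GstOn e t _ (fun X : Finset (Fin (n + 1)) => X.biUnion
        (clusters (firstSet (s + n) s) (Fin.natAdd s : Fin n → Fin (s + n))))
        (P.parts.erase (P.part 0)).toList fun X hX a ha => by
          rw [Finset.mem_toList, Finset.mem_erase] at hX
          refine Finset.disjoint_left.1 (hdis X hX.2 _ hP0 hX.1) ha ?_
          exact Finset.mem_biUnion.2 ⟨0, P.mem_part (Finset.mem_univ _),
            castAdd_mem_firstSet s n a⟩
      rw [h1, ← map_sub]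
      exact ⟨_, by
        change TC.ptr e _ = 0
        rw [map_sub, h2, sub_self], rfl⟩
  obtain ⟨k, hk, hk2⟩ := (hsub _ _).1 key
  refine ⟨k, ?_, hk⟩
  rw [← sub_eq_iff_eq_add']
  exact hk2.symm

/-- The complement of `X` is traced out first, which is `annT ^ (n - k)`; the particles in `X`
evolve; then they are traced down to the first `s`, which is `annT ^ k`. Symmetry leaves only the
cardinality of `X`. -/
theorem ptr_GTOn_eq {F : TSeq ι} (hF : F ∈ TSymm ι) (t : ℝ) {s n k : ℕ} (hk : k ≤ n)
    {X : Finset (Fin (s + n))} (hX : firstSet (s + n) s ⊆ X) (hc : X.card = s + k) :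
    TC.ptr (Fin.castAddEmb n : Fin s ↪ Fin (s + n)) (S.GTOn t X (F (s + n))) =
      (annT ^ k * S.GT t * annT ^ (n - k) : Module.End ℂ (TSeq ι)) F s := by
  let e : Fin (s + k) ↪ Fin (s + n) := (X.orderEmbOfFin hc).toEmbedding
  have he : Set.range e = X := range_orderEmbOfFin X hc
  have h1 : ∀ a : Fin s, ∃ b, e b = Fin.castAdd n a := fun a => by
    have : Fin.castAdd n a ∈ Set.range e := by
      rw [he]; exact hX (castAdd_mem_firstSet s n a)
    exact this
  choose e' he' using h1
  let e'' : Fin s ↪ Fin (s + k) := ⟨e', fun a b hab => by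
    have h : Fin.castAdd n a = Fin.castAdd n b := by rw [← he', ← he', hab]
    exact Fin.castAdd_injective s n h⟩
  have h2 : (Fin.castAddEmb n : Fin s ↪ Fin (s + n)) = e''.trans e :=
    Function.Embedding.ext fun a => (he' a).symm
  rw [h2, ← TC.ptr_trans, S.ptr_GTOn_lift e he, ← annT_pow_apply hF (n - k) (by omega) e,
    Module.End.mul_apply, Module.End.mul_apply,
    annT_pow_apply (S.GT_mem t (annT_pow_mem hF (n - k))) k rfl e'', GT_apply]

/-- The subsets `Y` are grouped by cardinality, which produces the binomial coefficients; reflecting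
the index matches `|Y|` with `n - k`. -/
theorem traceOut_redCumStSets {F : TSeq ι} (hF : F ∈ TSymm ι) (t : ℝ) (s n : ℕ) :
    ∃ g, S.redCumStSets t s n (ops F (s + n)) = TC.toOp g ∧
      TC.ptr (Fin.castAddEmb n : Fin s ↪ Fin (s + n)) g =
        (∑ k ∈ Finset.range (n + 1),
          ((-1 : ℂ) ^ k * (n.choose k : ℂ)) •
            (annT ^ (n - k) * S.GT t * annT ^ k) : Module.End ℂ (TSeq ι)) F s := by
  refine ⟨∑ Y : Finset (Fin n), (-1 : ℂ) ^ (n - Y.card) •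
    S.GTOn t (firstSet (s + n) s ∪ Y.image (Fin.natAdd s)) (F (s + n)), ?_, ?_⟩
  · rw [redCumStSets, redCumulantSets, LinearMap.sum_apply, map_sum]
    refine Finset.sum_congr rfl fun Y _ => ?_
    rw [LinearMap.smul_apply, map_smul]
    exact congrArg _ (S.GstOn_toOp _ _ _)
  · have hcard : ∀ Y : Finset (Fin n), Y.card ≤ n := fun Y => by
      simpa using Finset.card_le_univ Y
    have hX : ∀ Y : Finset (Fin n),
        (firstSet (s + n) s ∪ Y.image (Fin.natAdd s)).card = s + Y.card := fun Y => by
      rw [Finset.card_union_of_disjoint, Finset.card_image_of_injective _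
        (Fin.natAdd_injective n s)]
      · congr 1
        have := range_castLEEmb (Nat.le_add_right s n)
        have h2 : firstSet (s + n) s = Finset.univ.map (Fin.castLEEmb (Nat.le_add_right s n)) := by
          rw [← Finset.coe_inj, ← this, Finset.coe_map, Finset.coe_univ, Set.image_univ]
        rw [h2, Finset.card_map, Finset.card_univ, Fintype.card_fin]
      · rw [Finset.disjoint_right]
        intro x hx
        obtain ⟨i, -, rfl⟩ := Finset.mem_image.1 hx
        exact natAdd_notMem_firstSet s n i
    rw [map_sum]
    have h1 : ∀ Y ∈ (Finset.univ : Finset (Fin n)).powerset, TC.ptr (Fin.castAddEmb n) ((-1 : ℂ) ^ (n - Y.card) •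
        S.GTOn t (firstSet (s + n) s ∪ Y.image (Fin.natAdd s)) (F (s + n))) =
        (fun k => (-1 : ℂ) ^ (n - k) • (annT ^ k * S.GT t * annT ^ (n - k) : Module.End ℂ (TSeq ι)) F s) Y.card :=
      fun Y _ => by
        rw [map_smul, S.ptr_GTOn_eq hF t (hcard Y) Finset.subset_union_left (hX Y)]
    rw [← Finset.powerset_univ, Finset.sum_congr rfl h1, Finset.sum_powerset_apply_card
      (fun k => (-1 : ℂ) ^ (n - k) • (annT ^ k * S.GT t * annT ^ (n - k) : Module.End ℂ (TSeq ι)) F s),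
      Finset.card_univ, Fintype.card_fin, ← Finset.sum_range_reflect, LinearMap.sum_apply,
      Finset.sum_apply]
    refine Finset.sum_congr rfl fun k hk => ?_
    have hk' : k ≤ n := Nat.lt_succ_iff.1 (Finset.mem_range.1 hk)
    have e1 : n + 1 - 1 - k = n - k := by omega
    rw [e1, Nat.sub_sub_self hk', Nat.choose_symm hk', ← Nat.cast_smul_eq_nsmul ℂ, smul_smul,
      LinearMap.smul_apply, Pi.smul_apply, mul_comm]

theorem firstSet_card {N m : ℕ} (h : m ≤ N) : (firstSet N m).card = m := by
  have h2 : firstSet N m = Finset.univ.map (Fin.castLEEmb h) := by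
    rw [← Finset.coe_inj, ← range_castLEEmb h, Finset.coe_map, Finset.coe_univ, Set.image_univ]
  rw [h2, Finset.card_map, Finset.card_univ, Fintype.card_fin]

theorem traceOut_redCumSt {F : TSeq ι} (hF : F ∈ TSymm ι) (t : ℝ) (s n : ℕ) :
    ∃ g, S.redCumSt t s n (ops F (s + n)) = TC.toOp g ∧
      TC.ptr (Fin.castAddEmb n : Fin s ↪ Fin (s + n)) g =
        (∑ k ∈ Finset.range (n + 1),
          ((-1 : ℂ) ^ k * (n.choose k : ℂ)) •
            (annT ^ (n - k) * S.GT t * annT ^ k) : Module.End ℂ (TSeq ι)) F s := by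
  refine ⟨∑ k ∈ Finset.range (n + 1), ((-1 : ℂ) ^ k * (n.choose k : ℂ)) •
    S.GTOn t (firstSet (s + n) (s + n - k)) (F (s + n)), ?_, ?_⟩
  · rw [redCumSt, LinearMap.sum_apply, map_sum]
    refine Finset.sum_congr rfl fun k _ => ?_
    rw [LinearMap.smul_apply, map_smul]
    exact congrArg _ (S.GstOn_toOp _ _ _)
  · rw [map_sum, LinearMap.sum_apply, Finset.sum_apply]
    refine Finset.sum_congr rfl fun k hk => ?_
    have hk' : k ≤ n := Nat.lt_succ_iff.1 (Finset.mem_range.1 hk)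
    rw [map_smul, S.ptr_GTOn_eq hF t (Nat.sub_le n k) (fun i hi => ?_)
      ((firstSet_card (Nat.sub_le _ _)).trans (by omega)), Nat.sub_sub_self hk',
      LinearMap.smul_apply, Pi.smul_apply]
    have := (Finset.mem_filter.1 hi).2
    exact Finset.mem_filter.2 ⟨Finset.mem_univ _, by omega⟩

theorem stateTerm_redCumStSets {F : TSeq ι} (hF : F ∈ TSymm ι) (t : ℝ) (n : ℕ) :
    stateTerm (S.redCumStSets t) (ops F) n = ops (conjCoeff annT (S.GT t) n F) := by
  funext s
  obtain ⟨g, h1, h2⟩ := S.traceOut_redCumStSets hF t s n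
  rw [stateTerm, h1, TC.traceOut_toOp, h2, ops, conjCoeff, LinearMap.smul_apply, Pi.smul_apply,
    map_smul]

theorem stateTerm_redCumSt {F : TSeq ι} (hF : F ∈ TSymm ι) (t : ℝ) (n : ℕ) :
    stateTerm (S.redCumSt t) (ops F) n = ops (conjCoeff annT (S.GT t) n F) := by
  funext s
  obtain ⟨g, h1, h2⟩ := S.traceOut_redCumSt hF t s n
  rw [stateTerm, h1, TC.traceOut_toOp, h2, ops, conjCoeff, LinearMap.smul_apply, Pi.smul_apply,
    map_smul]

theorem stateTerm_cumSt {F : TSeq ι} (hF : F ∈ TSymm ι) (t : ℝ) (n : ℕ) :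
    stateTerm (S.cumSt t) (ops F) n = ops (conjCoeff annT (S.GT t) n F) := by
  funext s
  obtain ⟨g, h1, h2⟩ := S.traceOut_redCumStSets hF t s n
  obtain ⟨k, h3, h4⟩ := S.ptr_cumSt t s n (F (s + n))
  change S.redCumStSets t s n (TC.toOp (F (s + n))) = _ at h1
  have h5 : S.cumSt t s n (ops F (s + n)) = TC.toOp (g + k) := by rw [map_add, ← h1]; exact h3
  rw [stateTerm, h5, TC.traceOut_toOp, map_add, h4, add_zero, h2, ops, conjCoeff,
    LinearMap.smul_apply, Pi.smul_apply, map_smul]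

end PairSystem

/-! ### Transfer from trace-class sequences to sequences of bounded operators -/

section

variable {ι : Type*}

theorem ops_sub (F G : TSeq ι) : ops (F - G) = ops F - ops G := funext fun n => map_sub TC.toOp (F n) (G n)

theorem ops_neg (F : TSeq ι) : ops (-F) = -ops F := funext fun n => map_neg TC.toOp (F n)

theorem ops_smul (c : ℂ) (F : TSeq ι) : ops (c • F) = c • ops F :=
  funext fun n => map_smul TC.toOp c (F n)

theorem ops_sum {κ : Type*} (t : Finset κ) (F : κ → TSeq ι) : ops (∑ k ∈ t, F k) = ∑ k ∈ t, ops (F k) :=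
  funext fun n => by
    rw [Finset.sum_apply, ops, Finset.sum_apply, map_sum]
    rfl

/-- `lift e` as a continuous linear map. -/
def liftL {α β : Type*} (e : α ↪ β) :
    (L2 (α → ι) →L[ℂ] L2 (α → ι)) →L[ℂ] (L2 (β → ι) →L[ℂ] L2 (β → ι)) :=
  LinearMap.mkContinuous
    { toFun := lift e
      map_add' := fun T T' => lift_add e T T'
      map_smul' := fun c T => lift_smul e c T } 1 fun T => by
    rw [one_mul]
    exact norm_lift_le e T

theorem IsSymm.of_hasSum {n : ℕ} {κ : Type*} {u : κ → Op ι n} {f : Op ι n} (hu : ∀ k, IsSymm (u k))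
    (h : HasSum u f) : IsSymm f := fun σ => by
  have h1 := h.mapL (liftL (ι := ι) σ.toEmbedding)
  have h2 : (fun k => liftL (ι := ι) σ.toEmbedding (u k)) = u := funext fun k => hu k σ
  rw [h2] at h1
  exact h1.unique h

theorem IsSymm.smul {n : ℕ} {f : Op ι n} (hf : IsSymm f) (c : ℂ) : IsSymm (c • f) := fun σ => by
  rw [lift_smul, hf σ]

theorem IsSymm.sum {n : ℕ} {κ : Type*} (t : Finset κ) {u : κ → Op ι n} (hu : ∀ k ∈ t, IsSymm (u k)) :
    IsSymm (∑ k ∈ t, u k) := fun σ => by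
  rw [lift_sum]
  exact Finset.sum_congr rfl fun k hk => hu k hk σ

theorem ann_iterate_ops (k : ℕ) (F : TSeq ι) : ann^[k] (ops F) = ops ((annT ^ k) F) := by
  induction k with
  | zero => rfl
  | succ k ih => rw [Function.iterate_succ_apply', ih, ann_ops, pow_succ', Module.End.mul_apply]

theorem neg_ann_iterate_ops (k : ℕ) (F : TSeq ι) : (-ann)^[k] (ops F) = ops (((-annT) ^ k) F) := by
  induction k with
  | zero => rfl
  | succ k ih =>
    rw [Function.iterate_succ_apply', ih, Pi.neg_apply, ann_ops, ← ops_neg, pow_succ',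
      Module.End.mul_apply, LinearMap.neg_apply]

/-- The maps in the theorem act on all sequences and need not be linear there. On trace-class
sequences they agree with linear maps, and the nested commutators inherit this. -/
theorem comm_iterate_ops (n : ℕ) : ∀ {A : OpSeq ι → OpSeq ι} {B : Module.End ℂ (TSeq ι)},
    (∀ F, A (ops F) = ops (B F)) → ∀ F,
      (comm ann)^[n] A (ops F) = ops ((fun b => annT * b - b * annT)^[n] B F) := by
  induction n with
  | zero => exact fun h F => h F
  | succ n ih =>
    intro A B h F
    rw [Function.iterate_succ_apply, Function.iterate_succ_apply]
    refine ih (fun F => ?_) F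
    rw [comm, h, ann_ops, ann_ops, h, ← ops_sub]
    rfl

theorem expTerm_ann_ops (F : TSeq ι) (n : ℕ) :
    expTerm ann (ops F) n = ops (((n.factorial : ℂ)⁻¹) • (annT ^ n) F) := by
  rw [expTerm, ann_iterate_ops, ops_smul]

theorem expTerm_neg_ann_ops (F : TSeq ι) (n : ℕ) :
    expTerm (-ann) (ops F) n = ops (((n.factorial : ℂ)⁻¹) • ((-annT) ^ n) F) := by
  rw [expTerm, neg_ann_iterate_ops, ops_smul]

theorem tsum_ops {α : ℝ} (hα : 0 < α) {u : ℕ → TSeq ι} (hu : ∑' n, l1Norm α (ops (u n)) ≠ ∞) :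
    (fun s => ∑' n, ops (u n) s) = ops (seqSum u) :=
  funext fun s => (((isSeqNorm_l1 hα).hasSum hu s).mapL TC.toOp).tsum_eq

theorem hasSumL1_ops {α : ℝ} (hα : 0 < α) {u : ℕ → TSeq ι} (hu : ∑' n, l1Norm α (ops (u n)) ≠ ∞) :
    HasSumL1 α (fun n => ops (u n)) (ops (seqSum u)) := by
  refine ((isSeqNorm_l1 hα).tendsto hu).congr fun N => ?_
  rw [ops_sub, ops_sum]

end

/-! ### Assembly of the results for states -/

namespace PairSystem

variable {ι H : Type*} [NormedAddCommGroup H] [InnerProductSpace ℂ H] [CompleteSpace H]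
  (S : PairSystem ι H)

theorem conjCoeff_mem {F : TSeq ι} (hF : F ∈ TSymm ι) (t : ℝ) (n : ℕ) :
    conjCoeff annT (S.GT t) n F ∈ TSymm ι := fun s => by
  have h : TC.toOp (conjCoeff annT (S.GT t) n F s) = ((n.factorial : ℂ)⁻¹) •
      ∑ k ∈ Finset.range (n + 1), ((-1 : ℂ) ^ k * (n.choose k : ℂ)) •
        TC.toOp ((annT ^ (n - k) * S.GT t * annT ^ k : Module.End ℂ (TSeq ι)) F s) := by
    rw [conjCoeff, LinearMap.smul_apply, Pi.smul_apply, map_smul, LinearMap.sum_apply,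
      Finset.sum_apply, map_sum]
    refine congrArg _ (Finset.sum_congr rfl fun k _ => ?_)
    rw [LinearMap.smul_apply, Pi.smul_apply, map_smul]
  change IsSymm _
  rw [h]
  exact (IsSymm.sum _ fun k _ => IsSymm.smul
    (annT_pow_mem (S.GT_mem t (annT_pow_mem hF k)) (n - k) s) _).smul _

section

variable {α : ℝ} (hα : 0 < α) {F : TSeq ι} (hs : F ∈ TSymm ι) (hF : l1Norm α (ops F) ≠ ∞) (t : ℝ)
include hα hF

theorem l1Norm_conjCoeff_ne_top : ∑' n, l1Norm α (ops (conjCoeff annT (S.GT t) n F)) ≠ ∞ :=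
  (isSeqNorm_l1 hα).conjCoeff_ne_top (inv_nonneg.2 hα.le) (l1Norm_annT_le hα) (S.l1Norm_GT_le α t) hF

theorem l1Norm_exp_neg_ne_top :
    ∑' n : ℕ, l1Norm α (ops (((n.factorial : ℂ)⁻¹) • ((-annT) ^ n) F)) ≠ ∞ :=
  (isSeqNorm_l1 hα).exp_ne_top (inv_nonneg.2 hα.le)
    ((isSeqNorm_l1 hα).neg_le (l1Norm_annT_le hα)) hF

theorem expMap_neg_ann : expMap (-ann) (ops F) =
    ops (seqSum fun n => ((n.factorial : ℂ)⁻¹) • ((-annT) ^ n) F) := by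
  rw [← tsum_ops hα (l1Norm_exp_neg_ne_top hα hF)]
  simp only [← expTerm_neg_ann_ops]
  rfl

theorem hasSumL1_expTerm_neg_ann : HasSumL1 α (expTerm (-ann) (ops F)) (expMap (-ann) (ops F)) := by
  rw [expMap_neg_ann hα hF, funext (expTerm_neg_ann_ops F)]
  exact hasSumL1_ops hα (l1Norm_exp_neg_ne_top hα hF)

theorem l1Norm_exp_ne_top :
    ∑' n : ℕ, l1Norm α (ops (((n.factorial : ℂ)⁻¹) • (annT ^ n) F)) ≠ ∞ :=
  (isSeqNorm_l1 hα).exp_ne_top (inv_nonneg.2 hα.le) (l1Norm_annT_le hα) hF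

theorem expMap_ann : expMap ann (ops F) =
    ops (seqSum fun n => ((n.factorial : ℂ)⁻¹) • (annT ^ n) F) := by
  rw [← tsum_ops hα (l1Norm_exp_ne_top hα hF)]
  simp only [← expTerm_ann_ops]
  rfl

theorem hasSumL1_expTerm_ann : HasSumL1 α (expTerm ann (ops F)) (expMap ann (ops F)) := by
  rw [expMap_ann hα hF, funext (expTerm_ann_ops F)]
  exact hasSumL1_ops hα (l1Norm_exp_ne_top hα hF)

theorem l1Norm_GT_exp_neg_ne_top :
    l1Norm α (ops (S.GT t (seqSum fun n => ((n.factorial : ℂ)⁻¹) • ((-annT) ^ n) F))) ≠ ∞ := by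
  refine ne_top_of_le_ne_top (l1Norm_exp_neg_ne_top hα hF) ((S.l1Norm_GT_le α t _).trans ?_)
  exact (isSeqNorm_l1 hα).le_tsum ((isSeqNorm_l1 hα).hasSum (l1Norm_exp_neg_ne_top hα hF))

include hs

theorem redDensity_ops : S.redDensity t (ops F) = ops (seqSum fun n => conjCoeff annT (S.GT t) n F) := by
  rw [← tsum_ops hα (S.l1Norm_conjCoeff_ne_top hα hF t)]
  simp only [← S.stateTerm_cumSt hs]
  rfl

theorem hasSumL1_conjCoeff :
    HasSumL1 α (fun n => ops (conjCoeff annT (S.GT t) n F)) (S.redDensity t (ops F)) := by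
  rw [S.redDensity_ops hα hs hF]
  exact hasSumL1_ops hα (S.l1Norm_conjCoeff_ne_top hα hF t)

theorem memL1_redDensity : MemL1 α (S.redDensity t (ops F)) := by
  have h := S.l1Norm_conjCoeff_ne_top hα hF t
  rw [S.redDensity_ops hα hs hF]
  refine ⟨fun s => ?_, lt_of_le_of_lt ((isSeqNorm_l1 hα).le_tsum ((isSeqNorm_l1 hα).hasSum h)) h.lt_top⟩
  exact IsSymm.of_hasSum (fun n => S.conjCoeff_mem hs t n s)
    (((isSeqNorm_l1 hα).hasSum h s).mapL TC.toOp)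

theorem redDensity_eq_expMap : S.redDensity t (ops F) =
    expMap ann (S.Gst t (expMap (-ann) (ops F))) := by
  rw [expMap_neg_ann hα hF, Gst_ops, expMap_ann hα (S.l1Norm_GT_exp_neg_ne_top hα hF t),
    S.redDensity_ops hα hs hF]
  exact congrArg ops ((isSeqNorm_l1 hα).exp_conj (inv_nonneg.2 hα.le) (l1Norm_annT_le hα)
    (S.l1Norm_GT_le α t) isSeqCont_annT (S.isSeqCont_GT t) hF)

end

theorem conjCoeff_ops (F : TSeq ι) (t : ℝ) (n : ℕ) : ((n.factorial : ℂ)⁻¹) •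
    ∑ k ∈ Finset.range (n + 1), ((-1 : ℂ) ^ k * (n.choose k : ℂ)) •
      ann^[n - k] (S.Gst t (ann^[k] (ops F))) = ops (conjCoeff annT (S.GT t) n F) := by
  rw [conjCoeff, LinearMap.smul_apply, LinearMap.sum_apply, ops_smul, ops_sum]
  refine congrArg _ (Finset.sum_congr rfl fun k _ => ?_)
  rw [ann_iterate_ops, Gst_ops, ann_iterate_ops, LinearMap.smul_apply, ops_smul]
  rfl

theorem comm_iterate_Gst (F : TSeq ι) (t : ℝ) (n : ℕ) : ((n.factorial : ℂ)⁻¹) •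
    (comm ann)^[n] (S.Gst t) (ops F) = ops (conjCoeff annT (S.GT t) n F) := by
  rw [comm_iterate_ops n (S.Gst_ops t), iterate_commutator, LinearMap.smul_apply, ← ops_smul, smul_smul,
    inv_mul_cancel₀ (Nat.cast_ne_zero.2 n.factorial_ne_zero), one_smul]

theorem iterInt_duhamel {F : TSeq ι} (hF : F ∈ TSymm ι) (t : ℝ) (n s : ℕ) :
    iterInt n t (fun τ => duhamel S.Gst S.commAnn (ops F) n t τ s) =
      ops (conjCoeff annT (S.GT t) n F) s := by
  simp only [S.duhamel_ops]
  refine (iterInt_clm TC.toOp n t (g := fun τ => S.dT F n t τ s)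
    (S.continuous_dT F n continuous_const continuous_id s)).trans ?_
  rw [S.iterInt_dT hF]
  rfl

theorem duhamel_eq_traceOut (F : TSeq ι) (t : ℝ) (n s : ℕ) (τ : Fin n → ℝ) :
    duhamel S.Gst S.commAnn (ops F) n t τ s =
      traceOut s n (S.iterSt (ops F (s + n)) n s t τ) := by
  rw [S.duhamel_ops]
  have h : S.iterSt (ops F (s + n)) n s t τ = TC.toOp (S.itT (F (s + n)) n s t τ) :=
    S.iterSt_toOp (F (s + n)) n s t τ
  rw [h, TC.traceOut_toOp]
  exact congrArg TC.toOp (S.ptr_itT F n rfl (Nat.le_add_right s n) t τ).symm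

theorem states {α : ℝ} {F₀ : OpSeq ι} (t : ℝ) (hα : 1 < α) (hF₀ : MemL1 α F₀) :
      MemL1 α (S.redDensity t F₀) ∧
      HasSumL1 α (stateTerm (S.cumSt t) F₀) (S.redDensity t F₀) ∧
      (∀ n, stateTerm (S.cumSt t) F₀ n = stateTerm (S.redCumStSets t) F₀ n) ∧
      (∀ n, stateTerm (S.cumSt t) F₀ n = stateTerm (S.redCumSt t) F₀ n) ∧
      HasSumL1 α
        (fun n => ((n.factorial : ℂ)⁻¹) • ∑ k ∈ Finset.range (n + 1),
          ((-1 : ℂ) ^ k * (n.choose k : ℂ)) • ann^[n - k] (S.Gst t (ann^[k] F₀)))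
        (S.redDensity t F₀) ∧
      HasSumL1 α (fun n => ((n.factorial : ℂ)⁻¹) • (comm ann)^[n] (S.Gst t) F₀)
        (S.redDensity t F₀) ∧
      HasSumL1 α (expTerm (-ann) F₀) (expMap (-ann) F₀) ∧
      HasSumL1 α (expTerm ann (S.Gst t (expMap (-ann) F₀)))
        (expMap ann (S.Gst t (expMap (-ann) F₀))) ∧
      S.redDensity t F₀ = expMap ann (S.Gst t (expMap (-ann) F₀)) ∧
      (∀ n s, Continuous fun τ : Fin n → ℝ => duhamel S.Gst S.commAnn F₀ n t τ s) ∧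
      HasSumL1 α
        (fun n s => iterInt n t fun τ => duhamel S.Gst S.commAnn F₀ n t τ s)
        (S.redDensity t F₀) ∧
      (∀ (n s : ℕ) (τ : Fin n → ℝ), duhamel S.Gst S.commAnn F₀ n t τ s =
        traceOut s n (S.iterSt (F₀ (s + n)) n s t τ)) := by
  have h0 : 0 < α := zero_lt_one.trans hα
  have hfin : ∀ n, traceNorm (F₀ n) < ∞ := fun n => by
    have h1 : ENNReal.ofReal (α ^ n) * traceNorm (F₀ n) ≠ ∞ :=
      ne_top_of_le_ne_top hF₀.2.ne
        (ENNReal.le_tsum (f := fun n => ENNReal.ofReal (α ^ n) * traceNorm (F₀ n)) n)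
    exact (ENNReal.lt_top_of_mul_ne_top_right h1 (ENNReal.ofReal_pos.2 (pow_pos h0 n)).ne')
  obtain ⟨F, rfl⟩ := exists_ops hfin
  have hs : F ∈ TSymm ι := hF₀.1
  have hF := hF₀.2.ne
  have key := S.hasSumL1_conjCoeff h0 hs hF t
  refine ⟨S.memL1_redDensity h0 hs hF t, ?_, fun n => ?_, fun n => ?_, ?_, ?_,
    hasSumL1_expTerm_neg_ann h0 hF, ?_, S.redDensity_eq_expMap h0 hs hF t, fun n s => ?_, ?_,
    fun n s τ => S.duhamel_eq_traceOut F t n s τ⟩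
  · rwa [funext (S.stateTerm_cumSt hs t)]
  · rw [S.stateTerm_cumSt hs, S.stateTerm_redCumStSets hs]
  · rw [S.stateTerm_cumSt hs, S.stateTerm_redCumSt hs]
  · rwa [funext (S.conjCoeff_ops F t)]
  · rwa [funext (S.comm_iterate_Gst F t)]
  · rw [expMap_neg_ann h0 hF, Gst_ops]
    exact hasSumL1_expTerm_ann h0 (S.l1Norm_GT_exp_neg_ne_top h0 hF t)
  · simp only [S.duhamel_ops]
    exact TC.toOp.continuous.comp (S.continuous_dT F n continuous_const continuous_id s)
  · simp only [S.iterInt_duhamel hs]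
    exact key

end PairSystem

/-! ### Bounded commutators with a generator and differentiable orbits -/

section

variable {E : Type*} [NormedAddCommGroup E] [InnerProductSpace ℂ E] [CompleteSpace E]

/-- `f` maps `D(A)` into itself, and `-i(A f - f A)` is the restriction of `g`. -/
def IsCommutatorWith (A : E →ₗ.[ℂ] E) (f g : E →L[ℂ] E) : Prop :=
  ∀ ψ χ, (ψ, χ) ∈ A.graph → ∃ η, (f ψ, η) ∈ A.graph ∧ g ψ = -Complex.I • (η - f χ)

theorem IsUGroup.norm_conj_le {U : ℝ → E →L[ℂ] E} (hU : IsUGroup U) (g : E →L[ℂ] E) (t : ℝ) :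
    ‖U t * g * U (-t)‖ ≤ ‖g‖ := by
  refine ContinuousLinearMap.opNorm_le_bound _ (norm_nonneg _) fun x => ?_
  rw [mul_apply_eq_comp, mul_apply_eq_comp, hU.norm_apply]
  refine (g.le_opNorm _).trans (le_of_eq ?_)
  rw [hU.norm_apply]

/-- On the domain both groups can be differentiated because `f` preserves it; the result is the
conjugated `g`, which is bounded uniformly, so density gives all vectors. -/
theorem IsUnitaryGroupOf.strongC1_of_isCommutatorWith {A : E →ₗ.[ℂ] E} {U : ℝ → E →L[ℂ] E}
    (h : IsUnitaryGroupOf A U) {f g : E →L[ℂ] E} (hfg : IsCommutatorWith A f g) :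
    StrongC1 (fun t => U t * f * U (-t)) (fun t => U t * g * U (-t)) := by
  have hU := h.isUGroup
  refine ⟨fun ψ t => hasDerivAt_strong_of_dense (X := fun τ => U τ * f * U (-τ))
    (X' := fun t => U t * g * U (-t)) (hU.norm_conj_le g) h.dense_domain (fun x hx t => ?_) ψ t,
    (hU.strongCont.comp (StrongCont.const g)).comp (hU.strongCont.comp_continuous continuous_neg)⟩
  obtain ⟨y, hx⟩ := LinearPMap.mem_domain_iff.1 hx
  obtain ⟨η, hη, hg⟩ := hfg _ _ (h.graph_apply hx (-t))
  have h1 : HasDerivAt (fun τ => f (U (-τ) x)) (f (-U (-t) (-Complex.I • y))) t :=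
    (f.restrictScalars ℝ).hasFDerivAt.comp_hasDerivAt t (hU.hasDerivAt_neg (h.mem_iff.1 hx) t)
  have h2 := hasDerivAt_strong_apply (L := U) (t := t)
    (Eventually.of_forall fun τ => hU.norm_le τ) (h.deriv_of_mem hη t) (hU.cont _).continuousAt h1
  refine h2.congr_deriv ?_
  rw [mul_apply_eq_comp, mul_apply_eq_comp, hg, ← map_add]
  congr 1
  simp only [map_neg, map_smul, smul_sub, neg_smul, neg_neg, sub_neg_eq_add]

theorem IsUnitaryGroupOf.isCommutatorWith {A : E →ₗ.[ℂ] E} {U : ℝ → E →L[ℂ] E}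
    (h : IsUnitaryGroupOf A U) {f g : E →L[ℂ] E}
    (hd : ∀ ψ, HasDerivAt (fun t => (U t * f * U (-t)) ψ) (g ψ) 0) : IsCommutatorWith A f g := by
  intro ψ χ hψ
  have hU := h.isUGroup
  -- The image of `f ψ` under `A` is forced by the required formula for `g ψ`. That `f ψ` is in the
  -- domain follows from `U t f ψ = (U t f U (-t)) U t ψ` and the product rule.
  refine ⟨f χ + Complex.I • g ψ, h.mem_iff.2 ?_, ?_⟩
  · have h0 : ∀ x, (U 0 * f * U (-0)) x = f x := fun x => by
      rw [neg_zero, hU.zero, one_mul, mul_one]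
    have hc : Continuous fun t => (U t * f * U (-t)) (-Complex.I • χ) :=
      ((hU.strongCont.comp (StrongCont.const f)).comp
        (hU.strongCont.comp_continuous continuous_neg)) _
    have h1 := hasDerivAt_strong_apply (L := fun t => U t * f * U (-t)) (t := 0) (g := fun t => U t ψ)
      (Eventually.of_forall fun t => hU.norm_conj_le f t) (hd _) hc.continuousAt (h.mem_iff.1 hψ)
    rw [h0, hU.zero, one_apply_eq_self] at h1
    refine (h1.congr_deriv ?_).congr_of_eventuallyEq (Eventually.of_forall fun t => ?_)
    · have e : -Complex.I • Complex.I • g ψ = g ψ := by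
        rw [smul_smul, neg_mul, Complex.I_mul_I, neg_neg, one_smul]
      rw [smul_add, e, map_smul, add_comm]
    · change _ = (U t * f * U (-t)) (U t ψ)
      rw [mul_apply_eq_comp, mul_apply_eq_comp, hU.neg_apply]
  · simp [smul_smul]

end

/-! ### The commutator of 𝔞 and 𝒩* -/

namespace PairSystem

variable {ι H : Type*} [NormedAddCommGroup H] [InnerProductSpace ℂ H] [CompleteSpace H]
  (S : PairSystem ι H)

theorem mulLR_U_eq (n : ℕ) (t : ℝ) : TC.mulLR (S.U n t) (S.U n (-t)) = TC.conj (S.U n t) (S.U n t) := by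
  rw [TC.mulLR, adjoint_U, neg_neg]

theorem strongCont_mulLR_U (n : ℕ) : StrongCont fun t => TC.mulLR (S.U n t) (S.U n (-t)) := by
  simp only [mulLR_U_eq]
  exact TC.strongCont_conj (S.isUGroup_U n).strongCont (S.isUGroup_U n).strongCont
    (S.isUGroup_U n).norm_le (S.isUGroup_U n).norm_le

/-- The orbit of `G` is continuous in trace norm, so its integral exists there; tested on vectors it
equals the increment of the orbit of `F`. The strong derivative is thereby upgraded to one in trace
norm. -/
theorem hasDerivAt_mulLR_U {n : ℕ} {F G : TC (Fin n → ι)}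
    (h : IsCommutatorWith (S.hamiltonian n) (TC.toOp F) (TC.toOp G)) (t : ℝ) :
    HasDerivAt (fun t => TC.mulLR (S.U n t) (S.U n (-t)) F) (TC.mulLR (S.U n t) (S.U n (-t)) G) t := by
  have hU := S.isUGroup_U n
  have hc : Continuous fun t => TC.mulLR (S.U n t) (S.U n (-t)) G := S.strongCont_mulLR_U n G
  have h1 := (S.isUnitaryGroupOf_U n).strongC1_of_isCommutatorWith h
  have key : ∀ t, TC.mulLR (S.U n t) (S.U n (-t)) F =
      (∫ τ in (0 : ℝ)..t, TC.mulLR (S.U n τ) (S.U n (-τ)) G) + F := fun t => by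
    refine TC.toOp_injective (ContinuousLinearMap.ext fun ψ => ?_)
    have e1 : TC.toOp (∫ τ in (0 : ℝ)..t, TC.mulLR (S.U n τ) (S.U n (-τ)) G) ψ =
        ∫ τ in (0 : ℝ)..t, (S.U n τ * TC.toOp G * S.U n (-τ)) ψ := by
      have e := (((ContinuousLinearMap.apply ℂ (HS ι n) ψ).comp
        (TC.toOp (A := Fin n → ι))).intervalIntegral_comp_comm
          (hc.intervalIntegrable (μ := volume) 0 t)).symm
      refine Eq.trans e (intervalIntegral.integral_congr fun τ _ => ?_)
      exact DFunLike.congr_fun (TC.toOp_mulLR _ _ G) ψ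
    have e2 := intervalIntegral.integral_eq_sub_of_hasDerivAt (fun s _ => h1.deriv ψ s)
      ((h1.cont ψ).intervalIntegrable (μ := volume) 0 t)
    have e3 : (S.U n 0 * TC.toOp F * S.U n (-0)) ψ = TC.toOp F ψ := by
      rw [neg_zero, hU.zero, one_mul, mul_one]
    rw [e3] at e2
    rw [map_add, _root_.add_apply, TC.toOp_mulLR, e1]
    exact (sub_eq_iff_eq_add.1 e2.symm)
  rw [funext key]
  exact (intervalIntegral.integral_hasDerivAt_right (hc.intervalIntegrable 0 t)
    (hc.stronglyMeasurableAtFilter _ _) hc.continuousAt).add_const F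

/-- `GT (-t) (annT F) = AT t (GT (-t) F)`, and both factors on the right are differentiable. The
product rule gives the derivative of the orbit of `annT F`, which also yields the domain statement.
-/
theorem isCommutatorWith_annT {F G : TSeq ι}
    (h : ∀ n, IsCommutatorWith (S.hamiltonian n) (TC.toOp (F n)) (TC.toOp (G n))) (n : ℕ) :
    IsCommutatorWith (S.hamiltonian n) (TC.toOp (annT F n)) (TC.toOp ((annT G - S.VT F) n)) := by
  refine (S.isUnitaryGroupOf_U n).isCommutatorWith fun ψ => ?_
  obtain ⟨A, v, hA, h1, h2⟩ := S.strongC1_AT n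
  have hU := S.isUGroup_U (n + 1)
  have hF : HasDerivAt (fun t => S.GT (-t) F (n + 1)) (-(G (n + 1))) 0 := by
    have e := HasDerivAt.scomp (g₁ := fun t => S.GT t F (n + 1)) (0 : ℝ)
      (S.hasDerivAt_mulLR_U (h (n + 1)) (-0)) (hasDerivAt_neg 0)
    refine e.congr_deriv ?_
    have e1 : TC.mulLR (S.U (n + 1) (-(0 : ℝ))) (S.U (n + 1) (- -(0 : ℝ))) (G (n + 1)) = G (n + 1) := by
      refine Eq.trans ?_ (congrFun (DFunLike.congr_fun S.GT_zero G) (n + 1))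
      rw [neg_zero]; rfl
    rw [e1, neg_one_smul]
  have h3 : ∀ t, A t (S.GT (-t) F (n + 1)) = S.GT (-t) (annT F) n := fun t => by
    rw [← h1, AT, Module.End.mul_apply, Module.End.mul_apply]
    have := DFunLike.congr_fun (S.GT_mul_neg t) F
    rw [Module.End.mul_apply] at this
    rw [this]
    rfl
  have h4 := hA.apply hF
  simp only [h3] at h4
  have h5 : v 0 (S.GT (-0) F (n + 1)) + A 0 (-(G (n + 1))) = -((annT G - S.VT F) n) := by
    rw [map_neg, neg_zero, GT_zero, ← h1, S.AT_zero]
    have : v 0 (F (n + 1)) = S.VT F n := by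
      rw [← h2, vT, neg_zero, GT_zero, one_mul, mul_one]
    rw [Pi.sub_apply, ← this]
    change v 0 (F (n + 1)) + -(annT G n) = _
    abel
  rw [h5] at h4
  have h6 : HasDerivAt (fun t => S.GT t (annT F) n) ((annT G - S.VT F) n) 0 := by
    have e := HasDerivAt.scomp (g₁ := fun t => S.GT (-t) (annT F) n) (0 : ℝ)
      (by rw [neg_zero]; exact h4) (hasDerivAt_neg 0)
    simpa [Function.comp_def] using e
  have h7 := ((((ContinuousLinearMap.apply ℂ (HS ι n) ψ).comp
    (TC.toOp (A := Fin n → ι))).restrictScalars ℝ).hasFDerivAt.comp_hasDerivAt 0 h6)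
  refine h7.congr_of_eventuallyEq (Eventually.of_forall fun t => ?_)
  exact (DFunLike.congr_fun (TC.toOp_mulLR _ _ (annT F n)) ψ).symm

theorem commutator_ann (f g : OpSeq ι) (h : ∀ n, S.IsVonNeumann n (f n) (g n)) :
    ∃ d : OpSeq ι, (∀ n, S.IsVonNeumann n (ann f n) (d n)) ∧ ann g - d = S.commAnn f := by
  obtain ⟨F, rfl⟩ := exists_ops fun n => (h n).1
  obtain ⟨G, rfl⟩ := exists_ops fun n => (h n).2.1
  refine ⟨ops (annT G - S.VT F), fun n => ?_, ?_⟩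
  · rw [ann_ops]
    exact ⟨TC.ofReal_norm_eq (annT F n) ▸ ENNReal.ofReal_lt_top,
      TC.ofReal_norm_eq ((annT G - S.VT F) n) ▸ ENNReal.ofReal_lt_top,
      S.isCommutatorWith_annT (fun n => (h n).2.2) n⟩
  · rw [ann_ops, commAnn_ops, ← ops_sub, sub_sub_cancel]

end PairSystem

/-! ### The observables norm and the operator 𝔞⁺ -/

section

variable {ι : Type*}

theorem isSeqNorm_lg {γ : ℝ} (hγ : 0 < γ) : IsSeqNorm fun b : OpSeq ι => lgNorm γ b where
  bound s := by
    refine ⟨ENNReal.ofReal (γ ^ s / s.factorial)⁻¹, ENNReal.ofReal_ne_top, fun b => ?_⟩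
    calc ENNReal.ofReal ‖b s‖ = ENNReal.ofReal (γ ^ s / s.factorial)⁻¹ *
          (ENNReal.ofReal (γ ^ s / s.factorial) * ENNReal.ofReal ‖b s‖) := by
          have h : γ ^ s / s.factorial ≠ 0 :=
            div_ne_zero (pow_pos hγ s).ne' (Nat.cast_ne_zero.2 s.factorial_ne_zero)
          rw [← mul_assoc, ← ENNReal.ofReal_mul (by positivity), inv_mul_cancel₀ h,
            ENNReal.ofReal_one, one_mul]
      _ ≤ _ := by
          gcongr
          exact le_iSup (fun n : ℕ => ENNReal.ofReal (γ ^ n / (n.factorial : ℝ)) *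
            ENNReal.ofReal ‖b n‖) s
  le_tsum {u F} h := by
    refine iSup_le fun s => (mul_le_mul_right (ofReal_norm_le_tsum (h s)) _).trans ?_
    rw [← ENNReal.tsum_mul_left]
    refine ENNReal.tsum_le_tsum fun n => ?_
    exact le_iSup (fun s : ℕ => ENNReal.ofReal (γ ^ s / (s.factorial : ℝ)) *
      ENNReal.ofReal ‖u n s‖) s
  smul_le c b := by
    refine iSup_le fun s => ?_
    rw [Pi.smul_apply, norm_smul, ENNReal.ofReal_mul (norm_nonneg c), mul_left_comm]
    gcongr
    exact le_iSup (fun n : ℕ => ENNReal.ofReal (γ ^ n / (n.factorial : ℝ)) * ENNReal.ofReal ‖b n‖) s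

theorem onSet_add {N : ℕ} (X : Finset (Fin N)) (b c : OpSeq ι) :
    onSet X (b + c) = onSet X b + onSet X c := rfl

theorem onSet_smul {N : ℕ} (X : Finset (Fin N)) (a : ℂ) (b : OpSeq ι) :
    onSet X (a • b) = a • onSet X b := rfl

/-- `cre` as a linear map. -/
def creL : Module.End ℂ (OpSeq ι) where
  toFun := cre
  map_add' b c := funext fun n => by
    simp only [cre, onSet_add, Finset.sum_add_distrib]
    rfl
  map_smul' a b := funext fun n => by
    simp only [cre, onSet_smul, ← Finset.smul_sum]
    rfl

theorem creL_apply (b : OpSeq ι) (n : ℕ) : creL b n = ∑ j, onSet (Finset.univ.erase j) b := rfl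

theorem creL_zero (b : OpSeq ι) : creL b 0 = 0 := by
  rw [creL_apply]
  exact Finset.sum_of_isEmpty _

/-- The embedding of `s` particles into `s + 1` particles which omits the particle `j`. -/
def skipEmb {s : ℕ} (j : Fin (s + 1)) : Fin s ↪ Fin (s + 1) :=
  ((Finset.univ.erase j).orderEmbOfFin (Finset.card_erase_of_mem (Finset.mem_univ j)
    |>.trans (by simp))).toEmbedding

theorem onSet_erase {s : ℕ} (j : Fin (s + 1)) (b : OpSeq ι) :
    onSet (Finset.univ.erase j) b = lift (skipEmb j) (b s) := onSet_eq _ b _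

theorem mem_range_skipEmb {s : ℕ} (j x : Fin (s + 1)) : x ∈ Set.range (skipEmb j) ↔ x ≠ j := by
  rw [skipEmb, range_orderEmbOfFin]
  simp

theorem creL_succ (b : OpSeq ι) (s : ℕ) : creL b (s + 1) = ∑ j, lift (skipEmb j) (b s) :=
  (creL_apply b (s + 1)).trans (Finset.sum_congr rfl fun j _ => onSet_erase j b)

/-- The `s + 1` summands are each bounded by `‖b s‖`; the factor `s + 1` cancels against `(s + 1)!`,
which leaves `γ`. -/
theorem lgNorm_creL_le {γ : ℝ} (hγ : 0 < γ) (b : OpSeq ι) :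
    lgNorm γ (creL b) ≤ ENNReal.ofReal γ * lgNorm γ b := by
  refine iSup_le fun n => ?_
  cases n with
  | zero => rw [creL_zero, norm_zero, ENNReal.ofReal_zero, mul_zero]; exact zero_le
  | succ s =>
    have h : ‖creL b (s + 1)‖ ≤ (s + 1) * ‖b s‖ := by
      rw [creL_succ]
      refine (norm_sum_le_of_le _ fun j _ => norm_lift_le (skipEmb j) (b s)).trans (le_of_eq ?_)
      simp
    calc _ ≤ ENNReal.ofReal (γ ^ (s + 1) / ((s + 1).factorial : ℝ)) *
          ENNReal.ofReal ((s + 1) * ‖b s‖) := by gcongr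
      _ = ENNReal.ofReal γ * (ENNReal.ofReal (γ ^ s / (s.factorial : ℝ)) * ENNReal.ofReal ‖b s‖) := by
          rw [← ENNReal.ofReal_mul (by positivity), ← ENNReal.ofReal_mul (by positivity),
            ← ENNReal.ofReal_mul hγ.le, Nat.factorial_succ]
          congr 1
          have : (s.factorial : ℝ) ≠ 0 := Nat.cast_ne_zero.2 s.factorial_ne_zero
          push_cast
          field_simp
          ring
      _ ≤ _ := by
          gcongr
          exact le_iSup (fun n : ℕ => ENNReal.ofReal (γ ^ n / (n.factorial : ℝ)) *
            ENNReal.ofReal ‖b n‖) s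

theorem isSeqCont_creL : IsSeqCont (creL : Module.End ℂ (OpSeq ι)) := fun u F h s => by
  simp only [creL_apply]
  exact hasSum_sum fun j _ => (h _).mapL (liftL (ι := ι) _)

/-- Permutation symmetry of all components. -/
def OSymm (ι : Type*) : Set (OpSeq ι) := {b | ∀ n, IsSymm (b n)}

theorem creL_mem {b : OpSeq ι} (hb : b ∈ OSymm ι) : creL b ∈ OSymm ι := fun n σ => by
  rw [creL_apply, lift_sum]
  simp only [lift_onSet σ.toEmbedding _ (hb _)]
  have h : ∀ j, (Finset.univ.erase j).map σ.toEmbedding = Finset.univ.erase (σ j) := fun j => by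
    rw [Finset.map_erase, Finset.map_univ_equiv]
    rfl
  simp only [h]
  exact Equiv.sum_comp σ fun j => onSet (Finset.univ.erase j) b

theorem creL_pow_mem {b : OpSeq ι} (hb : b ∈ OSymm ι) (k : ℕ) : (creL ^ k) b ∈ OSymm ι := by
  induction k with
  | zero => exact hb
  | succ k ih => rw [pow_succ', Module.End.mul_apply]; exact creL_mem ih

theorem onSet_creL {b : OpSeq ι} (hb : b ∈ OSymm ι) {N : ℕ} (X : Finset (Fin N)) :
    onSet X (creL b) = ∑ a ∈ X, onSet (X.erase a) b := by
  classical
  set e := (X.orderEmbOfFin rfl).toEmbedding with he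
  have hX : Finset.univ.map e = X := by
    rw [← Finset.coe_inj, Finset.coe_map, Finset.coe_univ, Set.image_univ]
    exact range_orderEmbOfFin X rfl
  have h : onSet X (creL b) = lift e (creL b X.card) := rfl
  rw [h, creL_apply, lift_sum]
  simp only [lift_onSet e _ (hb _), Finset.map_erase, hX]
  conv_rhs => rw [← hX, Finset.sum_map, hX]

/-- Each application of 𝔞⁺ removes one more particle, so `k` of them choose `k` distinct particles
in order. -/
theorem onSet_creL_pow {b : OpSeq ι} (hb : b ∈ OSymm ι) (k : ℕ) {N : ℕ} (X : Finset (Fin N)) :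
    onSet X ((creL ^ k) b) =
      ∑ f : Fin k → Fin N with Function.Injective f ∧ ∀ i, f i ∈ X,
        onSet (X \ Finset.univ.image f) b := by
  classical
  induction k generalizing X with
  | zero =>
    have : (Finset.univ.filter fun f : Fin 0 → Fin N => Function.Injective f ∧ ∀ i, f i ∈ X) =
        {Fin.elim0} := by
      ext f
      simp only [Finset.mem_filter, Finset.mem_univ, true_and, Finset.mem_singleton]
      exact ⟨fun _ => Subsingleton.elim _ _, fun _ => ⟨fun i => i.elim0, fun i => i.elim0⟩⟩
    rw [this, Finset.sum_singleton]
    simp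
  | succ k ih =>
    rw [pow_succ', Module.End.mul_apply, onSet_creL (creL_pow_mem hb k)]
    simp only [ih]
    rw [Finset.sum_sigma']
    refine Finset.sum_bij' (fun p _ => (Fin.cons p.1 p.2 : Fin (k + 1) → Fin N))
      (fun f _ => ⟨f 0, Fin.tail f⟩) (fun p hp => ?_) (fun f hf => ?_) (fun p _ => ?_)
      (fun f _ => Fin.cons_self_tail f) fun p _ => ?_
    · simp only [Finset.mem_sigma, Finset.mem_filter, Finset.mem_univ, true_and,
        Finset.mem_erase] at hp ⊢
      refine ⟨Fin.cons_injective_iff.2 ⟨?_, hp.2.1⟩, fun i => ?_⟩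
      · rintro ⟨i, hi⟩
        exact (hp.2.2 i).1 hi
      · refine Fin.cases ?_ (fun i => ?_) i
        · exact hp.1
        · exact (hp.2.2 i).2
    · simp only [Finset.mem_sigma, Finset.mem_filter, Finset.mem_univ, true_and,
        Finset.mem_erase] at hf ⊢
      exact ⟨hf.2 0, hf.1.comp (Fin.succ_injective k),
        fun i => ⟨fun h => Fin.succ_ne_zero i (hf.1 h), hf.2 i.succ⟩⟩
    · rfl
    · congr 1
      ext x
      simp only [Finset.mem_sdiff, Finset.mem_erase, Finset.mem_image, Finset.mem_univ, true_and,
        Fin.exists_fin_succ, Fin.cons_zero, Fin.cons_succ]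
      tauto

end

/-! ### Evolution of observables and the operator [𝒩, 𝔞⁺] -/

namespace PairSystem

variable {ι H : Type*} [NormedAddCommGroup H] [InnerProductSpace ℂ H] [CompleteSpace H]
  (S : PairSystem ι H)

/-- `𝒢(t)` as a linear map. -/
def GC (t : ℝ) : Module.End ℂ (OpSeq ι) where
  toFun := S.G t
  map_add' b c := funext fun n => by
    simp only [G, Pi.add_apply, mul_add, add_mul]
  map_smul' a b := funext fun n => by
    simp only [G, Pi.smul_apply, mul_smul_comm, smul_mul_assoc, RingHom.id_apply]

theorem GC_apply (t : ℝ) (b : OpSeq ι) (n : ℕ) : S.GC t b n = S.U n (-t) * b n * S.U n t := rfl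

theorem lgNorm_GC_le (γ : ℝ) (t : ℝ) (b : OpSeq ι) : lgNorm γ (S.GC t b) ≤ lgNorm γ b := by
  refine iSup_mono fun n => ?_
  gcongr
  have h := (S.isUGroup_U n).norm_conj_le (b n) (-t)
  rwa [neg_neg] at h

theorem isSeqCont_GC (t : ℝ) : IsSeqCont (S.GC t) := fun _ _ h s =>
  ((h s).mul_left (S.U s (-t))).mul_right (S.U s t)

theorem GC_mul (s t : ℝ) : S.GC s * S.GC t = S.GC (s + t) := by
  refine LinearMap.ext fun b => funext fun n => ?_
  rw [Module.End.mul_apply, GC_apply, GC_apply, GC_apply, add_comm s t, (S.isUGroup_U n).add t s,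
    neg_add_rev, (S.isUGroup_U n).add]
  simp only [mul_assoc]

theorem GC_zero : S.GC 0 = 1 := by
  refine LinearMap.ext fun b => funext fun n => ?_
  rw [GC_apply, neg_zero, (S.isUGroup_U n).zero, one_mul, mul_one]
  rfl

theorem GC_mul_neg (t : ℝ) : S.GC t * S.GC (-t) = 1 := by rw [GC_mul, add_neg_cancel, GC_zero]

theorem GC_mem (t : ℝ) {b : OpSeq ι} (hb : b ∈ OSymm ι) : S.GC t b ∈ OSymm ι := fun n σ => by
  rw [GC_apply, lift_mul, lift_mul, S.isSymm_U n t σ, S.isSymm_U n (-t) σ, hb n σ]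

theorem onSet_GC {N : ℕ} (X : Finset (Fin N)) (t : ℝ) (b : OpSeq ι) :
    onSet X (S.GC t b) = S.GOn t X (onSet X b) := by
  rw [onSet, GC_apply, lift_mul, lift_mul]
  rfl

theorem intObs_add {N : ℕ} (i j : Fin N) (b c : Op ι N) :
    S.intObs i j (b + c) = S.intObs i j b + S.intObs i j c := by
  simp only [intObs, add_mul, mul_add]
  module

theorem intObs_smul {N : ℕ} (i j : Fin N) (a : ℂ) (b : Op ι N) :
    S.intObs i j (a • b) = a • S.intObs i j b := by
  simp only [intObs, smul_mul_assoc, mul_smul_comm]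
  module

theorem intObs_sum {N : ℕ} {κ : Type*} (i j : Fin N) (t : Finset κ) (b : κ → Op ι N) :
    S.intObs i j (∑ k ∈ t, b k) = ∑ k ∈ t, S.intObs i j (b k) := by
  simp only [intObs, Finset.sum_mul, Finset.mul_sum, ← Finset.sum_sub_distrib, Finset.smul_sum]

/-- `[𝒩, 𝔞⁺]` as a linear map. -/
def VC : Module.End ℂ (OpSeq ι) where
  toFun := S.commCre
  map_add' b c := funext fun n => by
    simp only [commCre, onSet_add, intObs_add, Finset.sum_add_distrib]
    rfl
  map_smul' a b := funext fun n => by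
    simp only [commCre, onSet_smul, intObs_smul, ← Finset.smul_sum]
    rfl

theorem VC_apply (b : OpSeq ι) (n : ℕ) : S.VC b n = ∑ p : Fin n × Fin n with p.1 ≠ p.2,
    S.intObs p.1 p.2 (onSet (Finset.univ.erase p.1) b) := rfl

theorem VC_zero (b : OpSeq ι) : S.VC b 0 = 0 := by
  rw [VC_apply]
  exact Finset.sum_of_isEmpty _

theorem VC_succ (b : OpSeq ι) (s : ℕ) : S.VC b (s + 1) = ∑ j,
    -Complex.I • (lift (skipEmb j) (b s) * S.PWith (skipEmb j) j - S.PWith (skipEmb j) j * lift (skipEmb j) (b s)) := by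
  rw [VC_apply, Finset.sum_filter, Fintype.sum_prod_type]
  refine Finset.sum_congr rfl fun j _ => ?_
  rw [sum_eq_add_sum (mem_range_skipEmb j), if_neg (by simp), zero_add]
  have h : ∀ i, j ≠ skipEmb j i := fun i h => (mem_range_skipEmb j _).1 ⟨i, rfl⟩ h.symm
  simp only [h, ne_eq, not_false_eq_true, if_true, onSet_erase, intObs]
  rw [← Finset.smul_sum, Finset.sum_sub_distrib, ← Finset.mul_sum, ← Finset.sum_mul, PWith]

end PairSystem

section

variable {E F : ℕ → Type*} [∀ n, NormedAddCommGroup (E n)] [∀ n, NormedSpace ℂ (E n)]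
  [∀ n, NormedAddCommGroup (F n)] [∀ n, NormedSpace ℂ (F n)]

theorem isDerivation_strongC1 : IsDerivation (X := fun n => E n →L[ℂ] F n) fun _ f f' =>
    StrongC1 f f' where
  const _ x := StrongC1.const x
  add _ _ _ _ _ hf hh := hf.add hh
  smul _ c _ _ hf := hf.smul c

end

/-! ### Differentiability of 𝒢(-τ) (-𝔞⁺) 𝒢(τ) and the Duhamel recursion -/

namespace PairSystem

variable {ι H : Type*} [NormedAddCommGroup H] [InnerProductSpace ℂ H] [CompleteSpace H]
  (S : PairSystem ι H)

/-- `𝒢(-τ) (-𝔞⁺) 𝒢(τ)`. -/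
def AC (τ : ℝ) : Module.End ℂ (OpSeq ι) := S.GC (-τ) * -creL * S.GC τ

/-- `𝒢(-τ) [𝒩, 𝔞⁺] 𝒢(τ)`. -/
def vC (τ : ℝ) : Module.End ℂ (OpSeq ι) := S.GC (-τ) * S.VC * S.GC τ

theorem lift_GC {s : ℕ} {e : Fin s ↪ Fin (s + 1)} {j : Fin (s + 1)}
    (he : ∀ x, x ∈ Set.range e ↔ x ≠ j) (τ : ℝ) (b : OpSeq ι) :
    lift e (S.U s (-τ)) * S.W j (-τ) * lift e (b s) * (S.W j τ * lift e (S.U s τ)) =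
      lift e (S.GC τ b s) := by
  rw [GC_apply, lift_mul, lift_mul, mul_assoc _ (S.W j (-τ)), ← (S.commute_lift_W he _ _).eq,
    mul_assoc, mul_assoc, ← mul_assoc (S.W j (-τ)), (S.isUGroup_W j).neg_mul, one_mul, mul_assoc]

theorem Z_lift_Y {s : ℕ} {e : Fin s ↪ Fin (s + 1)} {j : Fin (s + 1)}
    (he : ∀ x, x ∈ Set.range e ↔ x ≠ j) (τ : ℝ) (b : OpSeq ι) :
    S.Z e j (-τ) * (lift e (b s) * S.Y e j (-τ)) =
      S.U (s + 1) τ * lift e (S.GC τ b s) * S.U (s + 1) (-τ) := by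
  rw [← S.lift_GC he, Z, Y, neg_neg]
  simp only [mul_assoc]

theorem AC_zero_apply (τ : ℝ) (b : OpSeq ι) : S.AC τ b 0 = 0 := by
  rw [AC, Module.End.mul_apply, Module.End.mul_apply, GC_apply, LinearMap.neg_apply, Pi.neg_apply,
    creL_zero, neg_zero, mul_zero, zero_mul]

theorem vC_zero_apply (τ : ℝ) (b : OpSeq ι) : S.vC τ b 0 = 0 := by
  rw [vC, Module.End.mul_apply, Module.End.mul_apply, GC_apply, VC_zero, mul_zero, zero_mul]

theorem AC_succ (τ : ℝ) (b : OpSeq ι) (s : ℕ) : S.AC τ b (s + 1) = ∑ j, (-1 : ℂ) •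
    (S.U (s + 1) τ * lift (skipEmb j) (S.GC τ b s) * S.U (s + 1) (-τ)) := by
  rw [AC, Module.End.mul_apply, Module.End.mul_apply, GC_apply, LinearMap.neg_apply, Pi.neg_apply,
    creL_succ, neg_neg, ← Finset.smul_sum, neg_one_smul, mul_neg, neg_mul, Finset.mul_sum,
    Finset.sum_mul]

theorem vC_succ (τ : ℝ) (b : OpSeq ι) (s : ℕ) : S.vC τ b (s + 1) = ∑ j,
    S.U (s + 1) τ * (-Complex.I • (lift (skipEmb j) (S.GC τ b s) * S.PWith (skipEmb j) j -
      S.PWith (skipEmb j) j * lift (skipEmb j) (S.GC τ b s))) * S.U (s + 1) (-τ) := by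
  rw [vC, Module.End.mul_apply, Module.End.mul_apply, GC_apply, VC_succ, neg_neg, Finset.mul_sum,
    Finset.sum_mul]

/-- Each summand is `Z`, the lifted observable, and `Y` at time `-τ`: the free evolution of the
omitted particle commutes with the observable and cancels. All three factors are strongly
differentiable, and the derivatives of `Z` and `Y` form the commutator with the coupling. -/
theorem strongC1_AC {f f' : ℝ → OpSeq ι} (hf : ∀ s, StrongC1 (fun τ => f τ s) fun τ => f' τ s)
    (s : ℕ) : StrongC1 (fun τ => S.AC τ (f τ) s) fun τ => S.vC τ (f τ) s + S.AC τ (f' τ) s := by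
  cases s with
  | zero =>
    simp only [AC_zero_apply, vC_zero_apply, add_zero]
    exact StrongC1.const 0
  | succ s =>
    have h := StrongC1.sum (s := Finset.univ) fun (j : Fin (s + 1)) _ =>
      ((S.strongC1_Z (mem_range_skipEmb j)).comp_neg.comp (((hf s).lift (skipEmb j)).comp
        (S.strongC1_Y (mem_range_skipEmb j)).comp_neg)).smul (-1)
    refine h.congr (fun τ => ?_) fun τ => ?_
    · rw [AC_succ]
      exact Finset.sum_congr rfl fun j _ =>
        congrArg _ (S.Z_lift_Y (mem_range_skipEmb j) τ (f τ))
    · rw [AC_succ, vC_succ, ← Finset.sum_add_distrib]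
      refine Finset.sum_congr rfl fun j _ => ?_
      rw [← S.Z_lift_Y (mem_range_skipEmb j), ← S.lift_GC (mem_range_skipEmb j), Z, Y]
      simp only [← ContinuousLinearMap.mul_def, neg_neg]
      simp only [mul_add, mul_sub, sub_mul, smul_sub, smul_add, smul_mul_assoc, mul_smul_comm,
        mul_assoc]
      module

theorem onSet_VC {b : OpSeq ι} (hb : b ∈ OSymm ι) {N : ℕ} (X : Finset (Fin N)) :
    onSet X (S.VC b) = ∑ i ∈ X, ∑ j ∈ X, if i ≠ j then S.intObs i j (onSet (X.erase i) b) else 0 := by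
  classical
  set e := (X.orderEmbOfFin rfl).toEmbedding with he
  have hX : Finset.univ.map e = X := by
    rw [← Finset.coe_inj, Finset.coe_map, Finset.coe_univ, Set.image_univ]
    exact range_orderEmbOfFin X rfl
  have h : onSet X (S.VC b) = lift e (S.VC b X.card) := rfl
  have h2 : ∀ i j : Fin X.card, lift e (S.intObs i j (onSet (Finset.univ.erase i) b)) =
      S.intObs (e i) (e j) (onSet (X.erase (e i)) b) := fun i j => by
    rw [intObs, lift_smul, lift_sub, lift_mul, lift_mul, lift_pot, lift_onSet e _ (hb _),
      Finset.map_erase, hX]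
    rfl
  have hs : ∀ f : Fin N → Op ι N, ∑ i ∈ X, f i = ∑ i, f (e i) := fun f => by
    conv_lhs => rw [← hX]
    rw [Finset.sum_map]
  rw [h, VC_apply, lift_sum]
  simp only [h2, hs]
  rw [Finset.sum_filter, Fintype.sum_prod_type]
  refine Finset.sum_congr rfl fun i _ => Finset.sum_congr rfl fun j _ => ?_
  simp only [ne_eq, e.injective.eq_iff]

/-- Both sides are sums over triples of `Φ(i,j)`-commutators with `b` placed on all particles but
`a` and `i`. The terms with `j = a` occur only on the right, and they vanish because `b` then acts
on neither of the interacting particles. -/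
theorem creL_VC {b : OpSeq ι} (hb : b ∈ OSymm ι) : creL (S.VC b) = S.VC (creL b) := by
  classical
  funext N
  let T : Fin N → Fin N → Fin N → Op ι N := fun a i j =>
    S.intObs i j (onSet ((Finset.univ.erase a).erase i) b)
  have hT : ∀ i j, T j i j = 0 := fun i j => by
    rcases eq_or_ne i j with rfl | hij
    · simp only [T, intObs, pot_self, mul_zero, zero_mul, sub_zero, smul_zero]
    · have hc : Commute (S.pot i j) (onSet ((Finset.univ.erase j).erase i) b) := by
        rw [S.pot_of_ne hij, onSet]
        refine commute_lift _ _ _ _ ?_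
        rw [range_orderEmbOfFin _ rfl, Set.disjoint_left]
        rintro _ ⟨a, rfl⟩ ha
        fin_cases a
        · exact (Finset.mem_erase.1 (Finset.mem_coe.1 ha)).1 rfl
        · exact (Finset.mem_erase.1 (Finset.mem_erase.1 (Finset.mem_coe.1 ha)).2).1 rfl
      simp only [T, intObs, hc.eq, sub_self, smul_zero]
  have h1 : creL (S.VC b) N = ∑ a, ∑ i, ∑ j,
      if i ≠ a ∧ j ≠ a ∧ i ≠ j then T a i j else 0 := by
    rw [creL_apply]
    refine Finset.sum_congr rfl fun a _ => ?_
    rw [S.onSet_VC hb, ← Finset.filter_ne', Finset.sum_filter]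
    refine Finset.sum_congr rfl fun i _ => ?_
    rw [Finset.sum_filter]
    by_cases hi : i = a
    · simp [hi]
    · simp only [ne_eq, hi, not_false_eq_true, if_true, true_and]
      refine Finset.sum_congr rfl fun j _ => ?_
      by_cases hj : j = a
      · simp [hj]
      · simp only [hj, not_false_eq_true, if_true, true_and, T, Finset.filter_ne']
  have h2 : S.VC (creL b) N = ∑ i, ∑ j, ∑ a,
      if i ≠ a ∧ j ≠ a ∧ i ≠ j then T a i j else 0 := by
    rw [VC_apply, Finset.sum_filter, Fintype.sum_prod_type]
    refine Finset.sum_congr rfl fun i _ => Finset.sum_congr rfl fun j _ => ?_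
    rw [onSet_creL hb, intObs_sum, ← Finset.filter_ne', Finset.sum_filter]
    by_cases hij : i = j
    · simp [hij]
    · simp only [ne_eq, hij, not_false_eq_true, if_true, and_true]
      refine Finset.sum_congr rfl fun a _ => ?_
      by_cases ha : a = i
      · simp [ha]
      · by_cases haj : j = a
        · subst haj
          have := hT i j
          simp only [T] at this
          simp only [ha, not_false_eq_true, if_true, not_true_eq_false, and_false, if_false]
          rw [Finset.filter_ne', Finset.erase_right_comm]
          exact this
        · have ha' : ¬ i = a := fun h => ha h.symm
          simp only [ha, ha', haj, not_false_eq_true, if_true, true_and, T]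
          rw [Finset.filter_ne', Finset.erase_right_comm]
  rw [h1, h2, Finset.sum_comm]
  exact Finset.sum_congr rfl fun i _ => Finset.sum_comm

theorem AC_mem (τ : ℝ) {b : OpSeq ι} (hb : b ∈ OSymm ι) : S.AC τ b ∈ OSymm ι := by
  have h : S.AC τ b = (-1 : ℂ) • S.GC (-τ) (creL (S.GC τ b)) := by
    rw [AC, Module.End.mul_apply, Module.End.mul_apply, LinearMap.neg_apply, map_neg, neg_one_smul]
  rw [h]
  exact fun n => (S.GC_mem _ (creL_mem (S.GC_mem _ hb)) n).smul _

theorem AC_vC_comm (τ : ℝ) {b : OpSeq ι} (hb : b ∈ OSymm ι) :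
    S.AC τ (S.vC τ b) = S.vC τ (S.AC τ b) := by
  have h : ∀ b, S.GC τ (S.GC (-τ) b) = b := fun b => DFunLike.congr_fun (S.GC_mul_neg τ) b
  simp only [AC, vC, Module.End.mul_apply, h, LinearMap.neg_apply, map_neg]
  rw [S.creL_VC (S.GC_mem τ hb)]

theorem AC_zero : S.AC 0 = -creL := by rw [AC, neg_zero, GC_zero, one_mul, mul_one]

theorem strongC1_interCoeff {b : OpSeq ι} (hb : b ∈ OSymm ι) (n s : ℕ) :
    StrongC1 (fun τ => interCoeff (-creL) (S.AC τ) (n + 1) b s)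
      fun τ => S.vC τ (interCoeff (-creL) (S.AC τ) n b) s :=
  (isDerivation_strongC1 (E := HS ι) (F := HS ι)).interCoeff (A := S.AC) (v := S.vC) (Y := OSymm ι)
    (fun b hb n => by
      have := ((creL_mem hb) n).smul (-1)
      rwa [neg_one_smul] at this) (fun τ b hb => S.AC_mem τ hb) (fun τ b hb => S.AC_vC_comm τ hb)
    (fun f f' hf s => S.strongC1_AC hf s) hb n s

theorem conjCoeff_cre_succ_eq_integral {b : OpSeq ι} (hb : b ∈ OSymm ι) (n s : ℕ) (t : ℝ)
    (ψ : HS ι s) : conjCoeff (-creL) (S.GC t) (n + 1) b s ψ =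
      ∫ τ in (0 : ℝ)..t, S.GC (t - τ) (S.VC (conjCoeff (-creL) (S.GC τ) n b)) s ψ := by
  have h := S.strongC1_interCoeff hb n s
  -- The integrals are strong, so the right factor of `GC t` is absorbed into the fixed vector `U s
  -- t ψ`; the left factor is a bounded operator and passes through the integral.
  have h1 := intervalIntegral.integral_eq_sub_of_hasDerivAt
    (fun τ _ => h.deriv (S.U s t ψ) τ)
    ((h.cont (S.U s t ψ)).intervalIntegrable (μ := volume) 0 t)
  have h0 : interCoeff (-creL) (S.AC 0) (n + 1) b s (S.U s t ψ) = 0 := by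
    rw [AC_zero, interCoeff_self, LinearMap.zero_apply]
    rfl
  rw [h0, sub_zero] at h1
  rw [← mul_interCoeff (S.GC_mul_neg t), Module.End.mul_apply]
  have h2 : S.GC t (interCoeff (-creL) (S.GC (-t) * -creL * S.GC t) (n + 1) b) s ψ =
      S.U s (-t) (interCoeff (-creL) (S.AC t) (n + 1) b s (S.U s t ψ)) := rfl
  rw [h2, ← h1, ← ContinuousLinearMap.intervalIntegral_comp_comm _
    ((h.cont (S.U s t ψ)).intervalIntegrable 0 t)]
  refine intervalIntegral.integral_congr fun τ _ => ?_
  change S.GC t (S.vC τ (interCoeff (-creL) (S.AC τ) n b)) s ψ = _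
  rw [← mul_interCoeff (S.GC_mul_neg τ) n, vC, Module.End.mul_apply, Module.End.mul_apply,
    ← Module.End.mul_apply (S.GC t), GC_mul, ← sub_eq_add_neg]
  rfl

end PairSystem

/-! ### Iterated integrals in the strong operator topology -/

section IterSum

variable {E : Type*} [NormedAddCommGroup E] [NormedSpace ℝ E]

theorem iterInt_sum {κ : Type*} (T : Finset κ) (n : ℕ) : ∀ (t : ℝ) {g : κ → (Fin n → ℝ) → E},
    (∀ k ∈ T, Continuous (g k)) →
      iterInt n t (fun τ => ∑ k ∈ T, g k τ) = ∑ k ∈ T, iterInt n t (g k) := by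
  induction n with
  | zero => exact fun t g _ => rfl
  | succ n ih =>
    intro t g hg
    change ∫ τ in (0 : ℝ)..t, iterInt n τ (fun τs => ∑ k ∈ T, g k (Fin.cons τ τs)) =
      ∑ k ∈ T, ∫ τ in (0 : ℝ)..t, iterInt n τ fun τs => g k (Fin.cons τ τs)
    rw [← intervalIntegral.integral_finsetSum fun k hk =>
      (continuous_iterInt_cons (hg k hk)).intervalIntegrable 0 t]
    refine intervalIntegral.integral_congr fun τ _ => ?_
    exact ih τ fun k hk => (hg k hk).comp (Continuous.finCons continuous_const continuous_id)

end IterSum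

section StrongIter

variable {ι α β : Type*}

/-- `c` is the iterated integral of `g` in the strong operator topology. -/
structure StrongIter {A : Type*} (n : ℕ) (t : ℝ) (g : (Fin n → ℝ) → L2 A →L[ℂ] L2 A)
    (c : L2 A →L[ℂ] L2 A) : Prop where
  cont : StrongCont g
  eq : ∀ ψ, iterInt n t (fun τ => g τ ψ) = c ψ

variable {A : Type*} {n : ℕ} {t : ℝ} {g : (Fin n → ℝ) → L2 A →L[ℂ] L2 A} {c : L2 A →L[ℂ] L2 A}

theorem StrongIter.mul_left (h : StrongIter n t g c) (T : L2 A →L[ℂ] L2 A) :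
    StrongIter n t (fun τ => T * g τ) (T * c) where
  cont := (StrongCont.const T).comp h.cont
  eq ψ := (iterInt_clm T n t (h.cont ψ)).trans (congrArg T (h.eq ψ))

theorem StrongIter.mul_right (h : StrongIter n t g c) (T : L2 A →L[ℂ] L2 A) :
    StrongIter n t (fun τ => g τ * T) (c * T) where
  cont := h.cont.comp (StrongCont.const T)
  eq ψ := h.eq (T ψ)

theorem StrongIter.smul (h : StrongIter n t g c) (a : ℂ) :
    StrongIter n t (fun τ => a • g τ) (a • c) := by
  have := h.mul_left (a • 1)
  simpa only [smul_mul_assoc, one_mul] using this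

theorem StrongIter.sum {κ : Type*} {T : Finset κ} {g : κ → (Fin n → ℝ) → L2 A →L[ℂ] L2 A}
    {c : κ → L2 A →L[ℂ] L2 A} (h : ∀ k ∈ T, StrongIter n t (g k) (c k)) :
    StrongIter n t (fun τ => ∑ k ∈ T, g k τ) (∑ k ∈ T, c k) where
  cont := StrongCont.sum fun k hk => (h k hk).cont
  eq ψ := by
    simp only [_root_.sum_apply]
    rw [iterInt_sum T n t fun k hk => (h k hk).cont ψ]
    exact Finset.sum_congr rfl fun k hk => (h k hk).eq ψ

theorem StrongIter.add {g' : (Fin n → ℝ) → L2 A →L[ℂ] L2 A} {c' : L2 A →L[ℂ] L2 A}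
    (h : StrongIter n t g c) (h' : StrongIter n t g' c') :
    StrongIter n t (fun τ => g τ + g' τ) (c + c') := by
  have := StrongIter.sum (T := (Finset.univ : Finset Bool)) (g := fun b => if b then g else g')
    (c := fun b => if b then c else c') (n := n) (t := t) fun k _ => by
      cases k
      · exact h'
      · exact h
  simpa using this

/-- Evaluation at a vector does not commute with `lift` directly; on each fibre it does, and fibres
separate vectors. -/
theorem StrongIter.lift {g : (Fin n → ℝ) → L2 (α → ι) →L[ℂ] L2 (α → ι)}
    {c : L2 (α → ι) →L[ℂ] L2 (α → ι)} (h : StrongIter n t g c) (e : α ↪ β) :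
    StrongIter n t (fun τ => lift e (g τ)) (lift e c) where
  cont := h.cont.lift e
  eq ψ := by
    refine ext_fibre e fun r => ?_
    rw [pull_fibre_lift, ← h.eq, ← iterInt_clm (pull (fibre e r)) n t ((h.cont.lift e) ψ)]
    simp only [pull_fibre_lift]

end StrongIter

section

variable {M : Type*} [AddCommGroup M] [Module ℂ M]

theorem conjCoeff_neg (a g : Module.End ℂ M) (n : ℕ) : conjCoeff (-a) g n =
    ((n.factorial : ℂ)⁻¹) • ∑ k ∈ Finset.range (n + 1),
      ((-1 : ℂ) ^ (n - k) * (n.choose k : ℂ)) • (a ^ (n - k) * g * a ^ k) := by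
  have h : ∀ m : ℕ, (-a) ^ m = (-1 : ℂ) ^ m • a ^ m := fun m => by rw [← smul_pow, neg_one_smul]
  rw [conjCoeff]
  refine congrArg _ (Finset.sum_congr rfl fun k _ => ?_)
  rw [h, h, smul_mul_assoc, smul_mul_assoc, mul_smul_comm, smul_smul, smul_smul]
  congr 1
  have : (-1 : ℂ) ^ k * (-1) ^ k = 1 := by rw [← mul_pow]; norm_num
  linear_combination ((-1 : ℂ) ^ (n - k) * (n.choose k : ℂ)) * this

end

/-! ### The perturbation series and the cumulant series for observables -/

namespace PairSystem

variable {ι H : Type*} [NormedAddCommGroup H] [InnerProductSpace ℂ H] [CompleteSpace H]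
  (S : PairSystem ι H)

theorem strongCont_VC {X : Type*} [TopologicalSpace X] [LocallyCompactSpace X] {f : X → OpSeq ι}
    (hf : ∀ s, StrongCont fun x => f x s) (s : ℕ) : StrongCont fun x => S.VC (f x) s := by
  simp only [VC_apply]
  refine StrongCont.sum fun p _ => ?_
  have h : StrongCont fun x => onSet (Finset.univ.erase p.1) (f x) := (hf _).lift _
  exact ((h.comp (StrongCont.const (S.pot p.1 p.2))).sub
    ((StrongCont.const (S.pot p.1 p.2)).comp h)).smul _

theorem strongIter_VC {n : ℕ} {t : ℝ} {g : (Fin n → ℝ) → OpSeq ι} {c : OpSeq ι}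
    (h : ∀ s, StrongIter n t (fun τ => g τ s) (c s)) (s : ℕ) :
    StrongIter n t (fun τ => S.VC (g τ) s) (S.VC c s) := by
  simp only [VC_apply]
  refine StrongIter.sum fun p _ => ?_
  have h1 : StrongIter n t (fun τ => onSet (Finset.univ.erase p.1) (g τ))
      (onSet (Finset.univ.erase p.1) c) := (h _).lift _
  have h2 := ((h1.mul_right (S.pot p.1 p.2)).add ((h1.mul_left (S.pot p.1 p.2)).smul (-1))).smul
    (-Complex.I)
  simpa only [neg_one_smul, ← sub_eq_add_neg, intObs] using h2

theorem strongCont_duhamel {X : Type*} [TopologicalSpace X] [LocallyCompactSpace X] (b : OpSeq ι)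
    (n : ℕ) : ∀ {t : X → ℝ} {τ : X → Fin n → ℝ}, Continuous t → Continuous τ → ∀ s,
      StrongCont fun x => duhamel S.G S.commCre b n (t x) (τ x) s := by
  have hU : ∀ {t : X → ℝ}, Continuous t → ∀ s, StrongCont fun x => S.U s (t x) := fun ht s =>
    (S.isUGroup_U s).strongCont.comp_continuous ht
  induction n with
  | zero => exact fun ht _ s => ((hU ht.neg s).comp (StrongCont.const _)).comp (hU ht s)
  | succ n ih =>
    intro t τ ht hτ s
    have h0 : Continuous fun x => τ x 0 := (continuous_apply 0).comp hτ
    have h1 : Continuous fun x => Fin.tail (τ x) :=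
      continuous_pi fun i => (continuous_apply i.succ).comp hτ
    exact ((hU (ht.sub h0).neg s).comp (S.strongCont_VC (ih h0 h1) s)).comp (hU (ht.sub h0) s)

theorem strongIter_duhamel {b : OpSeq ι} (hb : b ∈ OSymm ι) (n : ℕ) : ∀ (t : ℝ) (s : ℕ),
    StrongIter n t (fun τ => duhamel S.G S.commCre b n t τ s)
      (conjCoeff (-creL) (S.GC t) n b s) := by
  induction n with
  | zero =>
    intro t s
    have h : conjCoeff (-creL) (S.GC t) 0 = S.GC t := by simp [conjCoeff]
    rw [h]
    exact ⟨S.strongCont_duhamel b 0 continuous_const continuous_id s, fun _ => rfl⟩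
  | succ n ih =>
    intro t s
    refine ⟨S.strongCont_duhamel b (n + 1) continuous_const continuous_id s, fun ψ => ?_⟩
    rw [S.conjCoeff_cre_succ_eq_integral hb]
    refine intervalIntegral.integral_congr fun τ _ => ?_
    exact (((S.strongIter_VC (ih τ) s).mul_left (S.U s (-(t - τ)))).mul_right (S.U s (t - τ))).eq ψ

/-! ### Cumulants -/

theorem GOn_eq_GstOn {N : ℕ} (t : ℝ) (X : Finset (Fin N)) : S.GOn t X = S.GstOn (-t) X := by
  rw [GOn, GstOn, neg_neg]

theorem commute_GOn {N : ℕ} (t : ℝ) {X Y : Finset (Fin N)} (h : Disjoint X Y) :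
    Commute (S.GOn t X) (S.GOn t Y) := by
  rw [GOn_eq_GstOn, GOn_eq_GstOn]
  exact S.commute_GstOn (-t) h

/-- Operators on disjoint sets of particles commute, so a unitary acting outside `Z` meets its
inverse. -/
theorem GOn_onSet {N : ℕ} (t : ℝ) {X Z : Finset (Fin N)} (h : Disjoint X Z) (b : OpSeq ι) :
    S.GOn t X (onSet Z b) = onSet Z b := by
  change S.UOn (-t) X * onSet Z b * S.UOn t X = _
  rw [mul_assoc, UOn, UOn, (commute_onSet X Z _ b h).symm.eq, ← mul_assoc]
  have := S.UOn_neg_mul t X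
  rw [UOn, UOn] at this
  rw [this, one_mul]

theorem prod_GOn_onSet {N : ℕ} (t : ℝ) {Z : Finset (Fin N)} (b : OpSeq ι) {τ : Type*}
    (c : τ → Finset (Fin N)) (L : List τ) (hL : ∀ X ∈ L, Disjoint (c X) Z) :
    (L.map fun X => S.GOn t (c X)).prod (onSet Z b) = onSet Z b := by
  induction L with
  | nil => rfl
  | cons X L ih =>
    rw [List.map_cons, List.prod_cons, Module.End.mul_apply,
      ih fun X hX => hL X (List.mem_cons_of_mem _ hX), S.GOn_onSet t (hL X List.mem_cons_self)]

/-- The block containing `{Z}` is put outermost; the remaining blocks act on particles outside `Z`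
and leave the observable unchanged. -/
theorem cumObs_onSet (t : ℝ) {s n : ℕ} (B : OpSeq ι) (j : Fin n ↪ Fin s) :
    S.cumObs t s n (Finset.univ \ Finset.univ.image j) j
        (onSet (Finset.univ \ Finset.univ.image j) B) =
      redCumulantSets (S.GOn t) (Finset.univ \ Finset.univ.image j) j
        (onSet (Finset.univ \ Finset.univ.image j) B) := by
  set Z : Finset (Fin s) := Finset.univ \ Finset.univ.image j with hZ
  have hjZ : ∀ i, j i ∉ Z := fun i h =>
    (Finset.mem_sdiff.1 h).2 (Finset.mem_image_of_mem _ (Finset.mem_univ i))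
  refine map_cumulant (S.GOn t) Z j (LinearMap.applyₗ (onSet Z B)) fun P => ?_
  have hP0 := P.part_mem.2 (Finset.mem_univ (0 : Fin (n + 1)))
  have hdis : ∀ A ∈ P.parts, ∀ B ∈ P.parts, A ≠ B →
      Disjoint (A.biUnion (clusters Z j)) (B.biUnion (clusters Z j)) :=
    fun A hA B hB hAB => disjoint_biUnion_clusters j.injective hjZ (P.disjoint hA hB hAB)
  rw [LinearMap.applyₗ_apply_apply, LinearMap.applyₗ_apply_apply,
    (prod_toList_eq P hP0 _ fun A hA B hB hAB => S.commute_GOn t (hdis A hA B hB hAB)).1,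
    Module.End.mul_apply, S.prod_GOn_onSet t B fun X : Finset (Fin (n + 1)) => X.biUnion (clusters Z j)]
  intro X hX
  rw [Finset.mem_toList, Finset.mem_erase] at hX
  refine (hdis X hX.2 _ hP0 hX.1).mono_right fun x hx => ?_
  exact Finset.mem_biUnion.2 ⟨0, P.mem_part (Finset.mem_univ _), hx⟩

/-- An injection `j` splits into its last `l` values, removed by the outer powers of 𝔞⁺ and absent
from the evolution, and its first `k` values, removed by the inner powers but present in the
evolution. -/
theorem sum_GOn_first (t : ℝ) {B : OpSeq ι} (hB : B ∈ OSymm ι) (s k l : ℕ) :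
    ∑ j : Fin (k + l) ↪ Fin s, S.GOn t (Finset.univ \ Finset.univ.image j ∪
        (Finset.univ.filter fun i : Fin (k + l) => i.val < k).image j)
        (onSet (Finset.univ \ Finset.univ.image j) B) =
      (creL ^ l * S.GC t * creL ^ k : Module.End ℂ (OpSeq ι)) B s := by
  have h1 : (creL ^ l * S.GC t * creL ^ k : Module.End ℂ (OpSeq ι)) B s =
      onSet (Finset.univ : Finset (Fin s)) ((creL ^ l) (S.GC t ((creL ^ k) B))) :=
    (onSet_univ _).symm
  rw [h1, onSet_creL_pow (S.GC_mem t (creL_pow_mem hB k))]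
  simp only [onSet_GC, onSet_creL_pow hB, map_sum]
  rw [Finset.sum_sigma']
  have him : ∀ j : Fin (k + l) ↪ Fin s, (Finset.univ.image j : Finset (Fin s)) =
      Finset.univ.image (fun i => j (Fin.castAdd l i)) ∪ Finset.univ.image fun i => j (Fin.natAdd k i) :=
    fun j => by
      ext x
      simp only [Finset.mem_image, Finset.mem_univ, true_and, Finset.mem_union]
      constructor
      · rintro ⟨i, rfl⟩
        refine Fin.addCases (fun i => Or.inl ⟨i, rfl⟩) (fun i => Or.inr ⟨i, rfl⟩) i
      · rintro (⟨i, rfl⟩ | ⟨i, rfl⟩) <;> exact ⟨_, rfl⟩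
  have him' : ∀ j : Fin (k + l) ↪ Fin s,
      (Finset.univ.filter fun i : Fin (k + l) => i.val < k).image j =
        Finset.univ.image fun i => j (Fin.castAdd l i) := fun j => by
    ext x
    simp only [Finset.mem_image, Finset.mem_univ, true_and, Finset.mem_filter]
    constructor
    · rintro ⟨i, hi, rfl⟩
      exact ⟨⟨i, hi⟩, rfl⟩
    · rintro ⟨i, rfl⟩
      exact ⟨_, i.2, rfl⟩
  refine Finset.sum_bij (fun j _ => ⟨fun i => j (Fin.natAdd k i), fun i => j (Fin.castAdd l i)⟩)
    (fun j _ => ?_) (fun j _ j' _ h => ?_) (fun p hp => ?_) fun j _ => ?_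
  · simp only [Finset.mem_sigma, Finset.mem_filter, Finset.mem_univ, true_and, Finset.mem_sdiff,
      Finset.mem_image, implies_true, and_true, not_exists]
    refine ⟨j.injective.comp (Fin.natAdd_injective l k), j.injective.comp (Fin.castAdd_injective k l),
      fun i i' h => ?_⟩
    have := congrArg Fin.val (j.injective h)
    simp only [Fin.val_natAdd, Fin.val_castAdd] at this
    omega
  · obtain ⟨h1, h2⟩ := Sigma.mk.inj h
    refine Function.Embedding.ext fun i => ?_
    exact Fin.addCases (fun i => congrFun (eq_of_heq h2) i) (fun i => congrFun h1 i) i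
  · simp only [Finset.mem_sigma, Finset.mem_filter, Finset.mem_univ, true_and, Finset.mem_sdiff,
      Finset.mem_image, implies_true, and_true, not_exists] at hp
    refine ⟨⟨Fin.append p.2 p.1, Fin.append_injective_iff.2 ⟨hp.2.1, hp.1, fun i i' h =>
      hp.2.2 i i' h.symm⟩⟩, Finset.mem_univ _, ?_⟩
    refine Sigma.ext (funext fun i => ?_) (heq_of_eq (funext fun i => ?_))
    · exact Fin.append_right _ _ i
    · exact Fin.append_left _ _ i
  · have hZ : (Finset.univ \ Finset.univ.image j : Finset (Fin s)) =
        (Finset.univ \ Finset.univ.image fun i => j (Fin.natAdd k i)) \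
          Finset.univ.image fun i => j (Fin.castAdd l i) := by
      rw [him]
      ext x
      simp only [Finset.mem_sdiff, Finset.mem_union]
      tauto
    have hX : Finset.univ \ Finset.univ.image j ∪
        (Finset.univ.filter fun i : Fin (k + l) => i.val < k).image j =
        (Finset.univ \ Finset.univ.image fun i => j (Fin.natAdd k i) : Finset (Fin s)) := by
      rw [him', hZ]
      refine Finset.sdiff_union_of_subset fun x hx => ?_
      obtain ⟨i, -, rfl⟩ := Finset.mem_image.1 hx
      refine Finset.mem_sdiff.2 ⟨Finset.mem_univ _, fun h => ?_⟩
      obtain ⟨i', -, h⟩ := Finset.mem_image.1 h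
      have := congrArg Fin.val (j.injective h)
      simp only [Fin.val_natAdd, Fin.val_castAdd] at this
      omega
    rw [hX, hZ]

/-- The sum runs over all injections `j`, so a permutation of the positions moves `Y` to the first
`k` of them. -/
theorem sum_GOn (t : ℝ) {B : OpSeq ι} (hB : B ∈ OSymm ι) (s : ℕ) {n k : ℕ} (hk : k ≤ n)
    {Y : Finset (Fin n)} (hY : Y.card = k) :
    ∑ j : Fin n ↪ Fin s, S.GOn t (Finset.univ \ Finset.univ.image j ∪ Y.image j)
        (onSet (Finset.univ \ Finset.univ.image j) B) =
      (creL ^ (n - k) * S.GC t * creL ^ k : Module.End ℂ (OpSeq ι)) B s := by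
  obtain ⟨l, rfl⟩ := Nat.exists_eq_add_of_le hk
  rw [Nat.add_sub_cancel_left, ← S.sum_GOn_first t hB]
  set Y0 : Finset (Fin (k + l)) := Finset.univ.filter fun i => i.val < k with hY0
  have hc : Y0.card = Y.card := by
    rw [hY]
    exact firstSet_card hk
  let σ : Equiv.Perm (Fin (k + l)) := (Finset.equivOfCardEq hc).extendSubtype
  have hσ : Y0.image σ = Y := by
    refine Finset.eq_of_subset_of_card_le (fun x hx => ?_) ?_
    · obtain ⟨i, hi, rfl⟩ := Finset.mem_image.1 hx
      exact (Finset.equivOfCardEq hc).extendSubtype_mem i hi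
    · rw [Finset.card_image_of_injective _ σ.injective, hc]
  let ρ : (Fin (k + l) ↪ Fin s) ≃ (Fin (k + l) ↪ Fin s) :=
    Equiv.embeddingCongr σ (Equiv.refl _)
  rw [← Equiv.sum_comp ρ]
  refine Finset.sum_congr rfl fun j _ => ?_
  have h0 : ∀ i, ρ j (σ i) = j i := fun i => by
    simp [ρ, Equiv.embeddingCongr]
  have h1 : (Finset.univ.image (ρ j) : Finset (Fin s)) = Finset.univ.image j := by
    ext x
    simp only [Finset.mem_image, Finset.mem_univ, true_and]
    exact ⟨fun ⟨i, hi⟩ => ⟨σ.symm i, by rw [← h0, Equiv.apply_symm_apply, hi]⟩,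
      fun ⟨i, hi⟩ => ⟨σ i, (h0 i).trans hi⟩⟩
  have h2 : Y.image (ρ j) = Y0.image j := by
    rw [← hσ, Finset.image_image]
    exact congrArg (Y0.image ·) (funext h0)
  rw [h1, h2]

theorem obsTerm_redCumulantSets (t : ℝ) {B : OpSeq ι} (hB : B ∈ OSymm ι) (n : ℕ) :
    obsTerm (fun _ _ => redCumulantSets (S.GOn t)) B n = conjCoeff (-creL) (S.GC t) n B := by
  funext s
  rw [obsTerm, conjCoeff_neg, LinearMap.smul_apply, Pi.smul_apply, LinearMap.sum_apply,
    Finset.sum_apply]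
  congr 1
  simp only [redCumulantSets, LinearMap.sum_apply, LinearMap.smul_apply]
  rw [Finset.sum_comm]
  have h : ∀ Y ∈ (Finset.univ : Finset (Fin n)).powerset, ∑ j : Fin n ↪ Fin s, (-1 : ℂ) ^ (n - Y.card) •
      S.GOn t (Finset.univ \ Finset.univ.image j ∪ Y.image j)
        (onSet (Finset.univ \ Finset.univ.image j) B) =
      (fun k => (-1 : ℂ) ^ (n - k) •
        (creL ^ (n - k) * S.GC t * creL ^ k : Module.End ℂ (OpSeq ι)) B s) Y.card := fun Y _ => by
    have hY : Y.card ≤ n := by simpa using Finset.card_le_univ Y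
    rw [← Finset.smul_sum, S.sum_GOn t hB s hY rfl]
  rw [← Finset.powerset_univ, Finset.sum_congr rfl h, Finset.sum_powerset_apply_card
    (fun k => (-1 : ℂ) ^ (n - k) •
      (creL ^ (n - k) * S.GC t * creL ^ k : Module.End ℂ (OpSeq ι)) B s), Finset.card_univ,
    Fintype.card_fin]
  refine Finset.sum_congr rfl fun k _ => ?_
  rw [← Nat.cast_smul_eq_nsmul ℂ, smul_smul, Pi.smul_apply, mul_comm]

theorem obsTerm_redCumulant (t : ℝ) {B : OpSeq ι} (hB : B ∈ OSymm ι) (n : ℕ) :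
    obsTerm (fun _ _ => redCumulant (S.GOn t)) B n = conjCoeff (-creL) (S.GC t) n B := by
  funext s
  rw [obsTerm, conjCoeff_neg, LinearMap.smul_apply, Pi.smul_apply, LinearMap.sum_apply,
    Finset.sum_apply]
  congr 1
  simp only [redCumulant, LinearMap.sum_apply, LinearMap.smul_apply]
  rw [Finset.sum_comm, ← Finset.sum_range_reflect]
  refine Finset.sum_congr rfl fun k hk => ?_
  have hk' : k ≤ n := Nat.lt_succ_iff.1 (Finset.mem_range.1 hk)
  have e1 : n + 1 - 1 - k = n - k := by omega
  rw [e1, Nat.sub_sub_self hk', Nat.choose_symm hk', ← Finset.smul_sum,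
    S.sum_GOn t hB s hk' (Y := Finset.univ.filter fun i : Fin n => i.val < k) (firstSet_card hk'), Pi.smul_apply]

theorem obsTerm_cumObs (t : ℝ) {B : OpSeq ι} (hB : B ∈ OSymm ι) (n : ℕ) :
    obsTerm (S.cumObs t) B n = conjCoeff (-creL) (S.GC t) n B := by
  rw [← S.obsTerm_redCumulantSets t hB]
  funext s
  exact congrArg _ (Finset.sum_congr rfl fun j _ => S.cumObs_onSet t B j)

theorem obsTerm_eq_zero (t : ℝ) (B : OpSeq ι) {n s : ℕ} (h : s < n) : obsTerm (S.cumObs t) B n s = 0 := by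
  have : IsEmpty (Fin n ↪ Fin s) := ⟨fun j => by
    have := Fintype.card_le_of_embedding j
    simp only [Fintype.card_fin] at this
    omega⟩
  rw [obsTerm, Finset.sum_of_isEmpty, smul_zero]

end PairSystem

/-! ### Self-adjoint sequences, nested commutators, and exponentials of 𝔞⁺ -/

section

variable {ι : Type*}

/-- Permutation symmetric sequences of self-adjoint operators. -/
def OSelfAdj (ι : Type*) : Set (OpSeq ι) := {b | ∀ n, IsSymm (b n) ∧ IsSelfAdjoint (b n)}

theorem creL_mem_selfAdj {b : OpSeq ι} (hb : b ∈ OSelfAdj ι) : creL b ∈ OSelfAdj ι := fun n =>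
  ⟨creL_mem (fun n => (hb n).1) n, isSelfAdjoint_sum _ fun _ _ => isSelfAdjoint_lift _ (hb _).2⟩

theorem creL_pow_mem_selfAdj {b : OpSeq ι} (hb : b ∈ OSelfAdj ι) (k : ℕ) :
    (creL ^ k) b ∈ OSelfAdj ι := by
  induction k with
  | zero => exact hb
  | succ k ih => rw [pow_succ', Module.End.mul_apply]; exact creL_mem_selfAdj ih

theorem sum_mem_selfAdj {κ : Type*} (T : Finset κ) {b : κ → OpSeq ι} (hb : ∀ k ∈ T, b k ∈ OSelfAdj ι) :
    ∑ k ∈ T, b k ∈ OSelfAdj ι := fun n => by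
  rw [Finset.sum_apply]
  exact ⟨IsSymm.sum T fun k hk => (hb k hk n).1, isSelfAdjoint_sum T fun k hk => (hb k hk n).2⟩

theorem smul_mem_selfAdj {c : ℂ} (hc : IsSelfAdjoint c) {b : OpSeq ι} (hb : b ∈ OSelfAdj ι) :
    c • b ∈ OSelfAdj ι := fun n => ⟨(hb n).1.smul c, hc.smul (hb n).2⟩

/-- `[A, 𝔞⁺]` is the commutator of `-𝔞⁺` with `A`, so the expansion computed for `a` applies to
`-creL`. -/
theorem comm_iterate_cre (n : ℕ) (g : Module.End ℂ (OpSeq ι)) :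
    (fun A => comm A cre)^[n] g = ⇑((fun b => -creL * b - b * -creL)^[n] g) := by
  induction n generalizing g with
  | zero => rfl
  | succ n ih =>
    rw [Function.iterate_succ_apply, Function.iterate_succ_apply, ← ih]
    congr 1
    funext b
    rw [LinearMap.sub_apply, Module.End.mul_apply, Module.End.mul_apply, LinearMap.neg_apply,
      LinearMap.neg_apply, map_neg, sub_neg_eq_add, neg_add_eq_sub]
    rfl

theorem expTerm_cre (b : OpSeq ι) (n : ℕ) :
    expTerm cre b n = ((n.factorial : ℂ)⁻¹) • (creL ^ n) b := by
  rw [Module.End.pow_apply]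
  rfl

theorem expTerm_neg_cre (b : OpSeq ι) (n : ℕ) :
    expTerm (-cre) b n = ((n.factorial : ℂ)⁻¹) • ((-creL) ^ n) b := by
  rw [Module.End.pow_apply]
  rfl

section

variable {γ : ℝ} (hγ : 0 < γ) {b : OpSeq ι} (hb : lgNorm γ b ≠ ∞)
include hγ hb

theorem lgNorm_exp_cre_ne_top : ∑' n : ℕ, lgNorm γ (((n.factorial : ℂ)⁻¹) • (creL ^ n) b) ≠ ∞ :=
  (isSeqNorm_lg hγ).exp_ne_top hγ.le (lgNorm_creL_le hγ) hb

theorem lgNorm_exp_neg_cre_ne_top :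
    ∑' n : ℕ, lgNorm γ (((n.factorial : ℂ)⁻¹) • ((-creL) ^ n) b) ≠ ∞ :=
  (isSeqNorm_lg hγ).exp_ne_top hγ.le ((isSeqNorm_lg hγ).neg_le (lgNorm_creL_le hγ)) hb

theorem hasSumLg_expTerm_cre : HasSumLg γ (expTerm cre b) (expMap cre b) := by
  have h : expTerm cre b = fun n => ((n.factorial : ℂ)⁻¹) • (creL ^ n) b := funext (expTerm_cre b)
  have h2 : expMap cre b = seqSum (expTerm cre b) := rfl
  rw [h2, h]
  exact (isSeqNorm_lg hγ).tendsto (lgNorm_exp_cre_ne_top hγ hb)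

theorem hasSumLg_expTerm_neg_cre : HasSumLg γ (expTerm (-cre) b) (expMap (-cre) b) := by
  have h : expTerm (-cre) b = fun n => ((n.factorial : ℂ)⁻¹) • ((-creL) ^ n) b :=
    funext (expTerm_neg_cre b)
  have h2 : expMap (-cre) b = seqSum (expTerm (-cre) b) := rfl
  rw [h2, h]
  exact (isSeqNorm_lg hγ).tendsto (lgNorm_exp_neg_cre_ne_top hγ hb)

theorem lgNorm_expMap_cre_ne_top : lgNorm γ (expMap cre b) ≠ ∞ := by
  have h2 : expMap cre b = seqSum fun n => ((n.factorial : ℂ)⁻¹) • (creL ^ n) b :=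
    congrArg seqSum (funext (expTerm_cre b))
  rw [h2]
  exact ne_top_of_le_ne_top (lgNorm_exp_cre_ne_top hγ hb) ((isSeqNorm_lg hγ).le_tsum
    ((isSeqNorm_lg hγ).hasSum (lgNorm_exp_cre_ne_top hγ hb)))

end

end

/-! ### Assembly of the results for observables -/

namespace PairSystem

variable {ι H : Type*} [NormedAddCommGroup H] [InnerProductSpace ℂ H] [CompleteSpace H]
  (S : PairSystem ι H)

theorem GC_mem_selfAdj (t : ℝ) {b : OpSeq ι} (hb : b ∈ OSelfAdj ι) : S.GC t b ∈ OSelfAdj ι := fun n => by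
  refine ⟨S.GC_mem t (fun n => (hb n).1) n, ?_⟩
  rw [IsSelfAdjoint, GC_apply, star_mul, star_mul, (S.isUGroup_U n).star_eq, (S.isUGroup_U n).star_eq,
    neg_neg, (hb n).2.star_eq, mul_assoc]

theorem conjCoeff_cre_mem (t : ℝ) {b : OpSeq ι} (hb : b ∈ OSelfAdj ι) (n : ℕ) :
    conjCoeff (-creL) (S.GC t) n b ∈ OSelfAdj ι := by
  rw [conjCoeff_neg, LinearMap.smul_apply, LinearMap.sum_apply]
  refine smul_mem_selfAdj (IsSelfAdjoint.natCast _).inv₀ (sum_mem_selfAdj _ fun k _ => ?_)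
  refine smul_mem_selfAdj (((IsSelfAdjoint.one ℂ).neg.pow _).mul (IsSelfAdjoint.natCast _)) ?_
  exact creL_pow_mem_selfAdj (S.GC_mem_selfAdj t (creL_pow_mem_selfAdj hb k)) (n - k)

theorem conjCoeff_cre_eq_zero (t : ℝ) {b : OpSeq ι} (hb : b ∈ OSymm ι) {n s : ℕ} (h : s < n) :
    conjCoeff (-creL) (S.GC t) n b s = 0 := by
  rw [← S.obsTerm_cumObs t hb, S.obsTerm_eq_zero t b h]

theorem redObs_apply (t : ℝ) {b : OpSeq ι} (hb : b ∈ OSymm ι) (s : ℕ) :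
    S.redObs t b s = ∑ n ∈ Finset.range (s + 1), conjCoeff (-creL) (S.GC t) n b s := by
  simp only [redObs, S.obsTerm_cumObs t hb]

theorem redObs_eq (t : ℝ) {b : OpSeq ι} (hb : b ∈ OSymm ι) :
    S.redObs t b = seqSum fun n => conjCoeff (-creL) (S.GC t) n b := by
  funext s
  rw [S.redObs_apply t hb, seqSum, tsum_eq_sum fun n hn => S.conjCoeff_cre_eq_zero t hb ?_]
  simpa using hn

theorem conjCoeff_cre (t : ℝ) (b : OpSeq ι) (n : ℕ) : ((n.factorial : ℂ)⁻¹) •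
    ∑ k ∈ Finset.range (n + 1), ((-1 : ℂ) ^ (n - k) * (n.choose k : ℂ)) •
      cre^[n - k] (S.G t (cre^[k] b)) = conjCoeff (-creL) (S.GC t) n b := by
  rw [conjCoeff_neg, LinearMap.smul_apply, LinearMap.sum_apply]
  refine congrArg _ (Finset.sum_congr rfl fun k _ => ?_)
  rw [LinearMap.smul_apply, Module.End.mul_apply, Module.End.mul_apply, Module.End.pow_apply,
    Module.End.pow_apply]
  rfl

theorem comm_iterate_G (t : ℝ) (b : OpSeq ι) (n : ℕ) : ((n.factorial : ℂ)⁻¹) •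
    (fun A => comm A cre)^[n] (S.G t) b = conjCoeff (-creL) (S.GC t) n b := by
  have h := comm_iterate_cre n (S.GC t)
  rw [iterate_commutator] at h
  have h2 : (fun A => comm A cre)^[n] (S.G t) b =
      (n.factorial : ℂ) • conjCoeff (-creL) (S.GC t) n b := congrFun h b
  rw [h2, smul_smul, inv_mul_cancel₀ (Nat.cast_ne_zero.2 n.factorial_ne_zero), one_smul]

theorem observables {γ : ℝ} {B₀ : OpSeq ι} (t : ℝ) (hγ : 0 < γ) (hB₀ : MemLg γ B₀) :
      MemLg γ (S.redObs t B₀) ∧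
      (∀ n, obsTerm (S.cumObs t) B₀ n = obsTerm (fun _ _ => redCumulantSets (S.GOn t)) B₀ n) ∧
      (∀ n, obsTerm (S.cumObs t) B₀ n = obsTerm (fun _ _ => redCumulant (S.GOn t)) B₀ n) ∧
      HasSumLg γ
        (fun n => ((n.factorial : ℂ)⁻¹) • ∑ k ∈ Finset.range (n + 1),
          ((-1 : ℂ) ^ (n - k) * (n.choose k : ℂ)) • cre^[n - k] (S.G t (cre^[k] B₀)))
        (S.redObs t B₀) ∧
      HasSumLg γ
        (fun n => ((n.factorial : ℂ)⁻¹) • (fun A => comm A cre)^[n] (S.G t) B₀)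
        (S.redObs t B₀) ∧
      HasSumLg γ (expTerm cre B₀) (expMap cre B₀) ∧
      HasSumLg γ (expTerm (-cre) (S.G t (expMap cre B₀))) (expMap (-cre) (S.G t (expMap cre B₀))) ∧
      S.redObs t B₀ = expMap (-cre) (S.G t (expMap cre B₀)) ∧
      (∀ (n s : ℕ) (ψ : HS ι s), Continuous fun τ : Fin n → ℝ =>
        duhamel S.G S.commCre B₀ n t τ s ψ) ∧
      (∀ (s : ℕ) (ψ : HS ι s),
        HasSum (fun n => iterInt n t fun τ => duhamel S.G S.commCre B₀ n t τ s ψ)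
          (S.redObs t B₀ s ψ)) := by
  have hs : B₀ ∈ OSymm ι := fun n => (hB₀.1 n).1
  have hB : lgNorm γ B₀ ≠ ∞ := hB₀.2.ne
  have hN := isSeqNorm_lg (ι := ι) hγ
  have hneg := hN.neg_le (lgNorm_creL_le hγ)
  have hfin := hN.conjCoeff_ne_top hγ.le hneg (S.lgNorm_GC_le γ t) hB
  have key : HasSumLg γ (fun n => conjCoeff (-creL) (S.GC t) n B₀) (S.redObs t B₀) := by
    rw [S.redObs_eq t hs]
    exact hN.tendsto hfin
  refine ⟨⟨?_, ?_⟩, fun n => ?_, fun n => ?_, ?_, ?_, hasSumLg_expTerm_cre hγ hB,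
    hasSumLg_expTerm_neg_cre hγ (ne_top_of_le_ne_top (lgNorm_expMap_cre_ne_top hγ hB)
      (S.lgNorm_GC_le γ t _)), ?_, fun n s ψ => S.strongCont_duhamel B₀ n continuous_const
      continuous_id s ψ, fun s ψ => ?_⟩
  · have h : S.redObs t B₀ = fun s =>
        (∑ n ∈ Finset.range (s + 1), conjCoeff (-creL) (S.GC t) n B₀) s := funext fun s => by
      rw [S.redObs_apply t hs, Finset.sum_apply]
    rw [h]
    exact fun s => sum_mem_selfAdj _ (fun n _ => S.conjCoeff_cre_mem t hB₀.1 n) s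
  · rw [S.redObs_eq t hs]
    exact lt_of_le_of_lt (hN.le_tsum (hN.hasSum hfin)) hfin.lt_top
  · rw [S.obsTerm_cumObs t hs, S.obsTerm_redCumulantSets t hs]
  · rw [S.obsTerm_cumObs t hs, S.obsTerm_redCumulant t hs]
  · rwa [funext (S.conjCoeff_cre t B₀)]
  · rwa [funext (S.comm_iterate_G t B₀)]
  · have h := hN.exp_conj hγ.le hneg (S.lgNorm_GC_le γ t) isSeqCont_creL.neg (S.isSeqCont_GC t) hB
    rw [neg_neg] at h
    have h2 : expMap cre B₀ = seqSum fun n => ((n.factorial : ℂ)⁻¹) • (creL ^ n) B₀ :=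
      congrArg seqSum (funext (expTerm_cre B₀))
    rw [S.redObs_eq t hs, h, ← h2]
    exact congrArg seqSum (funext fun n => (expTerm_neg_cre _ n).symm)
  · simp only [(S.strongIter_duhamel hs _ t s).eq]
    rw [S.redObs_apply t hs, _root_.sum_apply]
    -- Component `s` has only finitely many nonzero terms, as no more than `s` particles can be
    -- removed.
    refine hasSum_sum_of_ne_finset_zero fun n hn => ?_
    rw [S.conjCoeff_cre_eq_zero t hs (by simpa using hn)]
    rfl

/-- Up to sign, `AC τ` applied to the orbit of `b` is the orbit of 𝔞⁺b, so the product rule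
differentiates it. The sign of `c` changes because `IsHeisenberg` takes the commutator in the
opposite order from `IsCommutatorWith`. -/
theorem commutator_cre (b c : OpSeq ι) (h : ∀ n, S.IsHeisenberg n (b n) (c n)) :
    ∃ d : OpSeq ι, (∀ n, S.IsHeisenberg n (cre b n) (d n)) ∧ d - cre c = S.commCre b := by
  have hiff : ∀ n (b c : Op ι n), S.IsHeisenberg n b c ↔ IsCommutatorWith (S.hamiltonian n) b (-c) := by
    intro n b c
    refine forall₃_congr fun ψ χ _ => exists_congr fun η => and_congr_right fun _ => ?_
    rw [_root_.neg_apply, neg_eq_iff_eq_neg, ← smul_neg, neg_sub]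
  have hf : ∀ n, StrongC1 (fun τ => S.GC (-τ) b n) fun τ => ((-1 : ℂ) • S.GC (-τ) c) n := fun n => by
    refine ((S.isUnitaryGroupOf_U n).strongC1_of_isCommutatorWith ((hiff n _ _).1 (h n))).congr
      (fun τ => ?_) fun τ => ?_
    · rw [GC_apply, neg_neg]
    · rw [Pi.smul_apply, GC_apply, neg_neg, neg_one_smul, mul_neg, neg_mul]
  refine ⟨creL c + S.VC b, fun n => (hiff n _ _).2 ((S.isUnitaryGroupOf_U n).isCommutatorWith
    fun ψ => ?_), add_sub_cancel_left _ _⟩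
  have h1 := ((S.strongC1_AC hf n).deriv ψ 0).neg
  have e1 : ∀ τ, S.AC τ (S.GC (-τ) b) n = -(S.U n τ * cre b n * S.U n (-τ)) := fun τ => by
    have e := DFunLike.congr_fun (S.GC_mul_neg τ) b
    rw [Module.End.mul_apply] at e
    rw [AC, Module.End.mul_apply, Module.End.mul_apply, e, Module.End.one_apply, GC_apply,
      LinearMap.neg_apply, Pi.neg_apply, mul_neg, neg_mul, neg_neg]
    rfl
  have e2 : S.vC 0 (S.GC (-0) b) n + S.AC 0 ((-1 : ℂ) • S.GC (-0) c) n = (creL c + S.VC b) n := by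
    rw [AC_zero, vC, neg_zero, GC_zero, one_mul, mul_one, Module.End.one_apply, Module.End.one_apply,
      neg_one_smul, map_neg, LinearMap.neg_apply, neg_neg, add_comm, Pi.add_apply]
  rw [e2] at h1
  refine (h1.congr_deriv rfl).congr_of_eventuallyEq (Eventually.of_forall fun τ => ?_)
  change (S.U n τ * cre b n * S.U n (-τ)) ψ = -(S.AC τ (S.GC (-τ) b) n ψ)
  rw [e1, _root_.neg_apply, neg_neg]

end PairSystem

end QuantumHierarchy

end

/-! ### The theorem -/

theorem mainTheorem3 {ι H : Type*} [NormedAddCommGroup H] [InnerProductSpace ℂ H] [CompleteSpace H]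
    (S : QuantumHierarchy.PairSystem ι H) :
    -- states
    (∀ (α : ℝ) (F₀ : QuantumHierarchy.OpSeq ι) (t : ℝ), 1 < α → QuantumHierarchy.MemL1 α F₀ →
      -- the nonperturbative series defines a sequence in `𝔏¹_α`
      QuantumHierarchy.MemL1 α (S.redDensity t F₀) ∧
      QuantumHierarchy.HasSumL1 α (QuantumHierarchy.stateTerm (S.cumSt t) F₀) (S.redDensity t F₀) ∧
      -- its terms can be rewritten with reduced cumulants
      (∀ n, QuantumHierarchy.stateTerm (S.cumSt t) F₀ n =
        QuantumHierarchy.stateTerm (S.redCumStSets t) F₀ n) ∧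
      (∀ n, QuantumHierarchy.stateTerm (S.cumSt t) F₀ n =
        QuantumHierarchy.stateTerm (S.redCumSt t) F₀ n) ∧
      -- the expansion in powers of `𝔞`
      QuantumHierarchy.HasSumL1 α
        (fun n => ((n.factorial : ℂ)⁻¹) • ∑ k ∈ Finset.range (n + 1),
          ((-1 : ℂ) ^ k * (n.choose k : ℂ)) •
            QuantumHierarchy.ann^[n - k] (S.Gst t (QuantumHierarchy.ann^[k] F₀)))
        (S.redDensity t F₀) ∧
      -- the expansion in nested commutators `[𝔞, …, [𝔞, 𝒢*(t)]…]`
      QuantumHierarchy.HasSumL1 α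
        (fun n => ((n.factorial : ℂ)⁻¹) •
          (QuantumHierarchy.comm QuantumHierarchy.ann)^[n] (S.Gst t) F₀)
        (S.redDensity t F₀) ∧
      -- `F(t) = e^𝔞 𝒢*(t) e^{-𝔞} F(0)`, with norm-convergent exponential series
      QuantumHierarchy.HasSumL1 α (QuantumHierarchy.expTerm (-QuantumHierarchy.ann) F₀)
        (QuantumHierarchy.expMap (-QuantumHierarchy.ann) F₀) ∧
      QuantumHierarchy.HasSumL1 α
        (QuantumHierarchy.expTerm QuantumHierarchy.ann
          (S.Gst t (QuantumHierarchy.expMap (-QuantumHierarchy.ann) F₀)))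
        (QuantumHierarchy.expMap QuantumHierarchy.ann
          (S.Gst t (QuantumHierarchy.expMap (-QuantumHierarchy.ann) F₀))) ∧
      S.redDensity t F₀ = QuantumHierarchy.expMap QuantumHierarchy.ann
        (S.Gst t (QuantumHierarchy.expMap (-QuantumHierarchy.ann) F₀)) ∧
      -- the perturbation series
      (∀ n s, Continuous fun τ : Fin n → ℝ =>
        QuantumHierarchy.duhamel S.Gst S.commAnn F₀ n t τ s) ∧
      QuantumHierarchy.HasSumL1 α
        (fun n s => QuantumHierarchy.iterInt n t fun τ =>
          QuantumHierarchy.duhamel S.Gst S.commAnn F₀ n t τ s)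
        (S.redDensity t F₀) ∧
      -- its integrands, component by component
      (∀ (n s : ℕ) (τ : Fin n → ℝ), QuantumHierarchy.duhamel S.Gst S.commAnn F₀ n t τ s =
        QuantumHierarchy.traceOut s n (S.iterSt (F₀ (s + n)) n s t τ))) ∧
    -- `S.commAnn` is the commutator `[𝔞, 𝒩*]` on the domain of `𝒩*`
    (∀ f g : QuantumHierarchy.OpSeq ι, (∀ n, S.IsVonNeumann n (f n) (g n)) →
      ∃ h : QuantumHierarchy.OpSeq ι,
        (∀ n, S.IsVonNeumann n (QuantumHierarchy.ann f n) (h n)) ∧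
        QuantumHierarchy.ann g - h = S.commAnn f) ∧
    -- observables
    (∀ (γ : ℝ) (B₀ : QuantumHierarchy.OpSeq ι) (t : ℝ), 0 < γ → γ < 1 →
      QuantumHierarchy.MemLg γ B₀ →
      QuantumHierarchy.MemLg γ (S.redObs t B₀) ∧
      -- the terms can be rewritten with reduced cumulants
      (∀ n, QuantumHierarchy.obsTerm (S.cumObs t) B₀ n =
        QuantumHierarchy.obsTerm
          (fun _ _ => QuantumHierarchy.redCumulantSets (S.GOn t)) B₀ n) ∧
      (∀ n, QuantumHierarchy.obsTerm (S.cumObs t) B₀ n =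
        QuantumHierarchy.obsTerm
          (fun _ _ => QuantumHierarchy.redCumulant (S.GOn t)) B₀ n) ∧
      -- the expansion in powers of `𝔞⁺`
      QuantumHierarchy.HasSumLg γ
        (fun n => ((n.factorial : ℂ)⁻¹) • ∑ k ∈ Finset.range (n + 1),
          ((-1 : ℂ) ^ (n - k) * (n.choose k : ℂ)) •
            QuantumHierarchy.cre^[n - k] (S.G t (QuantumHierarchy.cre^[k] B₀)))
        (S.redObs t B₀) ∧
      -- the expansion in nested commutators `[…[𝒢(t), 𝔞⁺], …, 𝔞⁺]`
      QuantumHierarchy.HasSumLg γ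
        (fun n => ((n.factorial : ℂ)⁻¹) •
          (fun A => QuantumHierarchy.comm A QuantumHierarchy.cre)^[n] (S.G t) B₀)
        (S.redObs t B₀) ∧
      -- `B(t) = e^{-𝔞⁺} 𝒢(t) e^{𝔞⁺} B(0)`, with norm-convergent exponential series
      QuantumHierarchy.HasSumLg γ (QuantumHierarchy.expTerm QuantumHierarchy.cre B₀)
        (QuantumHierarchy.expMap QuantumHierarchy.cre B₀) ∧
      QuantumHierarchy.HasSumLg γ
        (QuantumHierarchy.expTerm (-QuantumHierarchy.cre)
          (S.G t (QuantumHierarchy.expMap QuantumHierarchy.cre B₀)))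
        (QuantumHierarchy.expMap (-QuantumHierarchy.cre)
          (S.G t (QuantumHierarchy.expMap QuantumHierarchy.cre B₀))) ∧
      S.redObs t B₀ = QuantumHierarchy.expMap (-QuantumHierarchy.cre)
        (S.G t (QuantumHierarchy.expMap QuantumHierarchy.cre B₀)) ∧
      -- the perturbation series, with integrals in the strong operator topology
      (∀ (n s : ℕ) (ψ : QuantumHierarchy.HS ι s), Continuous fun τ : Fin n → ℝ =>
        QuantumHierarchy.duhamel S.G S.commCre B₀ n t τ s ψ) ∧
      (∀ (s : ℕ) (ψ : QuantumHierarchy.HS ι s),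
        HasSum
          (fun n => QuantumHierarchy.iterInt n t fun τ =>
            QuantumHierarchy.duhamel S.G S.commCre B₀ n t τ s ψ)
          (S.redObs t B₀ s ψ))) ∧
    -- `S.commCre` is the commutator `[𝒩, 𝔞⁺]` on the domain of `𝒩`
    (∀ b c : QuantumHierarchy.OpSeq ι, (∀ n, S.IsHeisenberg n (b n) (c n)) →
      ∃ d : QuantumHierarchy.OpSeq ι,
        (∀ n, S.IsHeisenberg n (QuantumHierarchy.cre b n) (d n)) ∧
        d - QuantumHierarchy.cre c = S.commCre b) := by
  exact ⟨fun _ _ t hα hF => S.states t hα hF, fun f g h => S.commutator_ann f g h,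
    fun _ _ t hγ _ hB => S.observables t hγ hB, fun b c h => S.commutator_cre b c h⟩
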